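/- **Setting.** Let $N\ge 2$, $p>1$, and let $H$ be a real $N\times N$ matrix with $\det H>0$. The Kuhn decomposition $\mathcal T$ of $\mathbb R^N$ consists of the simplices with vertices $z,\ z+e_{\sigma(1)},\ \dots,\ z+e_{\sigma(1)}+\dots+e_{\sigma(N)}$, for $z\in\mathbb Z^N$ and permutations $\sigma$ of $\{1,\dots,N\}$. Let $B_1$ be the set of all differences $y-x$ of two vertices $x,y$ of one simplex of $\mathcal T$, let $B_2$ be the set of all differences $y_0-x_0$ of the vertices opposite to the common facet of two neighbouring simplices $[x_0,x_1,\dots,x_N]$, $[y_0,x_1,\dots,x_N]$ of $\mathcal T$, and let $r=\sup\{|\xi|:\xi\in B_1\cup B_2\}$. For $\varepsilon>0$ and a set $L\subset\varepsilon\mathbb Z^N$ put $$E_\varepsilon(u;L)=\varepsilon^{N-1}\sum_{\xi\in B_1\cup B_2}\ \sum_{\substack{x\in L\\ x+\varepsilon\xi\in L}}\Big|\frac{|u(x+\varepsilon\xi)-u(x)|}{\varepsilon}-|H\xi|\Big|^p .$$ Let $\Omega\subset\mathbb R^N$ be a bounded open set with Lipschitz boundary, and let $\overline\Omega_\varepsilon$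 be the union of the closed cubes of the lattice $\varepsilon\mathbb Z^N$ that meet $\Omega$. Put $E_\varepsilon(u)=E_\varepsilon(u;\varepsilon\mathbb Z^N\cap\overline\Omega_\varepsilon)$ if $u:\overline\Omega_\varepsilon\to\mathbb R^N$ is continuous and affine on each simplex of $\varepsilon\mathcal T$ contained in $\overline\Omega_\varepsilon$, and $E_\varepsilon(u)=+\infty$ otherwise. Let $$E''(u)=\inf\Big\{\limsup_{\varepsilon\to0^+}E_\varepsilon(u_\varepsilon): u_\varepsilon\to u\text{ strongly in }W^{1,p}(\Omega;\mathbb R^N)\Big\}$$ be the $\Gamma$-limsup of $E_\varepsilon$ as $\varepsilon\to0^+$. Let $\mathcal W(\Omega)$ be the set of all $u\in W^{1,\infty}(\Omega;\mathbb R^N)$ such that $\nabla u\in SBV(\Omega;O(N)H)$ and the jump set $J_{\nabla u}$ of $\nabla u$ is polyhedral, i.e. it is, up to an $\mathcal H^{N-1}$-null set, the intersection of $\Omega$ with the union of finitely many $(N-1)$-dimensional simplices. Let $\nu_{\nabla u}$ be the unit normal to $J_{\nabla u}$ (with either orientation). For $\nu\in S^{N-1}$ let $Q_\nu$ be any open cube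 with centre $0$, side length $1$ and two faces orthogonal to $\nu$, let $R_\nu$ be the unique matrix in $(O(N)\setminus SO(N))H$ such that $H-R_\nu=a\otimes\nu$ for some $a\in\mathbb R^N$, and let $u_0^\nu(x)=Hx$ if $\langle x,\nu\rangle\ge0$ and $u_0^\nu(x)=R_\nu x$ otherwise. **Proposition 1.8 (Upper bound).** For each $\nu\in S^{N-1}$ the limit $$g_2(\nu)=\lim_{T\to\infty}\frac1{T^{N-1}}\inf\Big\{E_1(u;\mathbb Z^N\cap TQ_\nu): u:\mathbb Z^N\cap TQ_\nu\to\mathbb R^N,\ u(x)=u_0^\nu(x)\text{ if }\operatorname{dist}(x,\partial(TQ_\nu))\le r\Big\}$$ exists in $[0,+\infty)$ and does not depend on the choice of $Q_\nu$, and for every bounded open set $\Omega$ with Lipschitz boundary and every $u\in\mathcal W(\Omega)$ $$E''(u)\le\int_{J_{\nabla u}}g_2(\nu_{\nabla u})\,d\mathcal H^{N-1}.$$ -/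

import Mathlib

open MeasureTheory Filter Topology Set
open scoped ENNReal NNReal ContDiff

noncomputable section

namespace LatticeUpperBound

/-- The space `ℝ^N` with its Euclidean norm. -/
abbrev Eu (N : ℕ) : Type := EuclideanSpace ℝ (Fin N)

/-- The Euclidean linear map `x ↦ M x` of a matrix. -/
abbrev lin {N : ℕ} (M : Matrix (Fin N) (Fin N) ℝ) : Eu N →L[ℝ] Eu N :=
  Matrix.toEuclideanCLM (𝕜 := ℝ) M

/-- The point `ε z` of the scaled lattice `ε ℤ^N`. -/
def node {N : ℕ} (ε : ℝ) (z : Fin N → ℤ) : Eu N := WithLp.toLp 2 fun i => ε * (z i : ℝ)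

/-! ### The Kuhn decomposition and the bonds -/

/-- The `k`-th vertex `z + e_{σ 0} + ⋯ + e_{σ (k-1)}` of the Kuhn simplex of the unit cube with
lower corner `z` that belongs to the permutation `σ`. -/
def kuhnVertex {N : ℕ} (z : Fin N → ℤ) (σ : Equiv.Perm (Fin N)) (k : Fin (N + 1)) :
    Fin N → ℤ :=
  z + ∑ j ∈ Finset.univ.filter (fun j : Fin N => (j : ℕ) < (k : ℕ)), Pi.single (σ j) 1

/-- The set of the vertices of a simplex of the Kuhn decomposition of `ℝ^N`. -/
def kuhnVertices {N : ℕ} (z : Fin N → ℤ) (σ : Equiv.Perm (Fin N)) : Finset (Fin N → ℤ) :=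
  Finset.univ.image (kuhnVertex z σ)

/-- `x` and `y` are vertices of one simplex of the decomposition. -/
def Contiguous {N : ℕ} (x y : Fin N → ℤ) : Prop :=
  ∃ z σ, x ∈ kuhnVertices z σ ∧ y ∈ kuhnVertices z σ

/-- `x` and `y` are the vertices opposite to the common facet (with vertex set `F`) of two
neighbouring simplices of the decomposition. -/
def Opposite {N : ℕ} (x y : Fin N → ℤ) : Prop :=
  x ≠ y ∧ ∃ (z z' : Fin N → ℤ) (σ σ' : Equiv.Perm (Fin N)) (F : Finset (Fin N → ℤ)),
    x ∉ F ∧ y ∉ F ∧ kuhnVertices z σ = insert x F ∧ kuhnVertices z' σ' = insert y F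

/-- The set `B₁ ∪ B₂` of all bonds. -/
def bonds (N : ℕ) : Set (Fin N → ℤ) :=
  {ξ | ∃ x, Contiguous x (x + ξ)} ∪ {ξ | ∃ x, Opposite x (x + ξ)}

/-- The length `r` of the longest bond. -/
def maxBond (N : ℕ) : ℝ := sSup ((fun ξ => ‖node 1 ξ‖) '' bonds N)

/-! ### The discrete energies -/

/-- The energy `ε^{N-1} ∑_ξ ∑_x | |w(x+εξ) - w(x)| / ε - |Hξ| |^p`, the inner sum over all `x` such
that `x` and `x + εξ` are in the set of the nodes `ε z`, `z ∈ L`; here `w z` is the deformed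
position of the node `ε z`. -/
def pairEnergy {N : ℕ} (H : Matrix (Fin N) (Fin N) ℝ) (p ε : ℝ) (L : Set (Fin N → ℤ))
    (w : (Fin N → ℤ) → Eu N) : ℝ≥0∞ :=
  ENNReal.ofReal (ε ^ (N - 1)) *
    ∑' ξ : bonds N, ∑' z : {z : Fin N → ℤ // z ∈ L ∧ z + ξ.1 ∈ L},
      ENNReal.ofReal (|‖w (z.1 + ξ.1) - w z.1‖ / ε - ‖lin H (node 1 ξ.1)‖| ^ p)

/-- The closed cube of the lattice `ε ℤ^N` with lower corner `ε c`. -/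
def latticeCube {N : ℕ} (ε : ℝ) (c : Fin N → ℤ) : Set (Eu N) :=
  {x | ∀ i, ε * (c i : ℝ) ≤ x i ∧ x i ≤ ε * ((c i : ℝ) + 1)}

/-- The union of all the cubes of the lattice `ε ℤ^N` that meet `Ω`. -/
def cubeHull {N : ℕ} (ε : ℝ) (Ω : Set (Eu N)) : Set (Eu N) :=
  ⋃ c ∈ {c : Fin N → ℤ | (latticeCube ε c ∩ Ω).Nonempty}, latticeCube ε c

/-- The admissible deformations: continuous on `cubeHull ε Ω` and affine on each simplex of the
scaled decomposition that is contained in it. (A simplex of the cube with corner `c` that is not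
in a cube meeting `Ω` has only parts of its boundary in `cubeHull ε Ω`.) -/
def Admissible {N : ℕ} (ε : ℝ) (Ω : Set (Eu N)) (v : Eu N → Eu N) : Prop :=
  ContinuousOn v (cubeHull ε Ω) ∧
    ∀ c : Fin N → ℤ, (latticeCube ε c ∩ Ω).Nonempty → ∀ σ : Equiv.Perm (Fin N),
      ∃ A : Eu N →ᵃ[ℝ] Eu N,
        EqOn v A (convexHull ℝ (range fun k => node ε (kuhnVertex c σ k)))

open Classical in
/-- The functional `E_ε`, with the value `+∞` outside its domain. -/
def energy {N : ℕ} (H : Matrix (Fin N) (Fin N) ℝ) (p : ℝ) (Ω : Set (Eu N)) (ε : ℝ)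
    (v : Eu N → Eu N) : ℝ≥0∞ :=
  if Admissible ε Ω v then
    pairEnergy H p ε {z | node ε z ∈ cubeHull ε Ω} (fun z => v (node ε z))
  else ⊤

/-! ### Sobolev functions and the upper Γ-limit -/

/-- Test functions on `Ω`. -/
def IsTest {N : ℕ} (Ω : Set (Eu N)) (φ : Eu N → ℝ) : Prop :=
  ContDiff ℝ ∞ φ ∧ HasCompactSupport φ ∧ tsupport φ ⊆ Ω

/-- `u ∈ W^{1,q}(Ω; ℝ^N)` with weak gradient `G`. -/
def IsSobolev {N : ℕ} (q : ℝ≥0∞) (Ω : Set (Eu N)) (u : Eu N → Eu N)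
    (G : Eu N → Eu N →L[ℝ] Eu N) : Prop :=
  MemLp u q (volume.restrict Ω) ∧ MemLp G q (volume.restrict Ω) ∧
    ∀ φ, IsTest Ω φ → ∀ h : Eu N,
      ∫ x in Ω, (fderiv ℝ φ x h) • u x = - ∫ x in Ω, φ x • G x h

/-- Strong convergence `v ε → u` in `W^{1,q}(Ω; ℝ^N)` as `ε → 0⁺`. -/
def TendstoSobolev {N : ℕ} (q : ℝ≥0∞) (Ω : Set (Eu N)) (v : ℝ → Eu N → Eu N)
    (u : Eu N → Eu N) : Prop :=
  ∃ (Gv : ℝ → Eu N → Eu N →L[ℝ] Eu N) (G : Eu N → Eu N →L[ℝ] Eu N),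
    (∀ ε, 0 < ε → IsSobolev q Ω (v ε) (Gv ε)) ∧ IsSobolev q Ω u G ∧
    Tendsto (fun ε => eLpNorm (fun x => v ε x - u x) q (volume.restrict Ω)) (𝓝[>] 0) (𝓝 0) ∧
    Tendsto (fun ε => eLpNorm (fun x => Gv ε x - G x) q (volume.restrict Ω)) (𝓝[>] 0) (𝓝 0)

/-- The `Γ`-limsup of the energies as `ε → 0⁺`, in the strong topology of `W^{1,p}(Ω; ℝ^N)`: the
infimum of `limsup E_ε(v_ε)` over all families `v_ε → u`. -/
def gammaLimsup {N : ℕ} (H : Matrix (Fin N) (Fin N) ℝ) (p : ℝ) (Ω : Set (Eu N))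
    (u : Eu N → Eu N) : ℝ≥0∞ :=
  ⨅ (v : ℝ → Eu N → Eu N) (_ : TendstoSobolev (ENNReal.ofReal p) Ω v u),
    limsup (fun ε => energy H p Ω ε (v ε)) (𝓝[>] 0)

/-! ### Jump sets, `SBV`, and the class of deformations with polyhedral jump set -/

section Jump

variable {N : ℕ} {V : Type*} [NormedAddCommGroup V] [NormedSpace ℝ V]

/-- The half of the open ball about `x` of radius `ρ` that lies on the side to which `ν` points. -/
def halfBall (x ν : Eu N) (ρ : ℝ) : Set (Eu N) :=
  Metric.ball x ρ ∩ {y | 0 < inner ℝ (y - x) ν}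

/-- `x` is an approximate jump point of `w` with normal `ν` and one-sided limits `a` (on the side
to which `ν` points) and `b`. -/
def IsJumpPoint (w : Eu N → V) (x ν : Eu N) (a b : V) : Prop :=
  ‖ν‖ = 1 ∧ a ≠ b ∧
    Tendsto (fun ρ : ℝ => laverage (volume.restrict (halfBall x ν ρ)) fun y => ‖w y - a‖ₑ)
      (𝓝[>] 0) (𝓝 0) ∧
    Tendsto (fun ρ : ℝ => laverage (volume.restrict (halfBall x (-ν) ρ)) fun y => ‖w y - b‖ₑ)
      (𝓝[>] 0) (𝓝 0)

/-- The jump set of `w` in `Ω`. -/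
def jumpSet (Ω : Set (Eu N)) (w : Eu N → V) : Set (Eu N) :=
  {x | x ∈ Ω ∧ ∃ ν a b, IsJumpPoint w x ν a b}

/-- The integral of a bounded continuous function with respect to a finite signed measure. -/
def signedIntegral (μ : SignedMeasure (Eu N)) (φ : Eu N → ℝ) : ℝ :=
  ∫ x, φ x ∂μ.toJordanDecomposition.posPart - ∫ x, φ x ∂μ.toJordanDecomposition.negPart

/-- `w ∈ SBV(Ω; V)` (`V` finite-dimensional): `w ∈ L¹(Ω)`, and for each component `ℓ ∘ w` and each
direction `h` the distributional derivative is a finite signed measure `μ` such that, for some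
`g ∈ L¹(Ω)`, the measure `μ - g 𝓛^N` on `Ω` is concentrated on the jump set of `w`. -/
def IsSBV (Ω : Set (Eu N)) (w : Eu N → V) : Prop :=
  MemLp w 1 (volume.restrict Ω) ∧
    ∀ (ℓ : V →L[ℝ] ℝ) (h : Eu N), ∃ (μ : SignedMeasure (Eu N)) (g : Eu N → ℝ),
      (∀ φ, IsTest Ω φ →
        ∫ x in Ω, fderiv ℝ φ x h * ℓ (w x) = - signedIntegral μ φ) ∧
      IntegrableOn g Ω ∧
      ∀ A, MeasurableSet A → A ⊆ Ω \ jumpSet Ω w → μ A = ∫ x in A, g x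

end Jump

/-- `K` is, up to an `𝓗^{N-1}`-null set, the intersection of `Ω` with the union of finitely many
`(N-1)`-dimensional simplices. -/
def IsPolyhedral {N : ℕ} (Ω K : Set (Eu N)) : Prop :=
  ∃ (m : ℕ) (s : Fin m → Fin N → Eu N), (∀ k, AffineIndependent ℝ (s k)) ∧
    K =ᵐ[(μHE[N - 1] : Measure (Eu N))] (Ω ∩ ⋃ k, convexHull ℝ (range (s k)) : Set (Eu N))

/-- `u` is in the class `𝒲(Ω)`, and `G` is its weak gradient: `u ∈ W^{1,∞}(Ω; ℝ^N)`,
`G ∈ SBV(Ω; O(N)H)`, and the jump set of `G` is polyhedral. -/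
def IsPolyhedralDeformation {N : ℕ} (H : Matrix (Fin N) (Fin N) ℝ) (Ω : Set (Eu N))
    (u : Eu N → Eu N) (G : Eu N → Eu N →L[ℝ] Eu N) : Prop :=
  IsSobolev ⊤ Ω u G ∧ IsSBV Ω G ∧
    (∀ᵐ x ∂(volume.restrict Ω), ∃ Q ∈ Matrix.orthogonalGroup (Fin N) ℝ, G x = lin (Q * H)) ∧
    IsPolyhedral Ω (jumpSet Ω G)

/-- `Ω` has Lipschitz boundary: near each boundary point it is the set above the graph of a
Lipschitz function of the variables orthogonal to some unit vector `e`. -/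
def HasLipschitzBoundary {N : ℕ} (Ω : Set (Eu N)) : Prop :=
  ∀ x ∈ frontier Ω, ∃ (e : Eu N) (K : ℝ≥0) (f : Eu N → ℝ) (ρ : ℝ),
    ‖e‖ = 1 ∧ LipschitzWith K f ∧ 0 < ρ ∧
      ∀ y ∈ Metric.ball x ρ, (y ∈ Ω ↔ f (y - (inner ℝ e y) • e) < inner ℝ e y)

/-! ### The cell problems -/

/-- `R ∈ (O(N) \ SO(N)) H` and `H - R = a ⊗ ν` for some vector `a`. -/
def IsTwin {N : ℕ} (H : Matrix (Fin N) (Fin N) ℝ) (ν : Eu N)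
    (R : Matrix (Fin N) (Fin N) ℝ) : Prop :=
  (∃ Q ∈ Matrix.orthogonalGroup (Fin N) ℝ,
    Q ∉ Matrix.specialOrthogonalGroup (Fin N) ℝ ∧ R = Q * H) ∧
  ∃ a : Fin N → ℝ, H - R = Matrix.vecMulVec a ν

/-- The piecewise affine map `u₀^ν`: `H x` if `⟨x, ν⟩ ≥ 0`, and `R x` otherwise. -/
def twinMap {N : ℕ} (H R : Matrix (Fin N) (Fin N) ℝ) (ν x : Eu N) : Eu N :=
  if 0 ≤ inner ℝ x ν then lin H x else lin R x

/-- The open cube with centre `0`, side length `T` and faces orthogonal to the vectors of the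
orthonormal basis `b`. -/
def orientedCube {N : ℕ} (b : OrthonormalBasis (Fin N) ℝ (Eu N)) (T : ℝ) : Set (Eu N) :=
  {x | ∀ l, |inner ℝ x (b l)| < T / 2}

/-- The infimum of the unscaled energy on `T Q_ν` over all deformations of the nodes of `ℤ^N` in
`T Q_ν` that agree with `u₀^ν` at distance at most `r` from the boundary. -/
def cellInf {N : ℕ} (H R : Matrix (Fin N) (Fin N) ℝ) (p : ℝ) (ν : Eu N)
    (b : OrthonormalBasis (Fin N) ℝ (Eu N)) (T : ℝ) : ℝ≥0∞ :=
  ⨅ (w : (Fin N → ℤ) → Eu N)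
    (_ : ∀ z, node 1 z ∈ orientedCube b T →
      Metric.infDist (node 1 z) (frontier (orientedCube b T)) ≤ maxBond N →
      w z = twinMap H R ν (node 1 z)),
    pairEnergy H p 1 {z | node 1 z ∈ orientedCube b T} w

end LatticeUpperBound

end

open LatticeUpperBound

noncomputable section

namespace LatticeUpperBound

/-! ### Bonds -/

/-! The energy sees only distances. It is therefore unchanged by lattice translations and by rigid
motions of the image (`latEnergy_move`), and a bond whose length agrees with that of its image under
`H` costs nothing. Two different wells `Q₁ H` and `Q₂ H` that differ by some `a ⊗ ν` are, up to an
orthogonal factor, `H` and its twin (`eq_one_or_of_one_sub_eq_vecMulVec`, `mul_twin_of_rankOne`).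
Hence `fold H ν` is the only interface that has to be studied. Throughout, `N = n + 1` with `1 ≤ n`.

Limit of the cell problems. A competitor on a cube of size `T` is moved to any centre on the
hyperplane `ν^⊥` (`exists_shifted_competitor`). The translation has to be by a lattice vector, and
there are lattice vectors near the prescribed centre that lie within `δ` of the hyperplane
(`exists_node_near_hyperplane`). The moved fold then differs from the original one by a multiple of
`δ`. This costs about `δ^p` on the `O(T^n)` bonds near the boundary of the cube, while the bonds
near the boundary that cross the fold plane number only `O(T^(n-1))`. Filling the middle section of
a huge cube with such tiles gives `cellInf_div_le`. It compares two arbitrary orthonormal bases with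
first vector `ν`, so it yields both the existence of the limit and its independence of the cube
(`exists_cell_limit`).

Structure of the deformations. The jump set lies, up to a null set, in finitely many hyperplanes.
The distributional derivative of a bounded function does not charge `𝓗^n`-null sets
(`measure_eq_of_isCompact`), so on a ball that misses the hyperplanes the gradient is weakly
differentiable (`IsSBV.exists_hasWeakDeriv`). There it takes values in `O(N)H`, and the algebra of
the Christoffel symbols of a flat metric makes it constant (`ae_eq_const_of_rigid`). A locally
Lipschitz representative of `u` is therefore piecewise rigid, and near a point of exactly one
hyperplane it is either rigid or a rotated fold (`PiecewiseRigid.flat_or_fold`). The points of the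
second kind form the creases.

Recovery sequence. The node `ε z` is sent to the value of the representative at `ε z + ε Y(ε z)`.
The Lipschitz field `Y` (`exists_shift_field`) moves the nodes near the boundary into `Ω`, and along
each crease it is a constant multiple of the normal that brings the hyperplane into lattice
position. Nearly optimal cells are then inserted in tiles of size `ε T` along the creases. They
contribute the density times the area of the crease, up to small errors. Bonds near the boundary or
near other hyperplanes are controlled by a small area (`exists_count_near_plane`,
`exists_creaseDist_small`). All remaining bonds are wrong only by the variation of `Y`, which costs
`O(ε^(p-1))` in total and vanishes because `1 < p` (`tendsto_bulk_energy`). This is collected in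
`exists_recovery`.

Conclusion. The piecewise affine interpolations of these lattice maps converge strongly by dominated
convergence (`gammaLimsup_le_of_recovery`). The creases consist of jump points of the gradient with
the normal of their hyperplane, so the sum over the creases is at most the integral over the jump
set (`sum_crease_le_lintegral`). -/

lemma kuhnVertex_apply {N : ℕ} (z : Fin N → ℤ) (σ : Equiv.Perm (Fin N)) (k : Fin (N + 1))
    (i : Fin N) :
    kuhnVertex z σ k i = z i + if ((σ.symm i : Fin N) : ℕ) < (k : ℕ) then 1 else 0 := by
  simp only [kuhnVertex, Pi.add_apply, Finset.sum_apply, Pi.single_apply, add_right_inj]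
  rw [Finset.sum_filter]
  have : ∀ j : Fin N, (if (j : ℕ) < (k : ℕ) then (if i = σ j then (1 : ℤ) else 0) else 0) =
      if σ.symm i = j then (if (j : ℕ) < (k : ℕ) then 1 else 0) else 0 := by
    intro j
    by_cases h : i = σ j
    · have h2 : σ.symm i = j := by rw [h]; simp
      simp [h]
    · have h2 : ¬ σ.symm i = j := fun h' => h (by rw [← h']; simp)
      simp [h, h2]
  simp [this]

lemma abs_sub_le_of_mem_kuhnVertices {N : ℕ} {z : Fin N → ℤ} {σ : Equiv.Perm (Fin N)}
    {x y : Fin N → ℤ} (hx : x ∈ kuhnVertices z σ) (hy : y ∈ kuhnVertices z σ) (i : Fin N) :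
    |y i - x i| ≤ 1 := by
  simp only [kuhnVertices, Finset.mem_image, Finset.mem_univ, true_and] at hx hy
  obtain ⟨k, rfl⟩ := hx
  obtain ⟨l, rfl⟩ := hy
  rw [kuhnVertex_apply, kuhnVertex_apply, abs_le]
  split_ifs <;> constructor <;> simp

lemma Contiguous.abs_sub_le {N : ℕ} {x y : Fin N → ℤ} (h : Contiguous x y) (i : Fin N) :
    |y i - x i| ≤ 1 := by
  obtain ⟨z, σ, hx, hy⟩ := h
  exact abs_sub_le_of_mem_kuhnVertices hx hy i

/-- The two simplices share a vertex, and within one simplex each coordinate varies by at most one.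
Passing through the shared vertex gives two. -/
lemma Opposite.abs_sub_le {N : ℕ} {x y : Fin N → ℤ} (h : Opposite x y) (i : Fin N) :
    |y i - x i| ≤ 2 := by
  obtain ⟨-, z, z', σ, σ', F, hxF, hyF, h1, h2⟩ := h
  -- With an empty facet the simplex would be a single point, but its first and last Kuhn vertices
  -- differ in the coordinate `i`.
  have hne : F.Nonempty := by
    rw [Finset.nonempty_iff_ne_empty]
    rintro rfl
    have a1 : kuhnVertex z σ 0 ∈ kuhnVertices z σ := Finset.mem_image_of_mem _ (Finset.mem_univ _)
    have a2 : kuhnVertex z σ (Fin.last N) ∈ kuhnVertices z σ :=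
      Finset.mem_image_of_mem _ (Finset.mem_univ _)
    rw [h1] at a1 a2
    simp only [insert_empty_eq, Finset.mem_singleton] at a1 a2
    have := congrFun (a1.trans a2.symm) i
    rw [kuhnVertex_apply, kuhnVertex_apply] at this
    simp at this
  obtain ⟨f, hf⟩ := hne
  have b1 := abs_sub_le_of_mem_kuhnVertices (z := z) (σ := σ) (x := x) (y := f)
    (by rw [h1]; simp) (by rw [h1]; simp [hf]) i
  have b2 := abs_sub_le_of_mem_kuhnVertices (z := z') (σ := σ') (x := f) (y := y)
    (by rw [h2]; simp [hf]) (by rw [h2]; simp) i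
  rw [abs_le] at *
  constructor <;> omega

lemma abs_le_of_mem_bonds {N : ℕ} {ξ : Fin N → ℤ} (h : ξ ∈ bonds N) (i : Fin N) : |ξ i| ≤ 2 := by
  rcases h with ⟨x, hx⟩ | ⟨x, hx⟩
  · have := hx.abs_sub_le i
    simp only [Pi.add_apply, add_sub_cancel_left] at this
    omega
  · simpa using hx.abs_sub_le i

lemma finite_bonds (N : ℕ) : (bonds N).Finite := by
  refine (Set.finite_Icc (fun _ : Fin N => (-2 : ℤ)) (fun _ => 2)).subset fun ξ hξ => ?_
  exact ⟨fun i => (abs_le.1 (abs_le_of_mem_bonds hξ i)).1,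
    fun i => (abs_le.1 (abs_le_of_mem_bonds hξ i)).2⟩

instance (N : ℕ) : Finite (bonds N) := finite_bonds N

instance (N : ℕ) : Fintype (bonds N) := Fintype.ofFinite _

lemma norm_node_le_maxBond {N : ℕ} {ξ : Fin N → ℤ} (h : ξ ∈ bonds N) : ‖node 1 ξ‖ ≤ maxBond N :=
  le_csSup ((finite_bonds N).image _).bddAbove (mem_image_of_mem _ h)

lemma maxBond_nonneg (N : ℕ) : 0 ≤ maxBond N := by
  refine Real.sSup_nonneg ?_
  rintro _ ⟨ξ, -, rfl⟩
  exact norm_nonneg _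

@[simp] lemma node_apply {N : ℕ} (ε : ℝ) (z : Fin N → ℤ) (i : Fin N) :
    node ε z i = ε * (z i : ℝ) := rfl

lemma node_add {N : ℕ} (ε : ℝ) (z z' : Fin N → ℤ) : node ε (z + z') = node ε z + node ε z' := by
  ext i; simp [mul_add]

lemma node_sub {N : ℕ} (ε : ℝ) (z z' : Fin N → ℤ) : node ε (z - z') = node ε z - node ε z' := by
  ext i; simp [mul_sub]

lemma node_eq_smul {N : ℕ} (ε : ℝ) (z : Fin N → ℤ) : node ε z = ε • node 1 z := by
  ext i; simp

/-! ### Twins -/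

lemma lin_apply {N : ℕ} (M : Matrix (Fin N) (Fin N) ℝ) (x : Eu N) (i : Fin N) :
    lin M x i = (M.mulVec x) i := by
  exact congrFun (Matrix.ofLp_toEuclideanCLM M x) i

lemma lin_mul {N : ℕ} (A B : Matrix (Fin N) (Fin N) ℝ) (x : Eu N) :
    lin (A * B) x = lin A (lin B x) := by
  simp [lin]

lemma norm_lin_orthogonal {N : ℕ} {Q : Matrix (Fin N) (Fin N) ℝ}
    (hQ : Q ∈ Matrix.orthogonalGroup (Fin N) ℝ) (x : Eu N) : ‖lin Q x‖ = ‖x‖ := by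
  have h1 : Q.transpose * Q = 1 := (Matrix.mem_orthogonalGroup_iff' (Fin N) ℝ).1 hQ
  have h2 : ContinuousLinearMap.adjoint (lin Q) = lin Q.transpose := by
    rw [← ContinuousLinearMap.star_eq_adjoint, ← map_star]
    congr 1
  have : inner ℝ (lin Q x) (lin Q x) = inner ℝ x x := by
    rw [← ContinuousLinearMap.adjoint_inner_left, h2, ← lin_mul, h1]
    simp
  rw [real_inner_self_eq_norm_sq, real_inner_self_eq_norm_sq] at this
  exact (sq_eq_sq₀ (norm_nonneg _) (norm_nonneg _)).1 this

lemma lin_sub_of_vecMulVec {N : ℕ} {H R : Matrix (Fin N) (Fin N) ℝ} {a : Fin N → ℝ} {ν : Eu N}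
    (h : H - R = Matrix.vecMulVec a ν) (x : Eu N) :
    lin H x - lin R x = (inner ℝ x ν) • (WithLp.toLp 2 a : Eu N) := by
  have : lin H x - lin R x = lin (H - R) x := by simp [lin]
  rw [this, h]
  ext i
  rw [lin_apply, Matrix.vecMulVec_mulVec]
  simp [EuclideanSpace.inner_eq_star_dotProduct, mul_comm]

/-- Expanding `Qᵀ Q = 1` for a rank-one perturbation of the identity leaves a relation between `m ⊗
m`, `m ⊗ a` and `a ⊗ m` only. It forces `a` to be parallel to `m` and leaves two possible factors,
that of the identity and that of the reflection. -/
lemma eq_one_or_of_one_sub_eq_vecMulVec {N : ℕ} {Q : Matrix (Fin N) (Fin N) ℝ}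
    (hQ : Q ∈ Matrix.orthogonalGroup (Fin N) ℝ) {a m : Fin N → ℝ} (hm : m ≠ 0)
    (h : 1 - Q = Matrix.vecMulVec a m) : Q = 1 ∨ a = (2 / (m ⬝ᵥ m)) • m := by
  have h1 : Q.transpose * Q = 1 := (Matrix.mem_orthogonalGroup_iff' (Fin N) ℝ).1 hQ
  have hQ' : Q = 1 - Matrix.vecMulVec a m := by rw [← h]; abel
  have hmm : m ⬝ᵥ m ≠ 0 := by simpa using hm
  have h2 : (a ⬝ᵥ a) • Matrix.vecMulVec m m = Matrix.vecMulVec m a + Matrix.vecMulVec a m := by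
    have e : Q.transpose * Q = 1 - Matrix.vecMulVec m a - Matrix.vecMulVec a m +
        (a ⬝ᵥ a) • Matrix.vecMulVec m m := by
      rw [hQ', Matrix.transpose_sub, Matrix.transpose_vecMulVec, Matrix.transpose_one, sub_mul,
        mul_sub, mul_sub, Matrix.vecMulVec_mul_vecMulVec]
      simp only [mul_one, one_mul, Matrix.vecMulVec_smul]
      abel
    rw [h1] at e
    have e2 := sub_eq_zero.2 e
    rw [← sub_eq_zero, ← neg_eq_zero, ← e2]
    abel
  -- Evaluation at `m` shows that `a` is a multiple of `m`. The factor then solves a quadratic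
  -- equation with the roots `0` and `2 / (m ⬝ᵥ m)`.
  have h3 := congrArg (fun M : Matrix (Fin N) (Fin N) ℝ => M.mulVec m) h2
  simp only [Matrix.smul_mulVec, Matrix.add_mulVec, Matrix.vecMulVec_mulVec] at h3
  have h4 : a = ((a ⬝ᵥ a) - (a ⬝ᵥ m) / (m ⬝ᵥ m)) • m := by
    ext i
    have := congrFun h3 i
    simp only [Pi.smul_apply, Pi.add_apply, smul_eq_mul, MulOpposite.smul_eq_mul_unop,
      MulOpposite.unop_op] at this ⊢
    field_simp
    linarith
  set l := (a ⬝ᵥ a) - (a ⬝ᵥ m) / (m ⬝ᵥ m) with hl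
  have h5 : l * (l * (m ⬝ᵥ m) - 2) = 0 := by
    have e1 : a ⬝ᵥ a = l * l * (m ⬝ᵥ m) := by
      nth_rewrite 1 2 [h4]; simp [mul_assoc]
    have e2 : a ⬝ᵥ m = l * (m ⬝ᵥ m) := by
      nth_rewrite 1 [h4]; simp
    rw [e1, e2] at hl
    field_simp at hl
    linarith
  rcases mul_eq_zero.1 h5 with h6 | h6
  · left
    rw [hQ', h4, h6]
    simp
  · right
    rw [h4]
    congr 1
    field_simp
    linarith

/-- The vector `H⁻ᵀ ν`. -/
def conormal {N : ℕ} (H : Matrix (Fin N) (Fin N) ℝ) (ν : Eu N) : Fin N → ℝ :=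
  Matrix.vecMul ν H⁻¹

/-- The reflection that takes `H` to its twin. -/
def twinReflection {N : ℕ} (H : Matrix (Fin N) (Fin N) ℝ) (ν : Eu N) :
    Matrix (Fin N) (Fin N) ℝ :=
  1 - Matrix.vecMulVec ((2 / (conormal H ν ⬝ᵥ conormal H ν)) • conormal H ν) (conormal H ν)

lemma conormal_vecMul {N : ℕ} {H : Matrix (Fin N) (Fin N) ℝ} (hH : 0 < H.det) (ν : Eu N) :
    Matrix.vecMul (conormal H ν) H = ν := by
  rw [conormal, Matrix.vecMul_vecMul, Matrix.nonsing_inv_mul _ (isUnit_iff_ne_zero.2 hH.ne')]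
  simp

lemma conormal_ne_zero {N : ℕ} {H : Matrix (Fin N) (Fin N) ℝ} (hH : 0 < H.det) {ν : Eu N}
    (hν : ‖ν‖ = 1) : conormal H ν ≠ 0 := by
  intro h
  have := conormal_vecMul hH ν
  rw [h, Matrix.zero_vecMul] at this
  have h0 : ν = 0 := by ext i; exact (congrFun this i).symm
  simp [h0] at hν

lemma twinReflection_mul_self {N : ℕ} {H : Matrix (Fin N) (Fin N) ℝ} (hH : 0 < H.det) {ν : Eu N}
    (hν : ‖ν‖ = 1) : twinReflection H ν * twinReflection H ν = 1 := by
  have hm : conormal H ν ⬝ᵥ conormal H ν ≠ 0 := by simpa using conormal_ne_zero hH hν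
  unfold twinReflection
  set m := conormal H ν
  rw [sub_mul, mul_sub, mul_sub, Matrix.vecMulVec_mul_vecMulVec, Matrix.smul_vecMulVec,
    Matrix.smul_vecMulVec, dotProduct_smul, Matrix.vecMulVec_smul, smul_smul]
  ext i j
  simp only [mul_one, one_mul, Matrix.sub_apply, Matrix.smul_apply, smul_eq_mul]
  field_simp
  ring

lemma twinReflection_mem {N : ℕ} {H : Matrix (Fin N) (Fin N) ℝ} (hH : 0 < H.det) {ν : Eu N}
    (hν : ‖ν‖ = 1) : twinReflection H ν ∈ Matrix.orthogonalGroup (Fin N) ℝ := by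
  rw [Matrix.mem_orthogonalGroup_iff']
  have : (twinReflection H ν).transpose = twinReflection H ν := by
    unfold twinReflection
    ext i j
    simp [Matrix.one_apply, Matrix.vecMulVec_apply, eq_comm, mul_comm]
  rw [this, twinReflection_mul_self hH hν]

lemma det_twinReflection {N : ℕ} {H : Matrix (Fin N) (Fin N) ℝ} (hH : 0 < H.det) {ν : Eu N}
    (hν : ‖ν‖ = 1) : (twinReflection H ν).det = -1 := by
  have hm : conormal H ν ⬝ᵥ conormal H ν ≠ 0 := by simpa using conormal_ne_zero hH hν
  unfold twinReflection
  set m := conormal H ν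
  have : (1 : Matrix (Fin N) (Fin N) ℝ) - Matrix.vecMulVec ((2 / (m ⬝ᵥ m)) • m) m =
      1 + Matrix.replicateCol Unit (-((2 / (m ⬝ᵥ m)) • m)) * Matrix.replicateRow Unit m := by
    rw [← Matrix.vecMulVec_eq, Matrix.neg_vecMulVec, sub_eq_add_neg]
  rw [this, Matrix.det_one_add_replicateCol_mul_replicateRow]
  simp only [dotProduct_neg, dotProduct_smul, smul_eq_mul]
  field_simp
  ring

lemma twin_sub {N : ℕ} {H : Matrix (Fin N) (Fin N) ℝ} (hH : 0 < H.det) (ν : Eu N) :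
    H - twinReflection H ν * H =
      Matrix.vecMulVec ((2 / (conormal H ν ⬝ᵥ conormal H ν)) • conormal H ν) ν := by
  unfold twinReflection
  rw [sub_mul, one_mul, sub_sub_cancel, Matrix.vecMulVec_mul, conormal_vecMul hH]

lemma isTwin_twinReflection {N : ℕ} {H : Matrix (Fin N) (Fin N) ℝ} (hH : 0 < H.det) {ν : Eu N}
    (hν : ‖ν‖ = 1) : IsTwin H ν (twinReflection H ν * H) := by
  refine ⟨⟨_, twinReflection_mem hH hν, fun h => ?_, rfl⟩, _, twin_sub hH ν⟩
  have := (Matrix.mem_specialOrthogonalGroup_iff.1 h).2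
  rw [det_twinReflection hH hν] at this
  norm_num at this

/-- Multiplication by `H⁻¹` from the right replaces `ν` by the conormal and `H` by the identity,
which is the case already settled. -/
lemma eq_twinReflection {N : ℕ} {H : Matrix (Fin N) (Fin N) ℝ} (hH : 0 < H.det) {ν : Eu N}
    (hν : ‖ν‖ = 1) {Q : Matrix (Fin N) (Fin N) ℝ} (hQ : Q ∈ Matrix.orthogonalGroup (Fin N) ℝ)
    (hQ1 : Q ≠ 1) {a : Fin N → ℝ} (h : H - Q * H = Matrix.vecMulVec a ν) :
    Q = twinReflection H ν := by
  have h1 : 1 - Q = Matrix.vecMulVec a (conormal H ν) := by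
    have e : (1 - Q) * H = Matrix.vecMulVec a ν := by rw [sub_mul, one_mul, h]
    have e2 := congrArg (· * H⁻¹) e
    simp only [Matrix.mul_assoc, Matrix.mul_nonsing_inv _ (isUnit_iff_ne_zero.2 hH.ne')] at e2
    rw [mul_one] at e2
    rw [e2, Matrix.vecMulVec_mul]
    rfl
  rcases eq_one_or_of_one_sub_eq_vecMulVec hQ (conormal_ne_zero hH hν) h1 with h2 | h2
  · exact absurd h2 hQ1
  · unfold twinReflection
    rw [← h2, ← h1, sub_sub_cancel]

lemma isTwin_iff {N : ℕ} {H : Matrix (Fin N) (Fin N) ℝ} (hH : 0 < H.det) {ν : Eu N}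
    (hν : ‖ν‖ = 1) {R : Matrix (Fin N) (Fin N) ℝ} :
    IsTwin H ν R ↔ R = twinReflection H ν * H := by
  refine ⟨?_, fun h => h ▸ isTwin_twinReflection hH hν⟩
  rintro ⟨⟨Q, hQ, hQS, rfl⟩, a, ha⟩
  rw [eq_twinReflection hH hν hQ ?_ ha]
  rintro rfl
  exact hQS (one_mem _)

/-- Two distinct rank-one connected wells are `Q H` and `Q R` with `R` the twin of `H`. -/
lemma mul_twin_of_rankOne {N : ℕ} {H : Matrix (Fin N) (Fin N) ℝ} (hH : 0 < H.det) {ν : Eu N}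
    (hν : ‖ν‖ = 1) {Q₁ Q₂ : Matrix (Fin N) (Fin N) ℝ}
    (h₁ : Q₁ ∈ Matrix.orthogonalGroup (Fin N) ℝ) (h₂ : Q₂ ∈ Matrix.orthogonalGroup (Fin N) ℝ)
    (hne : Q₁ ≠ Q₂) {a : Fin N → ℝ} (h : Q₁ * H - Q₂ * H = Matrix.vecMulVec a ν) :
    Q₂ * H = Q₁ * (twinReflection H ν * H) := by
  have hs : star Q₁ * Q₁ = 1 := (Matrix.mem_orthogonalGroup_iff' (Fin N) ℝ).1 h₁
  have hs' : Q₁ * star Q₁ = 1 := (Matrix.mem_orthogonalGroup_iff (Fin N) ℝ).1 h₁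
  have key : star Q₁ * Q₂ = twinReflection H ν := by
    refine eq_twinReflection hH hν (a := (star Q₁).mulVec a) (mul_mem (Unitary.star_mem h₁) h₂) ?_ ?_
    · intro h'
      apply hne
      rw [← one_mul Q₂, ← hs', mul_assoc, h', mul_one]
    · rw [← Matrix.mul_vecMulVec, ← h, mul_sub, ← mul_assoc, hs, one_mul, mul_assoc]
  rw [← key, ← mul_assoc, ← mul_assoc, hs', one_mul]

/-- The amplitude `a` of the twin `R`, for which `H - R = a ⊗ ν`. -/
def twinVec {N : ℕ} (H : Matrix (Fin N) (Fin N) ℝ) (ν : Eu N) : Eu N :=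
  WithLp.toLp 2 ((2 / (conormal H ν ⬝ᵥ conormal H ν)) • conormal H ν)

/-- The map `u₀^ν` for the twin of `H`. -/
def fold {N : ℕ} (H : Matrix (Fin N) (Fin N) ℝ) (ν x : Eu N) : Eu N :=
  twinMap H (twinReflection H ν * H) ν x

lemma lin_twin {N : ℕ} {H : Matrix (Fin N) (Fin N) ℝ} (hH : 0 < H.det) (ν x : Eu N) :
    lin (twinReflection H ν * H) x = lin H x - (inner ℝ x ν) • twinVec H ν := by
  rw [twinVec, ← lin_sub_of_vecMulVec (twin_sub hH ν) x, sub_sub_cancel]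

/-- The fold is `H` minus a scalar Lipschitz function times a fixed vector. In this form all
estimates for folds become estimates for `min (·) 0`. -/
lemma fold_eq {N : ℕ} {H : Matrix (Fin N) (Fin N) ℝ} (hH : 0 < H.det) (ν x : Eu N) :
    fold H ν x = lin H x - (min (inner ℝ x ν) 0) • twinVec H ν := by
  unfold fold twinMap
  split_ifs with h
  · simp [min_eq_right h]
  · rw [lin_twin hH, min_eq_left (not_le.1 h).le]

lemma norm_lin_twin {N : ℕ} {H : Matrix (Fin N) (Fin N) ℝ} (hH : 0 < H.det) {ν : Eu N}
    (hν : ‖ν‖ = 1) (x : Eu N) : ‖lin (twinReflection H ν * H) x‖ = ‖lin H x‖ := by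
  rw [lin_mul, norm_lin_orthogonal (twinReflection_mem hH hν)]

/-- Changing the sign of the normal exchanges the two halves, and the reflection exchanges them
back. On the hyperplane itself both conventions agree, since there `H` and its twin coincide. This
makes the surface density even in `ν`. -/
lemma fold_neg {N : ℕ} {H : Matrix (Fin N) (Fin N) ℝ} (hH : 0 < H.det) {ν : Eu N}
    (hν : ‖ν‖ = 1) (x : Eu N) : lin (twinReflection H ν) (fold H (-ν) x) = fold H ν x := by
  have hc : conormal H (-ν) = - conormal H ν := by
    unfold conormal; exact Matrix.neg_vecMul _ _
  have hr : twinReflection H (-ν) = twinReflection H ν := by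
    unfold twinReflection; rw [hc]; simp [Matrix.neg_vecMulVec, Matrix.vecMulVec_neg]
  unfold fold twinMap
  rw [hr, inner_neg_right]
  rcases lt_trichotomy (inner ℝ x ν) 0 with h | h | h
  · rw [if_pos (by linarith), if_neg (by linarith), lin_mul]
  · rw [if_pos (by linarith), if_pos (by linarith), ← lin_mul, lin_twin hH, h]
    simp
  · rw [if_neg (by linarith), if_pos (by linarith), ← lin_mul, ← mul_assoc,
      twinReflection_mul_self hH hν, one_mul]

/-! ### The unscaled lattice energy -/

/-- The energy of one bond of the unscaled lattice. -/
def bondCost {N : ℕ} (H : Matrix (Fin N) (Fin N) ℝ) (p : ℝ) (w : (Fin N → ℤ) → Eu N)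
    (ξ z : Fin N → ℤ) : ℝ≥0∞ :=
  ENNReal.ofReal (|‖w (z + ξ) - w z‖ - ‖lin H (node 1 ξ)‖| ^ p)

/-- The energy of the unscaled lattice. -/
def latEnergy {N : ℕ} (H : Matrix (Fin N) (Fin N) ℝ) (p : ℝ) (L : Set (Fin N → ℤ))
    (w : (Fin N → ℤ) → Eu N) : ℝ≥0∞ :=
  ∑ ξ : bonds N, ∑' z, indicator {z | z ∈ L ∧ z + ξ.1 ∈ L} (bondCost H p w ξ.1) z

/-- Blow-up: after division of the positions by `ε` only the surface factor `ε ^ (N - 1)` remembers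
the scale, so everything can be computed on the unit lattice. -/
lemma pairEnergy_eq {N : ℕ} (H : Matrix (Fin N) (Fin N) ℝ) (p : ℝ) {ε : ℝ} (hε : 0 < ε)
    (L : Set (Fin N → ℤ)) (w : (Fin N → ℤ) → Eu N) :
    pairEnergy H p ε L w =
      ENNReal.ofReal (ε ^ (N - 1)) * latEnergy H p L (fun z => ε⁻¹ • w z) := by
  unfold pairEnergy latEnergy
  rw [tsum_fintype]
  congr 1
  refine Finset.sum_congr rfl fun ξ _ => ?_
  rw [← tsum_subtype {z | z ∈ L ∧ z + ξ.1 ∈ L}]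
  refine tsum_congr fun z => ?_
  simp only [bondCost, ← smul_sub, norm_smul, norm_inv, Real.norm_eq_abs, abs_of_pos hε]
  rw [div_eq_inv_mul]

lemma pairEnergy_one {N : ℕ} (H : Matrix (Fin N) (Fin N) ℝ) (p : ℝ)
    (L : Set (Fin N → ℤ)) (w : (Fin N → ℤ) → Eu N) :
    pairEnergy H p 1 L w = latEnergy H p L w := by
  rw [pairEnergy_eq H p one_pos]; simp

lemma latEnergy_congr {N : ℕ} {H : Matrix (Fin N) (Fin N) ℝ} {p : ℝ} {L : Set (Fin N → ℤ)}
    {w w' : (Fin N → ℤ) → Eu N} (h : ∀ z ∈ L, w z = w' z) :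
    latEnergy H p L w = latEnergy H p L w' := by
  unfold latEnergy
  refine Finset.sum_congr rfl fun ξ _ => tsum_congr fun z => ?_
  by_cases hz : z ∈ L ∧ z + ξ.1 ∈ L
  · simp [hz, bondCost, h _ hz.1, h _ hz.2]
  · simp [hz]

/-- The energy is invariant under lattice translations and rigid motions of the image. -/
lemma latEnergy_move {N : ℕ} {H : Matrix (Fin N) (Fin N) ℝ} {p : ℝ} {L : Set (Fin N → ℤ)}
    {Q : Matrix (Fin N) (Fin N) ℝ} (hQ : Q ∈ Matrix.orthogonalGroup (Fin N) ℝ)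
    (w : (Fin N → ℤ) → Eu N) (c : Eu N) (k : Fin N → ℤ) :
    latEnergy H p {z | z - k ∈ L} (fun z => lin Q (w (z - k)) + c) = latEnergy H p L w := by
  classical
  unfold latEnergy
  refine Finset.sum_congr rfl fun ξ _ => ?_
  rw [← (Equiv.addRight k).tsum_eq]
  refine tsum_congr fun z => ?_
  have e : z + k + ξ.1 - k = z + ξ.1 := by abel
  have : bondCost H p (fun z => lin Q (w (z - k)) + c) ξ.1 (z + k) = bondCost H p w ξ.1 z := by
    simp only [bondCost, add_sub_add_right_eq_sub, e, ← map_sub, norm_lin_orthogonal hQ,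
      add_sub_cancel_right]
  simp only [indicator, mem_ofPred_eq, Equiv.coe_addRight, this]
  congr 1
  rw [e, add_sub_cancel_right]

lemma tsum_indicator_le_count {ι : Type*} [MeasurableSpace ι] [DiscreteMeasurableSpace ι]
    {A : Set ι} {f : ι → ℝ≥0∞} {c : ℝ≥0∞} (h : ∀ z ∈ A, f z ≤ c) :
    ∑' z, indicator A f z ≤ c * Measure.count A := by
  rw [Measure.count_apply (MeasurableSet.of_discrete), ← tsum_subtype, mul_comm,
    ← ENNReal.tsum_set_const]
  exact ENNReal.tsum_le_tsum fun z => h z z.2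

/-- If each bond of `L` lies in one of the sets `C k` or starts in one of the sets `A i`, where the
bonds cost at most `c i`, then the energy splits accordingly. -/
lemma latEnergy_le_sum {N : ℕ} {H : Matrix (Fin N) (Fin N) ℝ} {p : ℝ} {L : Set (Fin N → ℤ)}
    {w : (Fin N → ℤ) → Eu N} {κ ι : Type*} (K : Finset κ) (C : κ → Set (Fin N → ℤ))
    (I : Finset ι) (A : ι → Set (Fin N → ℤ)) (c : ι → ℝ≥0∞)
    (h : ∀ ξ ∈ bonds N, ∀ z, z ∈ L → z + ξ ∈ L →
      (∃ k ∈ K, z ∈ C k ∧ z + ξ ∈ C k) ∨ bondCost H p w ξ z = 0 ∨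
        ∃ i ∈ I, z ∈ A i ∧ bondCost H p w ξ z ≤ c i) :
    latEnergy H p L w ≤ ∑ k ∈ K, latEnergy H p (C k) w +
      Fintype.card (bonds N) * ∑ i ∈ I, c i * Measure.count (A i) := by
  have key : ∀ ξ : bonds N,
      ∑' z, indicator {z | z ∈ L ∧ z + ξ.1 ∈ L} (bondCost H p w ξ.1) z ≤
        ∑ k ∈ K, ∑' z, indicator {z | z ∈ C k ∧ z + ξ.1 ∈ C k} (bondCost H p w ξ.1) z +
          ∑ i ∈ I, c i * Measure.count (A i) := by
    intro ξ
    -- The minimum with `c i` is needed because a node of `A i` may also start an expensive bond,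
    -- which is paid for by one of the sets `C k`. With the truncation the last sum is bounded by
    -- counting.
    have h1 : ∀ z, indicator {z | z ∈ L ∧ z + ξ.1 ∈ L} (bondCost H p w ξ.1) z ≤
        ∑ k ∈ K, indicator {z | z ∈ C k ∧ z + ξ.1 ∈ C k} (bondCost H p w ξ.1) z +
          ∑ i ∈ I, indicator (A i) (fun z => min (bondCost H p w ξ.1 z) (c i)) z := by
      intro z
      by_cases hz : z ∈ L ∧ z + ξ.1 ∈ L
      · rw [indicator_of_mem (by exact hz)]
        rcases h ξ.1 ξ.2 z hz.1 hz.2 with ⟨k, hk, hk2⟩ | h0 | ⟨i, hi, hi2, hi3⟩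
        · refine le_add_right (le_trans ?_ (Finset.single_le_sum
            (f := fun k => indicator {z | z ∈ C k ∧ z + ξ.1 ∈ C k} (bondCost H p w ξ.1) z)
            (fun _ _ => zero_le) hk))
          rw [indicator_of_mem (by exact hk2)]
        · rw [h0]; exact zero_le
        · refine le_add_left (le_trans ?_ (Finset.single_le_sum
            (f := fun i => indicator (A i) (fun z => min (bondCost H p w ξ.1 z) (c i)) z)
            (fun _ _ => zero_le) hi))
          rw [indicator_of_mem hi2, min_eq_left hi3]
      · rw [indicator_of_notMem (by exact hz)]; exact zero_le
    refine (ENNReal.tsum_le_tsum h1).trans ?_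
    rw [ENNReal.tsum_add, Summable.tsum_finsetSum (fun _ _ => ENNReal.summable),
      Summable.tsum_finsetSum (fun _ _ => ENNReal.summable)]
    gcongr with i hi
    exact tsum_indicator_le_count fun z _ => min_le_right _ _
  unfold latEnergy
  refine (Finset.sum_le_sum fun ξ _ => key ξ).trans ?_
  rw [Finset.sum_add_distrib, Finset.sum_comm]
  simp [Finset.card_univ]

/-! ### Counting lattice points -/

/-- The half-open unit cube with lower corner `z`. -/
def unitCell {N : ℕ} (z : Fin N → ℤ) : Set (Eu N) := {x | ∀ i, (z i : ℝ) ≤ x i ∧ x i < z i + 1}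

lemma unitCell_eq {N : ℕ} (z : Fin N → ℤ) : unitCell z = (WithLp.ofLp : Eu N → Fin N → ℝ) ⁻¹'
    (Set.univ.pi fun i => Ico (z i : ℝ) (z i + 1)) := by
  ext x; simp [unitCell]

lemma measurableSet_unitCell {N : ℕ} (z : Fin N → ℤ) : MeasurableSet (unitCell z) := by
  rw [unitCell_eq]
  exact (PiLp.volume_preserving_ofLp (Fin N)).measurable
    (MeasurableSet.univ_pi fun i => measurableSet_Ico)

lemma volume_unitCell {N : ℕ} (z : Fin N → ℤ) : volume (unitCell z) = 1 := by
  rw [unitCell_eq, (PiLp.volume_preserving_ofLp (Fin N)).measure_preimage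
    (MeasurableSet.univ_pi fun i => measurableSet_Ico).nullMeasurableSet, Real.volume_pi_Ico]
  simp

lemma disjoint_unitCell {N : ℕ} {z z' : Fin N → ℤ} (h : z ≠ z') :
    Disjoint (unitCell z) (unitCell z') := by
  rw [Set.disjoint_left]
  intro x hx hx'
  apply h
  ext i
  rw [← Int.floor_eq_iff.2 (hx i), ← Int.floor_eq_iff.2 (hx' i)]

lemma norm_le_card_of_abs_le {N : ℕ} {x : Eu N} (h : ∀ i, |x i| ≤ 1) : ‖x‖ ≤ N := by
  rw [EuclideanSpace.norm_eq, Real.sqrt_le_left (by positivity)]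
  calc ∑ i, ‖x i‖ ^ 2 ≤ ∑ i : Fin N, (1 : ℝ) := by
        refine Finset.sum_le_sum fun i _ => ?_
        have := h i
        rw [Real.norm_eq_abs]
        nlinarith [abs_nonneg (x i)]
    _ = N := by simp
    _ ≤ (N : ℝ) ^ 2 := by
        have : (N : ℝ) = 0 ∨ (1 : ℝ) ≤ N := by
          rcases Nat.eq_zero_or_pos N with h | h
          · left; simp [h]
          · right; exact_mod_cast h
        rcases this with h | h <;> nlinarith

lemma norm_sub_node_le {N : ℕ} {z : Fin N → ℤ} {x : Eu N} (hx : x ∈ unitCell z) :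
    ‖x - node 1 z‖ ≤ N := by
  refine norm_le_card_of_abs_le fun i => ?_
  have := hx i
  simp only [PiLp.sub_apply, node_apply, one_mul]
  rw [abs_le]; constructor <;> linarith

/-- The unit cells at the nodes are disjoint, have volume one, and stay within distance `N` of their
nodes. -/
lemma count_le_volume {N : ℕ} {A : Set (Fin N → ℤ)} {A' : Set (Eu N)}
    (h : ∀ z ∈ A, ∀ y, ‖y - node 1 z‖ ≤ N → y ∈ A') :
    Measure.count A ≤ volume A' := by
  calc Measure.count A = ∑' z : A, volume (unitCell z.1) := by
        simp [Measure.count_apply (MeasurableSet.of_discrete), volume_unitCell]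
    _ = volume (⋃ z ∈ A, unitCell z) := by
        rw [measure_biUnion (Set.to_countable A) ?_ fun z _ => measurableSet_unitCell z]
        intro z _ z' _ hne
        exact disjoint_unitCell hne
    _ ≤ volume A' := by
        refine measure_mono (Set.iUnion₂_subset fun z hz x hx => h z hz x (norm_sub_node_le hx))

lemma volume_box {N : ℕ} (b : OrthonormalBasis (Fin N) ℝ (Eu N)) (lo hi : Fin N → ℝ) :
    volume {x : Eu N | ∀ l, inner ℝ x (b l) ∈ Icc (lo l) (hi l)} =
      ∏ l, ENNReal.ofReal (hi l - lo l) := by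
  have e : {x : Eu N | ∀ l, inner ℝ x (b l) ∈ Icc (lo l) (hi l)} =
      b.repr ⁻¹' ((WithLp.ofLp : Eu N → Fin N → ℝ) ⁻¹' Icc lo hi) := by
    ext x
    simp [b.repr_apply_apply, real_inner_comm, Pi.le_def, forall_and]
  rw [e, b.measurePreserving_repr.measure_preimage, (PiLp.volume_preserving_ofLp
    (Fin N)).measure_preimage measurableSet_Icc.nullMeasurableSet, Real.volume_Icc_pi]
  exact ((PiLp.volume_preserving_ofLp (Fin N)).measurable measurableSet_Icc).nullMeasurableSet

lemma measurableSet_boxIco {N : ℕ} (b : OrthonormalBasis (Fin N) ℝ (Eu N)) (lo hi : Fin N → ℝ) :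
    MeasurableSet {x : Eu N | ∀ l, inner ℝ x (b l) ∈ Ico (lo l) (hi l)} := by
  have : {x : Eu N | ∀ l, inner ℝ x (b l) ∈ Ico (lo l) (hi l)} =
      ⋂ l, (fun x : Eu N => inner ℝ x (b l)) ⁻¹' Ico (lo l) (hi l) := by
    ext x; simp
  rw [this]
  exact MeasurableSet.iInter fun l => (by fun_prop : Continuous fun x : Eu N =>
    (inner ℝ x (b l) : ℝ)).measurable measurableSet_Ico

lemma volume_boxIco {N : ℕ} (b : OrthonormalBasis (Fin N) ℝ (Eu N)) (lo hi : Fin N → ℝ) :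
    volume {x : Eu N | ∀ l, inner ℝ x (b l) ∈ Ico (lo l) (hi l)} =
      ∏ l, ENNReal.ofReal (hi l - lo l) := by
  have e : {x : Eu N | ∀ l, inner ℝ x (b l) ∈ Ico (lo l) (hi l)} = b.repr ⁻¹'
      ((WithLp.ofLp : Eu N → Fin N → ℝ) ⁻¹' Set.univ.pi fun l => Ico (lo l) (hi l)) := by
    ext x
    simp [b.repr_apply_apply, real_inner_comm]
  have hm : MeasurableSet (Set.univ.pi fun l => Ico (lo l) (hi l)) :=
    MeasurableSet.univ_pi fun i => measurableSet_Ico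
  rw [e, b.measurePreserving_repr.measure_preimage, (PiLp.volume_preserving_ofLp
    (Fin N)).measure_preimage hm.nullMeasurableSet, Real.volume_pi_Ico]
  exact ((PiLp.volume_preserving_ofLp (Fin N)).measurable hm).nullMeasurableSet

/-- The box is thickened by `N` on every side to contain the unit cells of its nodes, whence the
summand `2 * N` in each factor. -/
lemma count_box_le {N : ℕ} (b : OrthonormalBasis (Fin N) ℝ (Eu N)) (x₀ : Eu N)
    (lo hi : Fin N → ℝ) :
    Measure.count {z : Fin N → ℤ | ∀ l, inner ℝ (node 1 z - x₀) (b l) ∈ Icc (lo l) (hi l)} ≤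
      ∏ l, ENNReal.ofReal (hi l - lo l + 2 * N) := by
  have := volume_box b (fun l => lo l + inner ℝ x₀ (b l) - N) (fun l => hi l + inner ℝ x₀ (b l) + N)
  refine (count_le_volume ?_).trans (this.trans_le ?_)
  · intro z hz y hy l
    have h1 := hz l
    have h2 : |inner ℝ (y - node 1 z) (b l)| ≤ N := by
      refine (abs_real_inner_le_norm _ _).trans ?_
      rw [b.norm_eq_one, mul_one]; exact hy
    rw [abs_le] at h2
    simp only [inner_sub_left, mem_Icc] at h1 h2 ⊢
    constructor <;> linarith [h1.1, h1.2, h2.1, h2.2]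
  · refine Finset.prod_le_prod' fun l _ => ENNReal.ofReal_le_ofReal ?_
    linarith

lemma prod_le_of_one {n : ℕ} (l : Fin (n + 1)) (f : Fin (n + 1) → ℝ≥0∞) {B C : ℝ≥0∞}
    (hl : f l ≤ B) (h : ∀ m, m ≠ l → f m ≤ C) : ∏ m, f m ≤ B * C ^ n := by
  rw [← Finset.mul_prod_erase _ _ (Finset.mem_univ l)]
  refine mul_le_mul' hl ((Finset.prod_le_pow_card _ _ C fun m hm => h m
    (Finset.ne_of_mem_erase hm)).trans_eq ?_)
  simp

lemma prod_le_of_two {n : ℕ} (l : Fin (n + 1)) (hl0 : l ≠ 0) (f : Fin (n + 1) → ℝ≥0∞)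
    {A B C : ℝ≥0∞} (h0 : f 0 ≤ A) (hl : f l ≤ B) (h : ∀ m, f m ≤ C) :
    ∏ m, f m ≤ A * (B * C ^ (n - 1)) := by
  rw [← Finset.mul_prod_erase _ _ (Finset.mem_univ (0 : Fin (n + 1))), ← Finset.mul_prod_erase _ _
    (Finset.mem_erase.2 ⟨hl0, Finset.mem_univ l⟩)]
  refine mul_le_mul' h0 (mul_le_mul' hl ((Finset.prod_le_pow_card _ _ C fun m _ => h m).trans_eq ?_))
  congr 1
  rw [Finset.card_erase_of_mem (Finset.mem_erase.2 ⟨hl0, Finset.mem_univ l⟩)]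
  simp

/-- The lattice points of a cube that are near its faces. -/
lemma count_shell_le {n : ℕ} (b : OrthonormalBasis (Fin (n + 1)) ℝ (Eu (n + 1))) (x₀ : Eu (n + 1))
    {D h : ℝ} (hD : 0 ≤ D) (hh : 0 ≤ h) :
    Measure.count {z : Fin (n + 1) → ℤ | (∀ m, |inner ℝ (node 1 z - x₀) (b m)| ≤ D) ∧
      ∃ l, D - h ≤ |inner ℝ (node 1 z - x₀) (b l)|} ≤
      ENNReal.ofReal (2 * (n + 1) * ((h + 2 * (n + 1)) * (2 * D + 2 * (n + 1)) ^ n)) := by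
  classical
  -- One slab for each face: the index names a direction and the positive or negative side.
  let A : Fin (n + 1) × Bool → Set (Fin (n + 1) → ℤ) := fun i =>
    {z | ∀ m, inner ℝ (node 1 z - x₀) (b m) ∈ Icc
      (if m = i.1 then (if i.2 then D - h else -D) else -D)
      (if m = i.1 then (if i.2 then D else -D + h) else D)}
  have hA : ∀ i, Measure.count (A i) ≤
      ENNReal.ofReal ((h + 2 * (n + 1)) * (2 * D + 2 * (n + 1)) ^ n) := by
    intro i
    refine (count_box_le b x₀ _ _).trans ((prod_le_of_one i.1 _
      (B := ENNReal.ofReal (h + 2 * (n + 1))) (C := ENNReal.ofReal (2 * D + 2 * (n + 1)))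
      ?_ ?_).trans_eq ?_)
    · refine ENNReal.ofReal_le_ofReal ?_
      simp only [if_true]
      split_ifs <;> push_cast <;> linarith
    · intro m hm
      refine ENNReal.ofReal_le_ofReal ?_
      simp only [hm, if_false]
      push_cast; linarith
    · rw [ENNReal.ofReal_mul (by positivity), ENNReal.ofReal_pow (by positivity)]
  calc _ ≤ Measure.count (⋃ i, A i) := by
        refine measure_mono ?_
        rintro z ⟨h1, l, hl⟩
        simp only [mem_iUnion]
        rcases le_total 0 (inner ℝ (node 1 z - x₀) (b l)) with h0 | h0
        · refine ⟨(l, true), fun m => ?_⟩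
          have := abs_le.1 (h1 m)
          by_cases hm : m = l
          · subst hm
            rw [abs_of_nonneg h0] at hl
            simp [hl, this.2]
          · simp [hm, this.1, this.2]
        · refine ⟨(l, false), fun m => ?_⟩
          have := abs_le.1 (h1 m)
          by_cases hm : m = l
          · subst hm
            rw [abs_of_nonpos h0] at hl
            simp only [if_true, mem_Icc]
            exact ⟨this.1, by simp; linarith⟩
          · simp [hm, this.1, this.2]
    _ ≤ ∑ i, Measure.count (A i) := measure_iUnion_fintype_le _ _
    _ ≤ ∑ i : Fin (n + 1) × Bool,
        ENNReal.ofReal ((h + 2 * (n + 1)) * (2 * D + 2 * (n + 1)) ^ n) :=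
        Finset.sum_le_sum fun i _ => hA i
    _ = _ := by
        rw [Finset.sum_const, Finset.card_univ, Fintype.card_prod, nsmul_eq_mul,
          ENNReal.ofReal_mul (p := 2 * (n + 1)) (by positivity)]
        congr 1
        simp only [Fintype.card_fin, Fintype.card_bool, Nat.cast_mul, Nat.cast_add, Nat.cast_one,
          Nat.cast_ofNat]
        rw [ENNReal.ofReal_mul (by norm_num), mul_comm]
        norm_cast

/-- The lattice points of a plate that are near its lateral faces. -/
lemma count_plateShell_le {n : ℕ} (b : OrthonormalBasis (Fin (n + 1)) ℝ (Eu (n + 1)))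
    (x₀ : Eu (n + 1)) {k D h : ℝ} (hk : 0 ≤ k) (hD : 0 ≤ D) (hh : 0 ≤ h) :
    Measure.count {z : Fin (n + 1) → ℤ | |inner ℝ (node 1 z - x₀) (b 0)| ≤ k ∧
      (∀ m, |inner ℝ (node 1 z - x₀) (b m)| ≤ D) ∧
      ∃ l, l ≠ 0 ∧ D - h ≤ |inner ℝ (node 1 z - x₀) (b l)|} ≤
      ENNReal.ofReal (2 * (n + 1) * ((2 * k + 2 * (n + 1)) * ((h + 2 * (n + 1)) *
        (2 * D + 2 * (n + 1)) ^ (n - 1)))) := by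
  classical
  -- One box for each lateral face; the two lids are excluded by `i.1 ≠ 0`. Cutting with `-D` and
  -- `D` keeps every width below `2 * D`, also in the direction `0` when `k` exceeds `D`.
  let A : Fin (n + 1) × Bool → Set (Fin (n + 1) → ℤ) := fun i =>
    {z | i.1 ≠ 0 ∧ ∀ m, inner ℝ (node 1 z - x₀) (b m) ∈ Icc
      (max (-D) (if m = 0 then -k else if m = i.1 then (if i.2 then D - h else -D) else -D))
      (min D (if m = 0 then k else if m = i.1 then (if i.2 then D else -D + h) else D))}
  have hA : ∀ i, Measure.count (A i) ≤
      ENNReal.ofReal ((2 * k + 2 * (n + 1)) * ((h + 2 * (n + 1)) *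
        (2 * D + 2 * (n + 1)) ^ (n - 1))) := by
    intro i
    by_cases hi : i.1 = 0
    · simp [A, hi]
    refine (measure_mono (fun z (hz : z ∈ A i) => hz.2)).trans ?_
    refine (count_box_le b x₀ _ _).trans ((prod_le_of_two i.1 hi _
      (A := ENNReal.ofReal (2 * k + 2 * (n + 1)))
      (B := ENNReal.ofReal (h + 2 * (n + 1))) (C := ENNReal.ofReal (2 * D + 2 * (n + 1)))
      ?_ ?_ ?_).trans_eq ?_)
    · refine ENNReal.ofReal_le_ofReal ?_
      simp only [if_true]
      push_cast
      linarith [le_max_right (-D) (-k), min_le_right D k]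
    · refine ENNReal.ofReal_le_ofReal ?_
      simp only [hi, if_true, if_false]
      push_cast
      split_ifs
      · linarith [le_max_right (-D) (D - h), min_le_right D D]
      · linarith [le_max_right (-D) (-D), min_le_right D (-D + h)]
    · intro m
      refine ENNReal.ofReal_le_ofReal ?_
      push_cast
      refine add_le_add (le_trans (sub_le_sub (min_le_left _ _) (le_max_left _ _)) ?_) le_rfl
      linarith
    · rw [ENNReal.ofReal_mul (by positivity), ENNReal.ofReal_mul (by positivity),
        ENNReal.ofReal_pow (by positivity)]
  calc _ ≤ Measure.count (⋃ i, A i) := by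
        refine measure_mono ?_
        rintro z ⟨h0k, h1, l, hl0, hl⟩
        simp only [mem_iUnion]
        have h0k' := abs_le.1 h0k
        rcases le_total 0 (inner ℝ (node 1 z - x₀) (b l)) with h0 | h0
        · refine ⟨(l, true), hl0, fun m => ?_⟩
          have := abs_le.1 (h1 m)
          rw [abs_of_nonneg h0] at hl
          refine ⟨max_le this.1 ?_, le_min this.2 ?_⟩ <;> split_ifs with h3 h4 <;> simp_all
        · refine ⟨(l, false), hl0, fun m => ?_⟩
          have := abs_le.1 (h1 m)
          rw [abs_of_nonpos h0] at hl
          refine ⟨max_le this.1 ?_, le_min this.2 ?_⟩ <;> split_ifs with h3 h4 <;>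
            (simp_all; try linarith)
    _ ≤ ∑ i, Measure.count (A i) := measure_iUnion_fintype_le _ _
    _ ≤ ∑ i : Fin (n + 1) × Bool, _ := Finset.sum_le_sum fun i _ => hA i
    _ = _ := by
        rw [Finset.sum_const, Finset.card_univ, Fintype.card_prod, nsmul_eq_mul,
          ENNReal.ofReal_mul (p := 2 * (n + 1)) (by positivity)]
        congr 1
        simp only [Fintype.card_fin, Fintype.card_bool, Nat.cast_mul, Nat.cast_add, Nat.cast_one,
          Nat.cast_ofNat]
        rw [ENNReal.ofReal_mul (by norm_num), mul_comm]
        norm_cast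

/-- Near each point of the hyperplane `ν^⊥` there is a lattice point that is almost on it. -/
lemma exists_node_near_hyperplane {N : ℕ} {ν : Eu N} (hν : ‖ν‖ = 1) {δ : ℝ} (hδ : 0 < δ) :
    ∃ L : ℝ, 0 ≤ L ∧ ∀ t : Eu N, inner ℝ t ν = 0 →
      ∃ τ : Fin N → ℤ, ‖node 1 τ - t‖ ≤ L ∧ |inner ℝ (node 1 τ) ν| ≤ δ := by
  classical
  -- Pigeonhole: the heights over the hyperplane are sorted into bins of length `δ`, and `k j` is a
  -- representative of the bin `j` if that bin is occupied.
  have hch : ∀ j : ℤ, ∃ k : Fin N → ℤ, (∃ k' : Fin N → ℤ, ⌊inner ℝ (node 1 k') ν / δ⌋ = j) →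
      ⌊inner ℝ (node 1 k) ν / δ⌋ = j := by
    intro j
    by_cases h : ∃ k' : Fin N → ℤ, ⌊inner ℝ (node 1 k') ν / δ⌋ = j
    · exact ⟨h.choose, fun _ => h.choose_spec⟩
    · exact ⟨0, fun h' => absurd h' h⟩
  choose k hk using hch
  let M : ℤ := ⌈(N : ℝ) / δ⌉ + 1
  refine ⟨N + ∑ j ∈ Finset.Icc (-M) M, ‖node 1 (k j)‖,
    add_nonneg (Nat.cast_nonneg _) (Finset.sum_nonneg fun _ _ => norm_nonneg _), fun t ht => ?_⟩
  let z₀ : Fin N → ℤ := fun i => ⌊t i⌋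
  have hz₀ : ‖t - node 1 z₀‖ ≤ N :=
    norm_sub_node_le fun i => ⟨Int.floor_le _, Int.lt_floor_add_one _⟩
  have hs : |inner ℝ (node 1 z₀) ν| ≤ N := by
    have : inner ℝ (node 1 z₀) ν = - inner ℝ (t - node 1 z₀) ν := by
      rw [inner_sub_left, ht]; ring
    rw [this, abs_neg]
    refine (abs_real_inner_le_norm _ _).trans ?_
    rw [hν, mul_one]; exact hz₀
  set s := inner ℝ (node 1 z₀) ν with hsdef
  set j := ⌊s / δ⌋ with hj
  have hjM : j ∈ Finset.Icc (-M) M := by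
    rw [abs_le] at hs
    have h1 : s / δ ≤ N / δ := by gcongr; exact hs.2
    have h2 : -(N / δ) ≤ s / δ := by rw [← neg_div]; gcongr; exact hs.1
    have h3 := Int.le_ceil ((N : ℝ) / δ)
    rw [Finset.mem_Icc]
    constructor
    · rw [hj, Int.le_floor]; push_cast [M]; linarith
    · have := Int.floor_le (s / δ)
      rw [← hj] at this
      have h4 : (j : ℝ) ≤ ⌈(N : ℝ) / δ⌉ := by linarith
      have : j ≤ ⌈(N : ℝ) / δ⌉ := by exact_mod_cast h4
      simp only [M]; omega
  have hkj := hk j ⟨z₀, rfl⟩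
  -- Subtracting the representative of the same bin leaves a height below `δ`. Only the bins with
  -- index in `[-M, M]` occur, so the additional shift is bounded independently of `t`.
  refine ⟨z₀ - k j, ?_, ?_⟩
  · rw [node_sub]
    calc ‖node 1 z₀ - node 1 (k j) - t‖ = ‖-(t - node 1 z₀) - node 1 (k j)‖ := by congr 1; abel
      _ ≤ ‖t - node 1 z₀‖ + ‖node 1 (k j)‖ := by
        refine (norm_sub_le _ _).trans ?_; rw [norm_neg]
      _ ≤ _ := add_le_add hz₀ (Finset.single_le_sum (f := fun j => ‖node 1 (k j)‖)
        (fun _ _ => norm_nonneg _) hjM)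
  · rw [node_sub, inner_sub_left]
    have e := Int.abs_sub_lt_one_of_floor_eq_floor (hj.symm.trans hkj.symm)
    rw [← sub_div, abs_div, abs_of_pos hδ, div_lt_one hδ] at e
    exact e.le

/-! ### Cubes and the cell problem -/

/-- The segment from a point of the set to a point outside is connected, so it meets the frontier.
-/
lemma infDist_frontier_le {E : Type*} [NormedAddCommGroup E] [NormedSpace ℝ E] {A : Set E}
    {x y : E} (hx : x ∈ A) (hy : y ∉ A) : Metric.infDist x (frontier A) ≤ dist x y := by
  have : (segment ℝ x y ∩ frontier A).Nonempty := by
    by_contra hne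
    rw [Set.not_nonempty_iff_eq_empty, ← Set.disjoint_iff_inter_eq_empty,
      ← Set.subset_compl_iff_disjoint_right, compl_frontier_eq_union_interior] at hne
    have hx' : x ∈ interior A := by
      rcases hne (left_mem_segment ℝ x y) with h | h
      · exact h
      · exact absurd hx (interior_subset h)
    have := (convex_segment x y).isPreconnected.subset_left_of_subset_union isOpen_interior
      isOpen_interior (disjoint_compl_right.mono interior_subset interior_subset) hne
      ⟨x, left_mem_segment ℝ x y, hx'⟩
    exact hy (interior_subset (this (right_mem_segment ℝ x y)))
  obtain ⟨z, hz, hzf⟩ := this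
  refine (Metric.infDist_le_dist_of_mem hzf).trans ?_
  have := (segment_subset_closedBall_left x y) hz
  rwa [Metric.mem_closedBall, dist_comm] at this

/-- The open cube with centre `t`, side length `S` and faces orthogonal to the vectors of `b`. -/
def cubeAt {N : ℕ} (b : OrthonormalBasis (Fin N) ℝ (Eu N)) (t : Eu N) (S : ℝ) : Set (Eu N) :=
  {x | ∀ l, |inner ℝ (x - t) (b l)| < S / 2}

lemma orientedCube_eq {N : ℕ} (b : OrthonormalBasis (Fin N) ℝ (Eu N)) (T : ℝ) :
    orientedCube b T = cubeAt b 0 T := by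
  simp [orientedCube, cubeAt]

lemma abs_inner_basis_le {N : ℕ} (b : OrthonormalBasis (Fin N) ℝ (Eu N)) (x : Eu N) (l : Fin N) :
    |inner ℝ x (b l)| ≤ ‖x‖ := by
  simpa [b.norm_eq_one] using abs_real_inner_le_norm x (b l)

lemma abs_inner_sub_le {N : ℕ} (b : OrthonormalBasis (Fin N) ℝ (Eu N)) (x y t : Eu N)
    (l : Fin N) : |inner ℝ (y - t) (b l)| ≤ |inner ℝ (x - t) (b l)| + ‖y - x‖ := by
  have h := abs_inner_basis_le b (y - x) l
  have e : inner ℝ (y - t) (b l) = inner ℝ (x - t) (b l) + inner ℝ (y - x) (b l) := by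
    rw [← inner_add_left]; congr 1; abel
  rw [e]
  exact (abs_add_le _ _).trans (by linarith)

lemma mem_cubeAt_of_norm_le {N : ℕ} {b : OrthonormalBasis (Fin N) ℝ (Eu N)} {t x y : Eu N}
    {S r : ℝ} (hx : x ∈ cubeAt b t (S - 2 * r)) (h : ‖y - x‖ ≤ r) : y ∈ cubeAt b t S := by
  intro l
  have := hx l
  linarith [abs_inner_sub_le b x y t l]

lemma norm_le_sum_inner {N : ℕ} (b : OrthonormalBasis (Fin N) ℝ (Eu N)) (x : Eu N) :
    ‖x‖ ≤ ∑ l, |inner ℝ x (b l)| := by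
  conv_lhs => rw [← b.sum_repr x]
  refine (norm_sum_le _ _).trans_eq (Finset.sum_congr rfl fun l _ => ?_)
  rw [norm_smul, b.norm_eq_one, mul_one, b.repr_apply_apply, Real.norm_eq_abs, real_inner_comm]

lemma norm_le_of_abs_inner_le {N : ℕ} (b : OrthonormalBasis (Fin N) ℝ (Eu N)) {x : Eu N} {D : ℝ}
    (h : ∀ l, |inner ℝ x (b l)| ≤ D) : ‖x‖ ≤ N * D := by
  refine (norm_le_sum_inner b x).trans ((Finset.sum_le_sum fun l _ => h l).trans_eq ?_)
  simp

lemma finite_nodes_of_isBounded {N : ℕ} {A : Set (Eu N)} (hA : Bornology.IsBounded A) :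
    {z : Fin N → ℤ | node 1 z ∈ A}.Finite := by
  obtain ⟨R, hR⟩ := hA.exists_norm_le
  refine (Set.finite_Icc (fun _ : Fin N => -⌈R⌉) (fun _ => ⌈R⌉)).subset fun z hz => ?_
  have h : ∀ i, |(z i : ℝ)| ≤ ⌈R⌉ := fun i => by
    have := (PiLp.norm_apply_le (node 1 z) i).trans ((hR _ hz).trans (Int.le_ceil R))
    simpa using this
  refine ⟨fun i => ?_, fun i => ?_⟩
  · have := (abs_le.1 (h i)).1; exact_mod_cast this
  · have := (abs_le.1 (h i)).2; exact_mod_cast this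

lemma isBounded_cubeAt {N : ℕ} (b : OrthonormalBasis (Fin N) ℝ (Eu N)) (t : Eu N) (S : ℝ) :
    Bornology.IsBounded (cubeAt b t S) := by
  refine isBounded_iff_forall_norm_le.2 ⟨N * (S / 2) + ‖t‖, fun x hx => ?_⟩
  have := norm_le_of_abs_inner_le b (x := x - t) (fun l => (hx l).le)
  calc ‖x‖ = ‖(x - t) + t‖ := by simp
    _ ≤ _ := (norm_add_le _ _).trans (by linarith)

lemma bondCost_le {N : ℕ} {H : Matrix (Fin N) (Fin N) ℝ} {p : ℝ} (hp : 0 ≤ p)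
    {w : (Fin N → ℤ) → Eu N} {ξ z : Fin N → ℤ} {c : ℝ}
    (h : |‖w (z + ξ) - w z‖ - ‖lin H (node 1 ξ)‖| ≤ c) :
    bondCost H p w ξ z ≤ ENNReal.ofReal (c ^ p) :=
  ENNReal.ofReal_le_ofReal (Real.rpow_le_rpow (abs_nonneg _) h hp)

lemma bondCost_eq_zero {N : ℕ} {H : Matrix (Fin N) (Fin N) ℝ} {p : ℝ} (hp : 0 < p)
    {w : (Fin N → ℤ) → Eu N} {ξ z : Fin N → ℤ}
    (h : ‖w (z + ξ) - w z‖ = ‖lin H (node 1 ξ)‖) : bondCost H p w ξ z = 0 := by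
  simp [bondCost, h, Real.zero_rpow hp.ne']

lemma abs_norm_sub_le_of_near {E : Type*} [NormedAddCommGroup E] {x y x' y' : E} {c d e : ℝ}
    (hx : ‖x - x'‖ ≤ d) (hy : ‖y - y'‖ ≤ d) (h : |‖y' - x'‖ - c| ≤ e) :
    |‖y - x‖ - c| ≤ e + 2 * d := by
  have h1 : |‖y - x‖ - ‖y' - x'‖| ≤ 2 * d := by
    refine (abs_norm_sub_norm_le _ _).trans ?_
    have : y - x - (y' - x') = (y - y') - (x - x') := by abel
    rw [this]
    exact (norm_sub_le _ _).trans (by linarith)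
  have := abs_add_le (‖y - x‖ - ‖y' - x'‖) (‖y' - x'‖ - c)
  rw [sub_add_sub_cancel] at this
  linarith

/-! ### Lengths of bonds under the fold -/

section Fold

variable {N : ℕ} {H : Matrix (Fin N) (Fin N) ℝ} (hH : 0 < H.det) {ν : Eu N} (hν : ‖ν‖ = 1)

include hH in
lemma fold_sub_of_nonneg {x y : Eu N} (hx : 0 ≤ inner ℝ x ν) (hy : 0 ≤ inner ℝ y ν) :
    fold H ν y - fold H ν x = lin H (y - x) := by
  rw [fold_eq hH, fold_eq hH, min_eq_right hx, min_eq_right hy]; simp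

include hH in
lemma fold_sub_of_nonpos {x y : Eu N} (hx : inner ℝ x ν ≤ 0) (hy : inner ℝ y ν ≤ 0) :
    fold H ν y - fold H ν x = lin (twinReflection H ν * H) (y - x) := by
  rw [fold_eq hH, fold_eq hH, min_eq_left hx, min_eq_left hy, map_sub, lin_twin hH, lin_twin hH]

include hH in
lemma fold_add_of_orthogonal {x t : Eu N} (ht : inner ℝ t ν = 0) :
    fold H ν (x + t) = fold H ν x + lin H t := by
  rw [fold_eq hH, fold_eq hH, inner_add_left, ht, add_zero, map_add]; abel

include hH in
-- Translating the fold by `τ` and adding `H τ` changes nothing if `τ` is parallel to the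
-- hyperplane. In general only the height of `τ` enters, since `min (·) 0` is 1-Lipschitz.
lemma norm_fold_translate_le (x τ : Eu N) :
    ‖fold H ν (x - τ) + lin H τ - fold H ν x‖ ≤ ‖twinVec H ν‖ * |inner ℝ τ ν| := by
  rw [fold_eq hH, fold_eq hH, inner_sub_left, map_sub]
  have e : lin H x - lin H τ - min (inner ℝ x ν - inner ℝ τ ν) 0 • twinVec H ν + lin H τ -
      (lin H x - min (inner ℝ x ν) 0 • twinVec H ν) =
      (min (inner ℝ x ν) 0 - min (inner ℝ x ν - inner ℝ τ ν) 0) • twinVec H ν := by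
    rw [sub_smul]; abel
  rw [e, norm_smul, mul_comm, Real.norm_eq_abs]
  refine mul_le_mul_of_nonneg_left ?_ (norm_nonneg _)
  exact (abs_min_sub_min_le_max (inner ℝ x ν) 0 (inner ℝ x ν - inner ℝ τ ν) 0).trans_eq (by simp)

include hH hν in
lemma abs_norm_fold_sub_le (x y : Eu N) :
    |‖fold H ν y - fold H ν x‖ - ‖lin H (y - x)‖| ≤ ‖twinVec H ν‖ * ‖y - x‖ := by
  refine (abs_norm_sub_norm_le _ _).trans ?_
  rw [fold_eq hH, fold_eq hH, map_sub]
  have e : lin H y - min (inner ℝ y ν) 0 • twinVec H ν -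
      (lin H x - min (inner ℝ x ν) 0 • twinVec H ν) - (lin H y - lin H x) =
      (min (inner ℝ x ν) 0 - min (inner ℝ y ν) 0) • twinVec H ν := by
    rw [sub_smul]; abel
  rw [e, norm_smul, mul_comm, Real.norm_eq_abs]
  gcongr
  refine (abs_min_sub_min_le_max (inner ℝ x ν) 0 (inner ℝ y ν) 0).trans ?_
  rw [← inner_sub_left]
  have := abs_real_inner_le_norm (x - y) ν
  rw [hν, mul_one, norm_sub_rev] at this
  simpa using this

include hH hν in
/-- A bond of the folded lattice that does not cross the fold costs nothing. -/
lemma norm_fold_sub_or_crossing (x y : Eu N) :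
    ‖fold H ν y - fold H ν x‖ = ‖lin H (y - x)‖ ∨
      ∃ ζ, inner ℝ ζ ν = 0 ∧ ‖x - ζ‖ ≤ ‖y - x‖ ∧ ‖y - ζ‖ ≤ ‖y - x‖ := by
  rcases le_total 0 (inner ℝ x ν) with hx | hx <;> rcases le_total 0 (inner ℝ y ν) with hy | hy
  · left; rw [fold_sub_of_nonneg hH hx hy]
  on_goal 3 => left; rw [fold_sub_of_nonpos hH hx hy, norm_lin_twin hH hν]
  all_goals
    right
    -- The end points lie on opposite sides, so by the intermediate value theorem the height
    -- vanishes somewhere on the segment.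
    have hc : (0 : ℝ) ∈ (fun t : ℝ => inner ℝ (x + t • (y - x)) ν) '' Icc 0 1 := by
      refine (isPreconnected_Icc.image _ (by fun_prop)).ordConnected.out
        (x := min (inner ℝ x ν) (inner ℝ y ν)) (y := max (inner ℝ x ν) (inner ℝ y ν)) ?_ ?_ ?_
      · rcases min_choice (inner ℝ x ν) (inner ℝ y ν) with h | h <;> rw [h]
        · exact ⟨0, by simp, by simp⟩
        · exact ⟨1, by simp, by simp⟩
      · rcases max_choice (inner ℝ x ν) (inner ℝ y ν) with h | h <;> rw [h]
        · exact ⟨0, by simp, by simp⟩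
        · exact ⟨1, by simp, by simp⟩
      · constructor
        · simp [hx, hy]
        · simp [hx, hy]
    obtain ⟨t, ht, h0⟩ := hc
    refine ⟨x + t • (y - x), h0, ?_, ?_⟩
    · rw [sub_add_cancel_left, norm_neg, norm_smul, Real.norm_eq_abs, abs_of_nonneg ht.1]
      exact mul_le_of_le_one_left (norm_nonneg _) ht.2
    · have : y - (x + t • (y - x)) = (1 - t) • (y - x) := by
        rw [sub_smul, one_smul]; abel
      rw [this, norm_smul, Real.norm_eq_abs, abs_of_nonneg (by linarith [ht.2])]
      exact mul_le_of_le_one_left (norm_nonneg _) (by linarith [ht.1])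

end Fold

/-- Errors that live near the lateral faces of a plate have order `T ^ (n - 1)`. This absorbs them
into a small multiple of the area `T ^ n`. -/
lemma exists_mul_add_pow_le {n : ℕ} (hn : 1 ≤ n) {C q η : ℝ} (hC : 0 ≤ C) (hq : 0 ≤ q)
    (hη : 0 < η) : ∃ T₁ : ℝ, 1 ≤ T₁ ∧ ∀ T, T₁ ≤ T → C * (T + q) ^ (n - 1) ≤ η * T ^ n := by
  refine ⟨max 1 (max q (C * 2 ^ (n - 1) / η)), le_max_left _ _, fun T hT => ?_⟩
  have h1 : 1 ≤ T := (le_max_left _ _).trans hT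
  have h2 : q ≤ T := (le_max_left _ _).trans ((le_max_right _ _).trans hT)
  have h3 : C * 2 ^ (n - 1) / η ≤ T := (le_max_right _ _).trans ((le_max_right _ _).trans hT)
  rw [div_le_iff₀ hη] at h3
  obtain ⟨k, rfl⟩ : ∃ k, n = k + 1 := ⟨n - 1, by omega⟩
  simp only [add_tsub_cancel_right] at *
  calc C * (T + q) ^ k ≤ C * (2 * T) ^ k := by gcongr; linarith
    _ = (C * 2 ^ k) * T ^ k := by rw [mul_pow]; ring
    _ ≤ (T * η) * T ^ k := by gcongr
    _ = η * T ^ (k + 1) := by ring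

/-- The nodes of the unscaled lattice in a set. -/
def nodesIn {N : ℕ} (A : Set (Eu N)) : Set (Fin N → ℤ) := {z | node 1 z ∈ A}

/-- The boundary condition of the cell problem on the cube of side length `T`. -/
def IsCompetitor {N : ℕ} (H : Matrix (Fin N) (Fin N) ℝ) (ν : Eu N)
    (b : OrthonormalBasis (Fin N) ℝ (Eu N)) (T : ℝ) (w : (Fin N → ℤ) → Eu N) : Prop :=
  ∀ z, node 1 z ∈ orientedCube b T →
      Metric.infDist (node 1 z) (frontier (orientedCube b T)) ≤ maxBond N →
      w z = fold H ν (node 1 z)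

/-! ### Moving a competitor to another centre -/

section Tile

variable {n : ℕ} {H : Matrix (Fin (n + 1)) (Fin (n + 1)) ℝ} {ν : Eu (n + 1)}
  {b : OrthonormalBasis (Fin (n + 1)) ℝ (Eu (n + 1))} {p : ℝ}

/-- For a number of bonds proportional to the area, each wrong by `2 * (A * δ)`, the total error per
area is small once `δ` is. -/
lemma exists_small_rpow {p : ℝ} (hp : 1 < p) (A C : ℝ) {η : ℝ} (hη : 0 < η) :
    ∃ δ : ℝ, 0 < δ ∧ δ ≤ 1 ∧ C * (2 * (A * δ)) ^ p ≤ η := by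
  have hc : Tendsto (fun δ : ℝ => C * (2 * (A * δ)) ^ p) (𝓝[>] 0) (𝓝 0) := by
    have : ContinuousAt (fun δ : ℝ => C * (2 * (A * δ)) ^ p) 0 := by
      refine ContinuousAt.mul continuousAt_const (ContinuousAt.rpow_const (by fun_prop) ?_)
      right; linarith
    have h := this.tendsto
    simp only [mul_zero, Real.zero_rpow (by linarith : p ≠ 0)] at h
    exact h.mono_left nhdsWithin_le_nhds
  have h1 := (hc.eventually (ge_mem_nhds hη)).and
    ((eventually_nhdsWithin_of_forall fun x hx => hx : ∀ᶠ δ : ℝ in 𝓝[>] 0, 0 < δ).and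
      (Filter.Eventually.filter_mono nhdsWithin_le_nhds (ge_mem_nhds zero_lt_one)))
  obtain ⟨δ, h2, h3, h4⟩ := h1.exists
  exact ⟨δ, h3, h4, h2⟩

/-- A competitor for the cell problem, moved into a slightly larger cube with an arbitrary centre
on the hyperplane, and matched there with the fold. -/
lemma exists_shifted_competitor (hn : 1 ≤ n) (hp : 1 < p) (hH : 0 < H.det) (hν : ‖ν‖ = 1)
    (hb : b 0 = ν) {η : ℝ} (hη : 0 < η) :
    ∃ L : ℝ, 0 ≤ L ∧ ∃ T₁ : ℝ, 1 ≤ T₁ ∧ ∀ T, T₁ ≤ T → ∀ w₀, IsCompetitor H ν b T w₀ →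
      ∃ C : ℝ, ∀ t : Eu (n + 1), inner ℝ t ν = 0 → ∃ W : (Fin (n + 1) → ℤ) → Eu (n + 1),
        (∀ z, node 1 z ∉ cubeAt b t (T + 2 * L - 2 * maxBond (n + 1)) →
          W z = fold H ν (node 1 z)) ∧
        (∀ z, ‖W z - fold H ν (node 1 z)‖ ≤ C) ∧
        latEnergy H p (nodesIn (cubeAt b t (T + 2 * L))) W ≤
          latEnergy H p (nodesIn (orientedCube b T)) w₀ + ENNReal.ofReal (η * T ^ n) := by
  classical
  set r := maxBond (n + 1) with hr
  have hr0 : 0 ≤ r := maxBond_nonneg _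
  set m : ℝ := ((Fintype.card (bonds (n + 1)) : ℕ) : ℝ) with hm
  set a := ‖twinVec H ν‖ with ha
  have ha0 : 0 ≤ a := norm_nonneg _
  -- The third argument counts, per area and after multiplication by the number of bond types, the
  -- nodes near all faces of a tile. Each such bond that does not cross the fold plane is wrong by
  -- at most `2 * (a * δ)`, and together they get half of the error `η`.
  obtain ⟨δ, hδ, hδ1, hδη⟩ := exists_small_rpow hp a
    (m * (2 * (n + 1) * ((2 * r + 2 * (n + 1)) * 2 ^ n))) (half_pos hη)
  obtain ⟨L₀, hL₀, hτ⟩ := exists_node_near_hyperplane hν hδ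
  -- The additional `r` leaves a margin of one bond length around the moved tile, on which the
  -- deformation is the plain fold.
  set L := L₀ + r with hL
  -- The cost of a bond that crosses the fold plane: `a * r` for the fold itself, and `a * δ` for
  -- each displaced end. For other bonds only the second contribution remains, which is `ct`.
  set cm : ℝ := (a * r + 2 * (a * δ)) ^ p with hcm
  have hcm0 : 0 ≤ cm := Real.rpow_nonneg (by positivity) _
  set ct : ℝ := (2 * (a * δ)) ^ p with hct
  have hct0 : 0 ≤ ct := Real.rpow_nonneg (by positivity) _
  obtain ⟨T₂, hT₂, hT₂'⟩ := exists_mul_add_pow_le hn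
    (C := m * (cm * (2 * (n + 1) * ((2 * (r + δ) + 2 * (n + 1)) * (2 * L + r + 2 * (n + 1))))))
    (q := 4 * L + 2 * (n + 1)) (η := η / 2) (by positivity) (by positivity) (half_pos hη)
  refine ⟨L, by positivity, max T₂ (4 * r + 2 * (n + 1) + 4), hT₂.trans (le_max_left _ _),
    fun T hT w₀ hw₀ => ?_⟩
  have hTT₂ : T₂ ≤ T := (le_max_left _ _).trans hT
  have hTr : 4 * r + 2 * (n + 1) + 4 ≤ T := (le_max_right _ _).trans hT
  have hT0 : 0 < T := by linarith [hT₂.trans hTT₂]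
  obtain ⟨C₀, hC₀⟩ := ((finite_nodes_of_isBounded (isBounded_cubeAt b 0 T)).image
    (fun z => ‖w₀ z - fold H ν (node 1 z)‖)).bddAbove
  refine ⟨max C₀ 0 + a * δ, fun t ht => ?_⟩
  obtain ⟨τ, hτt, hτδ⟩ := hτ t ht
  -- The competitor is translated by the lattice vector `τ` near `t`, not by `t`, so that its energy
  -- is preserved exactly; `H τ` is added to match the fold outside.
  let W : (Fin (n + 1) → ℤ) → Eu (n + 1) := fun z =>
    if node 1 z ∈ cubeAt b (node 1 τ) T then w₀ (z - τ) + lin H (node 1 τ)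
    else fold H ν (node 1 z)
  have hmove : ∀ z, node 1 z ∈ cubeAt b (node 1 τ) T ↔ node 1 (z - τ) ∈ orientedCube b T := by
    intro z; simp [cubeAt, orientedCube, node_sub]
  have hshift : ∀ z, ‖fold H ν (node 1 (z - τ)) + lin H (node 1 τ) - fold H ν (node 1 z)‖ ≤
      a * δ := by
    intro z
    rw [node_sub]
    exact (norm_fold_translate_le hH _ _).trans (by gcongr)
  have hsub : ∀ z, node 1 z ∈ cubeAt b (node 1 τ) T → node 1 z ∈ cubeAt b t (T + 2 * L₀) := by
    intro z hz l
    have h1 := hz l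
    have h2 := abs_inner_basis_le b (node 1 τ - t) l
    have e : inner ℝ (node 1 z - t) (b l) = inner ℝ (node 1 z - node 1 τ) (b l) +
        inner ℝ (node 1 τ - t) (b l) := by rw [← inner_add_left]; congr 1; abel
    rw [e]
    linarith [abs_add_le (inner ℝ (node 1 z - node 1 τ) (b l)) (inner ℝ (node 1 τ - t) (b l))]
  have hW1 : ∀ z, node 1 z ∉ cubeAt b (node 1 τ) T → W z = fold H ν (node 1 z) :=
    fun z hz => if_neg hz
  refine ⟨W, ?_, ?_, ?_⟩
  · intro z hz
    refine hW1 z fun h => hz ?_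
    have : T + 2 * L - 2 * r = T + 2 * L₀ := by rw [hL]; ring
    rw [this]; exact hsub z h
  · intro z
    by_cases hz : node 1 z ∈ cubeAt b (node 1 τ) T
    · simp only [W, if_pos hz]
      have h1 : ‖w₀ (z - τ) - fold H ν (node 1 (z - τ))‖ ≤ C₀ := by
        refine hC₀ (mem_image_of_mem (fun z => ‖w₀ z - fold H ν (node 1 z)‖) ?_)
        have := (hmove z).1 hz
        rwa [orientedCube_eq] at this
      have e : w₀ (z - τ) + lin H (node 1 τ) - fold H ν (node 1 z) =
        (w₀ (z - τ) - fold H ν (node 1 (z - τ))) + (fold H ν (node 1 (z - τ)) + lin H (node 1 τ)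
          - fold H ν (node 1 z)) := by abel
      rw [e]
      exact (norm_add_le _ _).trans (add_le_add (h1.trans (le_max_left _ _)) (hshift z))
    · rw [hW1 z hz, sub_self, norm_zero]; positivity
  -- the energy
  have htile : latEnergy H p (nodesIn (cubeAt b (node 1 τ) T)) W =
      latEnergy H p (nodesIn (orientedCube b T)) w₀ := by
    rw [← latEnergy_move (one_mem (Matrix.orthogonalGroup (Fin (n + 1)) ℝ)) w₀ (lin H (node 1 τ)) τ]
    have e : nodesIn (cubeAt b (node 1 τ) T) = {z | z - τ ∈ nodesIn (orientedCube b T)} := by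
      ext z; exact hmove z
    rw [e]
    refine latEnergy_congr fun z hz => ?_
    have : node 1 z ∈ cubeAt b (node 1 τ) T := (hmove z).2 hz
    simp only [W, if_pos this]
    simp
  -- near the boundary of the tile, and outside, `W` is close to the fold
  have hnear : ∀ z z', ‖node 1 z' - node 1 z‖ ≤ r → node 1 z' ∉ cubeAt b (node 1 τ) T →
      ‖W z - fold H ν (node 1 z)‖ ≤ a * δ := by
    intro z z' hzz hz'
    by_cases hz : node 1 z ∈ cubeAt b (node 1 τ) T
    · simp only [W, if_pos hz]
      rw [hw₀ (z - τ) ((hmove z).1 hz) ?_]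
      · exact hshift z
      · refine (infDist_frontier_le ((hmove z).1 hz) (mt (hmove z').2 hz')).trans ?_
        rw [dist_comm, dist_eq_norm, node_sub, node_sub, sub_sub_sub_cancel_right]
        exact hzz
    · rw [hW1 z hz, sub_self, norm_zero]; positivity
  -- Bonds not inside the tile are of two kinds. Those that cross the fold plane are expensive, but
  -- they start in a plate near its lateral faces (`true`). Those that keep their length under the
  -- fold but touch the tile start near any of the faces, and are cheap (`false`).
  let A : Bool → Set (Fin (n + 1) → ℤ) := fun i => if i then
      {z | |inner ℝ (node 1 z - node 1 τ) (b 0)| ≤ r + δ ∧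
        (∀ m, |inner ℝ (node 1 z - node 1 τ) (b m)| ≤ T / 2 + 2 * L) ∧
        ∃ l, l ≠ 0 ∧ T / 2 + 2 * L - (2 * L + r) ≤ |inner ℝ (node 1 z - node 1 τ) (b l)|}
    else {z | (∀ m, |inner ℝ (node 1 z - node 1 τ) (b m)| ≤ T / 2 + r) ∧
        ∃ l, T / 2 + r - 2 * r ≤ |inner ℝ (node 1 z - node 1 τ) (b l)|}
  have hmain := latEnergy_le_sum (H := H) (p := p) (w := W)
    (L := nodesIn (cubeAt b t (T + 2 * L))) (K := ({()} : Finset Unit))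
    (C := fun _ => nodesIn (cubeAt b (node 1 τ) T)) Finset.univ A
    (fun i => if i then ENNReal.ofReal cm else ENNReal.ofReal ct) ?_
  · refine hmain.trans ?_
    rw [Finset.sum_singleton, htile]
    gcongr
    rw [Fintype.sum_bool]
    simp only [A, if_true, Bool.false_eq_true, if_false]
    have c1 := count_plateShell_le b (node 1 τ) (k := r + δ) (D := T / 2 + 2 * L) (h := 2 * L + r)
      (by positivity) (by positivity) (by positivity)
    have c2 := count_shell_le b (node 1 τ) (D := T / 2 + r) (h := 2 * r)
      (by positivity) (by positivity)
    have hmm : (Fintype.card (bonds (n + 1)) : ℝ≥0∞) = ENNReal.ofReal m := by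
      rw [hm, ENNReal.ofReal_natCast]
    refine (mul_le_mul_right (add_le_add (mul_le_mul_right c1 _) (mul_le_mul_right c2 _)) _).trans ?_
    rw [hmm, ← ENNReal.ofReal_mul hcm0, ← ENNReal.ofReal_mul hct0, ← ENNReal.ofReal_add
      (by positivity) (by positivity), ← ENNReal.ofReal_mul (by positivity)]
    refine ENNReal.ofReal_le_ofReal ?_
    have e1 := hT₂' T hTT₂
    have e2 : (2 * (T / 2 + r) + 2 * (n + 1)) ^ n ≤ 2 ^ n * T ^ n := by
      rw [← mul_pow]; gcongr; linarith
    have e3 : 2 * (T / 2 + 2 * L) + 2 * ((n : ℝ) + 1) = T + (4 * L + 2 * (n + 1)) := by ring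
    rw [e3]
    have e4 : m * (ct * (2 * (n + 1) * ((2 * r + 2 * (n + 1)) *
        (2 * (T / 2 + r) + 2 * (n + 1)) ^ n))) ≤ η / 2 * T ^ n := by
      calc _ ≤ m * (ct * (2 * (n + 1) * ((2 * r + 2 * (n + 1)) * (2 ^ n * T ^ n)))) := by gcongr
        _ = (m * (2 * (n + 1) * ((2 * r + 2 * (n + 1)) * 2 ^ n)) * ct) * T ^ n := by ring
        _ ≤ _ := by gcongr
    calc _ = m * (cm * (2 * (n + 1) * ((2 * (r + δ) + 2 * (n + 1)) * (2 * L + r + 2 * (n + 1))))) *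
          (T + (4 * L + 2 * (n + 1))) ^ (n - 1) + m * (ct * (2 * (n + 1) *
          ((2 * r + 2 * (n + 1)) * (2 * (T / 2 + r) + 2 * (n + 1)) ^ n))) := by ring
      _ ≤ η / 2 * T ^ n + η / 2 * T ^ n := add_le_add e1 e4
      _ = η * T ^ n := by ring
  · intro ξ hξ z hz hzξ
    have hξr : ‖node 1 (z + ξ) - node 1 z‖ ≤ r := by
      rw [node_add, add_sub_cancel_left]; exact norm_node_le_maxBond hξ
    have hξe : node 1 (z + ξ) - node 1 z = node 1 ξ := by rw [node_add, add_sub_cancel_left]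
    by_cases hin : node 1 z ∈ cubeAt b (node 1 τ) T ∧ node 1 (z + ξ) ∈ cubeAt b (node 1 τ) T
    · exact Or.inl ⟨(), by simp, hin⟩
    right
    have hd1 : ‖W z - fold H ν (node 1 z)‖ ≤ a * δ := by
      by_cases h1 : node 1 z ∈ cubeAt b (node 1 τ) T
      · exact hnear z (z + ξ) hξr fun h2 => hin ⟨h1, h2⟩
      · rw [hW1 z h1, sub_self, norm_zero]; positivity
    have hd2 : ‖W (z + ξ) - fold H ν (node 1 (z + ξ))‖ ≤ a * δ := by
      by_cases h1 : node 1 (z + ξ) ∈ cubeAt b (node 1 τ) T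
      · exact hnear (z + ξ) z (by rw [norm_sub_rev]; exact hξr) fun h2 => hin ⟨h2, h1⟩
      · rw [hW1 _ h1, sub_self, norm_zero]; positivity
    have hout : ∃ l, T / 2 - r ≤ |inner ℝ (node 1 z - node 1 τ) (b l)| := by
      by_contra hcon
      push Not at hcon
      have h1 : node 1 z ∈ cubeAt b (node 1 τ) (T - 2 * r) := fun l => by linarith [hcon l]
      exact hin ⟨fun l => by linarith [h1 l], mem_cubeAt_of_norm_le h1 hξr⟩
    rcases norm_fold_sub_or_crossing hH hν (node 1 z) (node 1 (z + ξ)) with heq | ⟨ζ, hζ, hζ1, hζ2⟩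
    · by_cases htouch : node 1 z ∈ cubeAt b (node 1 τ) T ∨ node 1 (z + ξ) ∈ cubeAt b (node 1 τ) T
      · right
        refine ⟨false, Finset.mem_univ _, ?_, ?_⟩
        · simp only [A, Bool.false_eq_true, if_false]
          refine ⟨fun m => ?_, ?_⟩
          · rcases htouch with h | h
            · linarith [h m]
            · have := abs_inner_sub_le b (node 1 (z + ξ)) (node 1 z) (node 1 τ) m
              rw [norm_sub_rev] at this
              linarith [h m]
          · obtain ⟨l, hl⟩ := hout
            exact ⟨l, by linarith⟩
        · simp only [Bool.false_eq_true, if_false]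
          refine bondCost_le (by linarith) ?_
          have := abs_norm_sub_le_of_near hd1 hd2 (c := ‖lin H (node 1 ξ)‖) (e := 0)
            (by rw [heq, hξe, sub_self, abs_zero])
          simpa using this
      · left
        push Not at htouch
        refine bondCost_eq_zero (by linarith) ?_
        rw [hW1 _ htouch.1, hW1 _ htouch.2, heq, hξe]
    · right
      refine ⟨true, Finset.mem_univ _, ?_, ?_⟩
      · have hz0 : |inner ℝ (node 1 z - node 1 τ) (b 0)| ≤ r + δ := by
          have e : inner ℝ (node 1 z - node 1 τ) (b 0) =
              inner ℝ (node 1 z - ζ) (b 0) - inner ℝ (node 1 τ) (b 0) := by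
            rw [inner_sub_left, inner_sub_left, hb, hζ]; ring
          have h1 := abs_inner_basis_le b (node 1 z - ζ) 0
          rw [e]
          refine (abs_sub _ _).trans ?_
          rw [hb] at *
          linarith
        simp only [A, if_true]
        refine ⟨hz0, fun m => ?_, ?_⟩
        · have h1 := hz m
          have h2 := abs_inner_basis_le b (t - node 1 τ) m
          rw [norm_sub_rev] at h2
          have e : inner ℝ (node 1 z - node 1 τ) (b m) = inner ℝ (node 1 z - t) (b m) +
            inner ℝ (t - node 1 τ) (b m) := by rw [← inner_add_left]; congr 1; abel
          rw [e]
          linarith [abs_add_le (inner ℝ (node 1 z - t) (b m)) (inner ℝ (t - node 1 τ) (b m))]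
        · obtain ⟨l, hl⟩ := hout
          refine ⟨l, ?_, by linarith⟩
          -- The height is at most `r + δ ≤ r + 1`, which is less than `T / 2 - r`. The face in
          -- question is therefore a lateral one.
          rintro rfl
          have : (0 : ℝ) ≤ n := Nat.cast_nonneg n
          linarith
      · simp only [if_true]
        refine bondCost_le (by linarith) (abs_norm_sub_le_of_near hd1 hd2 ?_)
        have := abs_norm_fold_sub_le hH hν (node 1 z) (node 1 (z + ξ))
        rw [hξe] at this hξr
        rw [hξe.symm] at hξr
        rw [← hξe] at this ⊢
        refine this.trans ?_
        gcongr

end Tile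

/-! ### Grids on a hyperplane and the limit of the cell problems -/

section Grid

variable {n : ℕ} (b : OrthonormalBasis (Fin (n + 1)) ℝ (Eu (n + 1)))

/-- The points of a square grid of mesh size `S` on the hyperplane orthogonal to `b 0`. -/
def gridPoint (S : ℝ) (κ : Fin n → ℤ) : Eu (n + 1) := ∑ l, (S * κ l) • b l.succ

lemma inner_basis (l m : Fin (n + 1)) : inner ℝ (b l) (b m) = if l = m then (1 : ℝ) else 0 :=
  orthonormal_iff_ite.1 b.orthonormal l m

@[simp] lemma inner_gridPoint_zero (S : ℝ) (κ : Fin n → ℤ) :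
    inner ℝ (gridPoint b S κ) (b 0) = 0 := by
  simp [gridPoint, sum_inner, inner_smul_left]

@[simp] lemma inner_gridPoint_succ (S : ℝ) (κ : Fin n → ℤ) (l : Fin n) :
    inner ℝ (gridPoint b S κ) (b l.succ) = S * κ l := by
  simp [gridPoint, sum_inner, inner_smul_left, inner_basis]

lemma exists_gridPoint_near {S : ℝ} (hS : 0 < S) {ζ : Eu (n + 1)} (hζ : inner ℝ ζ (b 0) = 0) :
    ∃ κ, ∀ m, |inner ℝ (ζ - gridPoint b S κ) (b m)| ≤ S / 2 := by
  refine ⟨fun l => round (inner ℝ ζ (b l.succ) / S), fun m => ?_⟩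
  refine Fin.cases ?_ (fun l => ?_) m
  · rw [inner_sub_left, hζ, inner_gridPoint_zero]; simp; positivity
  · rw [inner_sub_left, inner_gridPoint_succ]
    have h := abs_sub_round (inner ℝ ζ (b l.succ) / S)
    have e : inner ℝ ζ (b l.succ) - S * (round (inner ℝ ζ (b l.succ) / S) : ℝ) =
        S * (inner ℝ ζ (b l.succ) / S - round (inner ℝ ζ (b l.succ) / S)) := by
      field_simp
    rw [e, abs_mul, abs_of_pos hS]
    nlinarith

lemma disjoint_cubeAt_gridPoint {S : ℝ} (hS : 0 < S) (t : Eu (n + 1)) {κ κ' : Fin n → ℤ}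
    {x : Eu (n + 1)} (h : x ∈ cubeAt b (t + gridPoint b S κ) S)
    (h' : x ∈ cubeAt b (t + gridPoint b S κ') S) : κ = κ' := by
  ext l
  have h1 := abs_lt.1 (h l.succ)
  have h2 := abs_lt.1 (h' l.succ)
  rw [← sub_sub, inner_sub_left, inner_gridPoint_succ] at h1 h2
  have h3 : S * |(κ l : ℝ) - κ' l| < S * 1 := by
    rw [← abs_of_pos hS, ← abs_mul, abs_of_pos hS, abs_lt]
    constructor <;> nlinarith
  have h4 := lt_of_mul_lt_mul_left h3 hS.le
  have h5 : |κ l - κ' l| < 1 := by exact_mod_cast h4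
  have := Int.abs_lt_one_iff.1 h5
  omega

lemma finite_gridPoint {S : ℝ} (hS : 0 < S) {A : Set (Eu (n + 1))} (hA : Bornology.IsBounded A) :
    {κ | gridPoint b S κ ∈ A}.Finite := by
  obtain ⟨R, hR⟩ := hA.exists_norm_le
  refine (Set.finite_Icc (fun _ : Fin n => -⌈R / S⌉) (fun _ => ⌈R / S⌉)).subset fun κ hκ => ?_
  have h : ∀ l, |(κ l : ℝ)| ≤ ⌈R / S⌉ := fun l => by
    have h1 := (abs_inner_basis_le b (gridPoint b S κ) l.succ).trans (hR _ hκ)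
    rw [inner_gridPoint_succ, abs_mul, abs_of_pos hS] at h1
    exact le_trans ((le_div_iff₀' hS).2 h1) (Int.le_ceil _)
  refine ⟨fun i => ?_, fun i => ?_⟩
  · have := (abs_le.1 (h i)).1; exact_mod_cast this
  · have := (abs_le.1 (h i)).2; exact_mod_cast this

/-- The tiles are thickened to height one in the direction of the common normal and compared in
volume with the slab of the large cube. The bound `1 ≤ S` ensures that the thickened tiles stay
inside the tiles to which `hK` applies. -/
lemma card_mul_pow_le {S S' : ℝ} (hS : 1 ≤ S) (hS' : 0 ≤ S')
    (b' : OrthonormalBasis (Fin (n + 1)) ℝ (Eu (n + 1))) (hbb : b' 0 = b 0)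
    (K : Finset (Fin n → ℤ))
    (hK : ∀ κ ∈ K, ∀ x, (∀ l, |inner ℝ (x - gridPoint b' S κ) (b' l)| ≤ S / 2) →
      ∀ l, |inner ℝ x (b l)| ≤ S' / 2) : (K.card : ℝ) * S ^ n ≤ S' ^ n := by
  let B : (Fin n → ℤ) → Set (Eu (n + 1)) := fun κ => {x | ∀ l, inner ℝ x (b' l) ∈
    Ico (inner ℝ (gridPoint b' S κ) (b' l) + if l = 0 then (-1 / 2) else (-S / 2))
      (inner ℝ (gridPoint b' S κ) (b' l) + if l = 0 then (1 / 2) else (S / 2))}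
  have hvol : ∀ κ, volume (B κ) = ENNReal.ofReal (S ^ n) := by
    intro κ
    rw [volume_boxIco, Fin.prod_univ_succ]
    have : ∀ l : Fin n, inner ℝ (gridPoint b' S κ) (b' l.succ) +
        (if l.succ = 0 then (1 / 2 : ℝ) else (S / 2)) - (inner ℝ (gridPoint b' S κ) (b' l.succ) +
          if l.succ = 0 then (-1 / 2) else (-S / 2)) = S := by
      intro l; simp [Fin.succ_ne_zero]; ring
    simp only [this]
    simp only [if_true, Finset.prod_const, Finset.card_univ, Fintype.card_fin]
    rw [← ENNReal.ofReal_pow (by linarith)]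
    norm_num
  have hB : ∀ κ x, x ∈ B κ → ∀ l, |inner ℝ (x - gridPoint b' S κ) (b' l)| ≤
      if l = 0 then 1 / 2 else S / 2 := by
    intro κ x hx l
    have := hx l
    rw [inner_sub_left, abs_le]
    split_ifs at * <;> constructor <;> linarith [this.1, this.2]
  have hdisj : (K : Set (Fin n → ℤ)).PairwiseDisjoint B := by
    intro κ _ κ' _ hne
    refine Set.disjoint_left.2 fun x hx hx' => hne ?_
    ext l
    have h1 := hx l.succ
    have h2 := hx' l.succ
    simp only [inner_gridPoint_succ, Fin.succ_ne_zero, if_false] at h1 h2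
    have hSp : 0 < S := by linarith
    have h3 : S * |(κ l : ℝ) - κ' l| < S * 1 := by
      rw [← abs_of_pos hSp, ← abs_mul, abs_of_pos hSp, abs_lt]
      constructor <;> nlinarith [h1.1, h1.2, h2.1, h2.2]
    have h4 := lt_of_mul_lt_mul_left h3 hSp.le
    have h5 : |κ l - κ' l| < 1 := by exact_mod_cast h4
    have := Int.abs_lt_one_iff.1 h5
    omega
  have hsub : (⋃ κ ∈ K, B κ) ⊆ {x | ∀ l, inner ℝ x (b l) ∈
      Icc (if l = 0 then (-1 / 2) else (-S' / 2)) (if l = 0 then (1 / 2) else (S' / 2))} := by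
    refine Set.iUnion₂_subset fun κ hκ x hx l => ?_
    have h1 := hK κ hκ x (fun l => (hB κ x hx l).trans (by split_ifs <;> linarith)) l
    by_cases hl : l = 0
    · subst hl
      have := hB κ x hx 0
      rw [inner_sub_left, inner_gridPoint_zero, sub_zero, hbb, if_pos rfl, abs_le] at this
      simp only [if_true]
      constructor <;> linarith [this.1, this.2]
    · rw [abs_le] at h1
      simp only [hl, if_false]
      constructor <;> linarith [h1.1, h1.2]
  have := measure_mono (μ := volume) hsub
  rw [measure_biUnion_finset hdisj fun κ _ => measurableSet_boxIco _ _ _] at this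
  simp only [hvol, Finset.sum_const, nsmul_eq_mul] at this
  rw [volume_box, Fin.prod_univ_succ] at this
  have e : ∀ l : Fin n, (if l.succ = 0 then (1 / 2 : ℝ) else (S' / 2)) -
      (if l.succ = 0 then (-1 / 2) else (-S' / 2)) = S' := by
    intro l; simp [Fin.succ_ne_zero]; ring
  simp only [e] at this
  simp only [if_true, Finset.prod_const, Finset.card_univ, Fintype.card_fin] at this
  rw [← ENNReal.ofReal_pow hS', ← ENNReal.ofReal_natCast, ← ENNReal.ofReal_mul (by positivity),
    ← ENNReal.ofReal_mul (by norm_num)] at this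
  have h2 := (ENNReal.ofReal_le_ofReal_iff (by positivity)).1 this
  norm_num at h2
  linarith

end Grid

/-- The cube is open, so a point of its frontier has some coordinate of size at least `S / 2`, and
the corresponding coordinate of `x` is smaller by more than `r`. -/
lemma maxBond_lt_infDist {N : ℕ} {b : OrthonormalBasis (Fin N) ℝ (Eu N)} {S r : ℝ} {x : Eu N}
    (hN : 0 < N) (hr : 0 ≤ r)
    (h : ∀ l, |inner ℝ x (b l)| < S / 2 - r) :
    r < Metric.infDist x (frontier (orientedCube b S)) := by
  have hopen : IsOpen (orientedCube b S) := by
    have : orientedCube b S = ⋂ l, {x | |inner ℝ x (b l)| < S / 2} := by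
      ext; simp [orientedCube]
    rw [this]
    exact isOpen_iInter_of_finite fun l => isOpen_lt (by fun_prop) continuous_const
  have hx : x ∈ orientedCube b S := fun l => by linarith [h l]
  have hne : (frontier (orientedCube b S)).Nonempty := by
    rw [nonempty_frontier_iff]
    refine ⟨⟨x, hx⟩, fun h' => ?_⟩
    have : (S / 2) • b ⟨0, hN⟩ ∈ orientedCube b S := by rw [h']; trivial
    have := this ⟨0, hN⟩
    rw [inner_smul_left] at this
    simp at this
    exact absurd this (not_lt.2 (le_abs_self _))
  obtain ⟨y, hy, hxy⟩ := isClosed_frontier.exists_infDist_eq_dist hne x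
  rw [hxy]
  have hy' : y ∉ orientedCube b S := fun h' => by
    have : y ∈ orientedCube b S ∩ frontier (orientedCube b S) := ⟨h', hy⟩
    rw [hopen.inter_frontier_eq] at this
    exact this
  simp only [orientedCube, mem_ofPred_eq, not_forall, not_lt] at hy'
  obtain ⟨l, hl⟩ := hy'
  have := abs_inner_sub_le b x y 0 l
  rw [sub_zero, sub_zero] at this
  rw [dist_comm, dist_eq_norm]
  linarith [h l]

lemma cellInf_eq {N : ℕ} {H : Matrix (Fin N) (Fin N) ℝ} {p : ℝ} {ν : Eu N}
    {b : OrthonormalBasis (Fin N) ℝ (Eu N)} {T : ℝ} :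
    cellInf H (twinReflection H ν * H) p ν b T =
      ⨅ (w : (Fin N → ℤ) → Eu N) (_ : IsCompetitor H ν b T w),
        latEnergy H p (nodesIn (orientedCube b T)) w := by
  simp only [cellInf, pairEnergy_one]
  rfl

/-! ### Tiling a large cube by small cells -/

section Limit

variable {n : ℕ} {H : Matrix (Fin (n + 1)) (Fin (n + 1)) ℝ} {ν : Eu (n + 1)}
  {b b' : OrthonormalBasis (Fin (n + 1)) ℝ (Eu (n + 1))} {p : ℝ}

set_option maxHeartbeats 800000 in
/-- The energy of the cell problem on a large cube is estimated by a grid of smaller cells. -/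
lemma cellInf_div_le (hn : 1 ≤ n) (hp : 1 < p) (hH : 0 < H.det) (hν : ‖ν‖ = 1)
    (hb : b 0 = ν) (hb' : b' 0 = ν) {η : ℝ} (hη : 0 < η) :
    ∃ T₁ : ℝ, 0 < T₁ ∧ ∀ T, T₁ ≤ T → ∃ S₁ : ℝ, 0 < S₁ ∧ ∀ S, S₁ ≤ S →
      cellInf H (twinReflection H ν * H) p ν b S / ENNReal.ofReal (S ^ n) ≤
        cellInf H (twinReflection H ν * H) p ν b' T / ENNReal.ofReal (T ^ n) +
          ENNReal.ofReal η := by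
  classical
  set r := maxBond (n + 1) with hr
  have hr0 : 0 ≤ r := maxBond_nonneg _
  set m : ℝ := ((Fintype.card (bonds (n + 1)) : ℕ) : ℝ) with hm
  set a := ‖twinVec H ν‖ with ha
  have ha0 : 0 ≤ a := norm_nonneg _
  set c : ℝ := (a * r) ^ p with hc
  have hc0 : 0 ≤ c := Real.rpow_nonneg (by positivity) _
  have hη3 : 0 < η / 3 := by positivity
  obtain ⟨L, hL, T₂, hT₂, hshift⟩ := exists_shifted_competitor hn hp hH hν hb' hη3
  obtain ⟨T₃, hT₃, hT₃'⟩ := exists_mul_add_pow_le hn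
    (C := m * (c * (2 * (n + 1) * ((2 * r + 2 * (n + 1)) * (2 * r + 2 * (n + 1))))))
    (q := 2 * r + 2 * (n + 1)) (by positivity) (by positivity) hη3
  refine ⟨max T₂ (max T₃ (4 * r + 2)), by positivity, fun T hT => ?_⟩
  have hTT₂ : T₂ ≤ T := (le_max_left _ _).trans hT
  have hTT₃ : T₃ ≤ T := (le_max_left _ _).trans ((le_max_right _ _).trans hT)
  have hTr : 4 * r + 2 ≤ T := (le_max_right _ _).trans ((le_max_right _ _).trans hT)
  have hT1 : 1 ≤ T := hT₂.trans hTT₂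
  -- The mesh of the grid: the moved competitors live on the enlarged cubes.
  set T' := T + 2 * L with hT'
  have hTT' : T ≤ T' := by linarith
  -- A node within `r` of a point of a tile has at most this distance from every other point of that
  -- tile. A discarded tile thus lies within `D' + r` of the faces of the large cube.
  set D' : ℝ := (n + 1) * T' + r with hD'
  obtain ⟨S₃, hS₃, hS₃'⟩ := exists_mul_add_pow_le hn
    (C := m * (c * (2 * (n + 1) * ((2 * r + 2 * (n + 1)) * (r + D' + 2 * (n + 1))))))
    (q := 2 * (n + 1)) (by positivity) (by positivity) hη3
  refine ⟨max S₃ (T' + 2 * r + 1), by positivity, fun S hS => ?_⟩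
  have hSS₃ : S₃ ≤ S := (le_max_left _ _).trans hS
  have hST : T' + 2 * r + 1 ≤ S := (le_max_right _ _).trans hS
  have hS0 : 0 < S := by linarith
  have hSn : 0 < S ^ n := by positivity
  have hTn : 0 < T ^ n := by positivity
  -- The error and the factor `T ^ n` are moved to the left, so that the infimum on the right can be
  -- replaced by a single competitor; afterwards they are moved back.
  rw [← tsub_le_iff_right, ENNReal.le_div_iff_mul_le (Or.inl (by simpa using hTn))
    (Or.inl ENNReal.ofReal_ne_top)]
  conv_rhs => rw [cellInf_eq]
  refine le_iInf₂ fun w₀ hw₀ => ?_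
  rw [← ENNReal.le_div_iff_mul_le (Or.inl (by simpa using hTn))
    (Or.inl ENNReal.ofReal_ne_top), tsub_le_iff_right]
  rcases eq_or_ne (latEnergy H p (nodesIn (orientedCube b' T)) w₀) ⊤ with htop | htop
  · rw [htop, ENNReal.top_div_of_ne_top ENNReal.ofReal_ne_top]; simp
  set e₀ := (latEnergy H p (nodesIn (orientedCube b' T)) w₀).toReal with he₀
  have he₀0 : 0 ≤ e₀ := ENNReal.toReal_nonneg
  have hE₀ : latEnergy H p (nodesIn (orientedCube b' T)) w₀ = ENNReal.ofReal e₀ :=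
    (ENNReal.ofReal_toReal htop).symm
  obtain ⟨C, hW⟩ := hshift T hTT₂ w₀ hw₀
  have hgrid0 : ∀ κ, inner ℝ (gridPoint b' T' κ) ν = 0 := fun κ => by
    rw [← hb']; exact inner_gridPoint_zero b' T' κ
  choose W hW1 hW2 hW3 using fun κ : Fin n → ℤ => hW (gridPoint b' T' κ) (hgrid0 κ)
  have hT'0 : 0 < T' := by linarith
  -- The tiles that lie in the large cube with a margin of one bond length, as required by its
  -- boundary condition.
  let P : (Fin n → ℤ) → Prop := fun κ => ∀ x,
    (∀ l, |inner ℝ (x - gridPoint b' T' κ) (b' l)| ≤ T' / 2) → ∀ l, |inner ℝ x (b l)| < S / 2 - r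
  have hPfin : {κ | P κ}.Finite := by
    refine (finite_gridPoint b' hT'0 (isBounded_cubeAt b 0 S)).subset fun κ hκ l => ?_
    have := hκ (gridPoint b' T' κ) (fun l => by simp; positivity) l
    rw [sub_zero]; linarith
  let K := hPfin.toFinset
  have hKP : ∀ κ, κ ∈ K ↔ P κ := fun κ => by simp [K]
  -- The corrections of different tiles have disjoint supports, so in each tile `w` is the
  -- competitor of that tile, and elsewhere the fold.
  let w : (Fin (n + 1) → ℤ) → Eu (n + 1) := fun z =>
    fold H ν (node 1 z) + ∑ κ ∈ K, (W κ z - fold H ν (node 1 z))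
  have hdisj : ∀ κ κ' x, x ∈ cubeAt b' (gridPoint b' T' κ) T' →
      x ∈ cubeAt b' (gridPoint b' T' κ') T' → κ = κ' := fun κ κ' x h h' =>
    disjoint_cubeAt_gridPoint b' hT'0 0 (by simpa using h) (by simpa using h')
  have hsm : ∀ κ x, x ∈ cubeAt b' (gridPoint b' T' κ) (T' - 2 * r) →
      x ∈ cubeAt b' (gridPoint b' T' κ) T' := fun κ x hx =>
    mem_cubeAt_of_norm_le hx (by simpa using hr0)
  have hw1 : ∀ κ ∈ K, ∀ z, node 1 z ∈ cubeAt b' (gridPoint b' T' κ) T' → w z = W κ z := by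
    intro κ hκ z hz
    simp only [w]
    rw [Finset.sum_eq_single_of_mem κ hκ]
    · abel
    · intro κ' _ hne
      rw [hW1 κ' z fun h => hne (hdisj κ' κ _ (hsm κ' _ h) hz), sub_self]
  have hw2 : ∀ z, (∀ κ ∈ K, node 1 z ∉ cubeAt b' (gridPoint b' T' κ) (T' - 2 * r)) →
      w z = fold H ν (node 1 z) := by
    intro z hz
    simp only [w]
    rw [Finset.sum_eq_zero, add_zero]
    intro κ hκ
    rw [hW1 κ z (hz κ hκ), sub_self]
  have hcomp : IsCompetitor H ν b S w := by
    intro z hz hd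
    refine hw2 z fun κ hκ h => ?_
    have := (hKP κ).1 hκ (node 1 z) fun l => ((hsm κ _ h) l).le
    exact absurd hd (not_le.2 (maxBond_lt_infDist (by omega) hr0 this))
  have hcell : cellInf H (twinReflection H ν * H) p ν b S ≤
      latEnergy H p (nodesIn (orientedCube b S)) w := by
    rw [cellInf_eq]; exact iInf₂_le w hcomp
  -- Only bonds that cross the fold plane outside the cells cost anything. They start near the
  -- lateral faces of a used tile (`some κ`), or near the lateral faces of the large cube, where
  -- tiles were discarded (`none`).
  let A : Option (Fin n → ℤ) → Set (Fin (n + 1) → ℤ) := fun i => match i with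
    | none => {z | |inner ℝ (node 1 z - 0) (b 0)| ≤ r ∧
        (∀ m, |inner ℝ (node 1 z - 0) (b m)| ≤ S / 2) ∧
        ∃ l, l ≠ 0 ∧ S / 2 - (r + D') ≤ |inner ℝ (node 1 z - 0) (b l)|}
    | some κ => {z | |inner ℝ (node 1 z - gridPoint b' T' κ) (b' 0)| ≤ r ∧
        (∀ m, |inner ℝ (node 1 z - gridPoint b' T' κ) (b' m)| ≤ T' / 2 + r) ∧
        ∃ l, l ≠ 0 ∧ T' / 2 + r - 2 * r ≤ |inner ℝ (node 1 z - gridPoint b' T' κ) (b' l)|}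
  have hmain := latEnergy_le_sum (H := H) (p := p) (w := w)
    (L := nodesIn (orientedCube b S)) K
    (fun κ => nodesIn (cubeAt b' (gridPoint b' T' κ) T')) (Finset.insertNone K) A
    (fun _ => ENNReal.ofReal c) ?_
  · obtain ⟨k, hk⟩ : ∃ k : ℝ, k = (K.card : ℝ) := ⟨_, rfl⟩
    have hk0 : 0 ≤ k := by rw [hk]; exact Nat.cast_nonneg _
    have hkT : k * T' ^ n ≤ S ^ n := by
      rw [hk]
      refine card_mul_pow_le b (by linarith) hS0.le b' (by rw [hb, hb']) K fun κ hκ x hx l => ?_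
      linarith [(hKP κ).1 hκ x hx l]
    have hX1 := hT₃' T' (hTT₃.trans hTT')
    have hX2 := hS₃' S hSS₃
    set X1 : ℝ := 2 * (n + 1) * ((2 * r + 2 * (n + 1)) * ((2 * r + 2 * (n + 1)) *
        (2 * (T' / 2 + r) + 2 * (n + 1)) ^ (n - 1))) with hX1d
    set X2 : ℝ := 2 * (n + 1) * ((2 * r + 2 * (n + 1)) * ((r + D' + 2 * (n + 1)) *
        (2 * (S / 2) + 2 * (n + 1)) ^ (n - 1))) with hX2d
    have hX10 : 0 ≤ X1 := by positivity
    have hX20 : 0 ≤ X2 := by positivity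
    have hE : latEnergy H p (nodesIn (orientedCube b S)) w ≤ ENNReal.ofReal
        (k * (e₀ + η / 3 * T ^ n) + m * (c * X2 + k * (c * X1))) := by
      refine hmain.trans ?_
      rw [ENNReal.ofReal_add (by positivity) (by positivity)]
      gcongr
      · calc _ ≤ ∑ κ ∈ K, ENNReal.ofReal (e₀ + η / 3 * T ^ n) := by
              refine Finset.sum_le_sum fun κ hκ => ?_
              rw [latEnergy_congr (L := nodesIn (cubeAt b' (gridPoint b' T' κ) T'))
                (fun z hz => hw1 κ hκ z hz), ENNReal.ofReal_add he₀0 (by positivity), ← hE₀]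
              exact hW3 κ
          _ = _ := by
              rw [Finset.sum_const, nsmul_eq_mul, ENNReal.ofReal_mul hk0, hk,
                ENNReal.ofReal_natCast]
      · have hmm : (Fintype.card (bonds (n + 1)) : ℝ≥0∞) = ENNReal.ofReal m := by
          rw [hm, ENNReal.ofReal_natCast]
        rw [hmm, ENNReal.ofReal_mul (by positivity)]
        gcongr
        rw [Finset.sum_insertNone, ENNReal.ofReal_add (by positivity) (by positivity),
          ENNReal.ofReal_mul hc0]
        gcongr
        · exact count_plateShell_le b 0 hr0 (by positivity) (by positivity)
        · calc _ ≤ ∑ κ ∈ K, ENNReal.ofReal (c * X1) := by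
                refine Finset.sum_le_sum fun κ _ => ?_
                rw [ENNReal.ofReal_mul hc0]
                gcongr
                exact count_plateShell_le b' _ hr0 (by positivity) (by positivity)
            _ = _ := by
                rw [Finset.sum_const, nsmul_eq_mul, ENNReal.ofReal_mul hk0, hk,
                  ENNReal.ofReal_natCast]
    refine (ENNReal.div_le_div_right (hcell.trans hE) _).trans ?_
    rw [hE₀, ← ENNReal.ofReal_div_of_pos hSn, ← ENNReal.ofReal_div_of_pos hTn,
      ← ENNReal.ofReal_add (by positivity) hη.le]
    refine ENNReal.ofReal_le_ofReal ?_
    rw [div_le_iff₀ hSn]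
    have f1 : m * (c * X1) ≤ η / 3 * T' ^ n := by
      refine le_trans (le_of_eq ?_) hX1
      rw [hX1d]; ring
    have f2 : m * (c * X2) ≤ η / 3 * S ^ n := by
      refine le_trans (le_of_eq ?_) hX2
      rw [hX2d]; ring
    have hpow : T ^ n ≤ T' ^ n := by gcongr
    have f3 : k * T ^ n ≤ S ^ n := (mul_le_mul_of_nonneg_left hpow hk0).trans hkT
    have f4 : k * e₀ ≤ e₀ / T ^ n * S ^ n := by
      calc k * e₀ = e₀ / T ^ n * (k * T ^ n) := by field_simp
        _ ≤ _ := by gcongr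
    have f5 : k * (m * (c * X1)) ≤ k * (η / 3 * T' ^ n) := mul_le_mul_of_nonneg_left f1 hk0
    have f6 := mul_le_mul_of_nonneg_left hkT hη3.le
    have f7 := mul_le_mul_of_nonneg_left f3 hη3.le
    calc _ = k * e₀ + η / 3 * (k * T ^ n) + m * (c * X2) + k * (m * (c * X1)) := by ring
      _ ≤ e₀ / T ^ n * S ^ n + η / 3 * S ^ n + η / 3 * S ^ n + η / 3 * (k * T' ^ n) := by
        refine add_le_add (add_le_add (add_le_add f4 f7) f2) (f5.trans_eq (by ring))
      _ ≤ e₀ / T ^ n * S ^ n + η / 3 * S ^ n + η / 3 * S ^ n + η / 3 * S ^ n := by gcongr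
      _ = _ := by ring
  · intro ξ hξ z hz hzξ
    have hξe : node 1 (z + ξ) - node 1 z = node 1 ξ := by rw [node_add, add_sub_cancel_left]
    have hξr : ‖node 1 (z + ξ) - node 1 z‖ ≤ r := by rw [hξe]; exact norm_node_le_maxBond hξ
    by_cases hin : ∃ κ ∈ K, node 1 z ∈ cubeAt b' (gridPoint b' T' κ) T' ∧
        node 1 (z + ξ) ∈ cubeAt b' (gridPoint b' T' κ) T'
    · exact Or.inl hin
    right
    push Not at hin
    have hz1 : w z = fold H ν (node 1 z) := hw2 z fun κ hκ h =>
      hin κ hκ (hsm κ _ h) (mem_cubeAt_of_norm_le h hξr)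
    have hz2 : w (z + ξ) = fold H ν (node 1 (z + ξ)) := hw2 _ fun κ hκ h =>
      hin κ hκ (mem_cubeAt_of_norm_le h (by rw [norm_sub_rev]; exact hξr)) (hsm κ _ h)
    rcases norm_fold_sub_or_crossing hH hν (node 1 z) (node 1 (z + ξ)) with heq | ⟨ζ, hζ, hζ1, hζ2⟩
    · left
      refine bondCost_eq_zero (by linarith) ?_
      rw [hz1, hz2, heq, hξe]
    · right
      have hcost : bondCost H p w ξ z ≤ ENNReal.ofReal c := by
        refine bondCost_le (by linarith) ?_
        rw [hz1, hz2, ← hξe]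
        exact (abs_norm_fold_sub_le hH hν _ _).trans (by gcongr)
      obtain ⟨κ, hκ⟩ := exists_gridPoint_near b' hT'0 (ζ := ζ) (by rw [hb', hζ])
      have hz0 : |inner ℝ (node 1 z) ν| ≤ r := by
        have h1 := abs_inner_basis_le b (node 1 z - ζ) 0
        rw [hb, inner_sub_left, hζ, sub_zero] at h1
        linarith
      by_cases hκK : κ ∈ K
      · refine ⟨some κ, by simpa using hκK, ⟨?_, fun l => ?_, ?_⟩, hcost⟩
        · rw [inner_sub_left, inner_gridPoint_zero, sub_zero, hb']; exact hz0
        · have := abs_inner_sub_le b' ζ (node 1 z) (gridPoint b' T' κ) l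
          linarith [hκ l]
        · obtain ⟨l, hl⟩ : ∃ l, T' / 2 - r ≤ |inner ℝ (node 1 z - gridPoint b' T' κ) (b' l)| := by
            by_contra hcon
            push Not at hcon
            have h1 : node 1 z ∈ cubeAt b' (gridPoint b' T' κ) (T' - 2 * r) :=
              fun l => by linarith [hcon l]
            exact hin κ hκK (hsm κ _ h1) (mem_cubeAt_of_norm_le h1 hξr)
          by_cases hl0 : l = 0
          · exfalso
            subst hl0
            rw [inner_sub_left, inner_gridPoint_zero, sub_zero, hb'] at hl
            linarith
          · exact ⟨l, hl0, by linarith⟩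
      · refine ⟨none, by simp, ⟨?_, fun l => ?_, ?_⟩, hcost⟩
        · rw [sub_zero, hb]; exact hz0
        · rw [sub_zero]; exact (hz l).le
        -- The tile contains a point `x` that violates the margin in some direction, and the node is
        -- within `D'` of `x`. Hence the node is close to the same face of the large cube.
        · rw [hKP] at hκK
          simp only [P] at hκK
          push Not at hκK
          obtain ⟨x, hx, l, hl⟩ := hκK
          have hxζ : ‖x - ζ‖ ≤ (n + 1) * T' := by
            have := norm_le_of_abs_inner_le b' (x := x - ζ) (D := T') fun l => by
              have e : inner ℝ (x - ζ) (b' l) = inner ℝ (x - gridPoint b' T' κ) (b' l) -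
                inner ℝ (ζ - gridPoint b' T' κ) (b' l) := by
                rw [← inner_sub_left]; congr 1; abel
              rw [e]
              exact (abs_sub _ _).trans (by linarith [hx l, hκ l])
            push_cast at this; exact this
          have hxz : ‖x - node 1 z‖ ≤ D' := by
            have e : x - node 1 z = (x - ζ) - (node 1 z - ζ) := by abel
            rw [e, hD']
            exact (norm_sub_le _ _).trans (by linarith)
          refine ⟨l, ?_, ?_⟩
          · rintro rfl
            have := hx 0
            rw [inner_sub_left, inner_gridPoint_zero, sub_zero, hb'] at this
            rw [hb] at hl
            linarith
          · have := abs_inner_sub_le b (node 1 z) x 0 l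
            rw [sub_zero] at this
            linarith

end Limit

lemma latEnergy_ne_top {N : ℕ} {H : Matrix (Fin N) (Fin N) ℝ} {p : ℝ} {L : Set (Fin N → ℤ)}
    (hL : L.Finite) (w : (Fin N → ℤ) → Eu N) : latEnergy H p L w ≠ ⊤ := by
  classical
  unfold latEnergy
  refine ENNReal.sum_ne_top.2 fun ξ _ => ?_
  rw [tsum_eq_sum (s := hL.toFinset) fun z hz => ?_]
  · refine ENNReal.sum_ne_top.2 fun z _ => ?_
    rw [indicator]
    split_ifs <;> simp [bondCost]
  · rw [indicator_of_notMem]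
    rintro ⟨h, -⟩
    simp [h] at hz

lemma finite_nodesIn_orientedCube {N : ℕ} (b : OrthonormalBasis (Fin N) ℝ (Eu N)) (T : ℝ) :
    (nodesIn (orientedCube b T)).Finite := by
  rw [orientedCube_eq]
  exact finite_nodes_of_isBounded (isBounded_cubeAt b 0 T)

lemma cellInf_ne_top {N : ℕ} {H : Matrix (Fin N) (Fin N) ℝ} {p : ℝ} {ν : Eu N}
    (b : OrthonormalBasis (Fin N) ℝ (Eu N)) (T : ℝ) :
    cellInf H (twinReflection H ν * H) p ν b T ≠ ⊤ := by
  rw [cellInf_eq]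
  refine ne_top_of_le_ne_top ?_ (iInf₂_le (fun z => fold H ν (node 1 z)) fun z _ _ => rfl)
  exact latEnergy_ne_top (finite_nodesIn_orientedCube b T) _

/-! ### The surface energy density and its optimal cells -/

section Density

variable {n : ℕ} {H : Matrix (Fin (n + 1)) (Fin (n + 1)) ℝ} {ν : Eu (n + 1)} {p : ℝ}

/-- The surface energy density: the limit of the cell problems. -/
lemma exists_cell_limit (hn : 1 ≤ n) (hp : 1 < p) (hH : 0 < H.det) (hν : ‖ν‖ = 1) :
    ∃ g : ℝ≥0, ∀ b : OrthonormalBasis (Fin (n + 1)) ℝ (Eu (n + 1)), b 0 = ν →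
      Tendsto (fun T : ℝ => cellInf H (twinReflection H ν * H) p ν b T /
        ENNReal.ofReal (T ^ n)) atTop (𝓝 (g : ℝ≥0∞)) := by
  let f : OrthonormalBasis (Fin (n + 1)) ℝ (Eu (n + 1)) → ℝ → ℝ≥0∞ := fun b T =>
    cellInf H (twinReflection H ν * H) p ν b T / ENNReal.ofReal (T ^ n)
  -- For fixed `T` the upper limit is taken in the size of the large cube, and only then the lower
  -- limit in `T`. As the two bases are arbitrary, this gives existence and independence at the same
  -- time.
  have key : ∀ b b' : OrthonormalBasis (Fin (n + 1)) ℝ (Eu (n + 1)), b 0 = ν → b' 0 = ν →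
      limsup (f b) atTop ≤ liminf (f b') atTop := by
    intro b b' hb hb'
    refine ENNReal.le_of_forall_pos_le_add fun η hη _ => ?_
    obtain ⟨T₁, -, hT₁⟩ := cellInf_div_le hn hp hH hν hb hb' (NNReal.coe_pos.2 hη)
    rw [← tsub_le_iff_right]
    refine le_liminf_of_le (by isBoundedDefault) ?_
    filter_upwards [eventually_ge_atTop T₁] with T hT
    obtain ⟨S₁, -, hS₁⟩ := hT₁ T hT
    rw [tsub_le_iff_right]
    refine limsup_le_of_le (by isBoundedDefault) ?_
    filter_upwards [eventually_ge_atTop S₁] with S hS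
    have := hS₁ S hS
    rwa [ENNReal.ofReal_coe_nnreal] at this
  -- The case without any such basis holds vacuously, which spares the extension of `ν` to a basis
  -- at this point.
  by_cases hex : ∃ b : OrthonormalBasis (Fin (n + 1)) ℝ (Eu (n + 1)), b 0 = ν
  · obtain ⟨b₀, hb₀⟩ := hex
    have hfin : limsup (f b₀) atTop ≠ ⊤ := by
      obtain ⟨T₁, hT₁0, hT₁⟩ := cellInf_div_le hn hp hH hν hb₀ hb₀ zero_lt_one
      obtain ⟨S₁, -, hS₁⟩ := hT₁ T₁ le_rfl
      refine ne_top_of_le_ne_top ?_ (limsup_le_of_le (by isBoundedDefault)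
        ((eventually_ge_atTop S₁).mono hS₁))
      refine ENNReal.add_ne_top.2 ⟨ENNReal.div_ne_top (cellInf_ne_top _ _) ?_,
        ENNReal.ofReal_ne_top⟩
      simp only [ne_eq, ENNReal.ofReal_eq_zero, not_le]
      positivity
    refine ⟨(limsup (f b₀) atTop).toNNReal, fun b hb => ?_⟩
    rw [ENNReal.coe_toNNReal hfin]
    exact tendsto_of_le_liminf_of_limsup_le (key b₀ b hb₀ hb)
      ((key b b₀ hb hb₀).trans liminf_le_limsup)
  · exact ⟨0, fun b hb => absurd ⟨b, hb⟩ hex⟩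

/-- Near-optimal cells with an arbitrary centre on the hyperplane `ν^⊥`. -/
lemma exists_optimal_cells (hn : 1 ≤ n) (hp : 1 < p) (hH : 0 < H.det) (hν : ‖ν‖ = 1)
    {b : OrthonormalBasis (Fin (n + 1)) ℝ (Eu (n + 1))} (hb : b 0 = ν) {g : ℝ≥0}
    (hg : Tendsto (fun T : ℝ => cellInf H (twinReflection H ν * H) p ν b T /
        ENNReal.ofReal (T ^ n)) atTop (𝓝 (g : ℝ≥0∞))) {η : ℝ} (hη : 0 < η) :
    ∃ T₁ : ℝ, ∀ T, T₁ ≤ T → ∃ C : ℝ, ∀ t : Eu (n + 1), inner ℝ t ν = 0 →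
      ∃ W : (Fin (n + 1) → ℤ) → Eu (n + 1),
        (∀ z, node 1 z ∉ cubeAt b t (T - 2 * maxBond (n + 1)) → W z = fold H ν (node 1 z)) ∧
        (∀ z, ‖W z - fold H ν (node 1 z)‖ ≤ C) ∧
        latEnergy H p (nodesIn (cubeAt b t T)) W ≤ ENNReal.ofReal ((g + η) * T ^ n) := by
  obtain ⟨L, hL, T₁, hT₁, h⟩ := exists_shifted_competitor hn hp hH hν hb (half_pos hη)
  have hlt : (g : ℝ≥0∞) < ENNReal.ofReal (g + η / 2) := by
    rw [← ENNReal.ofReal_coe_nnreal]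
    exact (ENNReal.ofReal_lt_ofReal_iff (by positivity)).2 (by linarith)
  obtain ⟨T₂, hT₂⟩ := eventually_atTop.1 (hg.eventually (gt_mem_nhds hlt))
  -- The cell problem is solved on the size `T - 2 * L`, so that the enlarged cell has size exactly
  -- `T`.
  refine ⟨max T₁ T₂ + 2 * L, fun T hT => ?_⟩
  have h1 : T₁ ≤ T - 2 * L := by linarith [le_max_left T₁ T₂]
  have h2 : T₂ ≤ T - 2 * L := by linarith [le_max_right T₁ T₂]
  have h3 := hT₂ (T - 2 * L) h2
  have hpos : 0 < (T - 2 * L) ^ n := by have := hT₁.trans h1; positivity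
  rw [ENNReal.div_lt_iff (Or.inl (by simpa using hpos)) (Or.inl ENNReal.ofReal_ne_top),
    cellInf_eq, ← ENNReal.ofReal_mul (by positivity)] at h3
  simp only [iInf_lt_iff] at h3
  obtain ⟨w₀, hw₀, hE⟩ := h3
  obtain ⟨C, hC⟩ := h (T - 2 * L) h1 w₀ hw₀
  refine ⟨C, fun t ht => ?_⟩
  obtain ⟨W, hW1, hW2, hW3⟩ := hC t ht
  rw [sub_add_cancel] at hW1 hW3
  refine ⟨W, hW1, hW2, hW3.trans ((add_le_add_left hE.le _).trans ?_)⟩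
  rw [← ENNReal.ofReal_add (by positivity) (by positivity)]
  refine ENNReal.ofReal_le_ofReal ?_
  have hle : (T - 2 * L) ^ n ≤ T ^ n := by
    have := hT₁.trans h1
    gcongr; linarith
  calc (g + η / 2) * (T - 2 * L) ^ n + η / 2 * (T - 2 * L) ^ n = (g + η) * (T - 2 * L) ^ n := by ring
    _ ≤ _ := by gcongr

end Density

/-! ### Mollification and weak derivatives -/

section Mollify

open scoped Convolution

variable {N : ℕ}

/-- A standard sequence of mollifiers. -/
def mollifier (N i : ℕ) : ContDiffBump (0 : Eu N) where
  rIn := 1 / (i + 1)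
  rOut := 2 / (i + 1)
  rIn_pos := by positivity
  rIn_lt_rOut := by gcongr; norm_num

/-- The mollification of a function. -/
def moll (i : ℕ) (F : Eu N → ℝ) (x : Eu N) : ℝ :=
  ∫ y, (mollifier N i).normed volume (x - y) * F y

lemma moll_eq_convolution (i : ℕ) (F : Eu N → ℝ) :
    moll i F = ((mollifier N i).normed volume ⋆[ContinuousLinearMap.lsmul ℝ ℝ, volume] F) := by
  ext x
  rw [convolution_eq_swap]
  rfl

lemma tendsto_mollifier_rOut : Tendsto (fun i => (mollifier N i).rOut) atTop (𝓝 0) := by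
  have := (tendsto_one_div_add_atTop_nhds_zero_nat (𝕜 := ℝ)).const_mul 2
  simpa [mollifier, div_eq_mul_inv] using this

lemma ae_tendsto_moll {F : Eu N → ℝ} (hF : Integrable F) :
    ∀ᵐ x, Tendsto (fun i => moll i F x) atTop (𝓝 (F x)) := by
  simp only [moll_eq_convolution]
  refine ContDiffBump.ae_convolution_tendsto_right_of_locallyIntegrable (K := 2)
    tendsto_mollifier_rOut (Eventually.of_forall fun i => ?_) hF.locallyIntegrable
  simp [mollifier, div_eq_mul_inv]

lemma contDiff_moll {F : Eu N → ℝ} (hF : Integrable F) (i : ℕ) : ContDiff ℝ ∞ (moll i F) := by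
  rw [moll_eq_convolution]
  exact (mollifier N i).hasCompactSupport_normed.contDiff_convolution_left _
    (mollifier N i).contDiff_normed hF.locallyIntegrable

lemma integral_mollifier (i : ℕ) (x : Eu N) :
    ∫ y, (mollifier N i).normed volume (x - y) = 1 := by
  rw [integral_sub_left_eq_self (fun y => (mollifier N i).normed volume y)]
  exact (mollifier N i).integral_normed

lemma abs_moll_le {F : Eu N → ℝ} {M : ℝ} (hM : ∀ᵐ y, |F y| ≤ M) (i : ℕ) (x : Eu N) :
    |moll i F x| ≤ M := by
  have h1 : |moll i F x| ≤ ∫ y, (mollifier N i).normed volume (x - y) * M := by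
    rw [← Real.norm_eq_abs, moll]
    refine norm_integral_le_of_norm_le (g := fun y => (mollifier N i).normed volume (x - y) * M)
      ?_ ?_
    · exact ((mollifier N i).integrable_normed.comp_sub_left x).mul_const M
    · filter_upwards [hM] with y hy
      rw [norm_mul, Real.norm_of_nonneg ((mollifier N i).nonneg_normed _)]
      exact mul_le_mul_of_nonneg_left hy ((mollifier N i).nonneg_normed _)
  rwa [integral_mul_const, integral_mollifier, one_mul] at h1

/-- The kernel is even, so by Fubini mollification is symmetric. This permits moving it from one
factor of an integral to the other. -/
lemma integral_mul_moll {A B : Eu N → ℝ} (hA : Integrable A) (hB : Integrable B) (i : ℕ) :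
    ∫ x, A x * moll i B x = ∫ y, moll i A y * B y := by
  obtain ⟨C, hC⟩ := ((mollifier N i).hasCompactSupport_normed (μ := volume)).exists_bound_of_continuous
    (mollifier N i).continuous_normed
  have hint : Integrable (Function.uncurry fun x y : Eu N =>
      (mollifier N i).normed volume (x - y) * (A x * B y)) (volume.prod volume) := by
    refine (hA.mul_prod hB).bdd_mul (c := C) ?_ (Eventually.of_forall fun y => hC _)
    exact ((mollifier N i).continuous_normed.comp (by fun_prop)).aestronglyMeasurable
  calc ∫ x, A x * moll i B x
      = ∫ x, ∫ y, (mollifier N i).normed volume (x - y) * (A x * B y) := by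
        congr 1; ext x
        rw [moll, ← integral_const_mul]
        congr 1; ext y; ring
    _ = ∫ y, ∫ x, (mollifier N i).normed volume (x - y) * (A x * B y) :=
        integral_integral_swap hint
    _ = _ := by
        congr 1; ext y
        rw [moll, ← integral_mul_const]
        congr 1; ext x
        rw [← (mollifier N i).normed_neg (x - y), neg_sub]; ring

/-- `g` is the weak derivative of `f` in the direction `h` on `U`. -/
def HasWeakDeriv (U : Set (Eu N)) (f : Eu N → ℝ) (h : Eu N) (g : Eu N → ℝ) : Prop :=
  ∀ φ, IsTest U φ → ∫ x, fderiv ℝ φ x h * f x = - ∫ x, φ x * g x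

/-- The derivative falls on the kernel, and `y ↦ ρ (x - y)` is itself an admissible test function as
long as its ball stays in `U`. -/
lemma fderiv_moll {U : Set (Eu N)} {f g : Eu N → ℝ} {h : Eu N} (hf : Integrable f)
    (hw : HasWeakDeriv U f h g) {i : ℕ} {x : Eu N}
    (hx : Metric.closedBall x (mollifier N i).rOut ⊆ U) :
    fderiv ℝ (moll i f) x h = moll i g x := by
  set ρ := (mollifier N i).normed volume with hρ
  have hρs : ContDiff ℝ ∞ ρ := (mollifier N i).contDiff_normed
  have hρc : HasCompactSupport ρ := (mollifier N i).hasCompactSupport_normed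
  have hρ1 : ContDiff ℝ 1 ρ := hρs.of_le (by exact_mod_cast le_top)
  have hρd : Differentiable ℝ ρ := hρ1.differentiable one_ne_zero
  have h1 := hρc.hasFDerivAt_convolution_left (ContinuousLinearMap.lsmul ℝ ℝ) hρ1
    hf.locallyIntegrable x
  have hint := (hρc.fderiv ℝ).convolutionExists_left
    ((ContinuousLinearMap.lsmul ℝ ℝ : ℝ →L[ℝ] ℝ →L[ℝ] ℝ).precompL (Eu N))
    (hρ1.continuous_fderiv one_ne_zero) hf.locallyIntegrable x
  rw [moll_eq_convolution, h1.fderiv, convolution_eq_swap]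
  rw [ContinuousLinearMap.integral_apply hint.integrable_swap]
  -- the test function
  have htest : IsTest U fun y => ρ (x - y) := by
    have hts : tsupport (fun y => ρ (x - y)) ⊆ Metric.closedBall x (mollifier N i).rOut := by
      refine closure_minimal (fun y hy => ?_) Metric.isClosed_closedBall
      have : x - y ∈ Function.support ρ := hy
      rw [hρ, (mollifier N i).support_normed_eq, Metric.mem_ball, dist_zero_right] at this
      rw [Metric.mem_closedBall, dist_comm, dist_eq_norm]
      exact this.le
    exact ⟨hρs.comp (by fun_prop), (isCompact_closedBall _ _).of_isClosed_subset
      (isClosed_tsupport _) hts, hts.trans hx⟩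
  have hw' := hw _ htest
  have hd : ∀ y, fderiv ℝ (fun y => ρ (x - y)) y h = - fderiv ℝ ρ (x - y) h := by
    intro y
    have e : HasFDerivAt (fun y => ρ (x - y))
        ((fderiv ℝ ρ (x - y)).comp (-ContinuousLinearMap.id ℝ (Eu N))) y := by
      refine (hρd (x - y)).hasFDerivAt.comp y ?_
      exact (hasFDerivAt_id y).const_sub x
    rw [e.fderiv]; simp
  simp only [hd, neg_mul, integral_neg, neg_inj] at hw'
  rw [moll, ← hw']
  rfl

lemma exists_mollifier_subset {K U : Set (Eu N)} (hK : IsCompact K) (hU : IsOpen U) (hKU : K ⊆ U) :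
    ∀ᶠ i in atTop, ∀ x ∈ K, Metric.closedBall x (mollifier N i).rOut ⊆ U := by
  obtain ⟨δ, hδ, h⟩ := hK.exists_cthickening_subset_open hU hKU
  filter_upwards [tendsto_mollifier_rOut.eventually (gt_mem_nhds hδ)] with i hi x hx
  refine subset_trans ?_ h
  exact (Metric.closedBall_subset_closedBall hi.le).trans
    (Metric.closedBall_subset_cthickening hx δ)

/-- A function with a bounded weak derivative is Lipschitz along segments between good points. -/
lemma abs_sub_le_of_hasWeakDeriv {U : Set (Eu N)} (hU : IsOpen U) {f g : Eu N → ℝ} {x y : Eu N}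
    (hf : Integrable f) (hw : HasWeakDeriv U f (y - x) g) {M : ℝ}
    (hM : ∀ᵐ y, |g y| ≤ M) (hseg : segment ℝ x y ⊆ U)
    (hx : Tendsto (fun i => moll i f x) atTop (𝓝 (f x)))
    (hy : Tendsto (fun i => moll i f y) atTop (𝓝 (f y))) : |f y - f x| ≤ M := by
  have hK : IsCompact (segment ℝ x y) := by
    rw [segment_eq_image_lineMap]
    exact isCompact_Icc.image (AffineMap.lineMap_continuous)
  -- For the smooth mollifications this is the mean value inequality along the segment; the bound
  -- passes to the limit at the two end points.
  refine le_of_tendsto ((hy.sub hx).abs) ?_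
  filter_upwards [exists_mollifier_subset hK hU hseg] with i hi
  have hd : ∀ t ∈ Icc (0 : ℝ) 1, HasDerivWithinAt (fun t : ℝ => moll i f (x + t • (y - x)))
      (moll i g (x + t • (y - x))) (Icc 0 1) t := by
    intro t ht
    have hmem : x + t • (y - x) ∈ segment ℝ x y := by
      rw [segment_eq_image']; exact ⟨t, ht, rfl⟩
    rw [← fderiv_moll hf hw (hi _ hmem)]
    have h1 : HasFDerivAt (moll i f) (fderiv ℝ (moll i f) (x + t • (y - x))) (x + t • (y - x)) :=
      (((contDiff_moll hf i).differentiable (by simp)) _).hasFDerivAt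
    have h2 : HasDerivAt (fun t : ℝ => x + t • (y - x)) (y - x) t := by
      simpa using ((hasDerivAt_id t).smul_const (y - x)).const_add x
    exact (h1.comp_hasDerivAt t h2).hasDerivWithinAt
  have := (convex_Icc (0 : ℝ) 1).norm_image_sub_le_of_norm_hasDerivWithin_le hd
    (fun t _ => abs_moll_le hM i _) (left_mem_Icc.2 zero_le_one) (right_mem_Icc.2 zero_le_one)
  simpa using this

lemma IsTest.mul_contDiff {U : Set (Eu N)} {φ f : Eu N → ℝ} (hφ : IsTest U φ)
    (hf : ContDiff ℝ ∞ f) : IsTest U fun x => φ x * f x := by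
  refine ⟨hφ.1.mul hf, hφ.2.1.mul_right, ?_⟩
  exact (tsupport_mul_subset_left).trans hφ.2.2

lemma IsTest.continuous {U : Set (Eu N)} {φ : Eu N → ℝ} (hφ : IsTest U φ) : Continuous φ :=
  hφ.1.continuous

lemma IsTest.continuous_fderiv {U : Set (Eu N)} {φ : Eu N → ℝ} (hφ : IsTest U φ) (h : Eu N) :
    Continuous fun x => fderiv ℝ φ x h :=
  (hφ.1.continuous_fderiv (by simp)).clm_apply continuous_const

lemma IsTest.fderiv_apply {U : Set (Eu N)} {φ : Eu N → ℝ} (hφ : IsTest U φ) (h : Eu N) :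
    IsTest U fun x => fderiv ℝ φ x h := by
  refine ⟨?_, hφ.2.1.fderiv_apply ℝ h, ?_⟩
  · exact (hφ.1.fderiv_right (m := ∞) (by simp)).clm_apply contDiff_const
  · exact (tsupport_fderiv_apply_subset ℝ h).trans hφ.2.2

lemma IsTest.bounded {U : Set (Eu N)} {φ : Eu N → ℝ} (hφ : IsTest U φ) :
    ∃ C, ∀ x, ‖φ x‖ ≤ C :=
  hφ.2.1.exists_bound_of_continuous hφ.continuous

lemma IsTest.integrable_mul {U : Set (Eu N)} {φ f : Eu N → ℝ} (hφ : IsTest U φ)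
    (hf : Integrable f) : Integrable fun x => φ x * f x := by
  obtain ⟨C, hC⟩ := hφ.bounded
  exact hf.bdd_mul (c := C) hφ.continuous.aestronglyMeasurable (Eventually.of_forall hC)

/-- The product rule for bounded functions with integrable weak derivatives. -/
lemma HasWeakDeriv.mul {U : Set (Eu N)} (hU : IsOpen U) {f g f' g' : Eu N → ℝ} {h : Eu N}
    (hf : Integrable f) (hg : Integrable g) (hf' : Integrable f') (hg' : Integrable g') {M : ℝ}
    (hfM : ∀ x, |f x| ≤ M) (hgM : ∀ x, |g x| ≤ M)
    (hwf : HasWeakDeriv U f h f') (hwg : HasWeakDeriv U g h g') :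
    HasWeakDeriv U (fun x => f x * g x) h (fun x => f x * g' x + f' x * g x) := by
  intro φ hφ
  obtain ⟨C, hC⟩ := hφ.bounded
  obtain ⟨C', hC'⟩ := (hφ.fderiv_apply h).bounded
  have hC0 : 0 ≤ C := (norm_nonneg _).trans (hC 0)
  have hC'0 : 0 ≤ C' := (norm_nonneg _).trans (hC' 0)
  have hM0 : 0 ≤ M := (abs_nonneg _).trans (hfM 0)
  have hφg : Integrable fun x => φ x * g x := hφ.integrable_mul hg
  have hmf : ∀ i x, |moll i f x| ≤ M := fun i x => abs_moll_le (Eventually.of_forall hfM) i x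
  have hmm : ∀ i, AEStronglyMeasurable (moll i f) volume := fun i =>
    (contDiff_moll hf i).continuous.aestronglyMeasurable
  have hmm' : ∀ i, AEStronglyMeasurable (moll i fun x => φ x * g x) volume := fun i =>
    (contDiff_moll hφg i).continuous.aestronglyMeasurable
  -- The equation for `g` is tested with `φ` times the mollified `f`. In the term with the mollified
  -- `f'` the mollifier is then moved onto `φ * g`.
  have heq : ∀ᶠ i in atTop, ∫ x, fderiv ℝ φ x h * (moll i f x * g x) =
      - (∫ x, φ x * (moll i f x * g' x)) - ∫ x, moll i (fun x => φ x * g x) x * f' x := by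
    filter_upwards [exists_mollifier_subset hφ.2.1 hU hφ.2.2] with i hi
    have h1 := hwg _ (hφ.mul_contDiff (contDiff_moll hf i))
    have hd : ∀ x, fderiv ℝ (fun x => φ x * moll i f x) x h =
        fderiv ℝ φ x h * moll i f x + φ x * moll i f' x := by
      intro x
      have a1 : DifferentiableAt ℝ φ x := (hφ.1.differentiable (by simp)) x
      have a2 : DifferentiableAt ℝ (moll i f) x := ((contDiff_moll hf i).differentiable (by simp)) x
      rw [fderiv_fun_mul a1 a2]
      simp only [add_apply, smul_apply, smul_eq_mul]
      by_cases hx : x ∈ tsupport φ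
      · rw [fderiv_moll hf hwf (hi x hx)]; ring
      · rw [image_eq_zero_of_notMem_tsupport hx]; ring
    simp only [hd] at h1
    have i1 : Integrable fun x => fderiv ℝ φ x h * (moll i f x * g x) := by
      refine (hφ.fderiv_apply h).integrable_mul (hg.bdd_mul (c := M) (hmm i) ?_)
      exact Eventually.of_forall (hmf i)
    have i2 : Integrable fun x => φ x * g x * moll i f' x := by
      obtain ⟨D, hD⟩ := ((mollifier N i).hasCompactSupport_normed
        (μ := volume)).exists_bound_of_continuous (mollifier N i).continuous_normed
      have hbd : ∀ x, ‖moll i f' x‖ ≤ ∫ y, D * ‖f' y‖ := by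
        intro x
        refine norm_integral_le_of_norm_le (hf'.norm.const_mul D) (Eventually.of_forall fun y => ?_)
        rw [norm_mul]
        exact mul_le_mul_of_nonneg_right (hD _) (norm_nonneg _)
      have := hφg.bdd_mul (c := ∫ y, D * ‖f' y‖)
        (contDiff_moll hf' i).continuous.aestronglyMeasurable (Eventually.of_forall hbd)
      refine this.congr (Eventually.of_forall fun x => ?_)
      simp only; ring
    have e1 : ∫ x, (fderiv ℝ φ x h * moll i f x + φ x * moll i f' x) * g x =
        (∫ x, fderiv ℝ φ x h * (moll i f x * g x)) + ∫ x, φ x * g x * moll i f' x := by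
      rw [← integral_add i1 i2]
      congr 1; ext x; ring
    rw [e1, integral_mul_moll hφg hf'] at h1
    have e2 : ∫ x, φ x * moll i f x * g' x = ∫ x, φ x * (moll i f x * g' x) := by
      congr 1; ext x; ring
    rw [e2] at h1
    linarith
  have t1 : Tendsto (fun i => ∫ x, fderiv ℝ φ x h * (moll i f x * g x)) atTop
      (𝓝 (∫ x, fderiv ℝ φ x h * (f x * g x))) := by
    refine tendsto_integral_of_dominated_convergence (fun x => C' * (M * ‖g x‖)) (fun i => ?_)
      ((hg.norm.const_mul M).const_mul C') (fun i => Eventually.of_forall fun x => ?_) ?_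
    · exact ((hφ.continuous_fderiv h).aestronglyMeasurable).mul ((hmm i).mul hg.aestronglyMeasurable)
    · rw [norm_mul, norm_mul]
      have := hC' x
      have hm := hmf i x
      rw [← Real.norm_eq_abs] at hm
      gcongr
    · filter_upwards [ae_tendsto_moll hf] with x hx
      exact (hx.mul_const _).const_mul _
  have t2 : Tendsto (fun i => ∫ x, φ x * (moll i f x * g' x)) atTop
      (𝓝 (∫ x, φ x * (f x * g' x))) := by
    refine tendsto_integral_of_dominated_convergence (fun x => C * (M * ‖g' x‖)) (fun i => ?_)
      ((hg'.norm.const_mul M).const_mul C) (fun i => Eventually.of_forall fun x => ?_) ?_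
    · exact (hφ.continuous.aestronglyMeasurable).mul ((hmm i).mul hg'.aestronglyMeasurable)
    · rw [norm_mul, norm_mul]
      have := hC x
      have hm := hmf i x
      rw [← Real.norm_eq_abs] at hm
      gcongr
    · filter_upwards [ae_tendsto_moll hf] with x hx
      exact (hx.mul_const _).const_mul _
  -- Here the symmetry pays: `φ * g` is bounded, so its mollifications are dominated, whereas `f'`
  -- is only integrable.
  have t3 : Tendsto (fun i => ∫ x, moll i (fun x => φ x * g x) x * f' x) atTop
      (𝓝 (∫ x, φ x * g x * f' x)) := by
    refine tendsto_integral_of_dominated_convergence (fun x => C * M * ‖f' x‖) (fun i => ?_)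
      (hf'.norm.const_mul (C * M)) (fun i => Eventually.of_forall fun x => ?_) ?_
    · exact (hmm' i).mul hf'.aestronglyMeasurable
    · rw [norm_mul]
      gcongr
      refine abs_moll_le (Eventually.of_forall fun y => ?_) i x
      rw [abs_mul]
      have := hC y
      rw [Real.norm_eq_abs] at this
      exact mul_le_mul this (hgM y) (abs_nonneg _) hC0
    · filter_upwards [ae_tendsto_moll hφg] with x hx
      exact hx.mul_const _
  have hlim := tendsto_nhds_unique (t1.congr' heq) (t2.neg.sub t3)
  rw [hlim]
  have i1 : Integrable fun x => φ x * (f x * g' x) := by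
    refine hφ.integrable_mul (hg'.bdd_mul (c := M) hf.aestronglyMeasurable ?_)
    exact Eventually.of_forall hfM
  have i2 : Integrable fun x => φ x * (f' x * g x) := by
    refine hφ.integrable_mul ?_
    have := hf'.bdd_mul (c := M) hg.aestronglyMeasurable (Eventually.of_forall hgM)
    exact this.congr (Eventually.of_forall fun x => mul_comm _ _)
  have e3 : ∫ x, φ x * g x * f' x = ∫ x, φ x * (f' x * g x) := by
    congr 1; ext x; ring
  rw [e3, ← neg_add', ← integral_add i1 i2]
  congr 2; ext x; ring

end Mollify

/-! ### Derivative measures of bounded functions do not charge `𝓗^{N-1}`-null sets -/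

section Cutoff

variable {N n : ℕ}

/-- Vanishing Hausdorff measure provides covers with small sums of powers of diameters. Slightly
larger open balls around points of `K` do almost as well, and by compactness finitely many of them
suffice. -/
lemma exists_ball_cover {K : Set (Eu N)} (hK : IsCompact K) (h0 : μH[(n : ℝ)] K = 0)
    {δ : ℝ} (hδ : 0 < δ) :
    ∃ (I : Finset ℕ) (x : ℕ → Eu N) (r : ℕ → ℝ), (∀ k ∈ I, x k ∈ K ∧ 0 < r k ∧ r k < δ) ∧
      K ⊆ ⋃ k ∈ I, Metric.ball (x k) (r k) ∧ ∑ k ∈ I, r k ^ n ≤ δ := by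
  classical
  have h1 : (⨅ (t : ℕ → Set (Eu N)) (_ : K ⊆ ⋃ k, t k)
      (_ : ∀ k, Metric.ediam (t k) ≤ ENNReal.ofReal (δ / 2)),
      ∑' k, ⨆ _ : (t k).Nonempty, Metric.ediam (t k) ^ (n : ℝ)) < ENNReal.ofReal (δ / 2) := by
    refine lt_of_le_of_lt ?_ (ENNReal.ofReal_pos.2 (half_pos hδ))
    rw [← h0, Measure.hausdorffMeasure_apply]
    exact le_iSup₂ (f := fun (r : ℝ≥0∞) (_ : 0 < r) => ⨅ (t : ℕ → Set (Eu N)) (_ : K ⊆ ⋃ k, t k)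
      (_ : ∀ k, Metric.ediam (t k) ≤ r), ∑' k, ⨆ _ : (t k).Nonempty, Metric.ediam (t k) ^ (n : ℝ))
      (ENNReal.ofReal (δ / 2)) (ENNReal.ofReal_pos.2 (half_pos hδ))
  simp only [iInf_lt_iff] at h1
  obtain ⟨t, htK, htd, hts⟩ := h1
  obtain ⟨d, hd⟩ : ∃ d : ℕ → ℝ, ∀ k, d k = (Metric.ediam (t k)).toReal := ⟨_, fun _ => rfl⟩
  have hfin : ∀ k, Metric.ediam (t k) ≠ ⊤ := fun k => ne_top_of_le_ne_top ENNReal.ofReal_ne_top (htd k)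
  have hd0 : ∀ k, 0 ≤ d k := fun k => by rw [hd]; exact ENNReal.toReal_nonneg
  have hdδ : ∀ k, d k ≤ δ / 2 := fun k => by
    rw [hd]; exact ENNReal.toReal_le_of_le_ofReal (half_pos hδ).le (htd k)
  -- The radius must exceed the diameter, which may be zero, for an open ball around one point of `t
  -- k` to contain all of `t k`. The excess is summable with sum at most `δ / 2`.
  have hr : ∀ k, ∃ r, d k < r ∧ r < δ ∧ r ^ n < d k ^ n + δ / 2 / 2 ^ (k + 1) := by
    intro k
    have e1 : ∀ᶠ r in 𝓝[>] (d k), r < δ :=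
      nhdsWithin_le_nhds (gt_mem_nhds ((hdδ k).trans_lt (half_lt_self hδ)))
    have e2 : ∀ᶠ r in 𝓝[>] (d k), r ^ n < d k ^ n + δ / 2 / 2 ^ (k + 1) := by
      refine nhdsWithin_le_nhds ?_
      have : Tendsto (fun r : ℝ => r ^ n) (𝓝 (d k)) (𝓝 (d k ^ n)) := (continuous_pow n).tendsto _
      exact this.eventually (gt_mem_nhds (by linarith [show 0 < δ / 2 / 2 ^ (k + 1) by positivity]))
    obtain ⟨r, ⟨a, b⟩, c⟩ := ((e1.and e2).and self_mem_nhdsWithin).exists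
    exact ⟨r, c, a, b⟩
  choose r hr1 hr2 hr3 using hr
  have hx : ∀ k, ∃ x, (t k ∩ K).Nonempty → x ∈ t k ∩ K := by
    intro k
    by_cases h : (t k ∩ K).Nonempty
    · exact ⟨h.some, fun _ => h.some_mem⟩
    · exact ⟨0, fun h' => absurd h' h⟩
  choose x hx using hx
  have hcov : K ⊆ ⋃ k : {k // (t k ∩ K).Nonempty}, Metric.ball (x k) (r k) := by
    intro y hy
    obtain ⟨k, hk⟩ := mem_iUnion.1 (htK hy)
    have hne : (t k ∩ K).Nonempty := ⟨y, hk, hy⟩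
    refine mem_iUnion.2 ⟨⟨k, hne⟩, ?_⟩
    rw [Metric.mem_ball]
    refine lt_of_le_of_lt ?_ (hr1 k)
    rw [hd, dist_edist]
    exact ENNReal.toReal_mono (hfin k) (Metric.edist_le_ediam_of_mem hk (hx k hne).1)
  obtain ⟨J, hJ⟩ := hK.elim_finite_subcover _ (fun _ => Metric.isOpen_ball) hcov
  refine ⟨J.map (Function.Embedding.subtype _), x, r, ?_, ?_, ?_⟩
  · intro k hk
    obtain ⟨⟨k', hk'⟩, -, rfl⟩ := Finset.mem_map.1 hk
    exact ⟨(hx _ hk').2, (hd0 _).trans_lt (hr1 _), hr2 _⟩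
  · intro y hy
    obtain ⟨k, hk, hyk⟩ := mem_iUnion₂.1 (hJ hy)
    exact mem_iUnion₂.2 ⟨k, Finset.mem_map_of_mem _ hk, hyk⟩
  · obtain ⟨I, hI⟩ : ∃ I, I = J.map (Function.Embedding.subtype fun k => (t k ∩ K).Nonempty) := ⟨_, rfl⟩
    rw [← hI]
    have hIne : ∀ k ∈ I, (t k).Nonempty := by
      intro k hk
      rw [hI] at hk
      obtain ⟨⟨k', hk'⟩, -, rfl⟩ := Finset.mem_map.1 hk
      exact hk'.mono inter_subset_left
    have s1 : ∑ k ∈ I, d k ^ n ≤ δ / 2 := by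
      rw [← ENNReal.ofReal_le_ofReal_iff (half_pos hδ).le,
        ENNReal.ofReal_sum_of_nonneg fun k _ => pow_nonneg (hd0 k) n]
      refine le_trans ?_ hts.le
      refine le_trans (Finset.sum_le_sum fun k hk => ?_) (ENNReal.sum_le_tsum I)
      rw [ENNReal.ofReal_pow (hd0 k), hd, ENNReal.ofReal_toReal (hfin k)]
      refine le_trans ?_ (le_iSup _ (hIne k hk))
      rw [ENNReal.rpow_natCast]
    have s2 : ∑ k ∈ I, δ / 2 / 2 ^ (k + 1) ≤ δ / 2 := by
      have hs : HasSum (fun k : ℕ => δ / 2 / 2 ^ (k + 1)) (δ / 2) := by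
        have := hasSum_geometric_two' (δ / 2)
        convert this using 2 with k
        rw [pow_succ]; field_simp
      exact sum_le_hasSum I (fun k _ => by positivity) hs
    calc ∑ k ∈ I, r k ^ n ≤ ∑ k ∈ I, (d k ^ n + δ / 2 / 2 ^ (k + 1)) :=
          Finset.sum_le_sum fun k _ => (hr3 k).le
      _ ≤ δ := by rw [Finset.sum_add_distrib]; linarith

lemma integrable_norm_fderiv {f : Eu N → ℝ} (hf : ContDiff ℝ ∞ f) (hc : HasCompactSupport f)
    (h : Eu N) : Integrable fun y => ‖fderiv ℝ f y h‖ := by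
  refine Continuous.integrable_of_hasCompactSupport ?_ (hc.fderiv_apply ℝ h).norm
  exact ((hf.continuous_fderiv (by simp)).clm_apply continuous_const).norm

/-- Scaling: the gradient of a bump of radius `r` is of size `r⁻¹` on a set of volume `r ^ (n + 1)`.
-/
lemma exists_bump_integral_le (h : Eu (n + 1)) :
    ∃ C, 0 ≤ C ∧ ∀ (x : Eu (n + 1)) (r : ℝ), 0 < r → ∃ f : Eu (n + 1) → ℝ,
      ContDiff ℝ ∞ f ∧ (∀ y, 0 ≤ f y ∧ f y ≤ 1) ∧ (∀ y ∈ Metric.ball x r, f y = 1) ∧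
      (∀ y, 2 * r ≤ dist y x → f y = 0) ∧ ∫ y, ‖fderiv ℝ f y h‖ ≤ C * r ^ n := by
  let Φ : ContDiffBump (0 : Eu (n + 1)) := ⟨1, 2, one_pos, one_lt_two⟩
  have hΦ : ContDiff ℝ ∞ Φ := Φ.contDiff
  refine ⟨∫ y, ‖fderiv ℝ Φ y h‖, integral_nonneg fun _ => norm_nonneg _, fun x r hr => ?_⟩
  refine ⟨fun y => Φ (r⁻¹ • (y - x)), hΦ.comp (by fun_prop), fun y => ⟨Φ.nonneg, Φ.le_one⟩, ?_, ?_, ?_⟩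
  · intro y hy
    refine Φ.one_of_mem_closedBall ?_
    rw [mem_closedBall_zero_iff, norm_smul, norm_inv, Real.norm_of_nonneg hr.le, ← dist_eq_norm]
    rw [inv_mul_le_iff₀ hr]
    have := Metric.mem_ball.1 hy
    change dist y x ≤ r * 1
    linarith
  · intro y hy
    refine Φ.zero_of_le_dist ?_
    rw [dist_zero_right, norm_smul, norm_inv, Real.norm_of_nonneg hr.le, ← dist_eq_norm,
      le_inv_mul_iff₀ hr]
    change r * 2 ≤ _
    linarith
  · have hd : ∀ y, fderiv ℝ (fun y => Φ (r⁻¹ • (y - x))) y h = r⁻¹ * fderiv ℝ Φ (r⁻¹ • (y - x)) h := by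
      intro y
      have e2 : HasFDerivAt (fun y : Eu (n + 1) => r⁻¹ • (y - x))
          (r⁻¹ • ContinuousLinearMap.id ℝ (Eu (n + 1))) y :=
        ((hasFDerivAt_id y).sub_const x).const_smul r⁻¹
      have e := ((hΦ.differentiable (by simp)) (r⁻¹ • (y - x))).hasFDerivAt.comp y e2
      have e' : HasFDerivAt (fun y => Φ (r⁻¹ • (y - x))) _ y := e
      rw [e'.fderiv]; simp
    simp only [hd, norm_mul]
    rw [integral_const_mul, integral_sub_right_eq_self (fun y => ‖fderiv ℝ Φ (r⁻¹ • y) h‖) x,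
      Measure.integral_comp_smul volume (fun y => ‖fderiv ℝ Φ y h‖) r⁻¹]
    rw [finrank_euclideanSpace_fin, norm_inv, Real.norm_of_nonneg hr.le, inv_pow, inv_inv,
      abs_of_pos (pow_pos hr _), smul_eq_mul, pow_succ]
    refine le_of_eq ?_
    field_simp

/-- Two bumps are combined to `1 - (1 - η) * (1 - f)`. This equals one where either of them does,
and its derivative is at most the sum of theirs because both take values in `[0, 1]`. -/
lemma exists_cutoff_of_cover {h : Eu N} {C : ℝ} (x : ℕ → Eu N) (r : ℕ → ℝ)
    (hf : ∀ k, 0 < r k → ∃ f : Eu N → ℝ,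
      ContDiff ℝ ∞ f ∧ (∀ y, 0 ≤ f y ∧ f y ≤ 1) ∧ (∀ y ∈ Metric.ball (x k) (r k), f y = 1) ∧
      (∀ y, 2 * r k ≤ dist y (x k) → f y = 0) ∧ ∫ y, ‖fderiv ℝ f y h‖ ≤ C * r k ^ n)
    (I : Finset ℕ) (hI : ∀ k ∈ I, 0 < r k) :
    ∃ η : Eu N → ℝ, ContDiff ℝ ∞ η ∧ HasCompactSupport η ∧ (∀ y, 0 ≤ η y ∧ η y ≤ 1) ∧
      (∀ k ∈ I, ∀ y ∈ Metric.ball (x k) (r k), η y = 1) ∧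
      (∀ y, (∀ k ∈ I, 2 * r k ≤ dist y (x k)) → η y = 0) ∧
      ∫ y, ‖fderiv ℝ η y h‖ ≤ C * ∑ k ∈ I, r k ^ n := by
  classical
  induction I using Finset.induction_on with
  | empty =>
    refine ⟨fun _ => 0, contDiff_const, HasCompactSupport.zero, by simp, by simp, by simp, ?_⟩
    simp
  | insert k I hk ih =>
    obtain ⟨η, h1, h2, h3, h4, h5, h6⟩ := ih fun j hj => hI j (Finset.mem_insert_of_mem hj)
    obtain ⟨f, f1, f3, f4, f5, f6⟩ := hf k (hI k (Finset.mem_insert_self _ _))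
    have f2 : HasCompactSupport f := by
      refine HasCompactSupport.intro (isCompact_closedBall (x k) (2 * r k)) fun y hy => f5 y ?_
      rw [Metric.mem_closedBall, not_le] at hy
      exact hy.le
    refine ⟨fun y => η y + f y * (1 - η y), h1.add (f1.mul (contDiff_const.sub h1)),
      h2.add f2.mul_right, ?_, ?_, ?_, ?_⟩
    · intro y
      have := h3 y; have := f3 y
      constructor
      · nlinarith
      · nlinarith
    · intro j hj y hy
      rcases Finset.mem_insert.1 hj with rfl | hj
      · simp only [f4 y hy]; ring
      · simp only [h4 j hj y hy]; ring
    · intro y hy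
      simp only [f5 y (hy k (Finset.mem_insert_self _ _)),
        h5 y fun j hj => hy j (Finset.mem_insert_of_mem hj)]
      ring
    · have hd : ∀ y, ‖fderiv ℝ (fun y => η y + f y * (1 - η y)) y h‖ ≤
          ‖fderiv ℝ η y h‖ + ‖fderiv ℝ f y h‖ := by
        intro y
        have a1 := ((h1.differentiable (by simp)) y).hasFDerivAt
        have a2 := ((f1.differentiable (by simp)) y).hasFDerivAt
        have e := a1.add (a2.mul (a1.const_sub 1))
        have e' : HasFDerivAt (fun y => η y + f y * (1 - η y)) _ y := e
        rw [e'.fderiv]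
        have : (fderiv ℝ η y + (f y • -fderiv ℝ η y + (1 - η y) • fderiv ℝ f y)) h =
            (1 - f y) * fderiv ℝ η y h + (1 - η y) * fderiv ℝ f y h := by
          simp only [add_apply, smul_apply, smul_eq_mul, neg_apply]; ring
        rw [this]
        refine (norm_add_le _ _).trans ?_
        rw [norm_mul, norm_mul]
        have b1 : ‖1 - f y‖ ≤ 1 := by
          rw [Real.norm_eq_abs, abs_le]; constructor <;> linarith [f3 y]
        have b2 : ‖1 - η y‖ ≤ 1 := by
          rw [Real.norm_eq_abs, abs_le]; constructor <;> linarith [h3 y]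
        exact add_le_add (mul_le_of_le_one_left (norm_nonneg _) b1)
          (mul_le_of_le_one_left (norm_nonneg _) b2)
      have i1 := integrable_norm_fderiv h1 h2 h
      have i2 := integrable_norm_fderiv f1 f2 h
      calc _ ≤ ∫ y, (‖fderiv ℝ η y h‖ + ‖fderiv ℝ f y h‖) :=
            integral_mono_of_nonneg (Eventually.of_forall fun _ => norm_nonneg _) (i1.add i2)
              (Eventually.of_forall hd)
        _ ≤ _ := by
            rw [integral_add i1 i2, Finset.sum_insert hk, mul_add]
            linarith

/-- A measure that is the derivative of a bounded function vanishes on compact null sets. -/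
lemma measure_eq_of_isCompact {Ω K : Set (Eu (n + 1))} (hΩ : IsOpen Ω) (hK : IsCompact K)
    (hKΩ : K ⊆ Ω) (h0 : μH[(n : ℝ)] K = 0) {w : Eu (n + 1) → ℝ} {M : ℝ}
    (hM : ∀ᵐ x ∂(volume.restrict Ω), |w x| ≤ M) {h : Eu (n + 1)} {μ : SignedMeasure (Eu (n + 1))}
    (hw : ∀ φ, IsTest Ω φ → ∫ x in Ω, fderiv ℝ φ x h * w x = - signedIntegral μ φ) :
    μ.toJordanDecomposition.posPart K = μ.toJordanDecomposition.negPart K := by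
  obtain ⟨C, hC, hf⟩ := exists_bump_integral_le (n := n) h
  obtain ⟨δ₀, hδ₀, hth⟩ := hK.exists_cthickening_subset_open hΩ hKΩ
  -- The cutoffs reach up to `2 * δ i` from `K`; the factor `1 / 3` keeps this below `δ₀`, so that
  -- they are test functions on `Ω`.
  set δ : ℕ → ℝ := fun i => δ₀ / 3 / (i + 1) with hδdef
  have hδ : ∀ i, 0 < δ i := fun i => by positivity
  have hδ3 : ∀ i, δ i ≤ δ₀ / 3 := fun i => by
    rw [hδdef]; exact div_le_self (by positivity) (by linarith [show (0 : ℝ) ≤ i from i.cast_nonneg])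
  have hδt : Tendsto δ atTop (𝓝 0) := by
    have := (tendsto_one_div_add_atTop_nhds_zero_nat (𝕜 := ℝ)).const_mul (δ₀ / 3)
    simpa [hδdef, div_eq_mul_inv] using this
  have hη : ∀ i, ∃ η : Eu (n + 1) → ℝ, ContDiff ℝ ∞ η ∧ HasCompactSupport η ∧
      (∀ y, 0 ≤ η y ∧ η y ≤ 1) ∧ (∀ y ∈ K, η y = 1) ∧
      (∀ y, η y ≠ 0 → y ∈ Metric.cthickening (2 * δ i) K) ∧
      ∫ y, ‖fderiv ℝ η y h‖ ≤ C * δ i := by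
    intro i
    obtain ⟨I, x, r, h1, h2, h3⟩ := exists_ball_cover hK h0 (hδ i)
    obtain ⟨η, e1, e2, e3, e4, e5, e6⟩ := exists_cutoff_of_cover x r (fun k hk => hf (x k) (r k) hk) I
      fun k hk => (h1 k hk).2.1
    refine ⟨η, e1, e2, e3, fun y hy => ?_, fun y hy => ?_, e6.trans (mul_le_mul_of_nonneg_left h3 hC)⟩
    · obtain ⟨k, hk, hyk⟩ := mem_iUnion₂.1 (h2 hy)
      exact e4 k hk y hyk
    · by_contra hcon
      refine hy (e5 y fun k hk => ?_)
      by_contra hlt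
      rw [not_le] at hlt
      refine hcon (Metric.mem_cthickening_of_dist_le y (x k) _ _ (h1 k hk).1 ?_)
      have := (h1 k hk).2.2
      linarith
  choose η e1 e2 e3 e4 e5 e6 using hη
  have hsupp : ∀ i, tsupport (η i) ⊆ Metric.cthickening (2 * δ i) K := fun i =>
    closure_minimal (fun y hy => e5 i y hy) Metric.isClosed_cthickening
  have htest : ∀ i, IsTest Ω (η i) := fun i => ⟨e1 i, e2 i, (hsupp i).trans
    ((Metric.cthickening_mono (by linarith [hδ3 i]) K).trans hth)⟩
  have hpt : ∀ y, Tendsto (fun i => η i y) atTop (𝓝 (K.indicator (fun _ => (1 : ℝ)) y)) := by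
    intro y
    by_cases hy : y ∈ K
    · simp only [indicator_of_mem hy, e4 _ y hy, tendsto_const_nhds]
    · rw [indicator_of_notMem hy]
      refine tendsto_const_nhds.congr' ?_
      have hpos : 0 < Metric.infEDist y K := by
        rw [pos_iff_ne_zero, Ne, ← Metric.mem_closure_iff_infEDist_zero, hK.isClosed.closure_eq]
        exact hy
      have hlim : Tendsto (fun i => ENNReal.ofReal (2 * δ i)) atTop (𝓝 0) := by
        have := ENNReal.tendsto_ofReal (hδt.const_mul 2)
        simpa using this
      filter_upwards [hlim.eventually (gt_mem_nhds hpos)] with i hi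
      by_contra hne
      have := e5 i y (fun h => hne h.symm)
      rw [Metric.mem_cthickening_iff] at this
      exact absurd hi (not_lt.2 this)
  have hlimμ : ∀ (m : Measure (Eu (n + 1))) [IsFiniteMeasure m],
      Tendsto (fun i => ∫ x, η i x ∂m) atTop (𝓝 (m.real K)) := by
    intro m _
    have : m.real K = ∫ x, K.indicator (fun _ => (1 : ℝ)) x ∂m := by
      rw [integral_indicator hK.measurableSet]; simp
    rw [this]
    refine tendsto_integral_of_dominated_convergence (fun _ => 1) (fun i => ?_)
      (integrable_const _) (fun i => Eventually.of_forall fun x => ?_) (Eventually.of_forall hpt)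
    · exact (e1 i).continuous.aestronglyMeasurable
    · rw [Real.norm_of_nonneg (e3 i x).1]; exact (e3 i x).2
  -- By the defining equation of the derivative the pairing is at most `|M|` times the integral of
  -- the gradient of the cutoff, which tends to zero. On the other hand the pairings converge to the
  -- measure of `K`.
  have hzero : Tendsto (fun i => signedIntegral μ (η i)) atTop (𝓝 0) := by
    rw [tendsto_zero_iff_norm_tendsto_zero]
    have hb : Tendsto (fun i => |M| * (C * δ i)) atTop (𝓝 0) := by
      simpa using (hδt.const_mul C).const_mul |M|
    refine squeeze_zero (fun _ => norm_nonneg _) (fun i => ?_) hb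
    have := hw _ (htest i)
    rw [← neg_eq_iff_eq_neg] at this
    rw [← this, norm_neg]
    have hint := integrable_norm_fderiv (e1 i) (e2 i) h
    calc ‖∫ x in Ω, fderiv ℝ (η i) x h * w x‖
        ≤ ∫ x in Ω, |M| * ‖fderiv ℝ (η i) x h‖ := by
          refine norm_integral_le_of_norm_le (hint.integrableOn.const_mul _) ?_
          filter_upwards [hM] with x hx
          rw [norm_mul, mul_comm]
          exact mul_le_mul_of_nonneg_right (hx.trans (le_abs_self M)) (norm_nonneg _)
      _ = |M| * ∫ x in Ω, ‖fderiv ℝ (η i) x h‖ := integral_const_mul _ _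
      _ ≤ |M| * (C * δ i) := by
          refine mul_le_mul_of_nonneg_left (le_trans ?_ (e6 i)) (abs_nonneg _)
          exact setIntegral_le_integral hint (Eventually.of_forall fun _ => norm_nonneg _)
  have := tendsto_nhds_unique hzero ((hlimμ μ.toJordanDecomposition.posPart).sub
    (hlimμ μ.toJordanDecomposition.negPart))
  rw [eq_comm, sub_eq_zero, measureReal_def, measureReal_def,
    ENNReal.toReal_eq_toReal_iff' (measure_ne_top _ _) (measure_ne_top _ _)] at this
  exact this

/-- Two finite Borel measures that agree on the compact subsets of `A` agree on `A`. -/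
lemma measure_eq_of_compact_eq {m₁ m₂ : Measure (Eu N)} [IsFiniteMeasure m₁] [IsFiniteMeasure m₂]
    {A : Set (Eu N)} (hA : MeasurableSet A) (h : ∀ K ⊆ A, IsCompact K → m₁ K = m₂ K) :
    m₁ A = m₂ A := by
  have key : ∀ (m₁ m₂ : Measure (Eu N)) [IsFiniteMeasure m₁] [IsFiniteMeasure m₂],
      (∀ K ⊆ A, IsCompact K → m₁ K = m₂ K) → m₁ A ≤ m₂ A := by
    intro m₁ m₂ _ _ h
    rw [hA.measure_eq_iSup_isCompact_of_ne_top (measure_ne_top m₁ A)]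
    refine iSup₂_le fun K hK => iSup_le fun hKc => ?_
    rw [h K hK hKc]
    exact measure_mono hK
  exact le_antisymm (key _ _ h) (key _ _ fun K hK hc => (h K hK hc).symm)

lemma hausdorffMeasure_eq_zero_iff {A : Set (Eu N)} :
    (μHE[n] : Measure (Eu N)) A = 0 ↔ (μH[(n : ℝ)] : Measure (Eu N)) A = 0 := by
  rw [Measure.euclideanHausdorffMeasure_def]
  have := Measure.addHaarScalarFactor_volume_hausdorffMeasure_ne_zero n
  rw [Measure.smul_apply, smul_eq_zero]
  simp [this]

/-- A set of positive measure in the higher dimension has infinite measure in the lower one. -/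
lemma volume_eq_zero_of_hausdorff {A : Set (Eu (n + 1))}
    (h : (μHE[n] : Measure (Eu (n + 1))) A = 0) : volume A = 0 := by
  rw [← EuclideanSpace.euclideanHausdorffMeasure_eq_volume]
  rcases Measure.euclideanHausdorffMeasure_zero_or_top (Nat.lt_succ_self n) A with h' | h'
  · exact h'
  · rw [h] at h'; exact absurd h' (by simp)

lemma integral_eq_setIntegral_of_isTest {U B : Set (Eu N)} {φ : Eu N → ℝ} (hφ : IsTest U φ)
    (hUB : U ⊆ B) (f : Eu N → ℝ) (μ : Measure (Eu N)) :
    ∫ x in B, φ x * f x ∂μ = ∫ x, φ x * f x ∂μ := by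
  refine setIntegral_eq_integral_of_forall_compl_eq_zero fun x hx => ?_
  rw [image_eq_zero_of_notMem_tsupport fun h => hx (hUB (hφ.2.2 h)), zero_mul]

lemma integral_indicator_of_isTest {U B : Set (Eu N)} {φ : Eu N → ℝ} (hφ : IsTest U φ)
    (hUB : U ⊆ B) (f : Eu N → ℝ) (μ : Measure (Eu N)) :
    ∫ x, φ x * B.indicator f x ∂μ = ∫ x, φ x * f x ∂μ := by
  congr 1; ext x
  by_cases hx : x ∈ B
  · rw [indicator_of_mem hx]
  · rw [image_eq_zero_of_notMem_tsupport fun h => hx (hUB (hφ.2.2 h)), zero_mul, zero_mul]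

lemma IsTest.mono {U V : Set (Eu N)} {φ : Eu N → ℝ} (hφ : IsTest U φ) (h : U ⊆ V) : IsTest V φ :=
  ⟨hφ.1, hφ.2.1, hφ.2.2.trans h⟩

/-- Away from the jump set, a bounded function of special bounded variation is weakly
differentiable. -/
lemma IsSBV.exists_hasWeakDeriv {V : Type*} [NormedAddCommGroup V] [NormedSpace ℝ V]
    {Ω B : Set (Eu (n + 1))} (hΩ : IsOpen Ω) (hB : IsOpen B) (hBΩ : B ⊆ Ω) {w : Eu (n + 1) → V}
    (hw : IsSBV Ω w) {M : ℝ} (hM : ∀ᵐ x ∂(volume.restrict Ω), ‖w x‖ ≤ M)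
    (hJ : (μHE[n] : Measure (Eu (n + 1))) (jumpSet Ω w ∩ B) = 0) (ℓ : V →L[ℝ] ℝ) (h : Eu (n + 1)) :
    ∃ g : Eu (n + 1) → ℝ, Integrable g ∧
      HasWeakDeriv B (B.indicator fun x => ℓ (w x)) h (B.indicator g) := by
  obtain ⟨μ, g, hμ, hg, hA⟩ := hw.2 ℓ h
  set P := μ.toJordanDecomposition.posPart with hP
  set Q := μ.toJordanDecomposition.negPart with hQ
  have hbd : ∀ᵐ x ∂(volume.restrict Ω), |ℓ (w x)| ≤ ‖ℓ‖ * M := by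
    filter_upwards [hM] with x hx
    exact (ℓ.le_opNorm _).trans (mul_le_mul_of_nonneg_left hx (norm_nonneg _))
  have hnull : ∀ A, MeasurableSet A → A ⊆ Ω → (μHE[n] : Measure (Eu (n + 1))) A = 0 → P A = Q A := by
    intro A hAm hAΩ hA0
    refine measure_eq_of_compact_eq hAm fun K hK hKc => ?_
    refine measure_eq_of_isCompact hΩ hKc (hK.trans hAΩ) ?_ hbd hμ
    exact measure_mono_null hK (hausdorffMeasure_eq_zero_iff.1 hA0)
  have hμA : ∀ A, MeasurableSet A → μ A = P.real A - Q.real A := by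
    intro A hAm
    have : μ = μ.toJordanDecomposition.toSignedMeasure := μ.toSignedMeasure_toJordanDecomposition.symm
    conv_lhs => rw [this]
    rw [JordanDecomposition.toSignedMeasure, sub_apply,
      Measure.toSignedMeasure_apply_measurable hAm, Measure.toSignedMeasure_apply_measurable hAm]
  have hgB : IntegrableOn g B := hg.mono_set hBΩ
  -- The jump set in `B` is enclosed in a measurable null set. Off this set the derivative has the
  -- density `g`, and on it the measure vanishes.
  have hall : ∀ A, MeasurableSet A → A ⊆ B → P.real A - Q.real A = ∫ x in A, g x := by
    intro A hAm hAB
    obtain ⟨J, hJdef⟩ : ∃ J, J = toMeasurable (μHE[n] : Measure (Eu (n + 1))) (jumpSet Ω w ∩ B) :=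
      ⟨_, rfl⟩
    have hJm : MeasurableSet J := by rw [hJdef]; exact measurableSet_toMeasurable _ _
    have hJ0 : (μHE[n] : Measure (Eu (n + 1))) J = 0 := by rw [hJdef, measure_toMeasurable, hJ]
    have hJsub : jumpSet Ω w ∩ B ⊆ J := by rw [hJdef]; exact subset_toMeasurable _ _
    have h1 : P (A ∩ J) = Q (A ∩ J) := hnull _ (hAm.inter hJm)
      (inter_subset_left.trans (hAB.trans hBΩ)) (measure_mono_null inter_subset_right hJ0)
    have h2 := hA (A \ J) (hAm.diff hJm) fun x hx =>
      ⟨hBΩ (hAB hx.1), fun hxj => hx.2 (hJsub ⟨hxj, hAB hx.1⟩)⟩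
    rw [hμA _ (hAm.diff hJm)] at h2
    have h3 : ∫ x in A \ J, g x = ∫ x in A, g x := by
      refine setIntegral_congr_set ?_
      exact sdiff_null_ae_eq_self (volume_eq_zero_of_hausdorff hJ0)
    rw [h3] at h2
    have h4 : P.real (A ∩ J) = Q.real (A ∩ J) := by rw [measureReal_def, measureReal_def, h1]
    rw [← h2, ← measureReal_inter_add_sdiff (s := A) hJm, ← measureReal_inter_add_sdiff (s := A) hJm,
      h4]
    ring
  have hsigned : ∀ φ, IsTest B φ → signedIntegral μ φ = ∫ x in B, φ x * g x := by
    intro φ hφ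
    obtain ⟨Cφ, hCφ⟩ := hφ.bounded
    set gp : Eu (n + 1) → ℝ≥0∞ := fun x => ENNReal.ofReal (g x)
    set gm : Eu (n + 1) → ℝ≥0∞ := fun x => ENNReal.ofReal (-g x)
    have hgp : ∫⁻ x in B, gp x ≠ ⊤ := (Integrable.lintegral_lt_top hgB).ne
    have hgm : ∫⁻ x in B, gm x ≠ ⊤ := (Integrable.lintegral_lt_top (Integrable.neg hgB)).ne
    set νp := (volume.restrict B).withDensity gp
    set νm := (volume.restrict B).withDensity gm
    have : IsFiniteMeasure νp := isFiniteMeasure_withDensity hgp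
    have : IsFiniteMeasure νm := isFiniteMeasure_withDensity hgm
    -- The identity of signed measures is rearranged into an identity of finite positive measures,
    -- against which `φ` can be integrated.
    have hmeas : P.restrict B + νm = Q.restrict B + νp := by
      ext A hAm
      rw [Measure.add_apply, Measure.add_apply, Measure.restrict_apply hAm,
        Measure.restrict_apply hAm, withDensity_apply _ hAm, withDensity_apply _ hAm,
        Measure.restrict_restrict hAm]
      have h1 := hall (A ∩ B) (hAm.inter hB.measurableSet) inter_subset_right
      have hgA : IntegrableOn g (A ∩ B) := hgB.mono_set inter_subset_right
      rw [integral_eq_lintegral_pos_part_sub_lintegral_neg_part hgA] at h1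
      have f1 : ∫⁻ x in A ∩ B, gp x ≠ ⊤ := (Integrable.lintegral_lt_top hgA).ne
      have f2 : ∫⁻ x in A ∩ B, gm x ≠ ⊤ := (Integrable.lintegral_lt_top (Integrable.neg hgA)).ne
      rw [← ENNReal.toReal_eq_toReal_iff' (ENNReal.add_ne_top.2 ⟨measure_ne_top _ _, f2⟩)
        (ENNReal.add_ne_top.2 ⟨measure_ne_top _ _, f1⟩),
        ENNReal.toReal_add (measure_ne_top _ _) f2, ENNReal.toReal_add (measure_ne_top _ _) f1]
      simp only [measureReal_def] at h1
      linarith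
    have hbint : ∀ (m : Measure (Eu (n + 1))) [IsFiniteMeasure m], Integrable φ m := fun m _ =>
      Integrable.of_bound hφ.continuous.aestronglyMeasurable Cφ (Eventually.of_forall hCφ)
    have h1 := congrArg (fun m => ∫ x, φ x ∂m) hmeas
    rw [integral_add_measure (hbint _) (hbint _), integral_add_measure (hbint _) (hbint _)] at h1
    have hrestr : ∀ m : Measure (Eu (n + 1)), ∫ x in B, φ x ∂m = ∫ x, φ x ∂m := fun m =>
      setIntegral_eq_integral_of_forall_compl_eq_zero fun x hx =>
        image_eq_zero_of_notMem_tsupport fun h => hx (hφ.2.2 h)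
    rw [hrestr, hrestr] at h1
    have hae : AEMeasurable g (volume.restrict B) := hgB.aestronglyMeasurable.aemeasurable
    have e1 : ∫ x, φ x ∂νp = ∫ x in B, (gp x).toReal • φ x :=
      integral_withDensity_eq_integral_toReal_smul₀ hae.ennreal_ofReal
        (Eventually.of_forall fun _ => ENNReal.ofReal_lt_top) _
    have e2 : ∫ x, φ x ∂νm = ∫ x in B, (gm x).toReal • φ x :=
      integral_withDensity_eq_integral_toReal_smul₀ hae.neg.ennreal_ofReal
        (Eventually.of_forall fun _ => ENNReal.ofReal_lt_top) _
    have hmx : ∀ x, (gp x).toReal = max (g x) 0 ∧ (gm x).toReal = max (-g x) 0 := fun x =>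
      ⟨ENNReal.toReal_ofReal', ENNReal.toReal_ofReal'⟩
    have j1 : IntegrableOn (fun x => (gp x).toReal • φ x) B := by
      have := hgB.pos_part.bdd_mul (c := Cφ) hφ.continuous.aestronglyMeasurable
        (Eventually.of_forall hCφ)
      refine this.congr (Eventually.of_forall fun x => ?_)
      simp only [(hmx x).1, smul_eq_mul]; ring
    have j2 : IntegrableOn (fun x => (gm x).toReal • φ x) B := by
      have := hgB.neg_part.bdd_mul (c := Cφ) hφ.continuous.aestronglyMeasurable
        (Eventually.of_forall hCφ)
      refine this.congr (Eventually.of_forall fun x => ?_)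
      simp only [(hmx x).2, smul_eq_mul]; ring
    have e3 : ∫ x in B, φ x * g x = ∫ x, φ x ∂νp - ∫ x, φ x ∂νm := by
      rw [e1, e2, ← integral_sub j1 j2]
      congr 1; ext x
      simp only [(hmx x).1, (hmx x).2, smul_eq_mul]
      rw [← sub_mul, mul_comm]
      congr 1
      rcases le_total 0 (g x) with hx | hx
      · rw [max_eq_left hx, max_eq_right (by linarith)]; ring
      · rw [max_eq_right hx, max_eq_left (by linarith)]; ring
    rw [e3]
    have : signedIntegral μ φ = ∫ x, φ x ∂P - ∫ x, φ x ∂Q := rfl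
    rw [this]; linarith
  refine ⟨Ω.indicator g, hg.integrable_indicator hΩ.measurableSet, fun φ hφ => ?_⟩
  have hd := hφ.fderiv_apply h
  rw [integral_indicator_of_isTest hd subset_rfl, integral_indicator_of_isTest hφ subset_rfl,
    integral_indicator_of_isTest hφ hBΩ,
    ← integral_eq_setIntegral_of_isTest hφ subset_rfl, ← hsigned φ hφ,
    ← hμ φ (hφ.mono hBΩ), integral_eq_setIntegral_of_isTest hd hBΩ]

end Cutoff

/-! ### Rigidity: gradients in `O(N)H` without jumps are locally constant -/

section Rigidity

variable {N : ℕ}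

/-- The vectors of the standard basis. -/
abbrev unitVec (k : Fin N) : Eu N := EuclideanSpace.single k (1 : ℝ)

lemma sum_smul_unitVec (v : Eu N) : ∑ k, v k • unitVec k = v := by
  ext i
  simp [unitVec, Finset.sum_apply, Pi.single_apply]

lemma norm_le_sum_abs (v : Eu N) : ‖v‖ ≤ ∑ k, |v k| := by
  conv_lhs => rw [← sum_smul_unitVec v]
  refine (norm_sum_le _ _).trans (Finset.sum_le_sum fun k _ => ?_)
  rw [norm_smul]; simp [unitVec]

lemma hasWeakDeriv_of_contDiff {ψ : Eu N → ℝ} (hψ : ContDiff ℝ ∞ ψ) (U : Set (Eu N)) (h : Eu N) :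
    HasWeakDeriv U ψ h fun x => fderiv ℝ ψ x h := by
  intro φ hφ
  have hd : Continuous fun x => fderiv ℝ ψ x h :=
    (hψ.continuous_fderiv (by simp)).clm_apply continuous_const
  have hdφ := hφ.fderiv_apply h
  rw [eq_neg_iff_add_eq_zero, add_comm, ← eq_neg_iff_add_eq_zero]
  refine integral_mul_fderiv_eq_neg_fderiv_mul_of_integrable ?_ ?_ ?_ ?_ ?_
  · exact (hdφ.continuous.mul hψ.continuous).integrable_of_hasCompactSupport hdφ.2.1.mul_right
  · exact (hφ.continuous.mul hd).integrable_of_hasCompactSupport hφ.2.1.mul_right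
  · exact (hφ.continuous.mul hψ.continuous).integrable_of_hasCompactSupport hφ.2.1.mul_right
  · exact fun x _ => (hφ.1.differentiable (by simp)) x
  · exact fun x _ => (hψ.differentiable (by simp)) x

lemma HasWeakDeriv.congr {U : Set (Eu N)} {f f' g g' : Eu N → ℝ} {h : Eu N}
    (hw : HasWeakDeriv U f h g) (hf : ∀ᵐ x, x ∈ U → f x = f' x) (hg : ∀ᵐ x, x ∈ U → g x = g' x) :
    HasWeakDeriv U f' h g' := by
  intro φ hφ
  have e1 : ∫ x, fderiv ℝ φ x h * f' x = ∫ x, fderiv ℝ φ x h * f x := by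
    refine integral_congr_ae ?_
    filter_upwards [hf] with x hx
    by_cases hxU : x ∈ U
    · rw [hx hxU]
    · rw [image_eq_zero_of_notMem_tsupport fun h' => hxU ((hφ.fderiv_apply h).2.2 h')]; simp
  have e2 : ∫ x, φ x * g' x = ∫ x, φ x * g x := by
    refine integral_congr_ae ?_
    filter_upwards [hg] with x hx
    by_cases hxU : x ∈ U
    · rw [hx hxU]
    · rw [image_eq_zero_of_notMem_tsupport fun h' => hxU (hφ.2.2 h')]; simp
  rw [e1, e2, hw φ hφ]

lemma HasWeakDeriv.sum {ι : Type*} (s : Finset ι) {U : Set (Eu N)} {f g : ι → Eu N → ℝ} {h : Eu N}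
    (hf : ∀ i ∈ s, Integrable (f i)) (hg : ∀ i ∈ s, Integrable (g i))
    (hw : ∀ i ∈ s, HasWeakDeriv U (f i) h (g i)) :
    HasWeakDeriv U (fun x => ∑ i ∈ s, f i x) h fun x => ∑ i ∈ s, g i x := by
  intro φ hφ
  simp only [Finset.mul_sum]
  rw [integral_finsetSum _ fun i hi => (hφ.fderiv_apply h).integrable_mul (hf i hi),
    integral_finsetSum _ fun i hi => hφ.integrable_mul (hg i hi), ← Finset.sum_neg_distrib]
  exact Finset.sum_congr rfl fun i hi => hw i hi φ hφ

lemma HasWeakDeriv.sub {U : Set (Eu N)} {f g f' g' : Eu N → ℝ} {h : Eu N}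
    (hf : LocallyIntegrable f) (hf' : LocallyIntegrable f')
    (hg : LocallyIntegrable g) (hg' : LocallyIntegrable g')
    (hw : HasWeakDeriv U f h g) (hw' : HasWeakDeriv U f' h g') :
    HasWeakDeriv U (fun x => f x - f' x) h fun x => g x - g' x := by
  intro φ hφ
  have hd := hφ.fderiv_apply h
  have i : ∀ {ψ k : Eu N → ℝ}, IsTest U ψ → LocallyIntegrable k → Integrable fun x => ψ x * k x :=
    fun hψ hk => hk.integrable_smul_left_of_hasCompactSupport hψ.continuous hψ.2.1
  simp only [mul_sub]
  rw [integral_sub (i hd hf) (i hd hf'), integral_sub (i hφ hg) (i hφ hg'), hw φ hφ, hw' φ hφ]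
  ring

lemma HasWeakDeriv.ae_eq {U : Set (Eu N)} (hU : IsOpen U) {f g g' : Eu N → ℝ} {h : Eu N}
    (hg : Integrable g) (hg' : Integrable g')
    (hw : HasWeakDeriv U f h g) (hw' : HasWeakDeriv U f h g') : ∀ᵐ x, x ∈ U → g x = g' x := by
  have := hU.ae_eq_zero_of_integral_contDiff_smul_eq_zero (f := fun x => g x - g' x) (μ := volume)
    ((hg.sub hg').locallyIntegrable.locallyIntegrableOn U) fun φ h1 h2 h3 => by
      have hφ : IsTest U φ := ⟨h1, h2, h3⟩
      simp only [smul_eq_mul, mul_sub]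
      rw [integral_sub (hφ.integrable_mul hg) (hφ.integrable_mul hg'), sub_eq_zero,
        ← neg_inj, ← hw φ hφ, ← hw' φ hφ]
  filter_upwards [this] with x hx hxU
  exact sub_eq_zero.1 (hx hxU)

lemma HasWeakDeriv.zero_of_unitVec {U : Set (Eu N)} {f : Eu N → ℝ} (hf : Integrable f)
    (hw : ∀ k, HasWeakDeriv U f (unitVec k) fun _ => 0) (h : Eu N) :
    HasWeakDeriv U f h fun _ => 0 := by
  intro φ hφ
  have e : ∀ x, fderiv ℝ φ x h * f x = ∑ k, h k * (fderiv ℝ φ x (unitVec k) * f x) := by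
    intro x
    conv_lhs => rw [← sum_smul_unitVec h]
    simp only [map_sum, map_smul, smul_eq_mul, Finset.sum_mul, mul_assoc]
  simp only [e]
  rw [integral_finsetSum _ fun k _ =>
    ((hφ.fderiv_apply (unitVec k)).integrable_mul hf).const_mul (h k)]
  simp only [integral_const_mul, hw _ φ hφ]
  simp

/-- Almost every point is a point of convergence of the mollifications. Two such points are joined
by a segment in the convex set, along which the Lipschitz bound is zero. -/
lemma ae_eq_const_of_hasWeakDeriv_zero {U : Set (Eu N)} (hU : IsOpen U) (hc : Convex ℝ U)
    {f : Eu N → ℝ} (hf : Integrable f) (hw : ∀ h, HasWeakDeriv U f h fun _ => 0) :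
    ∃ c, ∀ᵐ x, x ∈ U → f x = c := by
  rcases U.eq_empty_or_nonempty with rfl | hne
  · exact ⟨0, by simp⟩
  have hae := ae_tendsto_moll hf
  obtain ⟨x₀, hx₀U, hx₀⟩ := (Measure.dense_of_ae hae).inter_open_nonempty U hU hne
  refine ⟨f x₀, ?_⟩
  filter_upwards [hae] with x hx hxU
  have := abs_sub_le_of_hasWeakDeriv hU hf (hw (x - x₀)) (M := 0) (by simp)
    (hc.segment_subset hx₀U hxU) hx₀ hx
  exact sub_eq_zero.1 (abs_nonpos_iff.1 this)

lemma exists_lin_eq {M : Matrix (Fin N) (Fin N) ℝ} (hM : M.det ≠ 0) (y : Eu N) :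
    ∃ x, lin M x = y := by
  refine ⟨lin M⁻¹ y, ?_⟩
  rw [← lin_mul, Matrix.mul_nonsing_inv _ (isUnit_iff_ne_zero.2 hM)]
  simp [lin]

lemma det_orthogonal_ne_zero {Q : Matrix (Fin N) (Fin N) ℝ}
    (hQ : Q ∈ Matrix.orthogonalGroup (Fin N) ℝ) : Q.det ≠ 0 := by
  have h1 : Q.transpose * Q = 1 := (Matrix.mem_orthogonalGroup_iff' (Fin N) ℝ).1 hQ
  intro h
  have := congrArg Matrix.det h1
  rw [Matrix.det_mul, h, mul_zero, Matrix.det_one] at this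
  exact zero_ne_one this

lemma inner_lin_orthogonal {Q : Matrix (Fin N) (Fin N) ℝ}
    (hQ : Q ∈ Matrix.orthogonalGroup (Fin N) ℝ) (x y : Eu N) :
    inner ℝ (lin Q x) (lin Q y) = inner ℝ x y := by
  rw [real_inner_eq_norm_mul_self_add_norm_mul_self_sub_norm_sub_mul_self_div_two,
    real_inner_eq_norm_mul_self_add_norm_mul_self_sub_norm_sub_mul_self_div_two, ← map_sub,
    norm_lin_orthogonal hQ, norm_lin_orthogonal hQ, norm_lin_orthogonal hQ]

lemma inner_eq_sum (x y : Eu N) : inner ℝ x y = ∑ a, x a * y a := by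
  rw [PiLp.inner_apply]
  exact Finset.sum_congr rfl fun a _ => by simp [mul_comm]

lemma fderiv_fderiv_comm {φ : Eu N → ℝ} (hφ : ContDiff ℝ ∞ φ) (h k x : Eu N) :
    fderiv ℝ (fun y => fderiv ℝ φ y h) x k = fderiv ℝ (fun y => fderiv ℝ φ y k) x h := by
  have hd : Differentiable ℝ (fderiv ℝ φ) :=
    (hφ.fderiv_right (m := ∞) (by simp)).differentiable (by simp)
  have e : ∀ h k, fderiv ℝ (fun y => fderiv ℝ φ y h) x k = fderiv ℝ (fderiv ℝ φ) x k h := by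
    intro h k
    rw [fderiv_clm_apply (hd x) (differentiableAt_const h)]
    simp
  rw [e, e]
  have h2 : ContDiff ℝ 2 φ := contDiff_infty.1 hφ 2
  exact (h2.contDiffAt.isSymmSndFDerivAt (by simp)) k h

/-- A weak gradient of `O(N)H`-valued matrices whose entries are weakly differentiable is constant:
the second derivatives satisfy the symmetries of a Levi-Civita connection of a flat metric. -/
lemma ae_eq_const_of_rigid {H : Matrix (Fin N) (Fin N) ℝ} (hH : H.det ≠ 0) {B : Set (Eu N)}
    (hB : IsOpen B) (hBc : Convex ℝ B) (hBb : volume B ≠ ⊤) {G : Eu N → Eu N →L[ℝ] Eu N}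
    (hG : ∀ x, ∃ Q ∈ Matrix.orthogonalGroup (Fin N) ℝ, G x = lin (Q * H))
    (hGm : AEStronglyMeasurable G (volume.restrict B)) {U : Fin N → Eu N → ℝ}
    (hU : ∀ i a, HasWeakDeriv B (U a) (unitVec i) (B.indicator fun x => G x (unitVec i) a))
    {D : Fin N → Fin N → Fin N → Eu N → ℝ} (hD : ∀ k i a, Integrable (D k i a))
    (hw : ∀ k i a, HasWeakDeriv B (B.indicator fun x => G x (unitVec i) a) (unitVec k) (D k i a)) :
    ∃ Q ∈ Matrix.orthogonalGroup (Fin N) ℝ, ∀ᵐ x, x ∈ B → G x = lin (Q * H) := by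
  classical
  set f : Fin N → Fin N → Eu N → ℝ := fun i a => B.indicator fun x => G x (unitVec i) a with hf
  have hcoord : ∀ (v : Eu N) a, |v a| ≤ ‖v‖ := fun v a => PiLp.norm_apply_le v a
  have hbd : ∀ i a x, |f i a x| ≤ ∑ j, ‖lin H (unitVec j)‖ := by
    intro i a x
    have hs : ‖lin H (unitVec i)‖ ≤ ∑ j, ‖lin H (unitVec j)‖ :=
      Finset.single_le_sum (f := fun j => ‖lin H (unitVec j)‖) (fun j _ => norm_nonneg _)
        (Finset.mem_univ i)
    by_cases hx : x ∈ B
    · simp only [hf, indicator_of_mem hx]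
      obtain ⟨Q, hQ, hGx⟩ := hG x
      rw [hGx]
      refine (hcoord _ _).trans ?_
      rw [lin_mul, norm_lin_orthogonal hQ]
      exact hs
    · simp only [hf, indicator_of_notMem hx, abs_zero]
      exact (norm_nonneg _).trans hs
  have hfint : ∀ i a, Integrable (f i a) := by
    intro i a
    have hm : AEStronglyMeasurable (fun x => G x (unitVec i) a) (volume.restrict B) :=
      (((EuclideanSpace.proj (𝕜 := ℝ) a).comp
        (ContinuousLinearMap.apply ℝ (Eu N) (unitVec i))).continuous.comp_aestronglyMeasurable hGm)
    rw [hf]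
    refine (integrable_indicator_iff hB.measurableSet).2 ?_
    have : IsFiniteMeasure (volume.restrict B) :=
      ⟨by rw [Measure.restrict_apply_univ]; exact hBb.lt_top⟩
    refine Integrable.of_bound hm (∑ j, ‖lin H (unitVec j)‖) ?_
    refine (ae_restrict_iff' hB.measurableSet).2 (Eventually.of_forall fun x hx => ?_)
    have := hbd i a x
    simp only [hf, indicator_of_mem hx] at this
    exact this
  -- Second derivatives of a test function commute, and both sides are second distributional
  -- derivatives of `U a`.
  have hsymm : ∀ k i a, ∀ᵐ x, x ∈ B → D k i a x = D i k a x := by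
    intro k i a
    have := hB.ae_eq_zero_of_integral_contDiff_smul_eq_zero
      (f := fun x => D k i a x - D i k a x) (μ := volume)
      (((hD k i a).sub (hD i k a)).locallyIntegrable.locallyIntegrableOn B) fun φ h1 h2 h3 => by
        have hφ : IsTest B φ := ⟨h1, h2, h3⟩
        have key : ∀ k i, ∫ x, φ x * D k i a x =
            ∫ x, fderiv ℝ (fun y => fderiv ℝ φ y (unitVec k)) x (unitVec i) * U a x := by
          intro k i
          rw [hU i a _ (hφ.fderiv_apply (unitVec k)), hw k i a φ hφ, neg_neg]
        simp only [smul_eq_mul, mul_sub]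
        rw [integral_sub (hφ.integrable_mul (hD k i a)) (hφ.integrable_mul (hD i k a)), key, key,
          sub_eq_zero]
        congr 1; ext x
        rw [fderiv_fderiv_comm h1]
    filter_upwards [this] with x hx hxB
    exact sub_eq_zero.1 (hx hxB)
  -- The inner products of the columns are those of `H`, hence constant. Their weak derivatives,
  -- computed by the product rule, vanish.
  have hanti : ∀ k i j, ∀ᵐ x, x ∈ B → ∑ a, (f i a x * D k j a x + D k i a x * f j a x) = 0 := by
    intro k i j
    have hpi : ∀ a, Integrable fun x => f i a x * f j a x := fun a =>
      (hfint j a).bdd_mul (hfint i a).aestronglyMeasurable (Eventually.of_forall (hbd i a))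
    have hpd : ∀ a, Integrable fun x => f i a x * D k j a x + D k i a x * f j a x := by
      intro a
      refine ((hD k j a).bdd_mul (hfint i a).aestronglyMeasurable
        (Eventually.of_forall (hbd i a))).add ?_
      refine ((hD k i a).bdd_mul (hfint j a).aestronglyMeasurable
        (Eventually.of_forall (hbd j a))).congr (Eventually.of_forall fun x => ?_)
      exact mul_comm _ _
    have h1 := HasWeakDeriv.sum Finset.univ (U := B) (h := unitVec k) (fun a _ => hpi a)
      (fun a _ => hpd a) fun a _ => HasWeakDeriv.mul hB (hfint i a) (hfint j a) (hD k i a)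
        (hD k j a) (hbd i a) (hbd j a) (hw k i a) (hw k j a)
    have h2 : HasWeakDeriv B (fun x => ∑ a, f i a x * f j a x) (unitVec k) fun _ => 0 := by
      have hc := hasWeakDeriv_of_contDiff
        (contDiff_const (c := inner ℝ (lin H (unitVec i)) (lin H (unitVec j)))) B (unitVec k)
      refine hc.congr (Eventually.of_forall fun x hx => ?_) (Eventually.of_forall fun x _ => by simp)
      simp only [hf, indicator_of_mem hx]
      obtain ⟨Q, hQ, hGx⟩ := hG x
      rw [← inner_eq_sum, hGx, lin_mul, lin_mul, inner_lin_orthogonal hQ]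
    have := HasWeakDeriv.ae_eq hB (integrable_finsetSum _ fun a _ => hpd a)
      (integrable_zero _ _ _) h1 h2
    filter_upwards [this] with x hx hxB
    exact hx hxB
  have hzero : ∀ᵐ x, x ∈ B → ∀ k i a, D k i a x = 0 := by
    have A1 : ∀ᵐ x, ∀ k i a, x ∈ B → D k i a x = D i k a x :=
      ae_all_iff.2 fun k => ae_all_iff.2 fun i => ae_all_iff.2 fun a => hsymm k i a
    have A2 : ∀ᵐ x, ∀ k i j, x ∈ B → ∑ a, (f i a x * D k j a x + D k i a x * f j a x) = 0 :=
      ae_all_iff.2 fun k => ae_all_iff.2 fun i => ae_all_iff.2 fun j => hanti k i j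
    filter_upwards [A1, A2] with x h1 h2 hxB k i a
    -- Christoffel symbols with lowered index: the derivative in direction `k` of column `i`, paired
    -- with column `j`. They are symmetric in the first two indices and antisymmetric in the last
    -- two, so cycling through the permutations gives zero.
    set c : Fin N → Fin N → Fin N → ℝ := fun k i j => ∑ a, D k i a x * f j a x with hc
    have c1 : ∀ k i j, c k i j = c i k j := fun k i j =>
      Finset.sum_congr rfl fun a _ => by rw [h1 k i a hxB]
    have c2 : ∀ k i j, c k j i + c k i j = 0 := by
      intro k i j
      rw [← h2 k i j hxB, Finset.sum_add_distrib]
      congr 1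
      exact Finset.sum_congr rfl fun a _ => mul_comm _ _
    have c3 : ∀ k i j, c k i j = 0 := by
      intro k i j
      have e1 := c1 k i j
      have e2 := c2 i k j
      have e3 := c1 i j k
      have e4 := c2 j i k
      have e5 := c1 j k i
      have e6 := c2 k j i
      linarith
    obtain ⟨d, hd⟩ : ∃ d : Eu N, ∀ a, d a = D k i a x := ⟨WithLp.toLp 2 fun a => D k i a x, fun _ => rfl⟩
    obtain ⟨Q, hQ, hGx⟩ := hG x
    -- The derivative of a column is orthogonal to all columns, and these span the space because `Q
    -- * H` is invertible.
    have horth : ∀ j, inner ℝ d (G x (unitVec j)) = 0 := by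
      intro j
      rw [inner_eq_sum, ← c3 k i j]
      refine Finset.sum_congr rfl fun a _ => ?_
      simp only [hf, indicator_of_mem hxB, hd]
    have hall : ∀ v, inner ℝ d (G x v) = 0 := by
      intro v
      rw [← sum_smul_unitVec v, map_sum, inner_sum]
      refine Finset.sum_eq_zero fun j _ => ?_
      rw [map_smul, inner_smul_right, horth, mul_zero]
    obtain ⟨v, hv⟩ := exists_lin_eq (M := Q * H)
      (by rw [Matrix.det_mul]; exact mul_ne_zero (det_orthogonal_ne_zero hQ) hH) d
    have : inner ℝ d d = 0 := by
      have := hall v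
      rwa [hGx, hv] at this
    rw [inner_self_eq_zero] at this
    rw [← hd, this]; rfl
  have hconst : ∀ i a, ∃ c, ∀ᵐ x, x ∈ B → f i a x = c := by
    intro i a
    refine ae_eq_const_of_hasWeakDeriv_zero hB hBc (hfint i a)
      (HasWeakDeriv.zero_of_unitVec (hfint i a) fun k => (hw k i a).congr ?_ ?_)
    · exact Eventually.of_forall fun x _ => rfl
    · filter_upwards [hzero] with x hx hxB
      exact hx hxB k i a
  choose c hc using hconst
  have hall : ∀ᵐ x, ∀ i a, x ∈ B → f i a x = c i a :=
    ae_all_iff.2 fun i => ae_all_iff.2 fun a => hc i a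
  rcases B.eq_empty_or_nonempty with rfl | hne
  · exact ⟨1, one_mem _, by simp⟩
  obtain ⟨x₀, hx₀B, hx₀⟩ := (Measure.dense_of_ae hall).inter_open_nonempty B hB hne
  obtain ⟨Q, hQ, hGx⟩ := hG x₀
  refine ⟨Q, hQ, ?_⟩
  filter_upwards [hall] with x hx hxB
  rw [← hGx]
  ext v a
  rw [← sum_smul_unitVec v, map_sum, map_sum]
  simp only [map_smul, WithLp.ofLp_sum, Finset.sum_apply, WithLp.ofLp_smul, Pi.smul_apply]
  refine Finset.sum_congr rfl fun i _ => ?_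
  have e1 := hx i a hxB
  have e2 := hx₀ i a hx₀B
  simp only [hf, indicator_of_mem hxB, indicator_of_mem hx₀B] at e1 e2
  rw [e1, e2]

end Rigidity

/-! ### The Lipschitz representative of a deformation -/

section Representative

variable {N n : ℕ}

/-- The hyperplane with unit normal `ν` at signed distance `c` from the origin. -/
def hyperplane (ν : Eu N) (c : ℝ) : Set (Eu N) := {x | inner ℝ x ν = c}

/-- The differences of `n + 1` points span a space of dimension at most `n`, so they have a common
unit normal in dimension `n + 1`. -/
lemma exists_hyperplane_of_points (s : Fin (n + 1) → Eu (n + 1)) :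
    ∃ (ν : Eu (n + 1)) (c : ℝ), ‖ν‖ = 1 ∧ convexHull ℝ (range s) ⊆ hyperplane ν c := by
  have h1 : Module.finrank ℝ (vectorSpan ℝ (range s)) ≤ n :=
    finrank_vectorSpan_range_le ℝ s (by simp)
  have h2 : (vectorSpan ℝ (range s))ᗮ ≠ ⊥ := by
    intro h
    rw [Submodule.orthogonal_eq_bot_iff] at h
    rw [h, finrank_top, finrank_euclideanSpace_fin] at h1
    omega
  obtain ⟨v, hv, hv0⟩ := Submodule.exists_mem_ne_zero_of_ne_bot h2
  have hvn : ‖v‖ ≠ 0 := norm_ne_zero_iff.2 hv0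
  refine ⟨‖v‖⁻¹ • v, inner ℝ (s 0) (‖v‖⁻¹ • v), ?_, ?_⟩
  · rw [norm_smul, norm_inv, norm_norm, inv_mul_cancel₀ hvn]
  · refine convexHull_min ?_ ?_
    · rintro _ ⟨k, rfl⟩
      have := (Submodule.mem_orthogonal' _ _).1 hv _
        (vsub_mem_vectorSpan ℝ (mem_range_self k) (mem_range_self 0))
      rw [vsub_eq_sub, real_inner_comm, inner_sub_left, sub_eq_zero] at this
      simp only [hyperplane, mem_ofPred_eq, inner_smul_right, this]
    · intro x hx y hy a b _ _ hab
      simp only [hyperplane, mem_ofPred_eq] at hx hy ⊢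
      rw [inner_add_left, inner_smul_left, inner_smul_left, hx, hy]
      simp only [conj_trivial]
      rw [← add_mul, hab, one_mul]

/-- A polyhedral set is contained, up to a null set, in finitely many distinct hyperplanes. -/
lemma IsPolyhedral.exists_hyperplanes {Ω K : Set (Eu (n + 1))} (h : IsPolyhedral Ω K) :
    ∃ (m : ℕ) (ν : Fin m → Eu (n + 1)) (c : Fin m → ℝ), (∀ j, ‖ν j‖ = 1) ∧
      (Function.Injective fun j => hyperplane (ν j) (c j)) ∧
      (μHE[n] : Measure (Eu (n + 1))) (K \ ⋃ j, hyperplane (ν j) (c j)) = 0 := by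
  classical
  obtain ⟨m, s, -, hK⟩ := h
  choose ν c hν hs using fun k => exists_hyperplane_of_points (s k)
  -- Several simplices may lie in the same hyperplane. Passing to the finite set of hyperplanes
  -- makes the enumeration injective.
  set F : Finset (Set (Eu (n + 1))) := Finset.univ.image fun k => hyperplane (ν k) (c k) with hF
  have hrep : ∀ q : F, ∃ k, hyperplane (ν k) (c k) = q := by
    rintro ⟨q, hq⟩
    obtain ⟨k, -, hk⟩ := Finset.mem_image.1 hq
    exact ⟨k, hk⟩
  choose r hr using hrep
  refine ⟨F.card, fun j => ν (r (F.equivFin.symm j)), fun j => c (r (F.equivFin.symm j)),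
    fun j => hν _, ?_, ?_⟩
  · intro i j hij
    simp only [hr] at hij
    exact F.equivFin.symm.injective (Subtype.ext hij)
  · have hK' : (μHE[n] : Measure (Eu (n + 1))) (K \ (Ω ∩ ⋃ k, convexHull ℝ (range (s k)))) = 0 :=
      (ae_eq_set.1 hK).1
    refine measure_mono_null ?_ hK'
    intro x hx
    refine ⟨hx.1, fun hx' => hx.2 ?_⟩
    obtain ⟨k, hk⟩ := mem_iUnion.1 hx'.2
    have hmem : hyperplane (ν k) (c k) ∈ F := Finset.mem_image_of_mem _ (Finset.mem_univ k)
    refine mem_iUnion.2 ⟨F.equivFin ⟨_, hmem⟩, ?_⟩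
    simp only [hr, Equiv.symm_apply_apply]
    exact hs k hk

lemma IsSobolev.hasWeakDeriv {Ω : Set (Eu N)} (hb : volume Ω ≠ ⊤)
    {u : Eu N → Eu N} {G : Eu N → Eu N →L[ℝ] Eu N} (h : IsSobolev ⊤ Ω u G) (a : Fin N) (v : Eu N) :
    HasWeakDeriv Ω (Ω.indicator fun x => u x a) v (Ω.indicator fun x => G x v a) := by
  have hfin : IsFiniteMeasure (volume.restrict Ω) :=
    ⟨by rw [Measure.restrict_apply_univ]; exact hb.lt_top⟩
  intro φ hφ
  have hd := hφ.fderiv_apply v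
  have hui : Integrable u (volume.restrict Ω) := h.1.integrable le_top
  have hGi : Integrable (fun x => G x v) (volume.restrict Ω) :=
    (ContinuousLinearMap.apply ℝ (Eu N) v).integrable_comp (h.2.1.integrable le_top)
  have hprod : ∀ {ψ : Eu N → ℝ} {k : Eu N → Eu N}, IsTest Ω ψ → Integrable k (volume.restrict Ω) →
      Integrable (fun x => ψ x • k x) (volume.restrict Ω) := by
    intro ψ k hψ hk
    obtain ⟨C, hC⟩ := hψ.bounded
    exact hk.bdd_smul C hψ.continuous.aestronglyMeasurable (Eventually.of_forall hC)
  have key := congrArg (EuclideanSpace.proj (𝕜 := ℝ) a) (h.2.2 φ hφ v)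
  rw [map_neg, ← ContinuousLinearMap.integral_comp_comm _ (hprod hd hui),
    ← ContinuousLinearMap.integral_comp_comm _ (hprod hφ hGi)] at key
  rw [integral_indicator_of_isTest hd subset_rfl, integral_indicator_of_isTest hφ subset_rfl,
    ← integral_eq_setIntegral_of_isTest hd subset_rfl,
    ← integral_eq_setIntegral_of_isTest hφ subset_rfl]
  exact key

lemma HasWeakDeriv.mono {U V : Set (Eu N)} {f g : Eu N → ℝ} {h : Eu N} (hw : HasWeakDeriv V f h g)
    (hUV : U ⊆ V) : HasWeakDeriv U f h g := fun φ hφ => hw φ (hφ.mono hUV)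

lemma integrable_indicator_coord {Ω : Set (Eu N)} (hΩ : IsOpen Ω) (hb : volume Ω ≠ ⊤)
    {u : Eu N → Eu N} (hu : MemLp u ⊤ (volume.restrict Ω)) (a : Fin N) :
    Integrable (Ω.indicator fun x => u x a) := by
  have hfin : IsFiniteMeasure (volume.restrict Ω) :=
    ⟨by rw [Measure.restrict_apply_univ]; exact hb.lt_top⟩
  refine (integrable_indicator_iff hΩ.measurableSet).2 ?_
  exact (EuclideanSpace.proj (𝕜 := ℝ) a).integrable_comp (hu.integrable le_top)

/-- A function with bounded weak gradient has a representative that is Lipschitz on all balls in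
the domain, with a uniform constant. -/
lemma IsSobolev.exists_lipschitz {Ω : Set (Eu N)} (hΩ : IsOpen Ω) (hb : volume Ω ≠ ⊤)
    {u : Eu N → Eu N} {G : Eu N → Eu N →L[ℝ] Eu N} (h : IsSobolev ⊤ Ω u G) {M : ℝ}
    (hM : ∀ᵐ x ∂(volume.restrict Ω), ‖G x‖ ≤ M) :
    ∃ (C : ℝ≥0) (u' : Eu N → Eu N), (∀ᵐ x, x ∈ Ω → u x = u' x) ∧
      ∀ x r, Metric.ball x r ⊆ Ω → LipschitzOnWith C u' (Metric.ball x r) := by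
  have hint := integrable_indicator_coord hΩ hb h.1
  set f : Fin N → Eu N → ℝ := fun a => Ω.indicator fun x => u x a with hf
  have hae : ∀ᵐ x, ∀ a, Tendsto (fun i => moll i (f a) x) atTop (𝓝 (f a x)) :=
    ae_all_iff.2 fun a => ae_tendsto_moll (hint a)
  -- The points at which all mollified coordinates converge; they have full measure, so `A` is dense
  -- in `Ω`.
  set D : Set (Eu N) := {x | ∀ a, Tendsto (fun i => moll i (f a) x) atTop (𝓝 (f a x))} with hD
  set A : Set (Eu N) := Ω ∩ D with hA
  have hAcl : Ω ⊆ closure A := fun x hx =>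
    hΩ.inter_closure ⟨hx, by rw [(Measure.dense_of_ae hae).closure_eq]; trivial⟩
  have hLip : ∀ x r, Metric.ball x r ⊆ Ω →
      LipschitzOnWith (Real.toNNReal (N * |M|)) u (A ∩ Metric.ball x r) := by
    intro x r hxr
    refine LipschitzOnWith.of_dist_le_mul fun y hy z hz => ?_
    rw [Real.coe_toNNReal _ (by positivity), dist_eq_norm, dist_eq_norm]
    refine (norm_le_sum_abs _).trans ?_
    have : ∀ a, |(u y - u z) a| ≤ |M| * ‖y - z‖ := by
      intro a
      have hbd : ∀ᵐ x, |Ω.indicator (fun x => G x (y - z) a) x| ≤ |M| * ‖y - z‖ := by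
        rw [ae_restrict_iff' hΩ.measurableSet] at hM
        filter_upwards [hM] with x hx
        by_cases hxΩ : x ∈ Ω
        · rw [indicator_of_mem hxΩ]
          refine (PiLp.norm_apply_le (G x (y - z)) a).trans (((G x).le_opNorm _).trans ?_)
          exact mul_le_mul_of_nonneg_right ((hx hxΩ).trans (le_abs_self M)) (norm_nonneg _)
        · rw [indicator_of_notMem hxΩ, abs_zero]; positivity
      have := abs_sub_le_of_hasWeakDeriv hΩ (hint a) (h.hasWeakDeriv hb a (y - z)) hbd
        (((convex_ball x r).segment_subset hz.2 hy.2).trans hxr) (hz.1.2 a) (hy.1.2 a)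
      simpa [hf, indicator_of_mem hy.1.1, indicator_of_mem hz.1.1] using this
    calc ∑ a, |(u y - u z) a| ≤ ∑ _a : Fin N, |M| * ‖y - z‖ := Finset.sum_le_sum fun a _ => this a
      _ = N * |M| * ‖y - z‖ := by simp [mul_assoc]
  -- On each ball the function extends from the dense set `A` to a Lipschitz function, which shows
  -- that the limits along `A` exist. The limits themselves do not depend on the ball, so the local
  -- extensions fit together.
  have hext : ∀ x r, Metric.ball x r ⊆ Ω → ∃ g : Eu N → Eu N,
      LipschitzWith (lipschitzExtensionConstant (Eu N) * Real.toNNReal (N * |M|)) g ∧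
      EqOn u g (A ∩ Metric.ball x r) ∧ EqOn (extendFrom A u) g (Metric.ball x r) := by
    intro x r hxr
    obtain ⟨g, hg, hug⟩ := (hLip x r hxr).extend_finite_dimension
    refine ⟨g, hg, hug, fun y hy => extendFrom_eq (hAcl (hxr hy)) ?_⟩
    have hg' : Tendsto g (𝓝[A] y) (𝓝 (g y)) := hg.continuous.continuousAt.mono_left nhdsWithin_le_nhds
    refine hg'.congr' ?_
    filter_upwards [self_mem_nhdsWithin, nhdsWithin_le_nhds (Metric.isOpen_ball.mem_nhds hy)] with z h1 h2
    exact (hug ⟨h1, h2⟩).symm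
  refine ⟨lipschitzExtensionConstant (Eu N) * Real.toNNReal (N * |M|), extendFrom A u, ?_, fun x r hxr => ?_⟩
  · filter_upwards [hae] with x hx hxΩ
    obtain ⟨r, hr, hxr⟩ := Metric.isOpen_iff.1 hΩ x hxΩ
    obtain ⟨g, -, h1, h2⟩ := hext x r hxr
    rw [h2 (Metric.mem_ball_self hr), h1 ⟨⟨hxΩ, hx⟩, Metric.mem_ball_self hr⟩]
  · obtain ⟨g, hg, -, h2⟩ := hext x r hxr
    intro y hy z hz
    rw [h2 hy, h2 hz]
    exact hg y z

lemma volume_ne_top_of_isBounded {s : Set (Eu N)} (h : Bornology.IsBounded s) : volume s ≠ ⊤ :=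
  h.measure_lt_top.ne

/-- The representative is affine, with gradient in `O(N)H`, on balls that miss the jump set. -/
lemma exists_affine_on_ball {H : Matrix (Fin (n + 1)) (Fin (n + 1)) ℝ} (hH : H.det ≠ 0)
    {Ω : Set (Eu (n + 1))} (hΩ : IsOpen Ω) (hb : Bornology.IsBounded Ω)
    {u : Eu (n + 1) → Eu (n + 1)} {G : Eu (n + 1) → Eu (n + 1) →L[ℝ] Eu (n + 1)}
    (hS : IsSobolev ⊤ Ω u G) (hV : IsSBV Ω G)
    (hG : ∀ᵐ x ∂(volume.restrict Ω), ∃ Q ∈ Matrix.orthogonalGroup (Fin (n + 1)) ℝ, G x = lin (Q * H))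
    {u' : Eu (n + 1) → Eu (n + 1)} (hu : ∀ᵐ x, x ∈ Ω → u x = u' x)
    {x : Eu (n + 1)} {r : ℝ} (hx : Metric.ball x r ⊆ Ω) (hcont : ContinuousOn u' (Metric.ball x r))
    (hJ : (μHE[n] : Measure (Eu (n + 1))) (jumpSet Ω G ∩ Metric.ball x r) = 0) :
    ∃ Q ∈ Matrix.orthogonalGroup (Fin (n + 1)) ℝ,
      (∀ᵐ y, y ∈ Metric.ball x r → G y = lin (Q * H)) ∧
      ∀ y ∈ Metric.ball x r, ∀ z ∈ Metric.ball x r, u' y - u' z = lin (Q * H) (y - z) := by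
  classical
  set B := Metric.ball x r with hBdef
  have hBo : IsOpen B := Metric.isOpen_ball
  have hbΩ := volume_ne_top_of_isBounded hb
  have hbB : volume B ≠ ⊤ := volume_ne_top_of_isBounded Metric.isBounded_ball
  rw [ae_restrict_iff' hΩ.measurableSet] at hG
  -- The gradient is changed on a null set so that it takes values in `O(N)H` at every point.
  set G' : Eu (n + 1) → Eu (n + 1) →L[ℝ] Eu (n + 1) := fun y =>
    if ∃ Q ∈ Matrix.orthogonalGroup (Fin (n + 1)) ℝ, G y = lin (Q * H) then G y else lin H with hG'
  have hGG' : ∀ᵐ y, y ∈ Ω → G y = G' y := by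
    filter_upwards [hG] with y hy hyΩ
    simp only [hG', if_pos (hy hyΩ)]
  have hall : ∀ y, ∃ Q ∈ Matrix.orthogonalGroup (Fin (n + 1)) ℝ, G' y = lin (Q * H) := by
    intro y
    by_cases h : ∃ Q ∈ Matrix.orthogonalGroup (Fin (n + 1)) ℝ, G y = lin (Q * H)
    · simpa only [hG', if_pos h] using h
    · exact ⟨1, one_mem _, by simp only [hG', if_neg h, one_mul]⟩
  have hnorm : ∀ᵐ y ∂(volume.restrict Ω), ‖G y‖ ≤ ‖lin H‖ := by
    rw [ae_restrict_iff' hΩ.measurableSet]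
    filter_upwards [hG] with y hy hyΩ
    obtain ⟨Q, hQ, hGy⟩ := hy hyΩ
    rw [hGy]
    refine ContinuousLinearMap.opNorm_le_bound _ (norm_nonneg _) fun v => ?_
    rw [lin_mul, norm_lin_orthogonal hQ]
    exact (lin H).le_opNorm v
  have hind : ∀ i a, ∀ᵐ y, y ∈ B → B.indicator (fun y => G y (unitVec i) a) y =
      B.indicator (fun y => G' y (unitVec i) a) y := by
    intro i a
    filter_upwards [hGG'] with y hy hyB
    rw [indicator_of_mem hyB, indicator_of_mem hyB, hy (hx hyB)]
  have hSBV := fun k i a => hV.exists_hasWeakDeriv hΩ hBo hx hnorm hJ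
    ((EuclideanSpace.proj (𝕜 := ℝ) a).comp
      (ContinuousLinearMap.apply ℝ (Eu (n + 1)) (unitVec i))) (unitVec k)
  choose D hD hwD using hSBV
  have hGm : AEStronglyMeasurable G' (volume.restrict B) := by
    have h1 : AEStronglyMeasurable G (volume.restrict B) :=
      hS.2.1.aestronglyMeasurable.mono_measure (Measure.restrict_mono hx le_rfl)
    refine h1.congr ?_
    rw [EventuallyEq, ae_restrict_iff' hBo.measurableSet]
    filter_upwards [hGG'] with y hy hyB
    exact hy (hx hyB)
  obtain ⟨Q, hQ, hQG⟩ := ae_eq_const_of_rigid hH hBo (convex_ball x r) hbB hall hGm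
    (U := fun a => Ω.indicator fun y => u y a)
    (fun i a => ((hS.hasWeakDeriv hbΩ a (unitVec i)).mono hx).congr
      (Eventually.of_forall fun _ _ => rfl) (by
        filter_upwards [hGG'] with y hy hyB
        rw [indicator_of_mem (hx hyB), indicator_of_mem hyB, hy (hx hyB)]))
    (D := fun k i a => B.indicator (D k i a)) (fun k i a => (hD k i a).indicator hBo.measurableSet)
    (fun k i a => (hwD k i a).congr (hind i a) (Eventually.of_forall fun _ _ => rfl))
  have hQG' : ∀ᵐ y, y ∈ B → G y = lin (Q * H) := by
    filter_upwards [hQG, hGG'] with y h1 h2 hyB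
    rw [h2 (hx hyB), h1 hyB]
  refine ⟨Q, hQ, hQG', ?_⟩
  set L := lin (Q * H) with hL
  -- Once the gradient is constant, `u - L` has vanishing weak gradient on the ball.
  have hconst : ∀ a, ∃ c, ∀ᵐ y, y ∈ B → B.indicator (fun y => u y a - L y a) y = c := by
    intro a
    have hLc : ContDiff ℝ ∞ fun y : Eu (n + 1) => L y a :=
      ((EuclideanSpace.proj (𝕜 := ℝ) a).comp L).contDiff
    have hint : Integrable (B.indicator fun y => u y a - L y a) := by
      refine (integrable_indicator_iff hBo.measurableSet).2 (Integrable.sub ?_ ?_)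
      · have := (integrable_indicator_iff hΩ.measurableSet).1 (integrable_indicator_coord hΩ hbΩ hS.1 a)
        exact this.mono_set hx
      · exact (hLc.continuous.continuousOn.integrableOn_compact (isCompact_closedBall x r)).mono_set
          Metric.ball_subset_closedBall
    refine ae_eq_const_of_hasWeakDeriv_zero hBo (convex_ball x r) hint fun v => ?_
    have h1 := (hS.hasWeakDeriv hbΩ a v).mono hx
    have h2 := hasWeakDeriv_of_contDiff hLc B v
    have hder : ∀ y, fderiv ℝ (fun y : Eu (n + 1) => L y a) y v = L v a := by
      intro y
      have : HasFDerivAt (fun y : Eu (n + 1) => L y a) ((EuclideanSpace.proj (𝕜 := ℝ) a).comp L) y :=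
        ((EuclideanSpace.proj (𝕜 := ℝ) a).comp L).hasFDerivAt
      rw [this.fderiv]; rfl
    simp only [hder] at h2
    have hGi : Integrable (Ω.indicator fun y => G y v a) := by
      have hfin : IsFiniteMeasure (volume.restrict Ω) :=
        ⟨by rw [Measure.restrict_apply_univ]; exact hbΩ.lt_top⟩
      refine (integrable_indicator_iff hΩ.measurableSet).2 ?_
      exact ((EuclideanSpace.proj (𝕜 := ℝ) a).comp
        (ContinuousLinearMap.apply ℝ (Eu (n + 1)) v)).integrable_comp (hS.2.1.integrable le_top)
    have h3 := HasWeakDeriv.sub (integrable_indicator_coord hΩ hbΩ hS.1 a).locallyIntegrable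
      hLc.continuous.locallyIntegrable hGi.locallyIntegrable
      (continuous_const (y := L v a)).locallyIntegrable h1 h2
    refine h3.congr (Eventually.of_forall fun y hyB => ?_) ?_
    · rw [indicator_of_mem (hx hyB), indicator_of_mem hyB]
    · filter_upwards [hQG'] with y hy hyB
      rw [indicator_of_mem (hx hyB), hy hyB, sub_self]
  choose c hc using hconst
  have heq : EqOn u' (fun y => L y + WithLp.toLp 2 c) B := by
    refine Measure.eqOn_open_of_ae_eq (μ := volume) ?_ hBo hcont (by fun_prop)
    rw [EventuallyEq, ae_restrict_iff' hBo.measurableSet]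
    filter_upwards [ae_all_iff.2 hc, hu] with y h1 h2 hyB
    rw [← h2 (hx hyB)]
    ext a
    have := h1 a hyB
    rw [indicator_of_mem hyB] at this
    simp only [WithLp.ofLp_add, Pi.add_apply]
    linarith
  intro y hy z hz
  rw [heq hy, heq hz, map_sub]
  exact add_sub_add_right_eq_sub _ _ _

end Representative

/-! ### A vector field that points into a Lipschitz domain -/

section InwardField

variable {N : ℕ}

/-- Moving by `t • e` raises the point by `t` over the graph. The perturbation `v` lowers it by at
most `‖v‖` and changes the value of the graph function by at most `K * ‖v‖`. -/
lemma mem_of_chart {Ω : Set (Eu N)} {x e : Eu N} {K : ℝ≥0} {f : Eu N → ℝ} {ρ : ℝ} (he : ‖e‖ = 1)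
    (hf : LipschitzWith K f)
    (hΩ : ∀ y ∈ Metric.ball x ρ, (y ∈ Ω ↔ f (y - (inner ℝ e y) • e) < inner ℝ e y))
    {y v : Eu N} {t : ℝ} (hy : y ∈ Ω) (hyx : y ∈ Metric.ball x ρ)
    (hy' : y + t • e + v ∈ Metric.ball x ρ) (ht : (1 + K) * ‖v‖ < t) : y + t • e + v ∈ Ω := by
  rw [hΩ _ hyx] at hy
  rw [hΩ _ hy']
  have hee : inner ℝ e e = (1 : ℝ) := by rw [real_inner_self_eq_norm_sq, he]; norm_num
  have h1 : inner ℝ e (y + t • e + v) = inner ℝ e y + t + inner ℝ e v := by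
    rw [inner_add_right, inner_add_right, inner_smul_right, hee, mul_one]
  set w : Eu N := v - (inner ℝ e v) • e with hw
  have h2 : y + t • e + v - (inner ℝ e (y + t • e + v)) • e = (y - (inner ℝ e y) • e) + w := by
    rw [h1, hw]; module
  have h3 : ‖w‖ ≤ ‖v‖ := by
    have : ‖w‖ ^ 2 ≤ ‖v‖ ^ 2 := by
      rw [hw, @norm_sub_sq_real, inner_smul_right, norm_smul, he, mul_one, real_inner_comm,
        Real.norm_eq_abs, sq_abs]
      nlinarith [sq_nonneg (inner ℝ v e)]
    exact (pow_le_pow_iff_left₀ (norm_nonneg _) (norm_nonneg _) two_ne_zero).1 this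
  have h4 : f ((y - (inner ℝ e y) • e) + w) ≤ f (y - (inner ℝ e y) • e) + K * ‖v‖ := by
    have := hf.dist_le_mul ((y - (inner ℝ e y) • e) + w) (y - (inner ℝ e y) • e)
    rw [dist_eq_norm, dist_eq_norm, add_sub_cancel_left, Real.norm_eq_abs] at this
    have := (le_abs_self _).trans this
    have : (K : ℝ) * ‖w‖ ≤ K * ‖v‖ := mul_le_mul_of_nonneg_left h3 K.2
    linarith
  have h5 : |inner ℝ e v| ≤ ‖v‖ := by
    have := abs_real_inner_le_norm e v
    rwa [he, one_mul] at this
  rw [h2, h1]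
  have := (abs_le.1 h5).1
  linarith

/-- The distance of `x` to `c`, cut off linearly: `1` up to distance `ρ`, and `0` from `2ρ` on. -/
def tent (c : Eu N) (ρ : ℝ) (x : Eu N) : ℝ := max 0 (min 1 (2 - ρ⁻¹ * dist x c))

lemma tent_nonneg (c : Eu N) (ρ : ℝ) (x : Eu N) : 0 ≤ tent c ρ x := le_max_left _ _

lemma tent_le_one (c : Eu N) (ρ : ℝ) (x : Eu N) : tent c ρ x ≤ 1 :=
  max_le zero_le_one (min_le_left _ _)

lemma tent_eq_one {c : Eu N} {ρ : ℝ} (hρ : 0 < ρ) {x : Eu N} (hx : dist x c ≤ ρ) :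
    tent c ρ x = 1 := by
  have : ρ⁻¹ * dist x c ≤ 1 := by rw [inv_mul_le_iff₀ hρ]; linarith
  rw [tent, min_eq_left (by linarith), max_eq_right zero_le_one]

lemma dist_lt_of_tent_ne_zero {c : Eu N} {ρ : ℝ} (hρ : 0 < ρ) {x : Eu N} (hx : tent c ρ x ≠ 0) :
    dist x c < 2 * ρ := by
  by_contra h
  rw [not_lt] at h
  refine hx (max_eq_left ((min_le_right _ _).trans ?_))
  have : 2 ≤ ρ⁻¹ * dist x c := by rw [le_inv_mul_iff₀ hρ]; linarith
  linarith

lemma lipschitzWith_tent (c : Eu N) {ρ : ℝ} (hρ : 0 < ρ) :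
    LipschitzWith (Real.toNNReal ρ⁻¹) (tent c ρ) := by
  refine LipschitzWith.const_max (LipschitzWith.const_min ?_ 1) 0
  refine LipschitzWith.of_dist_le_mul fun x y => ?_
  rw [Real.coe_toNNReal _ (by positivity), Real.dist_eq]
  have : 2 - ρ⁻¹ * dist x c - (2 - ρ⁻¹ * dist y c) = ρ⁻¹ * (dist y c - dist x c) := by ring
  rw [this, abs_mul, abs_of_pos (by positivity)]
  refine mul_le_mul_of_nonneg_left ?_ (by positivity)
  rw [dist_comm x y]
  exact abs_dist_sub_le y x c

/-- A Lipschitz field supported near the boundary that points into the domain. -/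
lemma exists_inward_field {Ω : Set (Eu N)} (hΩ : IsOpen Ω) (hb : Bornology.IsBounded Ω)
    (hL : HasLipschitzBoundary Ω) {δ : ℝ} (hδ : 0 < δ) :
    ∃ (X : Eu N → Eu N) (Λ : ℝ≥0) (C κ δ₁ t₀ : ℝ), LipschitzWith Λ X ∧ (∀ x, ‖X x‖ ≤ C) ∧ 0 < κ ∧
      0 < δ₁ ∧ 0 < t₀ ∧ (∀ x, Metric.ball x δ ⊆ Ω → X x = 0) ∧
      ∀ x ∈ Ω, Metric.ball x δ₁ ⊆ Ω ∨ ∀ t, 0 < t → t < t₀ → Metric.ball (x + t • X x) (κ * t) ⊆ Ω := by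
  classical
  have hcomp : IsCompact (frontier Ω) :=
    Metric.isCompact_of_isClosed_isBounded isClosed_frontier
      (hb.closure.subset frontier_subset_closure)
  -- The chart radii are divided by four, which leaves room for the supports of the tents of radius
  -- `2 * ρ` and for the displacements. The bound by `δ` makes the field vanish at points whose
  -- `δ`-ball lies in `Ω`.
  have hL' : ∀ x : frontier Ω, ∃ (e : Eu N) (K : ℝ≥0) (f : Eu N → ℝ) (ρ : ℝ),
      ‖e‖ = 1 ∧ LipschitzWith K f ∧ 0 < ρ ∧ 4 * ρ ≤ δ ∧
      ∀ y ∈ Metric.ball (x : Eu N) (4 * ρ), (y ∈ Ω ↔ f (y - (inner ℝ e y) • e) < inner ℝ e y) := by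
    rintro ⟨x, hx⟩
    obtain ⟨e, K, f, ρ, he, hf, hρ, h⟩ := hL x hx
    refine ⟨e, K, f, min ρ δ / 4, he, hf, by positivity, ?_, fun y hy => h y ?_⟩
    · have := min_le_right ρ δ; linarith
    · refine Metric.ball_subset_ball ?_ hy
      have := min_le_left ρ δ; linarith
  choose e K f ρ he hf hρ hρδ hch using hL'
  obtain ⟨S, hS⟩ := hcomp.elim_finite_subcover (fun x : frontier Ω => Metric.ball (x : Eu N) (ρ x / 2))
    (fun _ => Metric.isOpen_ball) fun x hx =>
      mem_iUnion.2 ⟨⟨x, hx⟩, Metric.mem_ball_self (half_pos (hρ _))⟩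
  obtain ⟨r, hr0, hr⟩ : ∃ r : ℝ, 0 < r ∧ ∀ k ∈ S, r ≤ ρ k := by
    rcases S.eq_empty_or_nonempty with rfl | hne
    · exact ⟨1, one_pos, by simp⟩
    · obtain ⟨k, hk, hmin⟩ := S.exists_min_image ρ hne
      exact ⟨ρ k, hρ k, hmin⟩
  -- The aperture of the cone in which perturbations are allowed, small with respect to all
  -- Lipschitz constants of the charts used.
  obtain ⟨κ, hκ0, hκ1, hκ⟩ : ∃ κ : ℝ, 0 < κ ∧ κ ≤ 1 ∧ ∀ k ∈ S, (1 + K k) * κ ≤ 1 := by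
    have hpos : (0 : ℝ) ≤ ∑ k ∈ S, (K k : ℝ) := Finset.sum_nonneg fun k _ => (K k).2
    refine ⟨(1 + ∑ k ∈ S, (K k : ℝ))⁻¹, by positivity, inv_le_one_of_one_le₀ (by linarith), fun k hk => ?_⟩
    have : (K k : ℝ) ≤ ∑ k ∈ S, (K k : ℝ) :=
      Finset.single_le_sum (f := fun k => (K k : ℝ)) (fun k _ => (K k).2) hk
    rw [mul_inv_le_iff₀ (by positivity)]
    linarith
  set X : Eu N → Eu N := fun x => ∑ k ∈ S, tent (k : Eu N) (ρ k) x • e k with hX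
  have hterm : ∀ (k : frontier Ω) (x : Eu N), ‖tent (k : Eu N) (ρ k) x • e k‖ ≤ 1 := by
    intro k x
    rw [norm_smul, he, mul_one, Real.norm_of_nonneg (tent_nonneg _ _ _)]
    exact tent_le_one _ _ _
  have hpart : ∀ (A : Finset (frontier Ω)) x, A ⊆ S →
      ‖∑ k ∈ A, tent (k : Eu N) (ρ k) x • e k‖ ≤ S.card := by
    intro A x hA
    refine (norm_sum_le _ _).trans ((Finset.sum_le_sum fun k _ => hterm k x).trans ?_)
    simp only [Finset.sum_const, nsmul_eq_mul, mul_one]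
    exact_mod_cast Finset.card_le_card hA
  refine ⟨X, ∑ k ∈ S, Real.toNNReal (ρ k)⁻¹, S.card, κ, r / 2, r / (S.card + 1), ?_, ?_, hκ0,
    by positivity, by positivity, ?_, ?_⟩
  · refine LipschitzWith.of_dist_le_mul fun x y => ?_
    rw [dist_eq_norm, hX]
    simp only [← Finset.sum_sub_distrib, ← sub_smul, NNReal.coe_sum, Finset.sum_mul]
    refine (norm_sum_le _ _).trans (Finset.sum_le_sum fun k _ => ?_)
    rw [norm_smul, he, mul_one]
    have := (lipschitzWith_tent (k : Eu N) (hρ k)).dist_le_mul x y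
    rwa [Real.dist_eq] at this
  · exact fun x => hpart S x subset_rfl
  · intro x hx
    refine Finset.sum_eq_zero fun k _ => ?_
    by_contra hne
    have hne' : tent (k : Eu N) (ρ k) x ≠ 0 := fun h => hne (by rw [h, zero_smul])
    have h1 := dist_lt_of_tent_ne_zero (hρ k) hne'
    have h2 : (k : Eu N) ∈ Ω := hx (by
      rw [Metric.mem_ball, dist_comm]
      linarith [hρδ k, hρ k])
    have h3 : (k : Eu N) ∉ interior Ω := k.2.2
    rw [hΩ.interior_eq] at h3
    exact h3 h2
  · intro x hxΩ
    by_cases hball : Metric.ball x (r / 2) ⊆ Ω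
    · exact Or.inl hball
    right
    intro t ht0 ht
    obtain ⟨z, hz, hzΩ⟩ := not_subset.1 hball
    have hfr : ∃ y ∈ frontier Ω, dist x y < r / 2 := by
      rw [← Metric.infDist_lt_iff
        (nonempty_frontier_iff.2 ⟨⟨x, hxΩ⟩, fun h => hzΩ (h ▸ mem_univ z)⟩)]
      refine (infDist_frontier_le hxΩ hzΩ).trans_lt ?_
      rw [dist_comm]; exact hz
    obtain ⟨y, hyf, hyx⟩ := hfr
    obtain ⟨k₀, hk₀, hyk⟩ := mem_iUnion₂.1 (hS hyf)
    have hxk : dist x k₀ ≤ ρ k₀ := by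
      have h2 := Metric.mem_ball.1 hyk
      have := dist_triangle x y k₀
      linarith [hr k₀ hk₀]
    have hcard : t * (S.card + 1) < r := by rwa [lt_div_iff₀ (by positivity)] at ht
    have hnear : ∀ k ∈ S, tent (k : Eu N) (ρ k) x ≠ 0 → ∀ v : Eu N, ‖v‖ ≤ t * (S.card + 1) →
        x + v ∈ Metric.ball (k : Eu N) (4 * ρ k) := by
      intro k hk hne v hv
      have h1 := dist_lt_of_tent_ne_zero (hρ k) hne
      rw [Metric.mem_ball]
      have : dist (x + v) x ≤ ‖v‖ := by rw [dist_eq_norm, add_sub_cancel_left]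
      have := dist_triangle (x + v) x k
      linarith [hr k hk]
    -- The displacement is performed one chart at a time. Each nonzero summand is an upward move in
    -- its own chart, and all intermediate points stay within that chart.
    have hind : ∀ A ⊆ S, x + t • ∑ k ∈ A, tent (k : Eu N) (ρ k) x • e k ∈ Ω := by
      intro A
      induction A using Finset.induction_on with
      | empty => intro _; simpa using hxΩ
      | insert k A hk ih =>
        intro hA
        have hA' : A ⊆ S := (Finset.subset_insert _ _).trans hA
        have hkS : k ∈ S := hA (Finset.mem_insert_self _ _)
        have ih := ih hA'
        have eq : x + t • ∑ j ∈ insert k A, tent (j : Eu N) (ρ j) x • e j =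
            (x + t • ∑ j ∈ A, tent (j : Eu N) (ρ j) x • e j) +
              (t * tent (k : Eu N) (ρ k) x) • e k + 0 := by
          rw [Finset.sum_insert hk, smul_add, smul_smul]; abel
        by_cases hne : tent (k : Eu N) (ρ k) x = 0
        · rw [eq, hne]; simpa using ih
        · have hsz : ∀ B ⊆ S, ‖t • ∑ j ∈ B, tent (j : Eu N) (ρ j) x • e j‖ ≤ t * (S.card + 1) := by
            intro B hB
            rw [norm_smul, Real.norm_of_nonneg ht0.le]
            exact mul_le_mul_of_nonneg_left ((hpart B x hB).trans (by linarith)) ht0.le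
          have m1 := hnear k hkS hne _ (hsz A hA')
          have m2 := hnear k hkS hne _ (hsz _ hA)
          rw [eq] at m2 ⊢
          refine mem_of_chart (he k) (hf k) (hch k) ih m1 m2 ?_
          rw [norm_zero, mul_zero]
          exact mul_pos ht0 (lt_of_le_of_ne (tent_nonneg _ _ _) (Ne.symm hne))
    intro y hy
    set v := y - (x + t • X x) with hv
    have hvn : ‖v‖ < κ * t := by rwa [Metric.mem_ball, dist_eq_norm] at hy
    have ht1 : tent (k₀ : Eu N) (ρ k₀) x = 1 := tent_eq_one (hρ k₀) hxk
    have hne : tent (k₀ : Eu N) (ρ k₀) x ≠ 0 := by rw [ht1]; exact one_ne_zero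
    -- The chart `k₀`, whose tent equals one at `x`, is applied last; its full step `t • e k₀`
    -- leaves room for the perturbation `v`.
    have hXs : X x = ∑ k ∈ S.erase k₀, tent (k : Eu N) (ρ k) x • e k + e k₀ := by
      rw [hX]
      simp only
      rw [← Finset.sum_erase_add S _ hk₀, ht1, one_smul]
    have hyeq : y = (x + t • ∑ k ∈ S.erase k₀, tent (k : Eu N) (ρ k) x • e k) + t • e k₀ + v := by
      rw [hv, hXs]; module
    have hvt : ‖v‖ ≤ t := hvn.le.trans (mul_le_of_le_one_left ht0.le hκ1)
    have m1 : x + t • ∑ k ∈ S.erase k₀, tent (k : Eu N) (ρ k) x • e k ∈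
        Metric.ball (k₀ : Eu N) (4 * ρ k₀) := by
      refine hnear k₀ hk₀ hne _ ?_
      rw [norm_smul, Real.norm_of_nonneg ht0.le]
      exact mul_le_mul_of_nonneg_left ((hpart _ x (Finset.erase_subset _ _)).trans (by linarith)) ht0.le
    have m2 : y ∈ Metric.ball (k₀ : Eu N) (4 * ρ k₀) := by
      have : y = x + (t • X x + v) := by rw [hv]; abel
      rw [this]
      refine hnear k₀ hk₀ hne _ ((norm_add_le _ _).trans ?_)
      rw [norm_smul, Real.norm_of_nonneg ht0.le, mul_add, mul_one]
      exact add_le_add (mul_le_mul_of_nonneg_left (hpart S x subset_rfl) ht0.le) hvt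
    rw [hyeq] at m2 ⊢
    refine mem_of_chart (he k₀) (hf k₀) (hch k₀) (hind _ (Finset.erase_subset _ _)) m1 m2 ?_
    have hK0 : (0 : ℝ) < 1 + K k₀ := by have := (K k₀).2; positivity
    calc (1 + (K k₀ : ℝ)) * ‖v‖ < (1 + K k₀) * (κ * t) := mul_lt_mul_of_pos_left hvn hK0
      _ = ((1 + K k₀) * κ) * t := by ring
      _ ≤ t := mul_le_of_le_one_left ht0.le (hκ k₀ hk₀)

end InwardField

/-! ### Piecewise affine interpolation on the Kuhn decomposition -/

section Interpolation

variable {N : ℕ}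

/-- The node of `ℤ^N` reached from `y` by shifting along the diagonal and rounding up. -/
def roundUp (y : Eu N) (s : ℝ) : Fin N → ℤ := fun i => ⌈y i - s⌉

/-- The piecewise affine interpolation on the Kuhn decomposition of the values `w z`. -/
def interp {E : Type*} [NormedAddCommGroup E] [NormedSpace ℝ E] (w : (Fin N → ℤ) → E) (y : Eu N) :
    E :=
  ∫ s in Ioo (0 : ℝ) 1, w (roundUp y s)

lemma measurable_roundUp (y : Eu N) : Measurable (roundUp y) :=
  measurable_pi_lambda _ fun _ => Int.measurable_ceil.comp (measurable_const.sub measurable_id)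

lemma roundUp_mem_Icc (y : Eu N) {s : ℝ} (hs : s ∈ Ioo (0 : ℝ) 1) :
    roundUp y s ∈ Finset.Icc (fun i => ⌈y i⌉ - 1) (fun i => ⌈y i⌉) := by
  rw [Finset.mem_Icc]
  constructor
  · intro i
    simp only [roundUp]
    have : ⌈y i⌉ < ⌈y i - s⌉ + 2 := by
      have h1 := Int.ceil_lt_add_one (y i)
      have h2 := Int.le_ceil (y i - s)
      have : (⌈y i⌉ : ℝ) < ⌈y i - s⌉ + 2 := by linarith [hs.2]
      exact_mod_cast this
    omega
  · exact fun i => Int.ceil_mono (by linarith [hs.1])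

lemma integrableOn_roundUp {E : Type*} [NormedAddCommGroup E] (f : (Fin N → ℤ) → E) (y : Eu N) :
    IntegrableOn (fun s => f (roundUp y s)) (Ioo (0 : ℝ) 1) := by
  classical
  have hfin : IsFiniteMeasure ((volume : Measure ℝ).restrict (Ioo 0 1)) := ⟨by simp⟩
  refine Integrable.of_bound ?_
    (∑ z ∈ Finset.Icc (fun i => ⌈y i⌉ - 1) (fun i => ⌈y i⌉), ‖f z‖) ?_
  · exact ((StronglyMeasurable.of_discrete (f := f)).comp_measurable
      (measurable_roundUp y)).aestronglyMeasurable
  · refine (ae_restrict_iff' measurableSet_Ioo).2 (Eventually.of_forall fun s hs => ?_)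
    exact Finset.single_le_sum (f := fun z => ‖f z‖) (fun z _ => norm_nonneg _) (roundUp_mem_Icc y hs)

lemma setIntegral_ite_lt {E : Type*} [NormedAddCommGroup E] [NormedSpace ℝ E] [CompleteSpace E]
    {x : ℝ} (h0 : 0 ≤ x) (h1 : x ≤ 1) (g : E) :
    IntegrableOn (fun s => if s < x then g else 0) (Ioo (0 : ℝ) 1) ∧
      ∫ s in Ioo (0 : ℝ) 1, (if s < x then g else 0) = x • g := by
  have e : (fun s => if s < x then g else 0) = (Iio x).indicator fun _ => g := by
    ext s; simp [indicator]
  rw [e]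
  have hi : Ioo (0 : ℝ) 1 ∩ Iio x = Ioo 0 x := by
    ext s; simp only [mem_inter_iff, mem_Ioo, mem_Iio]
    constructor
    · rintro ⟨⟨a, -⟩, b⟩; exact ⟨a, b⟩
    · rintro ⟨a, b⟩; exact ⟨⟨a, b.trans_le h1⟩, b⟩
  constructor
  · exact (integrableOn_const (by simp)).indicator measurableSet_Iio
  · rw [setIntegral_indicator measurableSet_Iio, hi, setIntegral_const, measureReal_def,
      Real.volume_Ioo, sub_zero, ENNReal.toReal_ofReal h0]

/-- Both end points `m` and `m + 1` are allowed, so the rounding can be read off on closed cubes,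
whichever of the cubes containing a point is used. -/
lemma ceil_sub_eq {t s : ℝ} {m : ℤ} (h0 : (m : ℝ) ≤ t) (h1 : t ≤ m + 1) (hs : s ∈ Ioo (0 : ℝ) 1) :
    ⌈t - s⌉ = m + if s < t - m then 1 else 0 := by
  split_ifs with h
  · rw [Int.ceil_eq_iff]; push_cast; constructor <;> linarith [hs.1]
  · rw [Int.ceil_eq_iff]; push_cast; constructor <;> linarith [hs.2]

lemma integral_ceil_sub (t : ℝ) : ∫ s in Ioo (0 : ℝ) 1, ((⌈t - s⌉ : ℤ) : ℝ) = t := by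
  have h0 := Int.floor_le t
  have h1 := (Int.lt_floor_add_one t).le
  have hx := setIntegral_ite_lt (x := t - ⌊t⌋) (by linarith) (by linarith) (1 : ℝ)
  have e : ∫ s in Ioo (0 : ℝ) 1, ((⌈t - s⌉ : ℤ) : ℝ) =
      ∫ s in Ioo (0 : ℝ) 1, ((⌊t⌋ : ℝ) + if s < t - ⌊t⌋ then 1 else 0) := by
    refine setIntegral_congr_fun measurableSet_Ioo fun s hs => ?_
    rw [ceil_sub_eq h0 h1 hs]; push_cast; rfl
  have hcst : Integrable (fun _ : ℝ => (⌊t⌋ : ℝ)) (volume.restrict (Ioo 0 1)) :=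
    integrableOn_const (by simp)
  rw [e, integral_add hcst hx.1, hx.2, setIntegral_const]
  simp

lemma interp_node {E : Type*} [NormedAddCommGroup E] [NormedSpace ℝ E] [CompleteSpace E]
    (w : (Fin N → ℤ) → E) (z : Fin N → ℤ) : interp w (node 1 z) = w z := by
  have e : interp w (node 1 z) = ∫ s in Ioo (0 : ℝ) 1, w z := by
    refine setIntegral_congr_fun measurableSet_Ioo fun s hs => ?_
    have : roundUp (node 1 z) s = z := by
      ext i
      simp only [roundUp, node_apply, one_mul]
      rw [ceil_sub_eq (m := z i) le_rfl (by linarith) hs, sub_self, if_neg (not_lt.2 hs.1.le), add_zero]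
    simp only [this]
  rw [e, setIntegral_const]; simp

lemma integral_coord {X : Type*} [MeasurableSpace X] {μ : Measure X} {k : X → Eu N}
    (hk : Integrable k μ) (a : Fin N) : ∫ x, k x a ∂μ = (∫ x, k x ∂μ) a :=
  (EuclideanSpace.proj (𝕜 := ℝ) a).integral_comp_comm hk

lemma integral_node_roundUp (y : Eu N) :
    ∫ s in Ioo (0 : ℝ) 1, node 1 (roundUp y s) = y := by
  ext i
  rw [← integral_coord (integrableOn_roundUp (node 1) y)]
  simp only [node_apply, one_mul, roundUp]
  exact integral_ceil_sub (y i)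

/-- The modulus of continuity of an interpolation, relative to an affine map. -/
lemma norm_interp_sub_le {w : (Fin N → ℤ) → Eu N} (L : Eu N →L[ℝ] Eu N) {D : ℝ} {x y : Eu N}
    (h : ∀ s ∈ Ioo (0 : ℝ) 1, ∀ t ∈ Ioo (0 : ℝ) 1,
      ‖w (roundUp x s) - w (roundUp y t) - L (node 1 (roundUp x s - roundUp y t))‖ ≤ D) :
    ‖interp w x - interp w y - L (x - y)‖ ≤ D * ∑ i, |x i - y i| := by
  have hD : 0 ≤ D := (norm_nonneg _).trans (h (1 / 2) (by norm_num) (1 / 2) (by norm_num))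
  have hLx : ∀ x : Eu N, L x = ∫ s in Ioo (0 : ℝ) 1, L (node 1 (roundUp x s)) := by
    intro x
    rw [ContinuousLinearMap.integral_comp_comm _ (integrableOn_roundUp (node 1) x),
      integral_node_roundUp]
  have e : interp w x - interp w y - L (x - y) = ∫ s in Ioo (0 : ℝ) 1,
      (w (roundUp x s) - w (roundUp y s) - L (node 1 (roundUp x s - roundUp y s))) := by
    have i1 : Integrable _ (volume.restrict (Ioo (0 : ℝ) 1)) := integrableOn_roundUp w x
    have i2 : Integrable _ (volume.restrict (Ioo (0 : ℝ) 1)) := integrableOn_roundUp w y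
    have i3 : Integrable _ (volume.restrict (Ioo (0 : ℝ) 1)) :=
      integrableOn_roundUp (fun z => L (node 1 z)) x
    have i4 : Integrable _ (volume.restrict (Ioo (0 : ℝ) 1)) :=
      integrableOn_roundUp (fun z => L (node 1 z)) y
    have i12 : Integrable (fun s => w (roundUp x s) - w (roundUp y s))
      (volume.restrict (Ioo (0 : ℝ) 1)) := i1.sub i2
    have i34 : Integrable (fun s => L (node 1 (roundUp x s)) - L (node 1 (roundUp y s)))
      (volume.restrict (Ioo (0 : ℝ) 1)) := i3.sub i4
    have : ∀ s, L (node 1 (roundUp x s - roundUp y s)) =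
        L (node 1 (roundUp x s)) - L (node 1 (roundUp y s)) := by
      intro s; rw [node_sub, map_sub]
    simp only [this]
    rw [integral_sub i12 i34, integral_sub i1 i2, integral_sub i3 i4, ← hLx, ← hLx,
      map_sub]
    rfl
  have hceil : ∀ i, IntegrableOn (fun s => |((⌈x i - s⌉ : ℤ) : ℝ) - ((⌈y i - s⌉ : ℤ) : ℝ)|)
      (Ioo (0 : ℝ) 1) := fun i =>
    ((integrableOn_roundUp (fun z => ((z i : ℤ) : ℝ)) x).sub
      (integrableOn_roundUp (fun z => ((z i : ℤ) : ℝ)) y)).abs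
  have hval : ∀ i, ∫ s in Ioo (0 : ℝ) 1, |((⌈x i - s⌉ : ℤ) : ℝ) - ((⌈y i - s⌉ : ℤ) : ℝ)| =
      |x i - y i| := by
    intro i
    have hsub : ∫ s in Ioo (0 : ℝ) 1, (((⌈x i - s⌉ : ℤ) : ℝ) - ((⌈y i - s⌉ : ℤ) : ℝ)) = x i - y i := by
      have j : ∀ x : Eu N, Integrable (fun s => ((⌈x i - s⌉ : ℤ) : ℝ))
          (volume.restrict (Ioo (0 : ℝ) 1)) := fun x =>
        integrableOn_roundUp (fun z => ((z i : ℤ) : ℝ)) x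
      rw [integral_sub (j x) (j y), integral_ceil_sub, integral_ceil_sub]
    rcases le_total (y i) (x i) with hxy | hxy
    · rw [abs_of_nonneg (sub_nonneg.2 hxy), ← hsub]
      congr 1; ext s
      refine abs_of_nonneg (sub_nonneg.2 ?_)
      exact_mod_cast Int.ceil_mono (by linarith)
    · rw [abs_of_nonpos (sub_nonpos.2 hxy), ← hsub, ← integral_neg]
      congr 1; ext s
      refine abs_of_nonpos (sub_nonpos.2 ?_)
      exact_mod_cast Int.ceil_mono (by linarith)
  rw [e]
  calc _ ≤ ∫ s in Ioo (0 : ℝ) 1, D * ∑ i, |((⌈x i - s⌉ : ℤ) : ℝ) - ((⌈y i - s⌉ : ℤ) : ℝ)| := by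
        refine norm_integral_le_of_norm_le ((integrable_finsetSum _ fun i _ => hceil i).const_mul D) ?_
        refine (ae_restrict_iff' measurableSet_Ioo).2 (Eventually.of_forall fun s hs => ?_)
        -- The two roundings differ only for those `s` at which some coordinate jumps, and then the
        -- sum of differences is at least one. Each difference has constant sign in `s`, so it
        -- integrates to `|x i - y i|`.
        by_cases hne : roundUp x s = roundUp y s
        · rw [hne]
          simp only [sub_self, node]
          have : L (WithLp.toLp 2 fun i => (1 : ℝ) * (((0 : Fin N → ℤ) i : ℤ) : ℝ)) = 0 := by
            rw [show (WithLp.toLp 2 fun i => (1 : ℝ) * (((0 : Fin N → ℤ) i : ℤ) : ℝ)) = (0 : Eu N) by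
              ext i; simp, map_zero]
          rw [this, sub_zero, norm_zero]
          exact mul_nonneg hD (Finset.sum_nonneg fun i _ => abs_nonneg _)
        · obtain ⟨i, hi⟩ := Function.ne_iff.1 hne
          refine (h s hs s hs).trans (le_mul_of_one_le_right hD ?_)
          have h1 : (1 : ℝ) ≤ |((⌈x i - s⌉ : ℤ) : ℝ) - ((⌈y i - s⌉ : ℤ) : ℝ)| := by
            have : (1 : ℤ) ≤ |⌈x i - s⌉ - ⌈y i - s⌉| := Int.one_le_abs (sub_ne_zero.2 hi)
            exact_mod_cast this
          exact h1.trans (Finset.single_le_sum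
            (f := fun i => |((⌈x i - s⌉ : ℤ) : ℝ) - ((⌈y i - s⌉ : ℤ) : ℝ)|)
            (fun i _ => abs_nonneg _) (Finset.mem_univ i))
    _ = D * ∑ i, |x i - y i| := by
        rw [integral_const_mul, integral_finsetSum _ fun i _ => hceil i]
        simp only [hval]

lemma sum_abs_le (x : Eu N) : ∑ i, |x i| ≤ N * ‖x‖ := by
  calc ∑ i, |x i| ≤ ∑ _i : Fin N, ‖x‖ := Finset.sum_le_sum fun i _ => PiLp.norm_apply_le x i
    _ = N * ‖x‖ := by simp

lemma roundUp_mem_cube {c : Fin N → ℤ} {y : Eu N} (hy : y ∈ latticeCube 1 c) {s : ℝ}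
    (hs : s ∈ Ioo (0 : ℝ) 1) : ∀ i, c i ≤ roundUp y s i ∧ roundUp y s i ≤ c i + 1 := by
  intro i
  have h := hy i
  simp only [one_mul] at h
  simp only [roundUp]
  rw [ceil_sub_eq h.1 h.2 hs]
  split_ifs <;> omega

lemma lipschitzWith_interp {w : (Fin N → ℤ) → Eu N} {B : ℝ} (hw : ∀ z, ‖w z‖ ≤ B) :
    LipschitzWith (Real.toNNReal (2 * B * N)) (interp w) := by
  have hB : 0 ≤ B := (norm_nonneg _).trans (hw 0)
  refine LipschitzWith.of_dist_le_mul fun x y => ?_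
  have := norm_interp_sub_le (w := w) (x := x) (y := y) 0 (D := 2 * B) fun s _ t _ => by
    rw [zero_apply, sub_zero]
    exact (norm_sub_le _ _).trans (by linarith [hw (roundUp x s), hw (roundUp y t)])
  rw [zero_apply, sub_zero] at this
  rw [dist_eq_norm, dist_eq_norm, Real.coe_toNNReal _ (by positivity), mul_assoc]
  exact this.trans (mul_le_mul_of_nonneg_left (sum_abs_le (x - y)) (by positivity))

/-! #### Affinity on the simplices -/

lemma exists_forall_iff_lt {N : ℕ} {P : Fin N → Prop} (hP : ∀ i j, i ≤ j → P j → P i) :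
    ∃ k ≤ N, ∀ j : Fin N, P j ↔ (j : ℕ) < k := by
  classical
  by_cases h : ∃ m, ∃ h : m < N, ¬ P ⟨m, h⟩
  · refine ⟨Nat.find h, (Nat.find_spec h).1.le, fun j => ⟨fun hj => ?_, fun hj => ?_⟩⟩
    · by_contra hlt
      rw [not_lt] at hlt
      obtain ⟨h1, h2⟩ := Nat.find_spec h
      exact h2 (hP _ j hlt hj)
    · by_contra hn
      exact Nat.find_min h hj ⟨j.2, hn⟩
  · push Not at h
    exact ⟨N, le_rfl, fun j => ⟨fun _ => j.2, fun _ => h j j.2⟩⟩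

lemma sum_ite_telescope {E : Type*} [AddCommGroup E] (F : ℕ → E) {k : ℕ} (hk : k ≤ N) :
    F 0 + ∑ j : Fin N, (if (j : ℕ) < k then F (j + 1) - F j else 0) = F k := by
  rw [Fin.sum_univ_eq_sum_range (fun j => if j < k then F (j + 1) - F j else 0) N,
    ← Finset.sum_filter]
  have : (Finset.range N).filter (fun j => j < k) = Finset.range k := by
    ext j; simp only [Finset.mem_filter, Finset.mem_range]; omega
  rw [this, Finset.sum_range_sub]
  abel

/-- If the fractional parts are decreasing along `σ`, the coordinates raised at parameter `s` form
an initial segment of that order, so the rounded node is a vertex of the Kuhn simplex. The time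
spent at each vertex is its barycentric coordinate, and summation by parts gives the formula. -/
lemma interp_eq_of_sorted (w : (Fin N → ℤ) → Eu N) (c : Fin N → ℤ) (σ : Equiv.Perm (Fin N))
    {y : Eu N} (h0 : ∀ j, (c j : ℝ) ≤ y j ∧ y j ≤ c j + 1)
    (hanti : ∀ i j, i ≤ j → y (σ j) - c (σ j) ≤ y (σ i) - c (σ i)) :
    interp w y = w (kuhnVertex c σ 0) + ∑ j : Fin N, (y (σ j) - c (σ j)) •
      (w (kuhnVertex c σ j.succ) - w (kuhnVertex c σ j.castSucc)) := by
  classical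
  set F : ℕ → Eu N := fun m => w fun i => c i + if ((σ.symm i : Fin N) : ℕ) < m then 1 else 0 with hF
  have hkv : ∀ k : Fin (N + 1), w (kuhnVertex c σ k) = F k := by
    intro k
    rw [hF]
    congr 1; ext i
    rw [kuhnVertex_apply]
  have hpt : ∀ s ∈ Ioo (0 : ℝ) 1, w (roundUp y s) =
      F 0 + ∑ j : Fin N, (if s < y (σ j) - c (σ j) then F (j + 1) - F j else 0) := by
    intro s hs
    obtain ⟨k, hk, hkiff⟩ := exists_forall_iff_lt (P := fun j : Fin N => s < y (σ j) - c (σ j))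
      fun i j hij hj => lt_of_lt_of_le hj (hanti i j hij)
    simp only [hkiff]
    rw [sum_ite_telescope F hk, hF]
    congr 1; ext i
    simp only [roundUp]
    rw [ceil_sub_eq (h0 i).1 (h0 i).2 hs]
    have := hkiff (σ.symm i)
    simp only [Equiv.apply_symm_apply] at this
    simp only [this]
  have hx : ∀ j, 0 ≤ y (σ j) - c (σ j) ∧ y (σ j) - c (σ j) ≤ 1 := fun j =>
    ⟨by linarith [(h0 (σ j)).1], by linarith [(h0 (σ j)).2]⟩
  have hcst : Integrable (fun _ : ℝ => F 0) (volume.restrict (Ioo 0 1)) :=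
    integrableOn_const (by simp)
  have hterm : ∀ j : Fin N, Integrable (fun s : ℝ => if s < y (σ j) - c (σ j) then F (j + 1) - F j
      else 0) (volume.restrict (Ioo 0 1)) := fun j => (setIntegral_ite_lt (hx j).1 (hx j).2 _).1
  rw [interp, setIntegral_congr_fun measurableSet_Ioo hpt,
    integral_add hcst (integrable_finsetSum _ fun j _ => hterm j),
    integral_finsetSum _ fun j _ => hterm j, setIntegral_const]
  simp only [(setIntegral_ite_lt (hx _).1 (hx _).2 _).2, hkv]
  simp

lemma exists_affine_interp (w : (Fin N → ℤ) → Eu N) {ε : ℝ} (hε : 0 < ε) (c : Fin N → ℤ)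
    (σ : Equiv.Perm (Fin N)) : ∃ A : Eu N →ᵃ[ℝ] Eu N,
      EqOn (fun x => interp w (ε⁻¹ • x)) A (convexHull ℝ (range fun k => node ε (kuhnVertex c σ k))) := by
  classical
  -- The inequalities that describe the closed simplex are affine in the point and hold at its
  -- vertices.
  have hsub : convexHull ℝ (range fun k => node ε (kuhnVertex c σ k)) ⊆
      {x | (∀ j, (c j : ℝ) ≤ ε⁻¹ * x j ∧ ε⁻¹ * x j ≤ c j + 1) ∧
        ∀ i j, i ≤ j → ε⁻¹ * x (σ j) - c (σ j) ≤ ε⁻¹ * x (σ i) - c (σ i)} := by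
    refine convexHull_min ?_ ?_
    · rintro _ ⟨k, rfl⟩
      have hv : ∀ i, ε⁻¹ * node ε (kuhnVertex c σ k) i =
          c i + if ((σ.symm i : Fin N) : ℕ) < k then 1 else 0 := by
        intro i
        rw [node_apply, kuhnVertex_apply, inv_mul_cancel_left₀ hε.ne']
        push_cast; rfl
      refine ⟨fun j => ?_, fun i j hij => ?_⟩
      · rw [hv]; split_ifs <;> constructor <;> linarith
      · rw [hv, hv]
        simp only [Equiv.symm_apply_apply, add_sub_cancel_left]
        have : (i : ℕ) ≤ j := hij
        split_ifs <;> first | omega | norm_num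
    · intro x hx y hy a b ha hb hab
      refine ⟨fun j => ?_, fun i j hij => ?_⟩
      · have h1 := hx.1 j
        have h2 := hy.1 j
        have e : ε⁻¹ * (a • x + b • y) j = a * (ε⁻¹ * x j) + b * (ε⁻¹ * y j) := by
          simp only [WithLp.ofLp_add, WithLp.ofLp_smul, Pi.add_apply, Pi.smul_apply, smul_eq_mul]; ring
        rw [e]
        have hb' : b = 1 - a := by linarith
        subst hb'
        constructor <;> nlinarith [h1.1, h1.2, h2.1, h2.2]
      · have h1 := hx.2 i j hij
        have h2 := hy.2 i j hij
        have e : ∀ j, ε⁻¹ * (a • x + b • y) j = a * (ε⁻¹ * x j) + b * (ε⁻¹ * y j) := by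
          intro j
          simp only [WithLp.ofLp_add, WithLp.ofLp_smul, Pi.add_apply, Pi.smul_apply, smul_eq_mul]; ring
        rw [e, e]
        have hb' : b = 1 - a := by linarith
        subst hb'
        nlinarith
  set g : Fin N → Eu N := fun j => w (kuhnVertex c σ j.succ) - w (kuhnVertex c σ j.castSucc) with hg
  set L : Eu N →ₗ[ℝ] Eu N :=
    ∑ j : Fin N, ((ε⁻¹ • (EuclideanSpace.proj (𝕜 := ℝ) (σ j)).toLinearMap).smulRight (g j)) with hL
  have hLx : ∀ x, L x = ∑ j : Fin N, (ε⁻¹ * x (σ j)) • g j := by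
    intro x
    simp only [hL, LinearMap.sum_apply, LinearMap.smulRight_apply]
    rfl
  refine ⟨L.toAffineMap + AffineMap.const ℝ (Eu N)
    (w (kuhnVertex c σ 0) - ∑ j : Fin N, (c (σ j) : ℝ) • g j), fun x hx => ?_⟩
  obtain ⟨h1, h2⟩ := hsub hx
  simp only
  rw [interp_eq_of_sorted w c σ (y := ε⁻¹ • x) h1 h2]
  change _ = L x + (w (kuhnVertex c σ 0) - ∑ j : Fin N, (c (σ j) : ℝ) • g j)
  rw [hLx]
  simp only [hg, WithLp.ofLp_smul, Pi.smul_apply, smul_eq_mul, sub_smul, Finset.sum_sub_distrib]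
  abel

lemma admissible_interp {w : (Fin N → ℤ) → Eu N} {B : ℝ} (hw : ∀ z, ‖w z‖ ≤ B) {ε : ℝ} (hε : 0 < ε)
    (Ω : Set (Eu N)) : Admissible ε Ω fun x => interp w (ε⁻¹ • x) :=
  ⟨((lipschitzWith_interp hw).continuous.comp (continuous_const_smul _)).continuousOn,
    fun c _ σ => exists_affine_interp w hε c σ⟩

/-! #### Lipschitz maps are Sobolev maps -/

/-- By Rademacher's theorem the derivative exists almost everywhere and is bounded by the Lipschitz
constant. The weak identity is integration by parts for Lipschitz functions, in each coordinate. -/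
lemma isSobolev_of_lipschitz {v : Eu N → Eu N} {C : ℝ≥0} (hv : LipschitzWith C v) {Ω : Set (Eu N)}
    (hΩ : Bornology.IsBounded Ω) (q : ℝ≥0∞) : IsSobolev q Ω v (fderiv ℝ v) := by
  have hb := volume_ne_top_of_isBounded hΩ
  have hfin : IsFiniteMeasure (volume.restrict Ω) :=
    ⟨by rw [Measure.restrict_apply_univ]; exact hb.lt_top⟩
  have hfd : ∀ x, ‖fderiv ℝ v x‖ ≤ C := fun x => norm_fderiv_le_of_lipschitz ℝ hv
  have hmf : Measurable (fderiv ℝ v) := measurable_fderiv ℝ v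
  refine ⟨?_, ?_, ?_⟩
  · obtain ⟨R, hR⟩ := hΩ.subset_closedBall 0
    obtain ⟨M, hM⟩ := (isCompact_closedBall (0 : Eu N) R).exists_bound_of_continuousOn
      hv.continuous.continuousOn
    refine MemLp.of_bound hv.continuous.aestronglyMeasurable M ?_
    -- The set `Ω` is not assumed to be measurable, so almost every point is placed in a closed ball
    -- instead.
    obtain ⟨t, ht, hsub⟩ : ∃ t, MeasurableSet t ∧ Ω ⊆ t ∧ t ⊆ Metric.closedBall 0 R :=
      ⟨_, measurableSet_closedBall, hR, subset_rfl⟩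
    have hmem : ∀ᵐ x ∂(volume.restrict Ω), x ∈ t :=
      ae_mono (Measure.restrict_mono hsub.1 le_rfl) (ae_restrict_mem ht)
    filter_upwards [hmem] with x hx
    exact hM x (hsub.2 hx)
  · exact MemLp.of_bound hmf.aestronglyMeasurable C (Eventually.of_forall hfd)
  · intro φ hφ h
    have hd := hφ.fderiv_apply h
    have hφL : ∃ D, LipschitzWith D φ := by
      obtain ⟨D, hD⟩ := (hφ.2.1.fderiv ℝ).exists_bound_of_continuous
        (hφ.1.continuous_fderiv (by simp))
      refine ⟨Real.toNNReal D, lipschitzWith_of_nnnorm_fderiv_le (hφ.1.differentiable (by simp))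
        fun x => ?_⟩
      rw [← NNReal.coe_le_coe, coe_nnnorm]
      exact (hD x).trans (Real.le_coe_toNNReal D)
    obtain ⟨D, hD⟩ := hφL
    have hcoord : ∀ a, LipschitzWith C fun x => v x a := fun a =>
      LipschitzWith.of_dist_le_mul fun x y => by
        refine le_trans ?_ (hv.dist_le_mul x y)
        rw [Real.dist_eq, dist_eq_norm]
        exact PiLp.norm_apply_le (v x - v y) a
    have hres : ∀ {ψ : Eu N → ℝ} {k : Eu N → Eu N}, IsTest Ω ψ →
        ∫ x in Ω, ψ x • k x = ∫ x, ψ x • k x := fun {ψ k} hψ =>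
      setIntegral_eq_integral_of_forall_compl_eq_zero fun x hx => by
        rw [image_eq_zero_of_notMem_tsupport fun h => hx (hψ.2.2 h), zero_smul]
    rw [hres hd, hres hφ]
    have i1 : Integrable fun x => fderiv ℝ φ x h • v x :=
      (hd.continuous.smul hv.continuous).integrable_of_hasCompactSupport hd.2.1.smul_right
    have i2 : Integrable fun x => φ x • fderiv ℝ v x h := by
      have hφi : Integrable φ := hφ.continuous.integrable_of_hasCompactSupport hφ.2.1
      refine (hφi.norm.mul_const (C * ‖h‖)).mono' ?_ (Eventually.of_forall fun x => ?_)
      · exact hφ.continuous.aestronglyMeasurable.smul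
          ((ContinuousLinearMap.apply ℝ (Eu N) h).continuous.comp_aestronglyMeasurable
            hmf.aestronglyMeasurable)
      · rw [norm_smul]
        exact mul_le_mul_of_nonneg_left (((fderiv ℝ v x).le_opNorm h).trans
          (mul_le_mul_of_nonneg_right (hfd x) (norm_nonneg _))) (norm_nonneg _)
    ext a
    rw [WithLp.ofLp_neg, Pi.neg_apply, ← integral_coord i1, ← integral_coord i2]
    simp only [WithLp.ofLp_smul, Pi.smul_apply, smul_eq_mul]
    have key := LipschitzWith.integral_lineDeriv_mul_eq (μ := volume) (hcoord a) hD hφ.2.1 h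
    have e3 : ∫ x, lineDeriv ℝ (fun x => v x a) x h * φ x = ∫ x, φ x * fderiv ℝ v x h a := by
      refine integral_congr_ae ?_
      filter_upwards [hv.ae_differentiableAt (μ := volume)] with x hx
      have : HasFDerivAt (fun x => v x a) ((EuclideanSpace.proj (𝕜 := ℝ) a).comp (fderiv ℝ v x)) x :=
        (EuclideanSpace.proj (𝕜 := ℝ) a).hasFDerivAt.comp x hx.hasFDerivAt
      rw [(this.hasLineDerivAt h).lineDeriv, mul_comm]
      rfl
    have e4 : ∫ x, lineDeriv ℝ φ x (-h) * v x a = - ∫ x, fderiv ℝ φ x h * v x a := by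
      rw [← integral_neg]
      congr 1; ext x
      rw [((hφ.1.differentiable (by simp)) x).lineDeriv_eq_fderiv, map_neg, neg_mul]
    rw [← e3, key, e4, neg_neg]

/-- The gradient of an interpolation is close to a linear map if the increments on the cube are. -/
lemma norm_fderiv_interp_sub_le {w : (Fin N → ℤ) → Eu N} {ε : ℝ} (hε : 0 < ε)
    {c : Fin N → ℤ} {x : Eu N} (hx : ∀ i, ε * c i < x i ∧ x i < ε * (c i + 1))
    (hd : DifferentiableAt ℝ (fun x => interp w (ε⁻¹ • x)) x) (L : Eu N →L[ℝ] Eu N) {D : ℝ}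
    (h : ∀ a b : Fin N → ℤ, (∀ i, c i ≤ a i ∧ a i ≤ c i + 1) → (∀ i, c i ≤ b i ∧ b i ≤ c i + 1) →
      ‖w a - w b - L (node ε (a - b))‖ ≤ D * ε) :
    ‖fderiv ℝ (fun x => interp w (ε⁻¹ • x)) x - L‖ ≤ N * D := by
  set S : Set (Eu N) := {y | ∀ i, ε * c i < y i ∧ y i < ε * (c i + 1)} with hS
  have hSo : IsOpen S := by
    have : S = ⋂ i, {y : Eu N | ε * c i < y i ∧ y i < ε * (c i + 1)} := by ext; simp [hS]
    rw [this]
    refine isOpen_iInter_of_finite fun i => ?_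
    have hc : Continuous fun y : Eu N => y i := (EuclideanSpace.proj (𝕜 := ℝ) i).continuous
    exact (isOpen_lt continuous_const hc).inter (isOpen_lt hc continuous_const)
  have hcube : ∀ y ∈ S, ε⁻¹ • y ∈ latticeCube 1 c := by
    intro y hy i
    have := hy i
    simp only [one_mul, WithLp.ofLp_smul, Pi.smul_apply, smul_eq_mul]
    constructor
    · rw [le_inv_mul_iff₀ hε]; exact this.1.le
    · rw [inv_mul_le_iff₀ hε]; exact this.2.le
  have hD0 : 0 ≤ D := by
    have := h c c (fun i => by omega) (fun i => by omega)
    have := (norm_nonneg _).trans this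
    exact nonneg_of_mul_nonneg_left this hε
  -- On the open cube the interpolation minus `L` has Lipschitz constant `N * D`, which bounds its
  -- derivative.
  have hLip : LipschitzOnWith (Real.toNNReal (N * D)) (fun x => interp w (ε⁻¹ • x) - L x) S := by
    refine LipschitzOnWith.of_dist_le_mul fun y hy z hz => ?_
    rw [dist_eq_norm, dist_eq_norm, Real.coe_toNNReal _ (by positivity)]
    have := norm_interp_sub_le (w := w) (x := ε⁻¹ • y) (y := ε⁻¹ • z) (ε • L) (D := D * ε)
      fun s hs t ht => by
        have := h _ _ (roundUp_mem_cube (hcube y hy) hs) (roundUp_mem_cube (hcube z hz) ht)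
        rw [node_eq_smul] at this
        rwa [smul_apply, ← map_smul]
    have e1 : (ε • L) (ε⁻¹ • y - ε⁻¹ • z) = L (y - z) := by
      rw [smul_apply, ← smul_sub, map_smul, smul_smul, mul_inv_cancel₀ hε.ne', one_smul]
    rw [e1] at this
    have e2 : interp w (ε⁻¹ • y) - L y - (interp w (ε⁻¹ • z) - L z) =
        interp w (ε⁻¹ • y) - interp w (ε⁻¹ • z) - L (y - z) := by rw [map_sub]; abel
    rw [e2]
    refine this.trans ?_
    have e3 : ∑ i, |(ε⁻¹ • y) i - (ε⁻¹ • z) i| ≤ N * (ε⁻¹ * ‖y - z‖) := by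
      have := sum_abs_le (ε⁻¹ • (y - z))
      rw [norm_smul, Real.norm_of_nonneg (inv_pos.2 hε).le] at this
      refine le_trans (le_of_eq (Finset.sum_congr rfl fun i _ => ?_)) this
      rw [smul_sub]; rfl
    calc D * ε * ∑ i, |(ε⁻¹ • y) i - (ε⁻¹ • z) i| ≤ D * ε * (N * (ε⁻¹ * ‖y - z‖)) :=
          mul_le_mul_of_nonneg_left e3 (by positivity)
      _ = N * D * ‖y - z‖ := by field_simp
  have hder : HasFDerivAt (fun x => interp w (ε⁻¹ • x) - L x)
      (fderiv ℝ (fun x => interp w (ε⁻¹ • x)) x - L) x := hd.hasFDerivAt.sub L.hasFDerivAt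
  have := hder.le_of_lipschitzOn (hSo.mem_nhds hx) hLip
  rwa [Real.coe_toNNReal _ (by positivity)] at this

end Interpolation

/-! ### The structure of piecewise rigid deformations -/

section PiecewiseRigid

variable {N m : ℕ} {H : Matrix (Fin N) (Fin N) ℝ} {Ω : Set (Eu N)} {ν : Fin m → Eu N}
  {c : Fin m → ℝ} {u : Eu N → Eu N} {C : ℝ≥0}

/-- `u` is Lipschitz on the balls in `Ω`, and a rigid motion composed with `H` on those balls in `Ω`
that miss finitely many hyperplanes. -/
structure PiecewiseRigid (H : Matrix (Fin N) (Fin N) ℝ) (Ω : Set (Eu N)) (ν : Fin m → Eu N)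
    (c : Fin m → ℝ) (u : Eu N → Eu N) (C : ℝ≥0) : Prop where
  isOpen : IsOpen Ω
  norm_normal : ∀ j, ‖ν j‖ = 1
  lipschitz : ∀ x r, Metric.ball x r ⊆ Ω → LipschitzOnWith C u (Metric.ball x r)
  affine : ∀ x r, Metric.ball x r ⊆ Ω → (∀ j, ∀ y ∈ Metric.ball x r, y ∉ hyperplane (ν j) (c j)) →
    ∃ Q ∈ Matrix.orthogonalGroup (Fin N) ℝ,
      ∀ y ∈ Metric.ball x r, ∀ z ∈ Metric.ball x r, u y - u z = lin (Q * H) (y - z)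

/-- The set of the points near which `u` is a rigid motion composed with `H`. -/
def flatSet (H : Matrix (Fin N) (Fin N) ℝ) (Ω : Set (Eu N)) (u : Eu N → Eu N) : Set (Eu N) :=
  {y | ∃ ρ > 0, Metric.ball y ρ ⊆ Ω ∧ ∃ Q ∈ Matrix.orthogonalGroup (Fin N) ℝ,
    ∀ a ∈ Metric.ball y ρ, ∀ b ∈ Metric.ball y ρ, u a - u b = lin (Q * H) (a - b)}

lemma isClosed_hyperplane (ν : Eu N) (c : ℝ) : IsClosed (hyperplane ν c) :=
  isClosed_eq (by fun_prop) continuous_const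

lemma hasFDerivAt_of_affine {S : Set (Eu N)} (hS : IsOpen S) {L : Eu N →L[ℝ] Eu N}
    (h : ∀ a ∈ S, ∀ b ∈ S, u a - u b = L (a - b)) {x : Eu N} (hx : x ∈ S) : HasFDerivAt u L x := by
  have h1 : HasFDerivAt (fun y => L y + (u x - L x)) L x := L.hasFDerivAt.add_const _
  refine h1.congr_of_eventuallyEq ?_
  filter_upwards [hS.mem_nhds hx] with y hy
  have := h y hy x hx
  rw [map_sub] at this
  rw [eq_add_of_sub_eq this]; abel

lemma isOpen_flatSet : IsOpen (flatSet H Ω u) := by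
  rw [Metric.isOpen_iff]
  rintro y ⟨ρ, hρ, hball, Q, hQ, h⟩
  refine ⟨ρ / 2, half_pos hρ, fun z hz => ⟨ρ / 2, half_pos hρ, ?_, Q, hQ, ?_⟩⟩
  all_goals
    have hsub : Metric.ball z (ρ / 2) ⊆ Metric.ball y ρ :=
      Metric.ball_subset_ball' (by rw [Metric.mem_ball] at hz; linarith)
  · exact hsub.trans hball
  · exact fun a ha b hb => h a (hsub ha) b (hsub hb)

/-- On convex open sets of flat points the deformation is globally rigid. -/
lemma exists_rigid_of_convex {S : Set (Eu N)} (hS : IsOpen S) (hc : Convex ℝ S)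
    (hSf : S ⊆ flatSet H Ω u) : ∃ Q ∈ Matrix.orthogonalGroup (Fin N) ℝ,
      ∀ a ∈ S, ∀ b ∈ S, u a - u b = lin (Q * H) (a - b) := by
  rcases S.eq_empty_or_nonempty with rfl | ⟨x₀, hx₀⟩
  · exact ⟨1, one_mem _, by simp⟩
  have hloc : ∀ x ∈ S, ∃ Q ∈ Matrix.orthogonalGroup (Fin N) ℝ,
      ∀ᶠ y in 𝓝 x, HasFDerivAt u (lin (Q * H)) y := by
    intro x hx
    obtain ⟨ρ, hρ, -, Q, hQ, h⟩ := hSf hx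
    refine ⟨Q, hQ, ?_⟩
    filter_upwards [Metric.ball_mem_nhds x hρ] with y hy
    exact hasFDerivAt_of_affine Metric.isOpen_ball h hy
  -- The derivative of `u` is locally constant, hence constant on the connected set.
  have hd : ∀ x ∈ S, HasFDerivAt (fderiv ℝ u) (0 : Eu N →L[ℝ] Eu N →L[ℝ] Eu N) x := by
    intro x hx
    obtain ⟨Q, -, h⟩ := hloc x hx
    refine (hasFDerivAt_const (lin (Q * H)) x).congr_of_eventuallyEq ?_
    filter_upwards [h] with y hy
    exact hy.fderiv
  obtain ⟨Q, hQ, hQ₀⟩ := hloc x₀ hx₀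
  have hfd : ∀ x ∈ S, fderiv ℝ u x = lin (Q * H) := by
    intro x hx
    rw [← hQ₀.self_of_nhds.fderiv]
    exact hS.is_const_of_fderiv_eq_zero (𝕜 := ℝ) hc.isPreconnected
      (fun y hy => (hd y hy).differentiableAt.differentiableWithinAt)
      (fun y hy => (hd y hy).fderiv) hx hx₀
  refine ⟨Q, hQ, fun a ha b hb => ?_⟩
  have hdu : DifferentiableOn ℝ u S := fun y hy => by
    obtain ⟨Q', -, h⟩ := hloc y hy
    exact h.self_of_nhds.differentiableAt.differentiableWithinAt
  obtain ⟨e, he⟩ := hS.exists_eq_add_of_fderiv_eq (𝕜 := ℝ) hc.isPreconnected hdu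
    (lin (Q * H)).differentiable.differentiableOn fun x hx => by
      rw [hfd x hx, (lin (Q * H)).fderiv]
  rw [he ha, he hb, map_sub]
  exact add_sub_add_right_eq_sub _ _ _

/-- A thin neighbourhood of the segment is open, convex and still consists of flat points. -/
lemma exists_rigid_of_segment {a b : Eu N} (h : segment ℝ a b ⊆ flatSet H Ω u) :
    ∃ Q ∈ Matrix.orthogonalGroup (Fin N) ℝ, u b - u a = lin (Q * H) (b - a) := by
  have hK : IsCompact (segment ℝ a b) := by
    rw [segment_eq_image_lineMap]
    exact isCompact_Icc.image (AffineMap.lineMap_continuous)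
  obtain ⟨δ, hδ, hsub⟩ := hK.exists_thickening_subset_open isOpen_flatSet h
  obtain ⟨Q, hQ, hr⟩ := exists_rigid_of_convex Metric.isOpen_thickening
    ((convex_segment a b).thickening δ) hsub
  refine ⟨Q, hQ, hr b ?_ a ?_⟩
  · exact Metric.self_subset_thickening hδ _ (right_mem_segment ℝ a b)
  · exact Metric.self_subset_thickening hδ _ (left_mem_segment ℝ a b)

lemma PiecewiseRigid.mem_flatSet (h : PiecewiseRigid H Ω ν c u C) {y : Eu N} (hy : y ∈ Ω)
    (hyP : ∀ j, y ∉ hyperplane (ν j) (c j)) : y ∈ flatSet H Ω u := by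
  have hopen : IsOpen (Ω ∩ ⋂ j, (hyperplane (ν j) (c j))ᶜ) :=
    h.isOpen.inter (isOpen_iInter_of_finite fun j => (isClosed_hyperplane _ _).isOpen_compl)
  obtain ⟨ρ, hρ, hball⟩ := Metric.isOpen_iff.1 hopen y ⟨hy, mem_iInter.2 hyP⟩
  have h1 : Metric.ball y ρ ⊆ Ω := fun x hx => (hball hx).1
  exact ⟨ρ, hρ, h1, h.affine y ρ h1 fun j x hx => mem_iInter.1 (hball hx).2 j⟩

lemma matrix_eq_of_lin {A B : Matrix (Fin N) (Fin N) ℝ} (h : ∀ x, lin A x = lin B x) : A = B :=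
  (Matrix.toEuclideanCLM (n := Fin N) (𝕜 := ℝ)).injective (ContinuousLinearMap.ext h)

/-- Subtracting from `x` its component along `ν` shows that `A - B` depends only on that component;
the amplitude is `(A - B) ν`. -/
lemma exists_vecMulVec {ν : Eu N} (hν : ‖ν‖ = 1) {A B : Matrix (Fin N) (Fin N) ℝ}
    (h : ∀ x, inner ℝ x ν = 0 → lin A x = lin B x) : ∃ a : Fin N → ℝ, A - B = Matrix.vecMulVec a ν := by
  refine ⟨lin (A - B) ν, matrix_eq_of_lin fun x => ?_⟩
  have e : ∀ x, lin (A - B) x = lin A x - lin B x := fun x => by simp [lin]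
  have hνν : inner ℝ ν ν = (1 : ℝ) := by rw [real_inner_self_eq_norm_sq, hν]; norm_num
  have h1 := h (x - (inner ℝ x ν) • ν) (by
    rw [inner_sub_left, inner_smul_left, hνν]; simp)
  rw [map_sub, map_sub, map_smul, map_smul] at h1
  have h2 : lin (A - B) x = (inner ℝ x ν) • lin (A - B) ν := by
    rw [e, e, smul_sub, sub_eq_sub_iff_sub_eq_sub]
    exact sub_eq_sub_iff_sub_eq_sub.1 (sub_eq_sub_iff_sub_eq_sub.1 h1)
  rw [h2]
  ext i
  rw [lin_apply, Matrix.vecMulVec_mulVec]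
  simp [inner_eq_sum, dotProduct, mul_comm]

/-- Near a point of exactly one of the hyperplanes, the deformation is either rigid, or a rigid
motion composed with a fold. -/
lemma PiecewiseRigid.flat_or_fold (h : PiecewiseRigid H Ω ν c u C) (hH : 0 < H.det) {j : Fin m}
    {y₀ : Eu N} (hy₀ : y₀ ∈ hyperplane (ν j) (c j)) {ρ : ℝ} (hρ : 0 < ρ)
    (hball : Metric.ball y₀ ρ ⊆ Ω)
    (hP : ∀ i, i ≠ j → ∀ y ∈ Metric.ball y₀ ρ, y ∉ hyperplane (ν i) (c i)) :
    Metric.ball y₀ ρ ⊆ flatSet H Ω u ∨ ∃ Q ∈ Matrix.orthogonalGroup (Fin N) ℝ,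
      Q * H ≠ Q * (twinReflection H (ν j) * H) ∧
      (∀ x, ‖x‖ < ρ → u (y₀ + x) = u y₀ + lin Q (fold H (ν j) x)) ∧
      ∀ y ∈ Metric.ball y₀ ρ, y ∈ hyperplane (ν j) (c j) → y ∉ flatSet H Ω u := by
  have hν := h.norm_normal j
  set n := ν j with hn
  have hnn : inner ℝ n n = (1 : ℝ) := by rw [real_inner_self_eq_norm_sq, hν]; norm_num
  have hy0 : inner ℝ y₀ n = c j := hy₀
  have hmem : ∀ x, ‖x‖ < ρ → y₀ + x ∈ Metric.ball y₀ ρ := fun x hx => by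
    rw [Metric.mem_ball, dist_eq_norm, add_sub_cancel_left]; exact hx
  -- Each open half ball misses all the hyperplanes and is convex, so `u` is rigid there. By
  -- continuity the formula extends to the flat side of the half ball, with `u y₀` as reference
  -- value.
  have hside : ∀ s : ℝ, s ≠ 0 → ∃ Q ∈ Matrix.orthogonalGroup (Fin N) ℝ,
      ∀ x, ‖x‖ < ρ → 0 ≤ s * inner ℝ x n → u (y₀ + x) - u y₀ = lin (Q * H) x := by
    intro s hs
    set S : Set (Eu N) := Metric.ball y₀ ρ ∩ {y | 0 < s * (inner ℝ y n - c j)} with hS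
    have hSo : IsOpen S := Metric.isOpen_ball.inter (isOpen_lt continuous_const (by fun_prop))
    have hSc : Convex ℝ S := by
      refine (convex_ball _ _).inter ?_
      have : {y : Eu N | 0 < s * (inner ℝ y n - c j)} = {y | s * c j < inner ℝ y (s • n)} := by
        ext y
        simp only [mem_ofPred_eq, inner_smul_right]
        constructor <;> intro h <;> linarith
      rw [this]
      refine convex_halfSpace_gt (f := fun y => inner ℝ y (s • n)) ?_ _
      exact ⟨fun x y => inner_add_left _ _ _, fun a x => by
        rw [inner_smul_left]; simp⟩
    have hSf : S ⊆ flatSet H Ω u := by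
      rintro y ⟨hyb, hys⟩
      refine h.mem_flatSet (hball hyb) fun i => ?_
      by_cases hi : i = j
      · subst hi
        intro hmem
        have : inner ℝ y n = c i := hmem
        rw [mem_ofPred_eq, this, sub_self, mul_zero] at hys
        exact lt_irrefl _ hys
      · exact hP i hi y hyb
    obtain ⟨Q, hQ, hr⟩ := exists_rigid_of_convex hSo hSc hSf
    refine ⟨Q, hQ, fun x hx hxs => ?_⟩
    have hcont : ContinuousOn u (Metric.ball y₀ ρ) := (h.lipschitz y₀ ρ hball).continuousOn
    have hcx : ∀ x, ‖x‖ < ρ → Tendsto (fun t : ℝ => u (y₀ + x + t • (s • n))) (𝓝[>] 0)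
        (𝓝 (u (y₀ + x))) := by
      intro x hx
      have h1 : ContinuousAt u (y₀ + x + (0 : ℝ) • (s • n)) := by
        rw [zero_smul, add_zero]
        exact hcont.continuousAt (Metric.isOpen_ball.mem_nhds (hmem x hx))
      have h2 : ContinuousAt (fun t : ℝ => y₀ + x + t • (s • n)) 0 := by fun_prop
      have h3 := (ContinuousAt.comp (f := fun t : ℝ => y₀ + x + t • (s • n)) h1 h2).tendsto
      simp only [Function.comp_def, zero_smul, add_zero] at h3
      exact h3.mono_left nhdsWithin_le_nhds
    have hl := (hcx x hx).sub (hcx 0 (by simpa using hρ))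
    rw [add_zero] at hl
    refine tendsto_nhds_unique hl (tendsto_const_nhds.congr' ?_)
    have hin : ∀ x, ‖x‖ < ρ → 0 ≤ s * inner ℝ x n →
        ∀ᶠ t : ℝ in 𝓝[>] 0, y₀ + x + t • (s • n) ∈ S := by
      intro x hx hxs
      have e1 : ∀ᶠ t : ℝ in 𝓝[>] 0, y₀ + x + t • (s • n) ∈ Metric.ball y₀ ρ := by
        refine nhdsWithin_le_nhds ?_
        have h2 : ContinuousAt (fun t : ℝ => y₀ + x + t • (s • n)) 0 := by fun_prop
        refine h2.preimage_mem_nhds (Metric.isOpen_ball.mem_nhds ?_)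
        rw [zero_smul, add_zero]; exact hmem x hx
      filter_upwards [e1, self_mem_nhdsWithin] with t ht1 ht2
      refine ⟨ht1, ?_⟩
      have ht : 0 < t := ht2
      simp only [mem_ofPred_eq, inner_add_left, inner_smul_left, hnn, hy0]
      simp only [conj_trivial, mul_one]
      have : 0 < t * (s * s) := mul_pos ht (mul_self_pos.2 hs)
      linarith [this]
    filter_upwards [hin x hx hxs, hin 0 (by simpa using hρ) (by simp)] with t h1 h2
    rw [add_zero] at h2
    rw [hr _ h1 _ h2]
    congr 1; abel
  obtain ⟨Q₁, hQ₁, h₁⟩ := hside 1 one_ne_zero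
  obtain ⟨Q₂, hQ₂, h₂⟩ := hside (-1) (by norm_num)
  -- On the hyperplane both one-sided formulas apply; scaling down to the ball loses nothing by
  -- linearity.
  have hperp : ∀ x, inner ℝ x n = 0 → lin (Q₁ * H) x = lin (Q₂ * H) x := by
    intro x hx
    obtain ⟨t, ht, htx⟩ : ∃ t : ℝ, 0 < t ∧ ‖t • x‖ < ρ := by
      refine ⟨ρ / (‖x‖ + 1), by positivity, ?_⟩
      rw [norm_smul, Real.norm_of_nonneg (by positivity), div_mul_eq_mul_div,
        div_lt_iff₀ (by positivity)]
      nlinarith [norm_nonneg x]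
    have e : inner ℝ (t • x) n = 0 := by rw [inner_smul_left, hx, mul_zero]
    have := (h₁ (t • x) htx (by rw [e, mul_zero])).symm.trans (h₂ (t • x) htx (by rw [e, mul_zero]))
    rw [map_smul, map_smul] at this
    exact smul_right_injective _ ht.ne' this
  by_cases hne : Q₁ = Q₂
  · left
    have hall : ∀ x, ‖x‖ < ρ → u (y₀ + x) - u y₀ = lin (Q₁ * H) x := by
      intro x hx
      rcases le_total 0 (inner ℝ x n) with hs | hs
      · exact h₁ x hx (by linarith)
      · rw [hne]; exact h₂ x hx (by linarith)
    have hr : ∀ a ∈ Metric.ball y₀ ρ, ∀ b ∈ Metric.ball y₀ ρ, u a - u b = lin (Q₁ * H) (a - b) := by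
      intro a ha b hb
      have e1 := hall (a - y₀) (by rwa [Metric.mem_ball, dist_eq_norm] at ha)
      have e2 := hall (b - y₀) (by rwa [Metric.mem_ball, dist_eq_norm] at hb)
      rw [add_sub_cancel] at e1 e2
      have : u a - u b = (u a - u y₀) - (u b - u y₀) := by abel
      rw [this, e1, e2, ← map_sub]
      congr 1; abel
    intro y hy
    obtain ⟨r, hr0, hsub⟩ := Metric.isOpen_iff.1 Metric.isOpen_ball y hy
    exact ⟨r, hr0, hsub.trans hball, Q₁, hQ₁, fun a ha b hb => hr a (hsub ha) b (hsub hb)⟩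
  · right
    obtain ⟨a, ha⟩ := exists_vecMulVec hν hperp
    have htw := mul_twin_of_rankOne hH hν hQ₁ hQ₂ hne ha
    have hQH : Q₁ * H ≠ Q₂ * H := fun he => hne (by
      have hu : IsUnit H := (Matrix.isUnit_iff_isUnit_det H).2 (isUnit_iff_ne_zero.2 hH.ne')
      exact hu.mul_right_cancel he)
    refine ⟨Q₁, hQ₁, by rw [← htw]; exact hQH, ?_, ?_⟩
    · intro x hx
      unfold fold twinMap
      split_ifs with hs
      · have := h₁ x hx (by linarith)
        rw [← lin_mul, ← this]; abel
      · have := h₂ x hx (by linarith [not_le.1 hs])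
        rw [← lin_mul, ← htw, ← this]; abel
    -- At a flat point of the hyperplane a short step along the normal to either side would give
    -- both wells the same value at the normal. As they agree on the hyperplane, they would be
    -- equal.
    · rintro y hyb hyP ⟨r, hr0, hsub, Q, hQ, hr⟩
      obtain ⟨r', hr'0, hr'sub⟩ := Metric.isOpen_iff.1 Metric.isOpen_ball y hyb
      set t : ℝ := min r r' / 2 with ht
      have ht0 : 0 < t := by positivity
      have htr : t < r := by have := min_le_left r r'; have : 0 < min r r' := by positivity
                             linarith
      have htr' : t < r' := by have := min_le_right r r'; have : 0 < min r r' := by positivity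
                               linarith
      have hyn : inner ℝ (y - y₀) n = 0 := by
        rw [inner_sub_left, hy0]; exact sub_eq_zero.2 hyP
      have hval : ∀ s : ℝ, |s| = 1 → ‖y - y₀ + (s * t) • n‖ < ρ ∧ y + (s * t) • n ∈ Metric.ball y r := by
        intro s hs
        have hnorm : ‖(s * t) • n‖ = t := by
          rw [norm_smul, hν, mul_one, Real.norm_eq_abs, abs_mul, hs, one_mul, abs_of_pos ht0]
        constructor
        · have : y + (s * t) • n ∈ Metric.ball y₀ ρ := hr'sub (by
            rw [Metric.mem_ball, dist_eq_norm, add_sub_cancel_left, hnorm]; exact htr')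
          rw [Metric.mem_ball, dist_eq_norm] at this
          rwa [sub_add_eq_add_sub]
        · rw [Metric.mem_ball, dist_eq_norm, add_sub_cancel_left, hnorm]; exact htr
      have key : ∀ (s : ℝ) (Q' : Matrix (Fin N) (Fin N) ℝ), |s| = 1 →
          (∀ x, ‖x‖ < ρ → 0 ≤ s * inner ℝ x n → u (y₀ + x) - u y₀ = lin (Q' * H) x) →
          lin (Q * H) n = lin (Q' * H) n := by
        intro s Q' hs hQ'
        obtain ⟨v1, v2⟩ := hval s hs
        have hss : s * s = 1 := by rw [← abs_mul_abs_self, hs, one_mul]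
        have e1 := hQ' _ v1 (by
          rw [inner_add_left, hyn, inner_smul_left, hnn]
          simp only [conj_trivial, mul_one, zero_add]
          nlinarith)
        have e2 := hQ' (y - y₀) (by rwa [Metric.mem_ball, dist_eq_norm] at hyb) (by rw [hyn, mul_zero])
        have e3 := hr _ v2 y (Metric.mem_ball_self hr0)
        rw [add_sub_cancel_left] at e3
        rw [add_sub_cancel] at e2
        have e4 : y₀ + (y - y₀ + (s * t) • n) = y + (s * t) • n := by abel
        rw [e4] at e1
        have e5 : lin (Q' * H) ((s * t) • n) = lin (Q * H) ((s * t) • n) := by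
          rw [← e3]
          have : u (y + (s * t) • n) - u y = (u (y + (s * t) • n) - u y₀) - (u y - u y₀) := by abel
          rw [this, e1, e2, ← map_sub, add_sub_cancel_left]
        rw [map_smul, map_smul] at e5
        have hst : s * t ≠ 0 := mul_ne_zero (fun h0 => by rw [h0, abs_zero] at hs; norm_num at hs) ht0.ne'
        exact (smul_right_injective _ hst e5).symm
      have k1 := key 1 Q₁ (by simp) h₁
      have k2 := key (-1) Q₂ (by simp) h₂
      refine hQH (matrix_eq_of_lin fun x => ?_)
      have hx := hperp (x - (inner ℝ x n) • n) (by rw [inner_sub_left, inner_smul_left, hnn]; simp)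
      rw [map_sub, map_sub, map_smul, map_smul, ← k1, ← k2, sub_left_inj] at hx
      exact hx

end PiecewiseRigid

/-! ### The hyperplanes, their measure, and the jump points -/

section Planes

variable {N n : ℕ}

lemma volume_level_eq_zero {v : Eu N} (hv : v ≠ 0) (d : ℝ) :
    volume {x : Eu N | inner ℝ x v = d} = 0 := by
  rcases ({x : Eu N | inner ℝ x v = d}).eq_empty_or_nonempty with h | ⟨x₀, hx₀⟩
  · rw [h, measure_empty]
  set K : Submodule ℝ (Eu N) := LinearMap.ker (innerSL ℝ v).toLinearMap with hK
  have hmem : ∀ x, x ∈ K ↔ inner ℝ v x = 0 := fun x => by simp [hK]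
  have hK' : K ≠ ⊤ := by
    intro h
    have : v ∈ K := h ▸ Submodule.mem_top
    rw [hmem, inner_self_eq_zero] at this
    exact hv this
  have e : {x : Eu N | inner ℝ x v = d} = (fun x => x + (-x₀)) ⁻¹' (K : Set (Eu N)) := by
    ext x
    simp only [mem_preimage, SetLike.mem_coe, hmem, mem_ofPred_eq]
    have : inner ℝ x₀ v = d := hx₀
    rw [inner_add_right, inner_neg_right, real_inner_comm x v, real_inner_comm x₀ v, this]
    constructor <;> intro h <;> linarith
  rw [e, measure_preimage_add_right]
  exact Measure.addHaar_submodule volume K hK'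

lemma volume_hyperplane {ν : Eu N} (hν : ‖ν‖ = 1) (c : ℝ) : volume (hyperplane ν c) = 0 :=
  volume_level_eq_zero (fun h => by rw [h, norm_zero] at hν; exact zero_ne_one hν) c

/-- The isometric parametrization of the hyperplane `⟨x, b₀⟩ = c` by `ℝ^n`. -/
def planeMap (b : OrthonormalBasis (Fin (n + 1)) ℝ (Eu (n + 1))) (c : ℝ) (x : Eu n) : Eu (n + 1) :=
  c • b 0 + ∑ l, x l • b l.succ

variable (b : OrthonormalBasis (Fin (n + 1)) ℝ (Eu (n + 1))) (c : ℝ)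

lemma isometry_planeMap : Isometry (planeMap b c) := by
  refine Isometry.of_dist_eq fun x y => ?_
  have e : planeMap b c x - planeMap b c y = ∑ l, (x - y) l • b l.succ := by
    simp only [planeMap, add_sub_add_left_eq_sub, ← Finset.sum_sub_distrib, ← sub_smul]
    rfl
  have ho : Orthonormal ℝ fun l : Fin n => b l.succ := b.orthonormal.comp _ (Fin.succ_injective n)
  rw [dist_eq_norm, dist_eq_norm, e]
  have h1 : ‖∑ l, (x - y) l • b l.succ‖ ^ 2 = ‖x - y‖ ^ 2 := by
    rw [← real_inner_self_eq_norm_sq, ← real_inner_self_eq_norm_sq,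
      ho.inner_sum (fun l => (x - y) l) (fun l => (x - y) l) Finset.univ, inner_eq_sum]
    rfl
  exact (pow_left_inj₀ (norm_nonneg _) (norm_nonneg _) two_ne_zero).1 h1

lemma inner_planeMap_zero (x : Eu n) : inner ℝ (planeMap b c x) (b 0) = c := by
  simp [planeMap, inner_add_left, sum_inner, inner_smul_left]

lemma inner_planeMap_succ (x : Eu n) (l : Fin n) : inner ℝ (planeMap b c x) (b l.succ) = x l := by
  simp [planeMap, inner_add_left, sum_inner, inner_smul_left, inner_basis,
    (Fin.succ_ne_zero _).symm]

lemma range_planeMap : range (planeMap b c) = hyperplane (b 0) c := by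
  ext y
  constructor
  · rintro ⟨x, rfl⟩
    exact inner_planeMap_zero b c x
  · intro hy
    refine ⟨WithLp.toLp 2 fun l => inner ℝ y (b l.succ), ?_⟩
    have hy' : inner ℝ y (b 0) = c := hy
    conv_rhs => rw [← b.sum_repr y, Fin.sum_univ_succ]
    simp only [planeMap, b.repr_apply_apply, real_inner_comm y, hy']

lemma euclideanHausdorff_inter_hyperplane (S : Set (Eu (n + 1))) :
    (μHE[n] : Measure (Eu (n + 1))) (S ∩ hyperplane (b 0) c) = volume (planeMap b c ⁻¹' S) := by
  rw [← range_planeMap, ← (isometry_planeMap b c).euclideanHausdorffMeasure_preimage,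
    EuclideanSpace.euclideanHausdorffMeasure_eq_volume]

lemma euclideanHausdorff_inter_hyperplane_ne_top {S : Set (Eu (n + 1))}
    (hS : Bornology.IsBounded S) : (μHE[n] : Measure (Eu (n + 1))) (S ∩ hyperplane (b 0) c) ≠ ⊤ := by
  rw [euclideanHausdorff_inter_hyperplane]
  refine volume_ne_top_of_isBounded ?_
  exact (isometry_planeMap b c).antilipschitz.isBounded_preimage hS

/-- Different hyperplanes meet in a null set. -/
lemma euclideanHausdorff_hyperplane_inter {ν' : Eu (n + 1)} {c' : ℝ} (hν' : ‖ν'‖ = 1)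
    (hne : hyperplane ν' c' ≠ hyperplane (b 0) c) :
    (μHE[n] : Measure (Eu (n + 1))) (hyperplane ν' c' ∩ hyperplane (b 0) c) = 0 := by
  rw [euclideanHausdorff_inter_hyperplane]
  set a : Eu n := WithLp.toLp 2 fun l => inner ℝ (b l.succ) ν' with ha
  have hval : ∀ x, inner ℝ (planeMap b c x) ν' = c * inner ℝ (b 0) ν' + inner ℝ x a := by
    intro x
    simp only [planeMap, inner_add_left, inner_smul_left, sum_inner, ha]
    simp [inner_eq_sum]
  have e : planeMap b c ⁻¹' hyperplane ν' c' = {x | inner ℝ x a = c' - c * inner ℝ (b 0) ν'} := by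
    ext x
    simp only [mem_preimage, hyperplane, mem_ofPred_eq, hval]
    constructor <;> intro h <;> linarith
  rw [e]
  by_cases ha0 : a = 0
  · have hal : ∀ l : Fin n, inner ℝ (b l.succ) ν' = 0 := fun l => by
      have : a l = 0 := by rw [ha0]; rfl
      simpa [ha] using this
    have hν : ν' = (inner ℝ (b 0) ν') • b 0 := by
      conv_lhs => rw [← b.sum_repr ν', Fin.sum_univ_succ]
      simp only [b.repr_apply_apply, hal, zero_smul, Finset.sum_const_zero, add_zero]
    set s := inner ℝ (b 0) ν' with hs
    have hs0 : s ≠ 0 := by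
      intro h0
      rw [h0, zero_smul] at hν
      rw [hν, norm_zero] at hν'; exact zero_ne_one hν'
    have : {x : Eu n | inner ℝ x a = c' - c * s} = ∅ := by
      rw [Set.eq_empty_iff_forall_notMem]
      intro x hx
      have hx : inner ℝ x a = c' - c * s := hx
      rw [ha0, inner_zero_right] at hx
      refine hne ?_
      ext y
      simp only [hyperplane, mem_ofPred_eq]
      rw [hν, inner_smul_right]
      constructor
      · intro h
        have : s * (inner ℝ y (b 0) - c) = 0 := by linarith
        rcases mul_eq_zero.1 this with h' | h'
        · exact absurd h' hs0
        · linarith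
      · intro h; rw [h]; linarith
    rw [this, measure_empty]
  · exact volume_level_eq_zero ha0 _

/-- The number of the points of a deformed lattice that are close to points of a hyperplane. -/
lemma exists_count_near_plane (ρ : ℝ) : ∃ K : ℝ≥0, ∀ (ε : ℝ) (_ : 0 < ε)
    (F : (Fin (n + 1) → ℤ) → Eu (n + 1)),
    (∀ z z', ‖node ε z - node ε z'‖ ≤ 2 * ‖F z - F z'‖) →
    ∀ (A : Set (Fin (n + 1) → ℤ)) (U : Set (Eu (n + 1))), IsOpen U →
    (∀ z ∈ A, ∃ y ∈ hyperplane (b 0) c, ‖y - F z‖ ≤ ρ * ε ∧ Metric.ball y ε ⊆ U) →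
    ENNReal.ofReal (ε ^ n) * Measure.count A ≤
      K * (μHE[n] : Measure (Eu (n + 1))) (U ∩ hyperplane (b 0) c) := by
  classical
  set V : ℝ≥0∞ := volume (Metric.ball (0 : Eu n) 1) with hV
  have hV0 : V ≠ 0 := (Metric.measure_ball_pos volume _ one_pos).ne'
  have hVt : V ≠ ⊤ := measure_ball_lt_top.ne
  -- A bound for the number of nodes whose balls contain a common point. Their images lie within `2
  -- * (ρ + 1) * ε` of each other, and by `hF` the nodes are at most twice as far apart.
  set K₀ : ℝ≥0∞ := volume (Metric.closedBall (0 : Eu (n + 1)) (4 * (ρ + 1) + ((n + 1 : ℕ) : ℝ))) with hK₀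
  have hK₀t : K₀ ≠ ⊤ := measure_closedBall_lt_top.ne
  have hKt : K₀ / V ≠ ⊤ := ENNReal.div_ne_top hK₀t hV0
  refine ⟨(K₀ / V).toNNReal, fun ε hε F hF A U hU h => ?_⟩
  rw [ENNReal.coe_toNNReal hKt]
  choose! y hyP hyz hyU using h
  have hx : ∀ z, ∃ x, z ∈ A → planeMap b c x = y z := by
    intro z
    by_cases hz : z ∈ A
    · have := hyP z hz
      rw [← range_planeMap] at this
      obtain ⟨x, hx⟩ := this
      exact ⟨x, fun _ => hx⟩
    · exact ⟨0, fun h => absurd h hz⟩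
  choose x hx using hx
  have hsum : ∑' z : A, volume (Metric.ball (x z) ε) ≤
      K₀ * (μHE[n] : Measure (Eu (n + 1))) (U ∩ hyperplane (b 0) c) := by
    rw [euclideanHausdorff_inter_hyperplane]
    have hm : MeasurableSet (planeMap b c ⁻¹' U) :=
      (hU.preimage (isometry_planeMap b c).continuous).measurableSet
    -- Each node contributes a ball of radius `ε` in the hyperplane. Integrating the number of
    -- overlapping balls bounds the total by `K₀` times the area.
    calc ∑' z : A, volume (Metric.ball (x z) ε)
        = ∑' z : A, ∫⁻ t, (Metric.ball (x z) ε).indicator 1 t := by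
          refine tsum_congr fun z => ?_
          rw [lintegral_indicator_one Metric.isOpen_ball.measurableSet]
      _ = ∫⁻ t, ∑' z : A, (Metric.ball (x z) ε).indicator 1 t := by
          rw [lintegral_tsum fun z =>
            (measurable_one.indicator Metric.isOpen_ball.measurableSet).aemeasurable]
      _ ≤ ∫⁻ t, (planeMap b c ⁻¹' U).indicator (fun _ => K₀) t := by
          refine lintegral_mono fun t => ?_
          by_cases hne : ∃ z : A, t ∈ Metric.ball (x z) ε
          · have hmem : ∀ z : A, t ∈ Metric.ball (x z) ε → planeMap b c t ∈ Metric.ball (y z) ε := by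
              intro z hz
              rw [Metric.mem_ball, ← hx z z.2, (isometry_planeMap b c).dist_eq]
              exact hz
            obtain ⟨z₀, hz₀⟩ := hne
            have htU : t ∈ planeMap b c ⁻¹' U := hyU z₀ z₀.2 (hmem z₀ hz₀)
            rw [indicator_of_mem htU]
            set A' : Set (Fin (n + 1) → ℤ) := {z | z ∈ A ∧ t ∈ Metric.ball (x z) ε} with hA'
            have h1 : ∑' z : A, (Metric.ball (x z) ε).indicator (1 : Eu n → ℝ≥0∞) t =
                Measure.count A' := by
              rw [Measure.count_apply MeasurableSet.of_discrete]
              have h2 : ∑' _ : A', (1 : ℝ≥0∞) = ∑' z, A'.indicator 1 z := by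
                rw [← tsum_subtype]; rfl
              have h3 : ∑' z : A, (Metric.ball (x z) ε).indicator (1 : Eu n → ℝ≥0∞) t =
                  ∑' z, A.indicator (fun z => (Metric.ball (x z) ε).indicator (1 : Eu n → ℝ≥0∞) t) z := by
                rw [← tsum_subtype]
              rw [h3]
              have h4 : (A'.encard : ℝ≥0∞) = ∑' _ : A', (1 : ℝ≥0∞) := by
                rw [ENNReal.tsum_set_one]
              rw [h4, h2]
              refine tsum_congr fun z => ?_
              by_cases hz : z ∈ A <;> by_cases hz' : t ∈ Metric.ball (x z) ε <;>
                simp [indicator, hA', hz, hz', -Metric.mem_ball]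
            rw [h1]
            have h5 : volume (Metric.closedBall (node 1 z₀) (4 * (ρ + 1) + ((n + 1 : ℕ) : ℝ))) = K₀ :=
              Measure.addHaar_closedBall_center volume _ _
            rw [← h5]
            have hd : ∀ z : A, t ∈ Metric.ball (x z) ε → ‖planeMap b c t - F z‖ ≤ (ρ + 1) * ε := by
              intro z hz
              have h7 := hmem z hz
              rw [Metric.mem_ball, dist_eq_norm] at h7
              have : planeMap b c t - F z = (planeMap b c t - y z) + (y z - F z) := by abel
              rw [this]
              exact (norm_add_le _ _).trans (by nlinarith [hyz z z.2])
            refine count_le_volume fun z hz w hw => ?_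
            rw [Metric.mem_closedBall, dist_eq_norm]
            have h8 : ‖node 1 z - node 1 z₀‖ ≤ 4 * (ρ + 1) := by
              have h9 : ε * ‖node 1 z - node 1 z₀.1‖ = ‖node ε z - node ε z₀.1‖ := by
                rw [node_eq_smul ε, node_eq_smul ε, ← smul_sub, norm_smul, Real.norm_of_nonneg hε.le]
              have e : F z - F z₀ = (planeMap b c t - F z₀) - (planeMap b c t - F z) := by abel
              have h10 : ‖F z - F z₀‖ ≤ (ρ + 1) * ε + (ρ + 1) * ε := by
                rw [e]
                exact (norm_sub_le _ _).trans (add_le_add (hd z₀ hz₀) (hd ⟨z, hz.1⟩ hz.2))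
              have h11 := hF z z₀
              refine le_of_mul_le_mul_left (a := ε) ?_ hε
              rw [h9]; linarith
            have : w - node 1 z₀ = (w - node 1 z) + (node 1 z - node 1 z₀.1) := by abel
            rw [this]
            exact (norm_add_le _ _).trans (by linarith)
          · push Not at hne
            have : ∑' z : A, (Metric.ball (x z) ε).indicator (1 : Eu n → ℝ≥0∞) t = 0 := by
              rw [ENNReal.tsum_eq_zero]
              exact fun z => indicator_of_notMem (hne z) _
            rw [this]; exact zero_le
      _ = K₀ * volume (planeMap b c ⁻¹' U) := by
          rw [lintegral_indicator hm, setLIntegral_const]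
  have hvol : ∀ z, volume (Metric.ball (x z) ε) = ENNReal.ofReal (ε ^ n) * V := by
    intro z
    rw [Measure.addHaar_ball_of_pos volume _ hε, finrank_euclideanSpace_fin]
  simp only [hvol] at hsum
  rw [ENNReal.tsum_const] at hsum
  rw [← ENNReal.mul_div_right_comm, ENNReal.le_div_iff_mul_le (Or.inl hV0) (Or.inl hVt)]
  refine le_trans (le_of_eq ?_) hsum
  rw [Measure.count_apply MeasurableSet.of_discrete]
  have : (A.encard : ℝ≥0∞) = ((ENat.card A : ℕ∞) : ℝ≥0∞) := rfl
  rw [this]; ring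

/-- Disjoint tiles in a hyperplane. -/
lemma card_tiles_mul_le (K : Finset (Fin n → ℤ)) (o : Eu n) {s : ℝ} (hs : 0 < s)
    {S : Set (Eu (n + 1))} (h : ∀ κ ∈ K, ∀ x : Eu n,
      (∀ l, |x l - (o l + s * κ l)| ≤ s / 2) → planeMap b c x ∈ S) :
    (K.card : ℝ≥0∞) * ENNReal.ofReal (s ^ n) ≤
      (μHE[n] : Measure (Eu (n + 1))) (S ∩ hyperplane (b 0) c) := by
  classical
  set F : (Fin n → ℤ) → Set (Eu n) := fun κ => {x | ∀ l, inner ℝ x (EuclideanSpace.basisFun (Fin n) ℝ l) ∈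
    Ico (o l + s * κ l - s / 2) (o l + s * κ l + s / 2)} with hF
  have hcoord : ∀ (x : Eu n) l, inner ℝ x (EuclideanSpace.basisFun (Fin n) ℝ l) = x l := fun x l => by
    rw [EuclideanSpace.basisFun_apply, EuclideanSpace.inner_single_right]; simp
  have hvol : ∀ κ, volume (F κ) = ENNReal.ofReal (s ^ n) := by
    intro κ
    rw [hF, volume_boxIco]
    have : ∀ l, o l + s * κ l + s / 2 - (o l + s * κ l - s / 2) = s := fun l => by ring
    simp only [this, Finset.prod_const, Finset.card_univ, Fintype.card_fin]
    rw [ENNReal.ofReal_pow hs.le]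
  have hdisj : ∀ κ κ', κ ≠ κ' → Disjoint (F κ) (F κ') := by
    intro κ κ' hne
    rw [Set.disjoint_left]
    intro x h1 h2
    refine hne (funext fun l => ?_)
    have a1 := h1 l
    have a2 := h2 l
    rw [mem_Ico] at a1 a2
    have h3 : s * ((κ l : ℝ) - κ' l) < s * 1 := by linarith [a1.1, a2.2]
    have h4 : s * ((κ' l : ℝ) - κ l) < s * 1 := by linarith [a2.1, a1.2]
    have h5 := lt_of_mul_lt_mul_left h3 hs.le
    have h6 := lt_of_mul_lt_mul_left h4 hs.le
    have h7 : κ l - κ' l < 1 := by exact_mod_cast h5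
    have h8 : κ' l - κ l < 1 := by exact_mod_cast h6
    omega
  rw [euclideanHausdorff_inter_hyperplane]
  calc (K.card : ℝ≥0∞) * ENNReal.ofReal (s ^ n) = ∑ κ ∈ K, volume (F κ) := by
        simp [hvol]
    _ = volume (⋃ κ ∈ K, F κ) := by
        rw [measure_biUnion_finset (fun κ _ κ' _ hne => hdisj κ κ' hne)
          fun κ _ => measurableSet_boxIco _ _ _]
    _ ≤ _ := by
        refine measure_mono (iUnion₂_subset fun κ hκ x hx => h κ hκ x fun l => ?_)
        have := hx l
        rw [hcoord, mem_Ico] at this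
        rw [abs_le]
        constructor <;> linarith [this.1, this.2]

end Planes

/-! ### Jump points of the gradient -/

section JumpPoints

variable {N n m : ℕ} {V : Type*} [NormedAddCommGroup V]

lemma isOpen_halfBall (x ν : Eu N) (ρ : ℝ) : IsOpen (halfBall x ν ρ) :=
  Metric.isOpen_ball.inter (isOpen_lt continuous_const (by fun_prop))

lemma tendsto_laverage_of_ae_eq [NormedSpace ℝ V] {G : Eu N → V} {x ν : Eu N} {ρ : ℝ} (hρ : 0 < ρ) {F : V}
    (h : ∀ᵐ y, y ∈ halfBall x ν ρ → G y = F) :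
    Tendsto (fun t : ℝ => laverage (volume.restrict (halfBall x ν t)) fun y => ‖G y - F‖ₑ)
      (𝓝[>] 0) (𝓝 0) := by
  refine tendsto_const_nhds.congr' ?_
  filter_upwards [Ioo_mem_nhdsGT hρ] with t ht
  rw [laverage_eq]
  have : ∫⁻ y in halfBall x ν t, ‖G y - F‖ₑ = 0 := by
    rw [← lintegral_zero (μ := volume.restrict (halfBall x ν t))]
    refine setLIntegral_congr_fun_ae (isOpen_halfBall _ _ _).measurableSet ?_
    filter_upwards [h] with y hy hyt
    rw [hy ⟨Metric.ball_subset_ball ht.2.le hyt.1, hyt.2⟩, sub_self, enorm_zero]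
  rw [this, ENNReal.zero_div]

/-- If the two normals are not antipodal, a ball centred on their bisector, of radius proportional
to `ρ`, fits into the half ball. By symmetry it fits into the other one as well. -/
lemma ball_subset_halfBall {x ν ν' : Eu N} (hν : ‖ν‖ = 1) (hν' : ‖ν'‖ = 1)
    {ρ : ℝ} (hρ : 0 < ρ) : Metric.ball (x + (ρ / 4) • (ν + ν')) ((1 + inner ℝ ν ν') / 8 * ρ) ⊆ halfBall x ν ρ := by
  intro y hy
  rw [Metric.mem_ball, dist_eq_norm] at hy
  obtain ⟨e, he⟩ : ∃ e, e = y - (x + (ρ / 4) • (ν + ν')) := ⟨_, rfl⟩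
  rw [← he] at hy
  have hyx : y - x = (ρ / 4) • (ν + ν') + e := by rw [he]; abel
  have hc : inner ℝ ν ν' ≤ 1 := by simpa [hν, hν'] using real_inner_le_norm ν ν'
  have hc1 : -1 ≤ inner ℝ ν ν' := by
    simpa [hν, hν'] using (abs_le.1 (abs_real_inner_le_norm ν ν')).1
  have hνν : inner ℝ ν ν = (1 : ℝ) := by rw [real_inner_self_eq_norm_sq, hν]; norm_num
  constructor
  · rw [Metric.mem_ball, dist_eq_norm, hyx]
    have h1 : ‖(ρ / 4) • (ν + ν')‖ ≤ ρ / 4 * 2 := by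
      rw [norm_smul, Real.norm_of_nonneg (by positivity)]
      have := norm_add_le ν ν'
      gcongr; linarith
    have := norm_add_le ((ρ / 4) • (ν + ν')) e
    nlinarith
  · rw [mem_ofPred_eq, hyx, inner_add_left, inner_smul_left, inner_add_left, hνν, real_inner_comm]
    have h1 : -‖e‖ ≤ inner ℝ e ν := by
      simpa [hν] using (abs_le.1 (abs_real_inner_le_norm e ν)).1
    simp only [conj_trivial]
    have : 0 < (1 + inner ℝ ν ν') / 8 * ρ := (norm_nonneg e).trans_lt hy
    nlinarith

/-- The half balls of the two normals overlap in a fixed fraction of their volume, on which `G`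
equals `F`. The averages can tend to zero only if `F = a`. -/
lemma eq_of_tendsto_laverage [NormedSpace ℝ V] {G : Eu N → V} {x ν ν' : Eu N} (hν : ‖ν‖ = 1) (hν' : ‖ν'‖ = 1)
    (hne : 0 < 1 + inner ℝ ν ν') {ρ : ℝ} (hρ : 0 < ρ) {F a : V}
    (h : ∀ᵐ y, y ∈ halfBall x ν ρ → G y = F)
    (ha : Tendsto (fun t : ℝ => laverage (volume.restrict (halfBall x ν' t)) fun y => ‖G y - a‖ₑ)
      (𝓝[>] 0) (𝓝 0)) : F = a := by
  set θ := (1 + inner ℝ ν ν') / 8 with hθ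
  have hθ0 : 0 < θ := by positivity
  have hle : ‖F - a‖ₑ * ENNReal.ofReal (θ ^ N) ≤ 0 := by
    refine ge_of_tendsto ha ?_
    filter_upwards [Ioo_mem_nhdsGT hρ] with t ht
    set B := Metric.ball (x + (t / 4) • (ν + ν')) (θ * t) with hB
    have hB1 : B ⊆ halfBall x ν t := ball_subset_halfBall hν hν' ht.1
    have hB2 : B ⊆ halfBall x ν' t := by
      have := ball_subset_halfBall (x := x) hν' hν ht.1
      rwa [add_comm ν' ν, real_inner_comm ν ν'] at this
    have hv : volume B = ENNReal.ofReal (θ ^ N) * volume (Metric.ball x t) := by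
      rw [hB, Measure.addHaar_ball_mul_of_pos volume _ hθ0, finrank_euclideanSpace_fin,
        Measure.addHaar_ball_center volume x]
    have hne0 : volume B ≠ 0 := (Metric.measure_ball_pos volume _ (mul_pos hθ0 ht.1)).ne'
    rw [laverage_eq, Measure.restrict_apply_univ]
    have hfin : volume (halfBall x ν' t) ≠ ⊤ :=
      measure_ne_top_of_subset inter_subset_left measure_ball_lt_top.ne
    rw [ENNReal.le_div_iff_mul_le (Or.inl fun h0 => hne0 (measure_mono_null hB2 h0)) (Or.inl hfin)]
    calc ‖F - a‖ₑ * ENNReal.ofReal (θ ^ N) * volume (halfBall x ν' t)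
        ≤ ‖F - a‖ₑ * ENNReal.ofReal (θ ^ N) * volume (Metric.ball x t) := by
          gcongr; exact inter_subset_left
      _ = ∫⁻ _ in B, ‖F - a‖ₑ := by rw [setLIntegral_const, hv]; ring
      _ = ∫⁻ y in B, ‖G y - a‖ₑ := by
          refine setLIntegral_congr_fun_ae Metric.isOpen_ball.measurableSet ?_
          filter_upwards [h] with y hy hyB
          rw [hy ⟨Metric.ball_subset_ball ht.2.le (hB1 hyB).1, (hB1 hyB).2⟩]
      _ ≤ _ := lintegral_mono_set hB2
  have h0 : ENNReal.ofReal (θ ^ N) ≠ 0 := by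
    rw [Ne, ENNReal.ofReal_eq_zero, not_le]; positivity
  rcases mul_eq_zero.1 (le_antisymm hle bot_le) with h1 | h1
  · exact sub_eq_zero.1 (enorm_eq_zero.1 h1)
  · exact absurd h1 h0

/-- The normal at a jump between two constant values is unique up to its sign. -/
lemma IsJumpPoint.eq_or_eq_neg [NormedSpace ℝ V] {G : Eu N → V} {x ν ν' : Eu N} (hν : ‖ν‖ = 1) {ρ : ℝ}
    (hρ : 0 < ρ) {F F' a b : V} (hF : F ≠ F') (h : ∀ᵐ y, y ∈ halfBall x ν ρ → G y = F)
    (h' : ∀ᵐ y, y ∈ halfBall x (-ν) ρ → G y = F') (hj : IsJumpPoint G x ν' a b) :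
    ν' = ν ∨ ν' = -ν := by
  by_contra! hcon
  have hc : inner ℝ ν ν' ≠ 1 := fun h => hcon.1 ((inner_eq_one_iff_of_norm_eq_one hν hj.1).1 h).symm
  have hc' : inner ℝ (-ν) ν' ≠ 1 := fun h =>
    hcon.2 ((inner_eq_one_iff_of_norm_eq_one (by rwa [norm_neg]) hj.1).1 h).symm
  have h1 : inner ℝ ν ν' < 1 :=
    lt_of_le_of_ne (by simpa [hν, hj.1] using real_inner_le_norm ν ν') hc
  have h2 : inner ℝ (-ν) ν' < 1 :=
    lt_of_le_of_ne (by simpa [hν, hj.1] using real_inner_le_norm (-ν) ν') hc'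
  rw [inner_neg_left] at h2
  -- A normal other than `ν` and `-ν` has a half ball that overlaps both sides, so the limit `a`
  -- would equal both `F` and `F'`.
  refine hF ((eq_of_tendsto_laverage hν hj.1 (by linarith) hρ h hj.2.2.1).trans
    (eq_of_tendsto_laverage (by rwa [norm_neg]) hj.1 ?_ hρ h' hj.2.2.1).symm)
  rw [inner_neg_left]; linarith

/-- The structure of deformations with polyhedral jump set. -/
lemma IsPolyhedralDeformation.exists_piecewiseRigid {H : Matrix (Fin (n + 1)) (Fin (n + 1)) ℝ}
    (hH : 0 < H.det) {Ω : Set (Eu (n + 1))} (hΩ : IsOpen Ω) (hb : Bornology.IsBounded Ω)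
    {u : Eu (n + 1) → Eu (n + 1)} {G : Eu (n + 1) → Eu (n + 1) →L[ℝ] Eu (n + 1)}
    (h : IsPolyhedralDeformation H Ω u G) :
    ∃ (m : ℕ) (ν : Fin m → Eu (n + 1)) (c : Fin m → ℝ) (C : ℝ≥0) (u' : Eu (n + 1) → Eu (n + 1)),
      PiecewiseRigid H Ω ν c u' C ∧ (Function.Injective fun j => hyperplane (ν j) (c j)) ∧
      (∀ᵐ x, x ∈ Ω → u x = u' x) ∧ ∀ᵐ x, x ∈ Ω → HasFDerivAt u' (G x) x := by
  obtain ⟨hS, hV, hG, hP⟩ := h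
  obtain ⟨m, ν, c, hν, hinj, hK⟩ := hP.exists_hyperplanes
  have hnorm : ∀ᵐ y ∂(volume.restrict Ω), ‖G y‖ ≤ ‖lin H‖ := by
    filter_upwards [hG] with y hy
    obtain ⟨Q, hQ, hGy⟩ := hy
    rw [hGy]
    refine ContinuousLinearMap.opNorm_le_bound _ (norm_nonneg _) fun v => ?_
    rw [lin_mul, norm_lin_orthogonal hQ]
    exact (lin H).le_opNorm v
  obtain ⟨C, u', hu, hLip⟩ := hS.exists_lipschitz hΩ (volume_ne_top_of_isBounded hb) hnorm
  have hball : ∀ x r, Metric.ball x r ⊆ Ω → (∀ j, ∀ y ∈ Metric.ball x r, y ∉ hyperplane (ν j) (c j)) →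
      ∃ Q ∈ Matrix.orthogonalGroup (Fin (n + 1)) ℝ, (∀ᵐ y, y ∈ Metric.ball x r → G y = lin (Q * H)) ∧
      ∀ y ∈ Metric.ball x r, ∀ z ∈ Metric.ball x r, u' y - u' z = lin (Q * H) (y - z) := by
    intro x r hxr hPr
    refine exists_affine_on_ball hH.ne' hΩ hb hS hV hG hu hxr (hLip x r hxr).continuousOn ?_
    refine measure_mono_null ?_ hK
    rintro y ⟨hy1, hy2⟩
    refine ⟨hy1, fun hy => ?_⟩
    obtain ⟨j, hj⟩ := mem_iUnion.1 hy
    exact hPr j y hy2 hj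
  refine ⟨m, ν, c, C, u', ⟨hΩ, hν, hLip, fun x r h1 h2 => ?_⟩, hinj, hu, ?_⟩
  · obtain ⟨Q, hQ, -, h3⟩ := hball x r h1 h2
    exact ⟨Q, hQ, h3⟩
  · have hU : IsOpen (Ω ∩ ⋂ j, (hyperplane (ν j) (c j))ᶜ) :=
      hΩ.inter (isOpen_iInter_of_finite fun j => (isClosed_hyperplane _ _).isOpen_compl)
    have hloc : volume ({x | x ∈ Ω ∩ ⋂ j, (hyperplane (ν j) (c j))ᶜ ∧ ¬ HasFDerivAt u' (G x) x}) = 0 := by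
      refine measure_null_of_locally_null _ fun x hx => ?_
      obtain ⟨ρ, hρ, hsub⟩ := Metric.isOpen_iff.1 hU x hx.1
      obtain ⟨Q, -, h1, h2⟩ := hball x ρ (fun y hy => (hsub hy).1)
        fun j y hy => mem_iInter.1 (hsub hy).2 j
      refine ⟨_, inter_mem self_mem_nhdsWithin
        (mem_nhdsWithin_of_mem_nhds (Metric.ball_mem_nhds x hρ)), ?_⟩
      refine measure_mono_null ?_ h1
      rintro y ⟨⟨-, hy1⟩, hy2⟩ h3
      exact hy1 (by rw [h3 hy2]; exact hasFDerivAt_of_affine Metric.isOpen_ball h2 hy2)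
    have hpl : ∀ᵐ x, ∀ j, x ∉ hyperplane (ν j) (c j) :=
      ae_all_iff.2 fun j => measure_eq_zero_iff_ae_notMem.1 (volume_hyperplane (hν j) (c j))
    filter_upwards [hpl, measure_eq_zero_iff_ae_notMem.1 hloc] with x h1 h2 hx
    by_contra h3
    exact h2 ⟨⟨hx, mem_iInter.2 h1⟩, h3⟩

/-- The points of the `j`-th hyperplane, and of no other one, near which `u` is not rigid. -/
def crease (H : Matrix (Fin N) (Fin N) ℝ) (Ω : Set (Eu N)) (ν : Fin m → Eu N) (c : Fin m → ℝ)
    (u : Eu N → Eu N) (j : Fin m) : Set (Eu N) :=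
  {y | y ∈ Ω ∧ y ∉ flatSet H Ω u ∧ y ∈ hyperplane (ν j) (c j) ∧ ∀ i, i ≠ j → y ∉ hyperplane (ν i) (c i)}

/-- The distance to the complement of `Ω` and to all the hyperplanes but the `j`-th one. -/
def creaseDist (Ω : Set (Eu N)) (ν : Fin m → Eu N) (c : Fin m → ℝ) (j : Fin m) (x : Eu N) : ℝ :=
  Metric.infDist x (Ωᶜ ∪ ⋃ i, ⋃ (_ : i ≠ j), hyperplane (ν i) (c i))

section Crease

variable {H : Matrix (Fin N) (Fin N) ℝ} {Ω : Set (Eu N)} {ν : Fin m → Eu N}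
  {c : Fin m → ℝ} {u : Eu N → Eu N} {C : ℝ≥0} {j : Fin m}

lemma mem_of_dist_lt_creaseDist {x y : Eu N} (h : dist x y < creaseDist Ω ν c j x) :
    y ∈ Ω ∧ ∀ i, i ≠ j → y ∉ hyperplane (ν i) (c i) := by
  have hy : y ∉ Ωᶜ ∪ ⋃ i, ⋃ (_ : i ≠ j), hyperplane (ν i) (c i) := fun hy =>
    (Metric.infDist_le_dist_of_mem hy).not_gt h
  simp only [mem_union, mem_compl_iff, mem_iUnion, not_or, not_exists, not_not] at hy
  exact hy

lemma creaseDist_le (x y : Eu N) : creaseDist Ω ν c j x ≤ creaseDist Ω ν c j y + dist x y :=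
  Metric.infDist_le_infDist_add_dist

lemma creaseDist_pos (h : PiecewiseRigid H Ω ν c u C) {y : Eu N} (hΩ : Ω ≠ univ) (hy : y ∈ Ω)
    (hP : ∀ i, i ≠ j → y ∉ hyperplane (ν i) (c i)) : 0 < creaseDist Ω ν c j y := by
  have hcl : IsClosed (Ωᶜ ∪ ⋃ i, ⋃ (_ : i ≠ j), hyperplane (ν i) (c i)) :=
    h.isOpen.isClosed_compl.union (isClosed_iUnion_of_finite fun i =>
      isClosed_iUnion_of_finite fun _ => isClosed_hyperplane _ _)
  refine (hcl.notMem_iff_infDist_pos ?_).1 ?_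
  · exact (nonempty_compl.2 hΩ).mono subset_union_left
  · simp only [mem_union, mem_compl_iff, mem_iUnion, not_or, not_exists, not_not]
    exact ⟨hy, hP⟩

lemma measurableSet_crease (h : PiecewiseRigid H Ω ν c u C) (j : Fin m) :
    MeasurableSet (crease H Ω ν c u j) := by
  have e : crease H Ω ν c u j = Ω ∩ ((flatSet H Ω u)ᶜ ∩ (hyperplane (ν j) (c j) ∩
      ⋂ i, ⋂ (_ : i ≠ j), (hyperplane (ν i) (c i))ᶜ)) := by
    ext y; simp only [crease, mem_inter_iff, mem_compl_iff, mem_iInter, mem_ofPred_eq]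
  rw [e]
  refine h.isOpen.measurableSet.inter (isOpen_flatSet.measurableSet.compl.inter
    ((isClosed_hyperplane _ _).measurableSet.inter ?_))
  exact MeasurableSet.iInter fun i => MeasurableSet.iInter fun _ =>
    (isClosed_hyperplane _ _).measurableSet.compl

/-- The creases consist of jump points of the gradient, with the normal of the hyperplane. -/
lemma PiecewiseRigid.isJumpPoint (h : PiecewiseRigid H Ω ν c u C) (hH : 0 < H.det)
    {G : Eu N → Eu N →L[ℝ] Eu N} (hG : ∀ᵐ x, x ∈ Ω → HasFDerivAt u (G x) x) {y : Eu N}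
    (hy : y ∈ crease H Ω ν c u j) : (∃ a b, IsJumpPoint G y (ν j) a b) ∧
      ∀ ν' a b, IsJumpPoint G y ν' a b → ν' = ν j ∨ ν' = -ν j := by
  have hν := h.norm_normal j
  obtain ⟨hyΩ, hyf, hyj, hyi⟩ := hy
  have hopen : IsOpen (Ω ∩ ⋂ i, ⋂ (_ : i ≠ j), (hyperplane (ν i) (c i))ᶜ) :=
    h.isOpen.inter (isOpen_iInter_of_finite fun i => isOpen_iInter_of_finite fun _ =>
      (isClosed_hyperplane _ _).isOpen_compl)
  obtain ⟨ρ, hρ, hsub⟩ := Metric.isOpen_iff.1 hopen y ⟨hyΩ, by simpa using hyi⟩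
  have hball : Metric.ball y ρ ⊆ Ω := fun x hx => (hsub hx).1
  rcases h.flat_or_fold hH hyj hρ hball
    (fun i hi x hx => by simpa using mem_iInter₂.1 (hsub hx).2 i hi) with h1 | ⟨Q, hQ, hne, hf, -⟩
  · exact absurd (h1 (Metric.mem_ball_self hρ)) hyf
  have hu : ∀ a ∈ Metric.ball y ρ, u a = u y + lin Q (fold H (ν j) (a - y)) := fun a ha => by
    rw [← hf (a - y) (by rwa [← dist_eq_norm]), add_sub_cancel]
  have hside : ∀ (ν' : Eu N) (F : Eu N →L[ℝ] Eu N),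
      (∀ a ∈ halfBall y ν' ρ, ∀ b ∈ halfBall y ν' ρ, u a - u b = F (a - b)) →
      ∀ᵐ x, x ∈ halfBall y ν' ρ → G x = F := by
    intro ν' F hF
    filter_upwards [hG] with x hx hxb
    exact (hx (hball hxb.1)).unique (hasFDerivAt_of_affine (isOpen_halfBall _ _ _) hF hxb)
  have hp := hside (ν j) (lin (Q * H)) fun a ha b hb => by
    rw [hu a ha.1, hu b hb.1, add_sub_add_left_eq_sub, ← map_sub,
      fold_sub_of_nonneg hH (le_of_lt hb.2) (le_of_lt ha.2), sub_sub_sub_cancel_right, lin_mul]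
  have hm := hside (-ν j) (lin (Q * (twinReflection H (ν j) * H))) fun a ha b hb => by
    have ha2 : 0 < inner ℝ (a - y) (-ν j) := ha.2
    have hb2 : 0 < inner ℝ (b - y) (-ν j) := hb.2
    rw [inner_neg_right] at ha2 hb2
    rw [hu a ha.1, hu b hb.1, add_sub_add_left_eq_sub, ← map_sub,
      fold_sub_of_nonpos hH (by linarith) (by linarith), sub_sub_sub_cancel_right, lin_mul Q]
  have hne' : lin (Q * H) ≠ lin (Q * (twinReflection H (ν j) * H)) := fun he =>
    hne (matrix_eq_of_lin fun x => by rw [he])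
  exact ⟨⟨_, _, hν, hne', tendsto_laverage_of_ae_eq hρ hp, tendsto_laverage_of_ae_eq hρ hm⟩,
    fun ν' a b hj => hj.eq_or_eq_neg hν hρ hne' hp hm⟩

/-- The creases are disjoint measurable subsets of the jump set, and on the `j`-th one the normal is
`ν j` up to sign. The sign does not matter because `g` is even. -/
lemma sum_crease_le_lintegral (h : PiecewiseRigid H Ω ν c u C) (hH : 0 < H.det)
    {G : Eu N → Eu N →L[ℝ] Eu N} (hG : ∀ᵐ x, x ∈ Ω → HasFDerivAt u (G x) x) (μ : Measure (Eu N))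
    {g : Eu N → ℝ≥0} (hg : ∀ x, ‖x‖ = 1 → g (-x) = g x) {ν' : Eu N → Eu N}
    (hν' : ∀ x ∈ jumpSet Ω G, ∃ F₁ F₂, IsJumpPoint G x (ν' x) F₁ F₂) :
    ∑ j, (g (ν j) : ℝ≥0∞) * μ (crease H Ω ν c u j) ≤ ∫⁻ x in jumpSet Ω G, g (ν' x) ∂μ := by
  have hsub : ⋃ j, crease H Ω ν c u j ⊆ jumpSet Ω G := by
    refine iUnion_subset fun j y hy => ⟨hy.1, ν j, ?_⟩
    exact (h.isJumpPoint hH hG hy).1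
  refine le_trans ?_ (lintegral_mono_set hsub)
  rw [lintegral_iUnion (measurableSet_crease h), tsum_fintype]
  · refine Finset.sum_le_sum fun j _ => ?_
    rw [← setLIntegral_const]
    refine le_of_eq (setLIntegral_congr_fun (measurableSet_crease h j) fun y hy => ?_)
    obtain ⟨F₁, F₂, hF⟩ := hν' y (hsub (mem_iUnion.2 ⟨j, hy⟩))
    rcases (h.isJumpPoint hH hG hy).2 _ _ _ hF with h1 | h1
    · simp only [h1]
    · simp only [h1, hg _ (h.norm_normal j)]
  · intro i j hij
    refine Set.disjoint_left.2 fun y hi hj => hi.2.2.2 j hij.symm hj.2.2.1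

end Crease

lemma exists_basis_zero_eq {ν : Eu (n + 1)} (hν : ‖ν‖ = 1) :
    ∃ b : OrthonormalBasis (Fin (n + 1)) ℝ (Eu (n + 1)), b 0 = ν := by
  obtain ⟨b, hb⟩ := Orthonormal.exists_orthonormalBasis_extension_of_card_eq (𝕜 := ℝ)
    (ι := Fin (n + 1)) (E := Eu (n + 1)) (by simp) (v := fun _ => ν) (s := {0})
    ⟨fun i => hν, fun i j hij => absurd (Subsingleton.elim i j) hij⟩
  exact ⟨b, hb 0 rfl⟩

/-- The part of a hyperplane close to the boundary and to the other hyperplanes is small. -/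
lemma exists_creaseDist_small {H : Matrix (Fin (n + 1)) (Fin (n + 1)) ℝ} {Ω : Set (Eu (n + 1))}
    {ν : Fin m → Eu (n + 1)} {c : Fin m → ℝ} {u : Eu (n + 1) → Eu (n + 1)} {C : ℝ≥0}
    (h : PiecewiseRigid H Ω ν c u C) (hb : Bornology.IsBounded Ω)
    (hinj : Function.Injective fun j => hyperplane (ν j) (c j)) (j : Fin m) {η : ℝ≥0∞} (hη : 0 < η) :
    ∃ δ : ℝ, 0 < δ ∧ (μHE[n] : Measure (Eu (n + 1)))
      ((Ω ∩ {y | creaseDist Ω ν c j y < δ}) ∩ hyperplane (ν j) (c j)) < η := by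
  obtain ⟨b, hbν⟩ := exists_basis_zero_eq (h.norm_normal j)
  have hΩ : Ω ≠ univ := fun e => NormedSpace.unbounded_univ ℝ (Eu (n + 1)) (e ▸ hb)
  have hcont : Continuous (creaseDist Ω ν c j) := Metric.continuous_infDist_pt _
  set s : ℕ → Set (Eu (n + 1)) := fun k =>
    (Ω ∩ {y | creaseDist Ω ν c j y < 1 / ((k : ℝ) + 1)}) ∩ hyperplane (ν j) (c j) with hs
  have hnull : (μHE[n] : Measure (Eu (n + 1))) (⋂ k, s k) = 0 := by
    -- In the limit only points of another hyperplane remain, since elsewhere in `Ω` the distance is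
    -- positive. Different hyperplanes meet in a null set.
    have hsub : ⋂ k, s k ⊆ ⋃ i, ⋃ (_ : i ≠ j), hyperplane (ν i) (c i) ∩ hyperplane (ν j) (c j) := by
      intro y hy
      rw [mem_iInter] at hy
      by_contra hcon
      simp only [mem_iUnion, not_exists, mem_inter_iff, not_and] at hcon
      have hpos : 0 < creaseDist Ω ν c j y :=
        creaseDist_pos h hΩ (hy 0).1.1 fun i hi hm => hcon i hi hm (hy 0).2
      obtain ⟨k, hk⟩ := exists_nat_one_div_lt hpos
      exact lt_asymm hk (hy k).1.2
    refine measure_mono_null hsub (measure_iUnion_null fun i => measure_iUnion_null fun hi => ?_)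
    have := euclideanHausdorff_hyperplane_inter b (c j) (h.norm_normal i) (c' := c i)
    rw [hbν] at this
    exact this fun e => hi (hinj e)
  have hlim : Tendsto (fun k => (μHE[n] : Measure (Eu (n + 1))) (s k)) atTop (𝓝 0) := by
    rw [← hnull]
    refine tendsto_measure_iInter_atTop (fun k => ?_) ?_ ⟨0, ?_⟩
    · exact ((h.isOpen.measurableSet.inter (isOpen_lt hcont continuous_const).measurableSet).inter
        (isClosed_hyperplane _ _).measurableSet).nullMeasurableSet
    · intro k l hkl y hy
      have h1 : creaseDist Ω ν c j y < 1 / ((l : ℝ) + 1) := hy.1.2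
      refine ⟨⟨hy.1.1, h1.trans_le ?_⟩, hy.2⟩
      exact one_div_le_one_div_of_le (by positivity) (by exact_mod_cast Nat.succ_le_succ hkl)
    · have := euclideanHausdorff_inter_hyperplane_ne_top b (c j)
        (S := Ω ∩ {y | creaseDist Ω ν c j y < 1 / (((0 : ℕ) : ℝ) + 1)}) (hb.subset inter_subset_left)
      rwa [hbν] at this
  obtain ⟨k, hk⟩ := (hlim.eventually (gt_mem_nhds hη)).exists
  exact ⟨1 / ((k : ℝ) + 1), by positivity, hk⟩

end JumpPoints

/-! ### The displacement of the lattice -/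

section Shift

variable {N m : ℕ} {H : Matrix (Fin N) (Fin N) ℝ} {Ω : Set (Eu N)} {ν : Fin m → Eu N}
  {c : Fin m → ℝ} {u : Eu N → Eu N} {C : ℝ≥0}

lemma exists_round_node (x : Eu N) : ∃ k : Fin N → ℤ, ‖x - node 1 k‖ ≤ N := by
  refine ⟨fun i => round (x i), norm_le_card_of_abs_le fun i => ?_⟩
  simp only [PiLp.sub_apply, node_apply, one_mul]
  exact (abs_sub_round _).trans (by norm_num)

/-- The position of a hyperplane relative to the lattice is split into a lattice vector, which the
energy does not see, and a bounded offset along the normal, which a displacement has to correct. -/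
lemma exists_normal_offset {ν : Eu N} (hν : ‖ν‖ = 1) (t : ℝ) :
    ∃ (k : Fin N → ℤ) (s : ℝ), |s| ≤ N ∧ inner ℝ (node 1 k) ν + s = t := by
  obtain ⟨k, hk⟩ := exists_round_node (t • ν)
  refine ⟨k, t - inner ℝ (node 1 k) ν, ?_, by ring⟩
  have e : t - inner ℝ (node 1 k) ν = inner ℝ (t • ν - node 1 k) ν := by
    rw [inner_sub_left, inner_smul_left, real_inner_self_eq_norm_sq, hν]; simp
  rw [e]
  exact (abs_real_inner_le_norm _ _).trans (by rw [hν, mul_one]; exact hk)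

lemma mem_latticeCube_floor {ε : ℝ} (hε : 0 < ε) (x : Eu N) : x ∈ latticeCube ε fun i => ⌊x i / ε⌋ := by
  intro i
  constructor
  · rw [mul_comm, ← le_div_iff₀ hε]; exact Int.floor_le _
  · rw [mul_comm, ← div_le_iff₀ hε]; exact (Int.lt_floor_add_one _).le

lemma subset_cubeHull {ε : ℝ} (hε : 0 < ε) : Ω ⊆ cubeHull ε Ω := fun x hx =>
  mem_iUnion₂.2 ⟨_, ⟨x, mem_latticeCube_floor hε x, hx⟩, mem_latticeCube_floor hε x⟩

lemma norm_sub_le_of_mem_latticeCube {ε : ℝ} (hε : 0 < ε) {c : Fin N → ℤ} {x y : Eu N}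
    (hx : x ∈ latticeCube ε c) (hy : y ∈ latticeCube ε c) : ‖x - y‖ ≤ N * ε := by
  have h : ‖ε⁻¹ • (x - y)‖ ≤ N := by
    refine norm_le_card_of_abs_le fun i => ?_
    simp only [PiLp.smul_apply, PiLp.sub_apply, smul_eq_mul]
    rw [abs_mul, abs_of_pos (inv_pos.2 hε), inv_mul_le_iff₀ hε, abs_le]
    constructor <;> linarith [(hx i).1, (hx i).2, (hy i).1, (hy i).2]
  rwa [norm_smul, norm_inv, Real.norm_of_nonneg hε.le, inv_mul_le_iff₀ hε, mul_comm] at h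

/-- The truncation of the distance that switches the normal offset on. -/
def ramp (δ d : ℝ) : ℝ := max 0 (min 1 (d / δ - 1))

lemma ramp_nonneg (δ d : ℝ) : 0 ≤ ramp δ d := le_max_left _ _

lemma ramp_le_one (δ d : ℝ) : ramp δ d ≤ 1 := max_le zero_le_one (min_le_left _ _)

lemma ramp_eq_zero {δ d : ℝ} (hδ : 0 < δ) (h : d ≤ δ) : ramp δ d = 0 :=
  max_eq_left ((min_le_right _ _).trans (by rw [sub_nonpos, div_le_one hδ]; exact h))

lemma ramp_eq_one {δ d : ℝ} (hδ : 0 < δ) (h : 2 * δ ≤ d) : ramp δ d = 1 := by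
  have : 1 ≤ d / δ - 1 := by rw [le_sub_iff_add_le, le_div_iff₀ hδ]; linarith
  rw [ramp, min_eq_left this, max_eq_right zero_le_one]

lemma abs_ramp_sub_le {δ : ℝ} (hδ : 0 < δ) (d d' : ℝ) : |ramp δ d - ramp δ d'| ≤ δ⁻¹ * |d - d'| := by
  have h1 := abs_max_sub_max_le_abs (min 1 (d / δ - 1)) (min 1 (d' / δ - 1)) 0
  have h2 := abs_min_sub_min_le_max 1 (d / δ - 1) 1 (d' / δ - 1)
  rw [sub_self, abs_zero, max_eq_right (abs_nonneg _)] at h2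
  have h3 : |d / δ - 1 - (d' / δ - 1)| = δ⁻¹ * |d - d'| := by
    rw [sub_sub_sub_cancel_right, ← sub_div, abs_div, abs_of_pos hδ, div_eq_inv_mul]
  rw [ramp, ramp, max_comm 0, max_comm 0]
  linarith

/-- A displacement that moves the nodes near the boundary into `Ω` and places the lattice in the
prescribed position with respect to the hyperplanes. -/
lemma exists_shift_field (h : PiecewiseRigid H Ω ν c u C) (hb : Bornology.IsBounded Ω)
    (hL : HasLipschitzBoundary Ω) {δ : ℝ} (hδ : 0 < δ) {R : ℝ} (hR : 0 < R) :
    ∃ (Λ : ℝ≥0) (CY ε₀ : ℝ), 0 < ε₀ ∧ 0 ≤ CY ∧ ∀ s : Fin m → ℝ, (∀ j, |s j| ≤ N) →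
      ∃ Y : Eu N → Eu N, LipschitzWith Λ Y ∧ (∀ x, ‖Y x‖ ≤ CY) ∧
        (∀ ε, 0 < ε → ε < ε₀ → ∀ z, node ε z ∈ cubeHull ε Ω →
          Metric.ball (node ε z + ε • Y (node ε z)) (R * ε) ⊆ Ω) ∧
        ∀ j, ∀ y ∈ hyperplane (ν j) (c j), 3 * δ ≤ creaseDist Ω ν c j y →
          ∀ x, dist x y ≤ δ → Y x = s j • ν j := by
  obtain ⟨X, Λ, C, κ, δ₁, t₀, hX, hXC, hκ, hδ₁, ht₀, hX0, hXin⟩ := exists_inward_field h.isOpen hb hL hδ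
  have hC : 0 ≤ C := (norm_nonneg _).trans (hXC 0)
  set S : ℝ := m * N with hS
  have hS0 : 0 ≤ S := by positivity
  -- The inward displacement by `M * ε` has to leave room for the distance `N * ε` from a node to a
  -- point of `Ω` in its cube, the offsets `S * ε`, the ball of radius `R * ε`, and another `ε` for
  -- the variation of the field.
  set M : ℝ := (N + S + R + 1) / κ with hM
  have hM0 : 0 < M := by positivity
  have hκM : κ * M = N + S + R + 1 := by rw [hM]; field_simp
  -- None of these constants depends on `s`, which will vary with the mesh size.
  refine ⟨Real.toNNReal (M * Λ + S * δ⁻¹), M * C + S,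
    min (δ₁ / (N + (M * C + S) + R)) (min (t₀ / M) (1 / (M * Λ * N + 1))), ?_, by positivity, fun s hs => ?_⟩
  · have : 0 < (N : ℝ) + (M * C + S) + R := by positivity
    refine lt_min (by positivity) (lt_min (by positivity) (by positivity))
  have hsum : ∀ f : Fin m → ℝ, ∀ D : ℝ, (∀ j, |f j| ≤ D) → ‖∑ j, (s j * f j) • ν j‖ ≤ S * D := by
    intro f D hf
    refine (norm_sum_le _ _).trans ((Finset.sum_le_sum (g := fun _ => (N : ℝ) * D) fun j _ => ?_).trans_eq ?_)
    · rw [norm_smul, h.norm_normal j, mul_one, norm_mul, Real.norm_eq_abs, Real.norm_eq_abs]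
      exact mul_le_mul (hs j) (hf j) (abs_nonneg _) (by positivity)
    · simp [hS, mul_assoc]
  -- The offset of each hyperplane is switched on only at points that are not close to the boundary
  -- or to the other hyperplanes.
  set Z : Eu N → Eu N := fun x => ∑ j, (s j * ramp δ (creaseDist Ω ν c j x)) • ν j with hZ
  have hZn : ∀ x, ‖Z x‖ ≤ S := fun x => by
    refine (hsum _ 1 fun j => ?_).trans_eq (mul_one _)
    rw [abs_of_nonneg (ramp_nonneg _ _)]; exact ramp_le_one _ _
  refine ⟨fun x => M • X x + Z x, LipschitzWith.of_dist_le_mul fun x y => ?_, fun x => ?_, ?_, ?_⟩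
  · rw [Real.coe_toNNReal _ (by positivity), dist_eq_norm]
    have e : M • X x + Z x - (M • X y + Z y) = M • (X x - X y) +
        ∑ j, (s j * (ramp δ (creaseDist Ω ν c j x) - ramp δ (creaseDist Ω ν c j y))) • ν j := by
      simp only [hZ, smul_sub, mul_sub, sub_smul, Finset.sum_sub_distrib]; abel
    rw [e]
    have h1 := hX.dist_le_mul x y
    rw [dist_eq_norm] at h1
    have h2 := hsum (fun j => ramp δ (creaseDist Ω ν c j x) - ramp δ (creaseDist Ω ν c j y))
      (δ⁻¹ * dist x y) fun j => by
        refine (abs_ramp_sub_le hδ _ _).trans (mul_le_mul_of_nonneg_left ?_ (inv_nonneg.2 hδ.le))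
        have := (Metric.lipschitz_infDist_pt (Ωᶜ ∪ ⋃ i, ⋃ (_ : i ≠ j), hyperplane (ν i) (c i))).dist_le_mul x y
        rwa [NNReal.coe_one, one_mul, Real.dist_eq] at this
    refine (norm_add_le _ _).trans ((add_le_add ?_ h2).trans_eq
      (b := M * (Λ * dist x y) + S * (δ⁻¹ * dist x y)) (by ring))
    rw [norm_smul, Real.norm_of_nonneg hM0.le]
    exact mul_le_mul_of_nonneg_left h1 hM0.le
  · refine (norm_add_le _ _).trans (add_le_add ?_ (hZn x))
    rw [norm_smul, Real.norm_of_nonneg hM0.le]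
    exact mul_le_mul_of_nonneg_left (hXC x) hM0.le
  · intro ε hε hε₀ z hz
    obtain ⟨q, ⟨x, hxq, hxΩ⟩, hzq⟩ := mem_iUnion₂.1 hz
    have hd := norm_sub_le_of_mem_latticeCube hε hzq hxq
    have e1 := hε₀.trans_le (min_le_left _ _)
    have e2 := hε₀.trans_le ((min_le_right _ _).trans (min_le_left _ _))
    have e3 := hε₀.trans_le ((min_le_right _ _).trans (min_le_right _ _))
    rw [lt_div_iff₀ (by positivity)] at e1 e2 e3
    have hZx := hZn (node ε z)
    rcases hXin x hxΩ with h1 | h1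
    · refine subset_trans (Metric.ball_subset_ball' ?_) h1
      rw [dist_eq_norm]
      have e : node ε z + ε • (M • X (node ε z) + Z (node ε z)) - x =
          (node ε z - x) + ε • (M • X (node ε z) + Z (node ε z)) := by abel
      have h3 : ‖ε • (M • X (node ε z) + Z (node ε z))‖ ≤ ε * (M * C + S) := by
        rw [norm_smul, Real.norm_of_nonneg hε.le]
        refine mul_le_mul_of_nonneg_left ((norm_add_le _ _).trans (add_le_add ?_ hZx)) hε.le
        rw [norm_smul, Real.norm_of_nonneg hM0.le]
        exact mul_le_mul_of_nonneg_left (hXC _) hM0.le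
      rw [e]
      have := norm_add_le (node ε z - x) (ε • (M • X (node ε z) + Z (node ε z)))
      nlinarith
    · refine subset_trans (Metric.ball_subset_ball' ?_) (h1 (M * ε) (by positivity) (by linarith))
      rw [dist_eq_norm]
      have e : node ε z + ε • (M • X (node ε z) + Z (node ε z)) - (x + (M * ε) • X x) =
          (node ε z - x) + ((M * ε) • (X (node ε z) - X x) + ε • Z (node ε z)) := by
        rw [smul_add, smul_smul, mul_comm ε M, smul_sub]; abel
      have h2 := hX.dist_le_mul (node ε z) x
      rw [dist_eq_norm, dist_eq_norm] at h2
      have h3 : ‖(M * ε) • (X (node ε z) - X x)‖ ≤ M * ε * (Λ * (N * ε)) := by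
        rw [norm_smul, Real.norm_of_nonneg (by positivity)]
        refine mul_le_mul_of_nonneg_left (h2.trans ?_) (by positivity)
        exact mul_le_mul_of_nonneg_left hd (by positivity)
      have h4 : ‖ε • Z (node ε z)‖ ≤ ε * S := by
        rw [norm_smul, Real.norm_of_nonneg hε.le]
        exact mul_le_mul_of_nonneg_left hZx hε.le
      rw [e]
      have h5 := norm_add_le (node ε z - x) ((M * ε) • (X (node ε z) - X x) + ε • Z (node ε z))
      have h6 := norm_add_le ((M * ε) • (X (node ε z) - X x)) (ε • Z (node ε z))
      have h7 : M * ε * (Λ * (N * ε)) ≤ ε * 1 := by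
        have : M * ε * (Λ * (N * ε)) = ε * (ε * (M * Λ * N)) := by ring
        rw [this]
        exact mul_le_mul_of_nonneg_left (by nlinarith) hε.le
      have h8 : κ * (M * ε) = (N + S + R + 1) * ε := by rw [← mul_assoc, hκM]
      rw [h8]; linarith
  · intro j y hy hyd x hxy
    have hdx : 2 * δ ≤ creaseDist Ω ν c j x := by
      have := creaseDist_le (Ω := Ω) (ν := ν) (c := c) (j := j) y x
      rw [dist_comm] at this
      linarith
    have hX' : X x = 0 := by
      refine hX0 x fun y' hy' => (mem_of_dist_lt_creaseDist (x := x) (ν := ν) (c := c) (j := j) ?_).1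
      rw [Metric.mem_ball, dist_comm] at hy'
      linarith
    have hZ' : Z x = s j • ν j := by
      simp only [hZ]
      rw [Finset.sum_eq_single j]
      · rw [ramp_eq_one hδ hdx, mul_one]
      -- The point `x` is within `δ` of the `j`-th hyperplane, so for every other index `i` the
      -- distance `creaseDist` is at most `δ`, and the offset is off.
      · intro i _ hij
        rw [ramp_eq_zero hδ, mul_zero, zero_smul]
        refine (Metric.infDist_le_dist_of_mem ?_).trans hxy
        exact Or.inr (mem_iUnion₂.2 ⟨j, hij.symm, hy⟩)
      · simp
    simp only [hX', hZ', smul_zero, zero_add]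

end Shift

/-! ### The recovery sequence on the lattice -/

lemma fold_smul {N : ℕ} {H : Matrix (Fin N) (Fin N) ℝ} (ν x : Eu N) {ε : ℝ} (hε : 0 < ε) :
    fold H ν (ε • x) = ε • fold H ν x := by
  have h : 0 ≤ inner ℝ (ε • x) ν ↔ 0 ≤ inner ℝ x ν := by
    rw [inner_smul_left]; exact mul_nonneg_iff_of_pos_left hε
  unfold fold twinMap
  simp only [h]
  split_ifs <;> rw [map_smul]

/-- The data for one member of the recovery sequence: a displacement `Y` of the lattice `ε ℤ^N`, which
puts it in the position `k j`, `s j` relative to the `j`-th hyperplane, and almost optimal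
deformations `W j κ` of the cells of size `T` along that hyperplane. -/
structure Layout {n m : ℕ} (H : Matrix (Fin (n + 1)) (Fin (n + 1)) ℝ) (Ω : Set (Eu (n + 1)))
    (ν : Fin m → Eu (n + 1)) (c : Fin m → ℝ) (u : Eu (n + 1) → Eu (n + 1)) (C : ℝ≥0) where
  basis : Fin m → OrthonormalBasis (Fin (n + 1)) ℝ (Eu (n + 1))
  (ε δ T CY CW : ℝ)
  Λ : ℝ≥0
  k : Fin m → Fin (n + 1) → ℤ
  s : Fin m → ℝ
  Y : Eu (n + 1) → Eu (n + 1)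
  W : Fin m → (Fin n → ℤ) → (Fin (n + 1) → ℤ) → Eu (n + 1)
  rigid : PiecewiseRigid H Ω ν c u C
  det_pos : 0 < H.det
  bounded : Bornology.IsBounded Ω
  basis_zero : ∀ j, basis j 0 = ν j
  ε_pos : 0 < ε
  δ_pos : 0 < δ
  le_T : 6 * maxBond (n + 1) + 1 ≤ T
  CY_nonneg : 0 ≤ CY
  small : ε * ((n + 1) * T + (n + 1) + 2 * maxBond (n + 1) + CY + 1) ≤ δ
  Λ_small : Λ * ε ≤ 1 / 2
  offset : ∀ j, inner ℝ (node 1 (k j)) (ν j) + s j = c j / ε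
  abs_offset : ∀ j, |s j| ≤ n + 1
  lipschitz : LipschitzWith Λ Y
  norm_le : ∀ x, ‖Y x‖ ≤ CY
  ball_subset : ∀ z, node ε z ∈ cubeHull ε Ω →
    Metric.ball (node ε z + ε • Y (node ε z)) ((2 * (maxBond (n + 1) + (n + 1)) + 1) * ε) ⊆ Ω
  field_eq : ∀ j, ∀ y ∈ hyperplane (ν j) (c j), 3 * δ ≤ creaseDist Ω ν c j y →
    ∀ x, dist x y ≤ δ → Y x = s j • ν j
  cell_eq : ∀ j κ z, node 1 z ∉ cubeAt (basis j) (gridPoint (basis j) T κ) (T - 2 * maxBond (n + 1)) →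
    W j κ z = fold H (ν j) (node 1 z)
  cell_near : ∀ j κ z, ‖W j κ z - fold H (ν j) (node 1 z)‖ ≤ CW

namespace Layout

variable {n m : ℕ} {H : Matrix (Fin (n + 1)) (Fin (n + 1)) ℝ} {Ω : Set (Eu (n + 1))}
  {ν : Fin m → Eu (n + 1)} {c : Fin m → ℝ} {u : Eu (n + 1) → Eu (n + 1)} {C : ℝ≥0}
  (A : Layout H Ω ν c u C)

/-- The displaced node. -/
def shift (z : Fin (n + 1) → ℤ) : Eu (n + 1) := node A.ε z + A.ε • A.Y (node A.ε z)

/-- The centre of a tile. -/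
def centre (q : Fin m × (Fin n → ℤ)) : Eu (n + 1) :=
  A.ε • (node 1 (A.k q.1) + A.s q.1 • ν q.1 + gridPoint (A.basis q.1) A.T q.2)

/-- The tiles along the creases. -/
def active : Set (Fin m × (Fin n → ℤ)) :=
  {q | 3 * A.δ ≤ creaseDist Ω ν c q.1 (A.centre q) ∧ A.centre q ∉ flatSet H Ω u}

/-- The nodes of a tile. -/
def cell (q : Fin m × (Fin n → ℤ)) : Set (Fin (n + 1) → ℤ) :=
  {z | z - A.k q.1 ∈ nodesIn (cubeAt (A.basis q.1) (gridPoint (A.basis q.1) A.T q.2) A.T)}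

lemma T_pos : 0 < A.T := by linarith [A.le_T, maxBond_nonneg (n + 1)]

lemma small_one : A.ε * ((n + 1) * A.T + (n + 1)) ≤ A.δ := by
  refine le_trans (mul_le_mul_of_nonneg_left ?_ A.ε_pos.le) A.small
  linarith [A.CY_nonneg, maxBond_nonneg (n + 1)]

lemma small_two : A.ε * (2 * maxBond (n + 1) + A.CY + 1) ≤ A.δ := by
  refine le_trans (mul_le_mul_of_nonneg_left ?_ A.ε_pos.le) A.small
  have : (0 : ℝ) ≤ (n + 1) * A.T + (n + 1) := by have := A.T_pos; positivity
  linarith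

include A in
lemma inner_normal (j : Fin m) : inner ℝ (ν j) (ν j) = (1 : ℝ) := by
  rw [real_inner_self_eq_norm_sq, A.rigid.norm_normal j]; norm_num

lemma inner_gridPoint (j : Fin m) (κ : Fin n → ℤ) :
    inner ℝ (gridPoint (A.basis j) A.T κ) (ν j) = 0 := by
  rw [← A.basis_zero j, inner_gridPoint_zero]

lemma centre_mem (q) : A.centre q ∈ hyperplane (ν q.1) (c q.1) := by
  change inner ℝ (A.centre q) (ν q.1) = c q.1
  rw [centre, inner_smul_left, inner_add_left, inner_add_left, inner_smul_left, A.inner_gridPoint,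
    A.inner_normal]
  simp only [conj_trivial, mul_one, add_zero, A.offset]
  have := A.ε_pos.ne'
  field_simp

lemma node_sub_centre (q) (z : Fin (n + 1) → ℤ) : node A.ε z + A.ε • (A.s q.1 • ν q.1) - A.centre q =
    A.ε • (node 1 (z - A.k q.1) - gridPoint (A.basis q.1) A.T q.2) := by
  rw [centre, node_eq_smul A.ε z, node_sub, ← smul_add, ← smul_sub]
  congr 1
  abel

lemma norm_le_of_mem_cell {q} {z} (hz : z ∈ A.cell q) :
    ‖node 1 (z - A.k q.1) - gridPoint (A.basis q.1) A.T q.2‖ ≤ (n + 1) * (A.T / 2) := by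
  have := norm_le_of_abs_inner_le (A.basis q.1) (fun l => (hz l).le)
  simpa using this

lemma dist_centre_le_mul {q} {z} (hz : z ∈ A.cell q) :
    dist (node A.ε z) (A.centre q) ≤ A.ε * ((n + 1) * A.T + (n + 1)) := by
  have e : node A.ε z - A.centre q = A.ε • (node 1 (z - A.k q.1) - gridPoint (A.basis q.1) A.T q.2) -
      A.ε • (A.s q.1 • ν q.1) := by rw [← A.node_sub_centre]; abel
  rw [dist_eq_norm, e, ← smul_sub, norm_smul, Real.norm_of_nonneg A.ε_pos.le]
  refine mul_le_mul_of_nonneg_left ?_ A.ε_pos.le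
  have h1 : ‖A.s q.1 • ν q.1‖ ≤ n + 1 := by
    rw [norm_smul, A.rigid.norm_normal, mul_one]; exact A.abs_offset _
  have h2 : ((n : ℝ) + 1) * (A.T / 2) ≤ (n + 1) * A.T := by
    have := A.T_pos
    gcongr; linarith
  linarith [norm_sub_le (node 1 (z - A.k q.1) - gridPoint (A.basis q.1) A.T q.2) (A.s q.1 • ν q.1),
    A.norm_le_of_mem_cell hz]

lemma dist_centre_le {q} {z} (hz : z ∈ A.cell q) : dist (node A.ε z) (A.centre q) ≤ A.δ :=
  (A.dist_centre_le_mul hz).trans A.small_one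

lemma centre_mem_domain {q} (hq : q ∈ A.active) {x : Eu (n + 1)} (hx : dist (A.centre q) x < 3 * A.δ) :
    x ∈ Ω ∧ ∀ i, i ≠ q.1 → x ∉ hyperplane (ν i) (c i) :=
  mem_of_dist_lt_creaseDist (lt_of_lt_of_le hx hq.1)

/-- The ball around the centre of an active tile meets no other hyperplane, and the centre is not
flat, so the fold alternative holds. Inactive tiles get the identity. -/
lemma exists_rot (q) : ∃ Q ∈ Matrix.orthogonalGroup (Fin (n + 1)) ℝ, q ∈ A.active →
    (∀ x, ‖x‖ < 3 * A.δ → u (A.centre q + x) = u (A.centre q) + lin Q (fold H (ν q.1) x)) ∧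
      ∀ y ∈ Metric.ball (A.centre q) (3 * A.δ), y ∈ hyperplane (ν q.1) (c q.1) → y ∉ flatSet H Ω u := by
  by_cases hq : q ∈ A.active
  · have hδ : 0 < 3 * A.δ := by linarith [A.δ_pos]
    rcases A.rigid.flat_or_fold A.det_pos (A.centre_mem q) hδ
      (fun y hy => (A.centre_mem_domain hq (by rwa [dist_comm])).1)
      (fun i hi y hy => (A.centre_mem_domain hq (by rwa [dist_comm])).2 i hi) with h | ⟨Q, hQ, -, h1, h2⟩
    · exact absurd (h (Metric.mem_ball_self hδ)) hq.2
    · exact ⟨Q, hQ, fun _ => ⟨h1, h2⟩⟩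
  · exact ⟨1, one_mem _, fun h => absurd h hq⟩

/-- The rotation of the deformation at the centre of a tile. -/
def rot (q : Fin m × (Fin n → ℤ)) : Matrix (Fin (n + 1)) (Fin (n + 1)) ℝ := (A.exists_rot q).choose

lemma rot_mem (q) : A.rot q ∈ Matrix.orthogonalGroup (Fin (n + 1)) ℝ := (A.exists_rot q).choose_spec.1

lemma apply_centre_add {q} (hq : q ∈ A.active) {x : Eu (n + 1)} (hx : ‖x‖ < 3 * A.δ) :
    u (A.centre q + x) = u (A.centre q) + lin (A.rot q) (fold H (ν q.1) x) :=
  ((A.exists_rot q).choose_spec.2 hq).1 x hx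

lemma notMem_flatSet {q} (hq : q ∈ A.active) {y : Eu (n + 1)} (hy : dist y (A.centre q) < 3 * A.δ)
    (hyP : y ∈ hyperplane (ν q.1) (c q.1)) : y ∉ flatSet H Ω u :=
  ((A.exists_rot q).choose_spec.2 hq).2 y hy hyP

/-- In an active tile `Y` is the constant offset, so the displaced nodes form a rigid copy of the
lattice in which the crease passes through lattice position. In lattice coordinates `u` is then
exactly a rotated fold. -/
lemma apply_shift {q} (hq : q ∈ A.active) {z} (hz : z ∈ A.cell q) :
    u (A.shift z) = u (A.centre q) + A.ε • lin (A.rot q) (fold H (ν q.1) (node 1 (z - A.k q.1)) -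
      lin H (gridPoint (A.basis q.1) A.T q.2)) := by
  have hY := A.field_eq q.1 _ (A.centre_mem q) hq.1 _ (A.dist_centre_le hz)
  have e : A.shift z = A.centre q +
      A.ε • (node 1 (z - A.k q.1) - gridPoint (A.basis q.1) A.T q.2) := by
    rw [shift, hY, ← A.node_sub_centre]; abel
  rw [e, A.apply_centre_add hq, fold_smul _ _ A.ε_pos, map_smul]
  · congr 3
    have := fold_add_of_orthogonal A.det_pos (x := node 1 (z - A.k q.1))
      (t := -gridPoint (A.basis q.1) A.T q.2) (ν := ν q.1)
      (by rw [inner_neg_left, A.inner_gridPoint, neg_zero])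
    rw [sub_eq_add_neg (node 1 _), this, map_neg, ← sub_eq_add_neg]
  · rw [norm_smul, Real.norm_of_nonneg A.ε_pos.le]
    have h1 := mul_le_mul_of_nonneg_left (A.norm_le_of_mem_cell hz) A.ε_pos.le
    have h2 := A.small_one
    have h3 : A.ε * ((n + 1) * (A.T / 2)) ≤ A.ε * ((n + 1) * A.T + (n + 1)) := by
      have := A.T_pos
      refine mul_le_mul_of_nonneg_left ?_ A.ε_pos.le
      nlinarith
    linarith [A.δ_pos]

/-- Along one hyperplane the cells form a grid. Cells along different hyperplanes cannot meet,
because the centre of an active tile is far from all other hyperplanes. -/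
lemma cell_disjoint {q q'} (hq : q ∈ A.active) {z} (hz : z ∈ A.cell q)
    (hz' : z ∈ A.cell q') : q = q' := by
  obtain ⟨j, κ⟩ := q
  obtain ⟨j', κ'⟩ := q'
  by_cases hj : j = j'
  · subst hj
    congr 1
    refine disjoint_cubeAt_gridPoint (A.basis j) A.T_pos 0 (x := node 1 (z - A.k j)) ?_ ?_
    · rw [zero_add]; exact hz
    · rw [zero_add]; exact hz'
  · have h1 := A.dist_centre_le hz
    have h2 := A.dist_centre_le hz'
    have h3 := dist_triangle_left (A.centre (j, κ)) (A.centre (j', κ')) (node A.ε z)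
    exact absurd (A.centre_mem (j', κ'))
      ((A.centre_mem_domain hq (by linarith [A.δ_pos])).2 j' (Ne.symm hj))

lemma finite_active : A.active.Finite := by
  obtain ⟨R, hR⟩ := A.bounded.exists_norm_le
  have hsub : A.active ⊆ ⋃ j : Fin m, (fun κ => (j, κ)) '' {κ | gridPoint (A.basis j) A.T κ ∈
      Metric.closedBall 0 (A.ε⁻¹ * R + ‖node 1 (A.k j) + A.s j • ν j‖)} := by
    rintro ⟨j, κ⟩ hq
    refine mem_iUnion.2 ⟨j, κ, ?_, rfl⟩
    have h1 := hR _ (A.centre_mem_domain hq (by rw [dist_self]; linarith [A.δ_pos])).1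
    have e : gridPoint (A.basis j) A.T κ = A.ε⁻¹ • A.centre (j, κ) - (node 1 (A.k j) + A.s j • ν j) := by
      rw [centre, smul_smul, inv_mul_cancel₀ A.ε_pos.ne', one_smul]; abel
    rw [mem_ofPred_eq, mem_closedBall_zero_iff, e]
    refine (norm_sub_le _ _).trans (add_le_add_left ?_ _)
    rw [norm_smul, norm_inv, Real.norm_of_nonneg A.ε_pos.le]
    exact mul_le_mul_of_nonneg_left h1 (inv_nonneg.2 A.ε_pos.le)
  exact (Set.finite_iUnion fun j =>
    (finite_gridPoint (A.basis j) A.T_pos Metric.isBounded_closedBall).image _).subset hsub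

/-- The finite set of the tiles along the creases. -/
def tiles : Finset (Fin m × (Fin n → ℤ)) := A.finite_active.toFinset

lemma mem_tiles {q} : q ∈ A.tiles ↔ q ∈ A.active := A.finite_active.mem_toFinset

/-- The correction of the deformation in a tile. -/
def correction (q : Fin m × (Fin n → ℤ)) (z : Fin (n + 1) → ℤ) : Eu (n + 1) :=
  A.ε • lin (A.rot q) (A.W q.1 q.2 (z - A.k q.1) - fold H (ν q.1) (node 1 (z - A.k q.1)))

lemma norm_correction_le (q z) : ‖A.correction q z‖ ≤ A.ε * A.CW := by
  rw [correction, norm_smul, Real.norm_of_nonneg A.ε_pos.le, norm_lin_orthogonal (A.rot_mem q)]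
  exact mul_le_mul_of_nonneg_left (A.cell_near _ _ _) A.ε_pos.le

lemma mem_of_correction_ne_zero {q z} (h : A.correction q z ≠ 0) :
    node 1 (z - A.k q.1) ∈
      cubeAt (A.basis q.1) (gridPoint (A.basis q.1) A.T q.2) (A.T - 2 * maxBond (n + 1)) := by
  by_contra hcon
  exact h (by rw [correction, A.cell_eq _ _ _ hcon, sub_self, map_zero, smul_zero])

lemma mem_cell_of_correction {q z ξ} (h : A.correction q z ≠ 0) (hξ : ‖node 1 ξ‖ ≤ maxBond (n + 1)) :
    z + ξ ∈ A.cell q := by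
  refine mem_cubeAt_of_norm_le (A.mem_of_correction_ne_zero h) ?_
  rw [← node_sub]
  have : z + ξ - A.k q.1 - (z - A.k q.1) = ξ := by abel
  rwa [this]

lemma mem_cell_of_correction_self {q z} (h : A.correction q z ≠ 0) : z ∈ A.cell q := by
  have := A.mem_cell_of_correction h (ξ := 0) (by
    have : (node 1 0 : Eu (n + 1)) = 0 := by ext i; simp
    rw [this, norm_zero]; exact maxBond_nonneg _)
  rwa [add_zero] at this

open Classical in
/-- The deformation of the nodes. -/
def position (z : Fin (n + 1) → ℤ) : Eu (n + 1) :=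
  if node A.ε z ∈ cubeHull A.ε Ω then u (A.shift z) + ∑ q ∈ A.tiles, A.correction q z else 0

lemma position_eq {z} (hz : node A.ε z ∈ cubeHull A.ε Ω) :
    A.position z = u (A.shift z) + ∑ q ∈ A.tiles, A.correction q z := if_pos hz

lemma sum_correction {q z} (hq : q ∈ A.active) (hz : z ∈ A.cell q) :
    ∑ q' ∈ A.tiles, A.correction q' z = A.correction q z := by
  refine Finset.sum_eq_single q (fun q' _ hne => ?_) fun h => absurd (A.mem_tiles.2 hq) h
  by_contra h
  exact hne (A.cell_disjoint hq hz (A.mem_cell_of_correction_self h)).symm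

lemma norm_sum_correction_le (hCW : 0 ≤ A.CW) (z) : ‖∑ q ∈ A.tiles, A.correction q z‖ ≤ A.ε * A.CW := by
  by_cases h : ∃ q ∈ A.tiles, A.correction q z ≠ 0
  · obtain ⟨q, hq, hne⟩ := h
    rw [A.sum_correction (A.mem_tiles.1 hq) (A.mem_cell_of_correction_self hne)]
    exact A.norm_correction_le q z
  · push Not at h
    rw [Finset.sum_eq_zero h, norm_zero]
    exact mul_nonneg A.ε_pos.le hCW

lemma mem_hull_of_mem_cell {q z} (hq : q ∈ A.active) (hz : z ∈ A.cell q) :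
    node A.ε z ∈ cubeHull A.ε Ω := by
  refine subset_cubeHull A.ε_pos (A.centre_mem_domain hq ?_).1
  rw [dist_comm]
  linarith [A.dist_centre_le hz, A.δ_pos]

/-- Inside a tile the rescaled deformation is the cell solution up to a lattice translation and a
rigid motion, which the energy ignores. -/
lemma latEnergy_cell {p : ℝ} {q} (hq : q ∈ A.active) :
    latEnergy H p (A.cell q) (fun z => A.ε⁻¹ • A.position z) = latEnergy H p
      (nodesIn (cubeAt (A.basis q.1) (gridPoint (A.basis q.1) A.T q.2) A.T)) (A.W q.1 q.2) := by
  rw [← latEnergy_move (A.rot_mem q) (A.W q.1 q.2) (A.ε⁻¹ • u (A.centre q) -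
    lin (A.rot q) (lin H (gridPoint (A.basis q.1) A.T q.2))) (A.k q.1)]
  refine latEnergy_congr fun z hz => ?_
  rw [A.position_eq (A.mem_hull_of_mem_cell hq hz), A.sum_correction hq hz, A.apply_shift hq hz, correction]
  rw [smul_add, smul_add, smul_smul, smul_smul, inv_mul_cancel₀ A.ε_pos.ne', one_smul, one_smul,
    map_sub, map_sub]
  abel

end Layout

lemma bondCost_smul_le {N : ℕ} {H : Matrix (Fin N) (Fin N) ℝ} {p : ℝ} (hp : 0 ≤ p)
    {w : (Fin N → ℤ) → Eu N} {ξ z : Fin N → ℤ} {ε d : ℝ} (hε : 0 < ε)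
    (h : |‖w (z + ξ) - w z‖ - ‖lin H (node ε ξ)‖| ≤ ε * d) :
    bondCost H p (fun z => ε⁻¹ • w z) ξ z ≤ ENNReal.ofReal (d ^ p) := by
  refine bondCost_le hp ?_
  rw [← smul_sub, norm_smul, norm_inv, Real.norm_of_nonneg hε.le]
  rw [node_eq_smul ε, map_smul, norm_smul, Real.norm_of_nonneg hε.le] at h
  have e : ε⁻¹ * ‖w (z + ξ) - w z‖ - ‖lin H (node 1 ξ)‖ =
      ε⁻¹ * (‖w (z + ξ) - w z‖ - ε * ‖lin H (node 1 ξ)‖) := by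
    field_simp
  rwa [e, abs_mul, abs_of_pos (inv_pos.2 hε), inv_mul_le_iff₀ hε]

/-! ### Classification of the bonds of the displaced lattice -/

namespace Layout

variable {n m : ℕ} {H : Matrix (Fin (n + 1)) (Fin (n + 1)) ℝ} {Ω : Set (Eu (n + 1))}
  {ν : Fin m → Eu (n + 1)} {c : Fin m → ℝ} {u : Eu (n + 1) → Eu (n + 1)} {C : ℝ≥0}
  (A : Layout H Ω ν c u C)

lemma norm_shift_sub_le (z z' : Fin (n + 1) → ℤ) :
    ‖A.shift z' - A.shift z - (node A.ε z' - node A.ε z)‖ ≤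
      A.Λ * A.ε * ‖node A.ε z' - node A.ε z‖ := by
  have e : A.shift z' - A.shift z - (node A.ε z' - node A.ε z) =
      A.ε • (A.Y (node A.ε z') - A.Y (node A.ε z)) := by
    rw [shift, shift, smul_sub]; abel
  have h := A.lipschitz.dist_le_mul (node A.ε z') (node A.ε z)
  rw [dist_eq_norm, dist_eq_norm] at h
  rw [e, norm_smul, Real.norm_of_nonneg A.ε_pos.le, mul_comm (A.Λ : ℝ), mul_assoc]
  exact mul_le_mul_of_nonneg_left h A.ε_pos.le

lemma norm_shift_sub_le_two_mul (z z' : Fin (n + 1) → ℤ) :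
    ‖A.shift z' - A.shift z‖ ≤ 2 * ‖node A.ε z' - node A.ε z‖ := by
  have h := A.norm_shift_sub_le z z'
  have h1 := norm_sub_norm_le (A.shift z' - A.shift z) (node A.ε z' - node A.ε z)
  nlinarith [A.Λ_small, norm_nonneg (node A.ε z' - node A.ε z)]

lemma norm_node_sub_le_two_mul (z z' : Fin (n + 1) → ℤ) :
    ‖node A.ε z' - node A.ε z‖ ≤ 2 * ‖A.shift z' - A.shift z‖ := by
  have h := A.norm_shift_sub_le z z'
  have h1 := norm_sub_norm_le (node A.ε z' - node A.ε z) (A.shift z' - A.shift z)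
  rw [norm_sub_rev (node A.ε z' - node A.ε z) (A.shift z' - A.shift z)] at h1
  nlinarith [A.Λ_small, norm_nonneg (node A.ε z' - node A.ε z)]

lemma dist_shift_le (z : Fin (n + 1) → ℤ) : dist (node A.ε z) (A.shift z) ≤ A.ε * A.CY := by
  rw [dist_eq_norm, shift, sub_add_cancel_left, norm_neg, norm_smul, Real.norm_of_nonneg A.ε_pos.le]
  exact mul_le_mul_of_nonneg_left (A.norm_le _) A.ε_pos.le

lemma ball_shift_subset {z} (hz : node A.ε z ∈ cubeHull A.ε Ω) :
    Metric.ball (A.shift z) ((2 * (maxBond (n + 1) + (n + 1)) + 1) * A.ε) ⊆ Ω := A.ball_subset z hz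

lemma shift_mem {z} (hz : node A.ε z ∈ cubeHull A.ε Ω) : A.shift z ∈ Ω := by
  refine A.ball_shift_subset hz (Metric.mem_ball_self ?_)
  have := A.ε_pos
  have := maxBond_nonneg (n + 1)
  positivity

lemma norm_apply_shift_sub_le {z z'} (hz : node A.ε z ∈ cubeHull A.ε Ω)
    (h : ‖node A.ε z' - node A.ε z‖ ≤ A.ε * (maxBond (n + 1) + (n + 1))) :
    ‖u (A.shift z') - u (A.shift z)‖ ≤ C * (2 * ‖node A.ε z' - node A.ε z‖) := by
  have hε := A.ε_pos
  have h1 := A.norm_shift_sub_le_two_mul z z'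
  have h2 := (A.rigid.lipschitz _ _ (A.ball_shift_subset hz)).dist_le_mul (A.shift z') (by
    rw [Metric.mem_ball, dist_eq_norm]; nlinarith) (A.shift z) (Metric.mem_ball_self (by
      have := maxBond_nonneg (n + 1)
      positivity))
  rw [dist_eq_norm, dist_eq_norm] at h2
  exact h2.trans (mul_le_mul_of_nonneg_left h1 C.2)

lemma norm_node_bond {ξ} (hξ : ξ ∈ bonds (n + 1)) : ‖node A.ε ξ‖ ≤ A.ε * maxBond (n + 1) := by
  rw [node_eq_smul, norm_smul, Real.norm_of_nonneg A.ε_pos.le]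
  exact mul_le_mul_of_nonneg_left (norm_node_le_maxBond hξ) A.ε_pos.le

/-- The deformation is rigid along the segment, so the only error is the change of the bond by the
Lipschitz displacement. -/
lemma abs_sub_le_of_flat {z z' : Fin (n + 1) → ℤ}
    (h : segment ℝ (A.shift z) (A.shift z') ⊆ flatSet H Ω u) :
    |‖u (A.shift z') - u (A.shift z)‖ - ‖lin H (node A.ε z' - node A.ε z)‖| ≤
      ‖lin H‖ * (A.Λ * A.ε * ‖node A.ε z' - node A.ε z‖) := by
  obtain ⟨Q, hQ, e⟩ := exists_rigid_of_segment h
  rw [e, lin_mul, norm_lin_orthogonal hQ]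
  refine (abs_norm_sub_norm_le _ _).trans ?_
  rw [← map_sub]
  exact ((lin H).le_opNorm _).trans
    (mul_le_mul_of_nonneg_left (A.norm_shift_sub_le z z') (norm_nonneg _))

/-- The nodes near that part of a hyperplane which is close to the boundary or to other ones. -/
def near (j : Fin m) : Set (Fin (n + 1) → ℤ) :=
  {z | ∃ y ∈ hyperplane (ν j) (c j), ‖y - A.shift z‖ ≤ 2 * maxBond (n + 1) * A.ε ∧
    creaseDist Ω ν c j y < 4 * A.δ ∧ Metric.ball y A.ε ⊆ Ω}

/-- The nodes near the crease that are close to the lateral faces of a tile. -/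
def shell (q : Fin m × (Fin n → ℤ)) : Set (Fin (n + 1) → ℤ) :=
  {z | |inner ℝ (node 1 z - (node 1 (A.k q.1) + gridPoint (A.basis q.1) A.T q.2)) (A.basis q.1 0)| ≤
      2 * maxBond (n + 1) ∧
    (∀ l, |inner ℝ (node 1 z - (node 1 (A.k q.1) + gridPoint (A.basis q.1) A.T q.2)) (A.basis q.1 l)| ≤
      A.T / 2 + 2 * maxBond (n + 1)) ∧
    ∃ l, l ≠ 0 ∧ A.T / 2 + 2 * maxBond (n + 1) - 3 * maxBond (n + 1) ≤
      |inner ℝ (node 1 z - (node 1 (A.k q.1) + gridPoint (A.basis q.1) A.T q.2)) (A.basis q.1 l)|}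

/-- The point `y`, written in lattice coordinates, is rounded to the grid of tile centres; the node
is within two bond lengths of it. If the bond is not inside that tile, the node must be near a
lateral face. -/
lemma exists_tile {j : Fin m} {z ξ : Fin (n + 1) → ℤ} (hξ : ‖node 1 ξ‖ ≤ maxBond (n + 1)) {y : Eu (n + 1)}
    (hy : y ∈ hyperplane (ν j) (c j)) (hyf : y ∉ flatSet H Ω u)
    (hyz : ‖y - A.shift z‖ ≤ 2 * maxBond (n + 1) * A.ε) (hyd : 4 * A.δ ≤ creaseDist Ω ν c j y) :
    ∃ q ∈ A.active, (z ∈ A.cell q ∧ z + ξ ∈ A.cell q) ∨ z ∈ A.shell q := by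
  have hε := A.ε_pos
  have hδ := A.δ_pos
  have hr := maxBond_nonneg (n + 1)
  have hT := A.le_T
  set r := maxBond (n + 1) with hrdef
  have hd : dist (node A.ε z) y ≤ A.δ := by
    have h1 := dist_triangle_right (node A.ε z) y (A.shift z)
    have h2 := A.dist_shift_le z
    rw [dist_eq_norm y] at h1
    have h3 := A.small_two
    nlinarith
  have hY := A.field_eq j y hy (by linarith) _ hd
  -- The coordinates of `y` in the displaced lattice, relative to the reference position on the
  -- hyperplane.
  obtain ⟨ζ, hζ⟩ : ∃ ζ, ζ = A.ε⁻¹ • y - (node 1 (A.k j) + A.s j • ν j) := ⟨_, rfl⟩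
  have hy' : inner ℝ y (ν j) = c j := hy
  have hζ0 : inner ℝ ζ (A.basis j 0) = 0 := by
    rw [A.basis_zero, hζ, inner_sub_left, inner_smul_left, inner_add_left, inner_smul_left,
      A.inner_normal, hy']
    simp only [conj_trivial, mul_one, A.offset]
    rw [div_eq_inv_mul, sub_self]
  obtain ⟨κ, hκ⟩ := exists_gridPoint_near (A.basis j) A.T_pos hζ0
  have hzx : node 1 (z - A.k j) - ζ = A.ε⁻¹ • (A.shift z - y) := by
    rw [shift, hY, node_eq_smul A.ε, ← smul_add, smul_sub, smul_smul, inv_mul_cancel₀ hε.ne', one_smul,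
      hζ, node_sub]
    abel
  have hzn : ‖node 1 (z - A.k j) - ζ‖ ≤ 2 * r := by
    rw [hzx, norm_smul, norm_inv, Real.norm_of_nonneg hε.le, inv_mul_le_iff₀ hε, norm_sub_rev]
    linarith
  have hcy : dist (A.centre (j, κ)) y ≤ A.δ := by
    have e : A.centre (j, κ) - y = -(A.ε • (ζ - gridPoint (A.basis j) A.T κ)) := by
      rw [centre, hζ, smul_sub, smul_sub, smul_smul, mul_inv_cancel₀ hε.ne', one_smul, smul_add]
      abel
    rw [dist_eq_norm, e, norm_neg, norm_smul, Real.norm_of_nonneg hε.le]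
    have h1 := norm_le_of_abs_inner_le (A.basis j) hκ
    push_cast at h1
    refine le_trans (mul_le_mul_of_nonneg_left (h1.trans ?_) hε.le) A.small_one
    have := A.T_pos
    nlinarith [(Nat.cast_nonneg n : (0 : ℝ) ≤ n)]
  have hcd : 3 * A.δ ≤ creaseDist Ω ν c j (A.centre (j, κ)) := by
    have := creaseDist_le (Ω := Ω) (ν := ν) (c := c) (j := j) y (A.centre (j, κ))
    rw [dist_comm] at this
    linarith
  -- A crease cannot end inside the large ball around the centre: either the whole ball is flat,
  -- which `y` excludes, or no point of the hyperplane in it is flat.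
  have hq : (j, κ) ∈ A.active := by
    refine ⟨hcd, fun hflat => ?_⟩
    have hmem : ∀ x ∈ Metric.ball (A.centre (j, κ)) (3 * A.δ), x ∈ Ω ∧ ∀ i, i ≠ j → x ∉ hyperplane (ν i) (c i) :=
      fun x hx => mem_of_dist_lt_creaseDist (lt_of_lt_of_le (by rwa [dist_comm]) hcd)
    rcases A.rigid.flat_or_fold A.det_pos (A.centre_mem (j, κ)) (by linarith)
      (fun x hx => (hmem x hx).1) (fun i hi x hx => (hmem x hx).2 i hi) with h | ⟨-, -, -, -, h⟩
    · refine hyf (h ?_)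
      rw [Metric.mem_ball, dist_comm]; linarith
    · exact h _ (Metric.mem_ball_self (by linarith)) (A.centre_mem (j, κ)) hflat
  refine ⟨(j, κ), hq, ?_⟩
  by_cases hcell : z ∈ A.cell (j, κ) ∧ z + ξ ∈ A.cell (j, κ)
  · exact Or.inl hcell
  refine Or.inr ?_
  set t := gridPoint (A.basis j) A.T κ with ht
  set x := node 1 (z - A.k j) with hx
  have hx0 : node 1 z - (node 1 (A.k j) + t) = x - t := by rw [hx, node_sub]; abel
  have hb : ∀ l, |inner ℝ (x - t) (A.basis j l)| ≤ |inner ℝ (ζ - t) (A.basis j l)| + 2 * r := fun l =>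
    (abs_inner_sub_le (A.basis j) ζ x t l).trans (by linarith)
  have hb0 : |inner ℝ (x - t) (A.basis j 0)| ≤ 2 * r := by
    have := hb 0
    rwa [inner_sub_left ζ, hζ0, ht, inner_gridPoint_zero, sub_zero, abs_zero, zero_add] at this
  have hex : ∃ l, A.T / 2 - r ≤ |inner ℝ (x - t) (A.basis j l)| := by
    by_contra! hcon
    refine hcell ⟨fun l => (hcon l).trans_le (by linarith), fun l => ?_⟩
    have e : node 1 (z + ξ - A.k j) - x = node 1 ξ := by
      rw [hx, ← node_sub]; congr 1; abel
    have := abs_inner_sub_le (A.basis j) x (node 1 (z + ξ - A.k j)) t l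
    rw [e] at this
    linarith [hcon l]
  obtain ⟨l, hl⟩ := hex
  refine ⟨?_, fun l => ?_, l, ?_, ?_⟩
  · rw [hx0]; exact hb0
  · rw [hx0]; linarith [hb l, hκ l]
  · rintro rfl; linarith
  · rw [hx0]; linarith

/-- The bonds whose energy is not small lie in a tile, or have their first node in one of the sets
`near j` and `shell q`. -/
lemma bond_cases {p : ℝ} (hp : 0 ≤ p) {ξ z : Fin (n + 1) → ℤ} (hξ : ξ ∈ bonds (n + 1))
    (hz : node A.ε z ∈ cubeHull A.ε Ω) (hz' : node A.ε (z + ξ) ∈ cubeHull A.ε Ω) :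
    (∃ q ∈ A.tiles, z ∈ A.cell q ∧ z + ξ ∈ A.cell q) ∨
      bondCost H p (fun z => A.ε⁻¹ • A.position z) ξ z ≤
        ENNReal.ofReal ((‖lin H‖ * A.Λ * maxBond (n + 1) * A.ε) ^ p) ∨
      (((∃ j, z ∈ A.near j) ∨ ∃ q ∈ A.tiles, z ∈ A.shell q) ∧
        bondCost H p (fun z => A.ε⁻¹ • A.position z) ξ z ≤
          ENNReal.ofReal ((2 * C * maxBond (n + 1) + ‖lin H‖ * maxBond (n + 1)) ^ p)) := by
  have hε := A.ε_pos
  have hr := maxBond_nonneg (n + 1)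
  have hξn := norm_node_le_maxBond hξ
  have hξε := A.norm_node_bond hξ
  by_cases hcell : ∃ q ∈ A.tiles, z ∈ A.cell q ∧ z + ξ ∈ A.cell q
  · exact Or.inl hcell
  refine Or.inr ?_
  have hsub : node A.ε (z + ξ) - node A.ε z = node A.ε ξ := by rw [node_add, add_sub_cancel_left]
  -- Corrections vanish within one bond length of the faces of a tile. A bond that lies in no tile
  -- therefore has uncorrected ends.
  have hpos : A.position z = u (A.shift z) := by
    rw [A.position_eq hz, Finset.sum_eq_zero, add_zero]
    intro q hq
    by_contra h
    exact hcell ⟨q, hq, A.mem_cell_of_correction_self h, A.mem_cell_of_correction h hξn⟩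
  have hpos' : A.position (z + ξ) = u (A.shift (z + ξ)) := by
    rw [A.position_eq hz', Finset.sum_eq_zero, add_zero]
    intro q hq
    by_contra h
    refine hcell ⟨q, hq, ?_, A.mem_cell_of_correction_self h⟩
    have hneg : ‖node 1 (-ξ)‖ ≤ maxBond (n + 1) := by
      have : node 1 (-ξ) = -node 1 ξ := by ext i; simp
      rwa [this, norm_neg]
    have := A.mem_cell_of_correction h hneg
    rwa [add_neg_cancel_right] at this
  by_cases hseg : segment ℝ (A.shift z) (A.shift (z + ξ)) ⊆ flatSet H Ω u
  · left
    refine bondCost_smul_le hp hε ?_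
    have h := A.abs_sub_le_of_flat hseg
    rw [hsub] at h
    rw [hpos, hpos']
    refine h.trans (le_trans (mul_le_mul_of_nonneg_left (mul_le_mul_of_nonneg_left hξε ?_) (norm_nonneg _))
      (le_of_eq ?_))
    · exact mul_nonneg A.Λ.2 hε.le
    · ring
  right
  refine ⟨?_, ?_⟩
  -- The displaced bond meets a point that is not flat, which has to lie on a hyperplane. Depending
  -- on its distance to the boundary and to the other hyperplanes, it is near a bad part or near a
  -- tile.
  · obtain ⟨y, hys, hyf⟩ := not_subset.1 hseg
    have hsd := A.norm_shift_sub_le_two_mul z (z + ξ)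
    rw [hsub] at hsd
    have hyz : ‖y - A.shift z‖ ≤ 2 * maxBond (n + 1) * A.ε := by
      have h1 : ‖y - A.shift z‖ ≤ ‖A.shift (z + ξ) - A.shift z‖ := norm_sub_le_of_mem_segment hys
      linarith
    have hyb : Metric.ball y A.ε ⊆ Ω := by
      refine subset_trans (Metric.ball_subset_ball' ?_) (A.ball_shift_subset hz)
      rw [dist_eq_norm]
      nlinarith [(Nat.cast_nonneg n : (0 : ℝ) ≤ n)]
    have hyP : ∃ j, y ∈ hyperplane (ν j) (c j) := by
      by_contra! hcon
      exact hyf (A.rigid.mem_flatSet (hyb (Metric.mem_ball_self hε)) hcon)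
    obtain ⟨j, hj⟩ := hyP
    rcases lt_or_ge (creaseDist Ω ν c j y) (4 * A.δ) with hd | hd
    · exact Or.inl ⟨j, y, hj, hyz, hd, hyb⟩
    · obtain ⟨q, hq, h1 | h1⟩ := A.exists_tile hξn hj hyf hyz hd
      · exact absurd ⟨q, A.mem_tiles.2 hq, h1⟩ hcell
      · exact Or.inr ⟨q, A.mem_tiles.2 hq, h1⟩
  · refine bondCost_smul_le hp hε ?_
    rw [hpos, hpos']
    have h1 := A.norm_apply_shift_sub_le hz (z' := z + ξ) (by rw [hsub]; nlinarith)
    rw [hsub] at h1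
    have h2 := (lin H).le_opNorm (node A.ε ξ)
    have h3 : ‖lin H‖ * ‖node A.ε ξ‖ ≤ ‖lin H‖ * (A.ε * maxBond (n + 1)) :=
      mul_le_mul_of_nonneg_left hξε (norm_nonneg _)
    have h4 : (C : ℝ) * (2 * ‖node A.ε ξ‖) ≤ C * (2 * (A.ε * maxBond (n + 1))) :=
      mul_le_mul_of_nonneg_left (by linarith) C.2
    have h5 := norm_nonneg (u (A.shift (z + ξ)) - u (A.shift z))
    have h6 := norm_nonneg (lin H (node A.ε ξ))
    rw [abs_le]
    constructor <;> nlinarith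

end Layout

/-- The nodes lie in a fixed ball, so their number is at most of the order `ε ^ (-N)`. -/
lemma exists_count_hull_le {N : ℕ} {Ω : Set (Eu N)} (hb : Bornology.IsBounded Ω) :
    ∃ K : ℝ≥0, ∀ ε : ℝ, 0 < ε → ε ≤ 1 →
      ENNReal.ofReal (ε ^ N) * Measure.count {z : Fin N → ℤ | node ε z ∈ cubeHull ε Ω} ≤ K := by
  obtain ⟨R, hR⟩ := hb.exists_norm_le
  set V := volume (Metric.closedBall (0 : Eu N) (R + 2 * N)) with hV
  have hVt : V ≠ ⊤ := measure_closedBall_lt_top.ne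
  refine ⟨V.toNNReal, fun ε hε hε1 => ?_⟩
  rw [ENNReal.coe_toNNReal hVt]
  have hcount : Measure.count {z : Fin N → ℤ | node ε z ∈ cubeHull ε Ω} ≤
      volume (Metric.closedBall (0 : Eu N) (ε⁻¹ * (R + 2 * N))) := by
    refine count_le_volume fun z hz y hy => ?_
    obtain ⟨q, ⟨x, hxq, hxΩ⟩, hzq⟩ := mem_iUnion₂.1 hz
    have hd := norm_sub_le_of_mem_latticeCube hε hzq hxq
    have h1 : ‖node ε z‖ ≤ R + N * ε := by
      have := norm_add_le (node ε z - x) x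
      rw [sub_add_cancel] at this
      linarith [hR x hxΩ]
    rw [node_eq_smul, norm_smul, Real.norm_of_nonneg hε.le] at h1
    have h2 := norm_add_le (y - node 1 z) (node 1 z)
    rw [sub_add_cancel] at h2
    rw [mem_closedBall_zero_iff, ← div_eq_inv_mul, le_div_iff₀ hε]
    have h3 : (N : ℝ) * ε ≤ N * 1 := mul_le_mul_of_nonneg_left hε1 (Nat.cast_nonneg N)
    nlinarith
  refine (mul_le_mul_right hcount _).trans (le_of_eq ?_)
  rw [Measure.addHaar_closedBall_mul_of_pos volume _ (inv_pos.2 hε), finrank_euclideanSpace_fin, ← mul_assoc,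
    ← ENNReal.ofReal_mul (by positivity), ← mul_pow, mul_inv_cancel₀ hε.ne', one_pow, ENNReal.ofReal_one,
    one_mul]

/-! ### The energy of the deformed lattice -/

namespace Layout

variable {n m : ℕ} {H : Matrix (Fin (n + 1)) (Fin (n + 1)) ℝ} {Ω : Set (Eu (n + 1))}
  {ν : Fin m → Eu (n + 1)} {c : Fin m → ℝ} {u : Eu (n + 1) → Eu (n + 1)} {C : ℝ≥0}
  (A : Layout H Ω ν c u C)

/-- The bound for the number of nodes near the lateral faces of a tile of size `T`. -/
def shellBound (n : ℕ) (T : ℝ) : ℝ :=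
  2 * (n + 1) * ((2 * (2 * maxBond (n + 1)) + 2 * (n + 1)) * ((3 * maxBond (n + 1) + 2 * (n + 1)) *
    (2 * (T / 2 + 2 * maxBond (n + 1)) + 2 * (n + 1)) ^ (n - 1)))

lemma count_shell_le (q) : Measure.count (A.shell q) ≤ ENNReal.ofReal (shellBound n A.T) := by
  have hr := maxBond_nonneg (n + 1)
  have hT := A.T_pos
  exact count_plateShell_le (A.basis q.1) (node 1 (A.k q.1) + gridPoint (A.basis q.1) A.T q.2)
    (k := 2 * maxBond (n + 1)) (D := A.T / 2 + 2 * maxBond (n + 1)) (h := 3 * maxBond (n + 1))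
    (by positivity) (by positivity) (by positivity)

/-- The traces of the active tiles on the hyperplane are disjoint squares of side `ε * T`. They are
contained in the crease because the fold persists throughout the ball around each centre. -/
lemma card_tiles_le (j : Fin m) :
    ((A.tiles.filter fun q => q.1 = j).card : ℝ≥0∞) * ENNReal.ofReal ((A.ε * A.T) ^ n) ≤
      (μHE[n] : Measure (Eu (n + 1))) (crease H Ω ν c u j) := by
  classical
  have hε := A.ε_pos
  have hT := A.T_pos
  have hcard : (A.tiles.filter fun q => q.1 = j).card =
      ((A.tiles.filter fun q => q.1 = j).image Prod.snd).card := by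
    rw [Finset.card_image_of_injOn]
    intro q hq q' hq' h
    simp only [Finset.coe_filter, mem_ofPred_eq] at hq hq'
    exact Prod.ext (hq.2.trans hq'.2.symm) h
  rw [hcard]
  refine (card_tiles_mul_le (A.basis j) (c j) _ (WithLp.toLp 2 fun l : Fin n =>
    A.ε * inner ℝ (node 1 (A.k j)) (A.basis j l.succ)) (mul_pos hε hT)
    (S := crease H Ω ν c u j) fun κ hκ x hx => ?_).trans (measure_mono inter_subset_left)
  simp only [Finset.mem_image, Finset.mem_filter, Prod.exists, exists_eq_right] at hκ
  have hq := A.mem_tiles.1 hκ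
  have hyP : planeMap (A.basis j) (c j) x ∈ hyperplane (ν j) (c j) := by
    have := inner_planeMap_zero (A.basis j) (c j) x
    rwa [A.basis_zero] at this
  have hd : dist (planeMap (A.basis j) (c j) x) (A.centre (j, κ)) ≤ A.δ := by
    have h1 : ∀ l, |inner ℝ (planeMap (A.basis j) (c j) x - A.centre (j, κ)) (A.basis j l)| ≤
        A.ε * A.T / 2 := by
      intro l
      refine Fin.cases ?_ (fun l => ?_) l
      · have h2 : inner ℝ (A.centre (j, κ)) (A.basis j 0) = c j := by
          rw [A.basis_zero]; exact A.centre_mem (j, κ)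
        rw [inner_sub_left, inner_planeMap_zero, h2, sub_self, abs_zero]
        positivity
      · have h3 : inner ℝ (A.centre (j, κ)) (A.basis j l.succ) =
            A.ε * inner ℝ (node 1 (A.k j)) (A.basis j l.succ) + A.ε * A.T * κ l := by
          rw [centre, inner_smul_left, inner_add_left, inner_add_left, inner_smul_left,
            inner_gridPoint_succ, ← A.basis_zero, inner_basis, if_neg (Fin.succ_ne_zero l).symm]
          simp only [conj_trivial]
          ring
        rw [inner_sub_left, inner_planeMap_succ, h3]
        exact hx l
    have h4 := norm_le_of_abs_inner_le (A.basis j) h1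
    rw [dist_eq_norm]
    refine h4.trans (le_trans ?_ A.small_one)
    push_cast
    have : (0 : ℝ) ≤ n := Nat.cast_nonneg n
    have h5 : 0 ≤ ((n : ℝ) + 1) * (A.ε * A.T) := by positivity
    nlinarith
  have hlt : dist (planeMap (A.basis j) (c j) x) (A.centre (j, κ)) < 3 * A.δ := by linarith [A.δ_pos]
  have hm := A.centre_mem_domain hq (by rwa [dist_comm])
  exact ⟨hm.1, A.notMem_flatSet hq hlt hyP, hyP, hm.2⟩

/-- The bound for the energy of a bond that meets a crease. -/
def creaseCost (H : Matrix (Fin (n + 1)) (Fin (n + 1)) ℝ) (C : ℝ≥0) (p : ℝ) : ℝ :=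
  (2 * C * maxBond (n + 1) + ‖lin H‖ * maxBond (n + 1)) ^ p

lemma creaseCost_nonneg (H : Matrix (Fin (n + 1)) (Fin (n + 1)) ℝ) (C : ℝ≥0) (p : ℝ) :
    0 ≤ creaseCost H C p := by
  have := maxBond_nonneg (n + 1)
  unfold creaseCost
  positivity

lemma latEnergy_position_le {p : ℝ} (hp : 0 ≤ p) :
    latEnergy H p {z | node A.ε z ∈ cubeHull A.ε Ω} (fun z => A.ε⁻¹ • A.position z) ≤
      ∑ q ∈ A.tiles, (latEnergy H p (nodesIn (cubeAt (A.basis q.1) (gridPoint (A.basis q.1) A.T q.2) A.T))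
        (A.W q.1 q.2) + ENNReal.ofReal (Fintype.card (bonds (n + 1)) * creaseCost H C p * shellBound n A.T)) +
      Fintype.card (bonds (n + 1)) * (ENNReal.ofReal (creaseCost H C p) * ∑ j, Measure.count (A.near j) +
        ENNReal.ofReal ((‖lin H‖ * A.Λ * maxBond (n + 1) * A.ε) ^ p) *
          Measure.count {z | node A.ε z ∈ cubeHull A.ε Ω}) := by
  classical
  -- All nodes pay the small price of the displacement (`true`); the nodes near bad parts or lateral
  -- faces also pay the price of a bond at a crease (`false`).
  set D : Bool → Set (Fin (n + 1) → ℤ) := fun i => bif i then {z | node A.ε z ∈ cubeHull A.ε Ω} else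
    (⋃ j, A.near j) ∪ ⋃ q ∈ A.tiles, A.shell q with hD
  set d : Bool → ℝ≥0∞ := fun i => bif i then
    ENNReal.ofReal ((‖lin H‖ * A.Λ * maxBond (n + 1) * A.ε) ^ p) else
    ENNReal.ofReal (creaseCost H C p) with hd
  have h := latEnergy_le_sum (H := H) (p := p) (L := {z | node A.ε z ∈ cubeHull A.ε Ω})
    (w := fun z => A.ε⁻¹ • A.position z) A.tiles A.cell Finset.univ D d (fun ξ hξ z hz hz' => by
      rcases A.bond_cases hp hξ hz hz' with h | h | ⟨h, h'⟩
      · exact Or.inl h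
      · exact Or.inr (Or.inr ⟨true, Finset.mem_univ _, hz, h⟩)
      · refine Or.inr (Or.inr ⟨false, Finset.mem_univ _, ?_, h'⟩)
        rcases h with ⟨j, hj⟩ | ⟨q, hq, hz⟩
        · exact Or.inl (mem_iUnion.2 ⟨j, hj⟩)
        · exact Or.inr (mem_iUnion₂.2 ⟨q, hq, hz⟩))
  refine h.trans ?_
  have hcell : ∑ q ∈ A.tiles, latEnergy H p (A.cell q) (fun z => A.ε⁻¹ • A.position z) =
      ∑ q ∈ A.tiles, latEnergy H p
        (nodesIn (cubeAt (A.basis q.1) (gridPoint (A.basis q.1) A.T q.2) A.T)) (A.W q.1 q.2) :=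
    Finset.sum_congr rfl fun q hq => A.latEnergy_cell (A.mem_tiles.1 hq)
  have hcount : Measure.count ((⋃ j, A.near j) ∪ ⋃ q ∈ A.tiles, A.shell q) ≤
      ∑ j, Measure.count (A.near j) + ∑ q ∈ A.tiles, ENNReal.ofReal (shellBound n A.T) := by
    refine (measure_union_le _ _).trans (add_le_add ?_ ?_)
    · exact measure_iUnion_fintype_le _ _
    · exact (measure_biUnion_finset_le _ _).trans (Finset.sum_le_sum fun q _ => A.count_shell_le q)
  rw [hcell, Fintype.sum_bool, Finset.sum_add_distrib]
  simp only [hd, hD, cond_true, cond_false]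
  have hcc : ENNReal.ofReal (Fintype.card (bonds (n + 1)) * creaseCost H C p * shellBound n A.T) =
      Fintype.card (bonds (n + 1)) * (ENNReal.ofReal (creaseCost H C p) * ENNReal.ofReal (shellBound n A.T)) := by
    rw [mul_assoc, ENNReal.ofReal_mul (Nat.cast_nonneg _), ENNReal.ofReal_mul (creaseCost_nonneg H C p),
      ENNReal.ofReal_natCast]
  rw [hcc, Finset.sum_const, nsmul_eq_mul]
  rw [Finset.sum_const, nsmul_eq_mul] at hcount
  exact (add_le_add_right (mul_le_mul_right (add_le_add_right (mul_le_mul_right hcount _) _) _) _).trans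
    (le_of_eq (by ring))

/-- The energy of the deformation. -/
lemma pairEnergy_le {p : ℝ} (hp : 0 ≤ p) {g : Fin m → ℝ≥0} {η : ℝ} (hη : 0 ≤ η)
    (hcell : ∀ j κ, latEnergy H p (nodesIn (cubeAt (A.basis j) (gridPoint (A.basis j) A.T κ) A.T))
        (A.W j κ) ≤ ENNReal.ofReal ((g j + η) * A.T ^ n))
    (hshell : Fintype.card (bonds (n + 1)) * creaseCost H C p * shellBound n A.T ≤ η * A.T ^ n)
    {a : Fin m → ℝ≥0∞}
    (hnear : ∀ j, ENNReal.ofReal (A.ε ^ n) * Measure.count (A.near j) ≤ a j) :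
    pairEnergy H p A.ε {z | node A.ε z ∈ cubeHull A.ε Ω} A.position ≤
      ∑ j, ENNReal.ofReal (g j + 2 * η) * (μHE[n] : Measure (Eu (n + 1))) (crease H Ω ν c u j) +
      Fintype.card (bonds (n + 1)) * (ENNReal.ofReal (creaseCost H C p) * ∑ j, a j +
        ENNReal.ofReal ((‖lin H‖ * A.Λ * maxBond (n + 1) * A.ε) ^ p) *
          (ENNReal.ofReal (A.ε ^ n) * Measure.count {z | node A.ε z ∈ cubeHull A.ε Ω})) := by
  classical
  have hε := A.ε_pos
  have hT := A.T_pos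
  rw [pairEnergy_eq H p hε, Nat.add_sub_cancel]
  refine (mul_le_mul_right (A.latEnergy_position_le hp) _).trans ?_
  rw [mul_add, Finset.mul_sum]
  refine add_le_add ?_ ?_
  · rw [← Finset.sum_fiberwise A.tiles Prod.fst]
    refine Finset.sum_le_sum fun j _ => ?_
    refine le_trans ?_ (mul_le_mul_right (A.card_tiles_le j) _)
    have hq : ∀ q ∈ A.tiles.filter (fun q => q.1 = j), ENNReal.ofReal (A.ε ^ n) * (latEnergy H p
        (nodesIn (cubeAt (A.basis q.1) (gridPoint (A.basis q.1) A.T q.2) A.T)) (A.W q.1 q.2) +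
        ENNReal.ofReal (Fintype.card (bonds (n + 1)) * creaseCost H C p * shellBound n A.T)) ≤
        ENNReal.ofReal (g j + 2 * η) * ENNReal.ofReal ((A.ε * A.T) ^ n) := by
      intro q hq
      rw [Finset.mem_filter] at hq
      have h1 := hcell q.1 q.2
      rw [hq.2] at h1 ⊢
      refine (mul_le_mul_right (add_le_add h1 (ENNReal.ofReal_le_ofReal hshell)) _).trans (le_of_eq ?_)
      rw [← ENNReal.ofReal_add (by positivity) (by positivity), ← ENNReal.ofReal_mul (by positivity),
        ← ENNReal.ofReal_mul (by positivity)]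
      congr 1
      ring
    refine (Finset.sum_le_sum hq).trans (le_of_eq ?_)
    rw [Finset.sum_const, nsmul_eq_mul]
    ring
  · have h1 : ENNReal.ofReal (A.ε ^ n) * ∑ j, Measure.count (A.near j) ≤ ∑ j, a j := by
      rw [Finset.mul_sum]; exact Finset.sum_le_sum fun j _ => hnear j
    calc _ = Fintype.card (bonds (n + 1)) * (ENNReal.ofReal (creaseCost H C p) *
            (ENNReal.ofReal (A.ε ^ n) * ∑ j, Measure.count (A.near j)) +
          ENNReal.ofReal ((‖lin H‖ * A.Λ * maxBond (n + 1) * A.ε) ^ p) *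
            (ENNReal.ofReal (A.ε ^ n) * Measure.count {z | node A.ε z ∈ cubeHull A.ε Ω})) := by ring
      _ ≤ _ := by gcongr

end Layout

/-- The properties of a deformation `w` of the nodes of `ε ℤ^N` that make its interpolation a good
approximation of `u`, with energy at most `B`. -/
structure IsRecovery {N m : ℕ} (H : Matrix (Fin N) (Fin N) ℝ) (p : ℝ) (Ω : Set (Eu N))
    (ν : Fin m → Eu N) (c : Fin m → ℝ) (u : Eu N → Eu N) (D R : ℝ) (B : ℝ≥0∞) (ε : ℝ)
    (w : (Fin N → ℤ) → Eu N) : Prop where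
  norm_le : ∀ z, ‖w z‖ ≤ D
  norm_sub_le : ∀ a b, node ε a ∈ cubeHull ε Ω → node ε b ∈ cubeHull ε Ω →
    ‖node ε a - node ε b‖ ≤ N * ε → ‖w a - w b‖ ≤ D * ε
  near_flat : ∀ x, Metric.ball x (R * ε) ⊆ Ω →
    (∀ j, ∀ y ∈ Metric.ball x (R * ε), y ∉ hyperplane (ν j) (c j)) →
    ∀ a, node ε a ∈ cubeHull ε Ω → ‖node ε a - x‖ ≤ N * ε →
      ‖w a - u x‖ ≤ D * ε ∧ ∀ b, node ε b ∈ cubeHull ε Ω → ‖node ε b - x‖ ≤ N * ε →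
        ‖w a - w b - fderiv ℝ u x (node ε a - node ε b)‖ ≤ D * ε * ε
  energy_le : pairEnergy H p ε {z | node ε z ∈ cubeHull ε Ω} w ≤ B

/-! ### Approximation by the deformed lattice -/

namespace Layout

variable {n m : ℕ} {H : Matrix (Fin (n + 1)) (Fin (n + 1)) ℝ} {Ω : Set (Eu (n + 1))}
  {ν : Fin m → Eu (n + 1)} {c : Fin m → ℝ} {u : Eu (n + 1) → Eu (n + 1)} {C : ℝ≥0}
  (A : Layout H Ω ν c u C)

lemma norm_position_le (hCW : 0 ≤ A.CW) {M : ℝ} (hM0 : 0 ≤ M) (hM : ∀ x ∈ Ω, ‖u x‖ ≤ M) (z) :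
    ‖A.position z‖ ≤ M + A.ε * A.CW := by
  by_cases hz : node A.ε z ∈ cubeHull A.ε Ω
  · rw [A.position_eq hz]
    exact (norm_add_le _ _).trans (add_le_add (hM _ (A.shift_mem hz)) (A.norm_sum_correction_le hCW z))
  · rw [position, if_neg hz, norm_zero]
    exact add_nonneg hM0 (mul_nonneg A.ε_pos.le hCW)

lemma norm_position_sub_le (hCW : 0 ≤ A.CW) {a b} (ha : node A.ε a ∈ cubeHull A.ε Ω)
    (hb : node A.ε b ∈ cubeHull A.ε Ω) (hab : ‖node A.ε a - node A.ε b‖ ≤ A.ε * (n + 1)) :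
    ‖A.position a - A.position b‖ ≤ A.ε * (2 * C * (n + 1) + 2 * A.CW) := by
  have hε := A.ε_pos
  rw [A.position_eq ha, A.position_eq hb, add_sub_add_comm]
  have h1 := A.norm_apply_shift_sub_le hb (z' := a) (hab.trans (by
    nlinarith [mul_nonneg hε.le (maxBond_nonneg (n + 1))]))
  have h2 := norm_sub_le (∑ q ∈ A.tiles, A.correction q a) (∑ q ∈ A.tiles, A.correction q b)
  have h3 := A.norm_sum_correction_le hCW a
  have h4 := A.norm_sum_correction_le hCW b
  have h5 : (C : ℝ) * (2 * ‖node A.ε a - node A.ε b‖) ≤ C * (2 * (A.ε * (n + 1))) :=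
    mul_le_mul_of_nonneg_left (by linarith) C.2
  refine (norm_add_le _ _).trans ?_
  linarith

/-- A nonzero correction at `a` would bring the centre of a tile, which lies on a hyperplane, into
the ball. -/
lemma position_eq_of_ball {x : Eu (n + 1)} {R : ℝ} (hR : (n + 1) * A.T + (n + 1) + (n + 1) < R)
    (hP : ∀ j, ∀ y ∈ Metric.ball x (R * A.ε), y ∉ hyperplane (ν j) (c j)) {a}
    (ha : node A.ε a ∈ cubeHull A.ε Ω) (hax : ‖node A.ε a - x‖ ≤ A.ε * (n + 1)) :
    A.position a = u (A.shift a) := by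
  rw [A.position_eq ha, Finset.sum_eq_zero, add_zero]
  intro q _
  by_contra h
  refine hP q.1 (A.centre q) ?_ (A.centre_mem q)
  have h1 := A.dist_centre_le_mul (A.mem_cell_of_correction_self h)
  rw [Metric.mem_ball]
  have h2 := dist_triangle_left (A.centre q) x (node A.ε a)
  rw [dist_eq_norm (node A.ε a) x] at h2
  have h3 := mul_lt_mul_of_pos_left hR A.ε_pos
  linarith

/-- Away from the hyperplanes there are no corrections and `u` is affine. The error of an increment
is then that of the displacement, `Λ * ε` times a bond length of order `ε`, hence of order `ε ^ 2`.
-/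
lemma isRecovery (hCW : 0 ≤ A.CW) {M : ℝ} (hM0 : 0 ≤ M) (hM : ∀ x ∈ Ω, ‖u x‖ ≤ M) (hε1 : A.ε ≤ 1)
    {p : ℝ} {D R : ℝ} {B : ℝ≥0∞}
    (hR : (n + 1) * A.T + (n + 1) + (n + 1) + A.CY < R) (hD1 : M + A.CW ≤ D)
    (hD2 : 2 * C * (n + 1) + 2 * A.CW ≤ D)
    (hD3 : ‖lin H‖ * ((n + 1) + A.CY) ≤ D) (hD4 : ‖lin H‖ * (A.Λ * (2 * (n + 1))) ≤ D)
    (hB : pairEnergy H p A.ε {z | node A.ε z ∈ cubeHull A.ε Ω} A.position ≤ B) :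
    IsRecovery H p Ω ν c u D R B A.ε A.position := by
  have hε := A.ε_pos
  have hn : ((n + 1 : ℕ) : ℝ) = n + 1 := by push_cast; ring
  refine ⟨fun z => ?_, fun a b ha hb hab => ?_, fun x hx hxP => ?_, hB⟩
  · refine (A.norm_position_le hCW hM0 hM z).trans (le_trans ?_ hD1)
    nlinarith
  · rw [hn, mul_comm] at hab
    refine (A.norm_position_sub_le hCW ha hb hab).trans ?_
    rw [mul_comm]
    exact mul_le_mul_of_nonneg_right hD2 hε.le
  · obtain ⟨Q, hQ, hr⟩ := A.rigid.affine x _ hx hxP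
    have hT := A.T_pos
    have hCY := A.CY_nonneg
    have hRpos : 0 < R := lt_of_le_of_lt (by positivity) hR
    have hxm : x ∈ Metric.ball x (R * A.ε) := Metric.mem_ball_self (by positivity)
    have hd : fderiv ℝ u x = lin (Q * H) := (hasFDerivAt_of_affine Metric.isOpen_ball hr hxm).fderiv
    have hnorm : ∀ v, ‖lin (Q * H) v‖ ≤ ‖lin H‖ * ‖v‖ := fun v => by
      rw [lin_mul, norm_lin_orthogonal hQ]; exact (lin H).le_opNorm v
    have key : ∀ a, node A.ε a ∈ cubeHull A.ε Ω → ‖node A.ε a - x‖ ≤ ((n + 1 : ℕ) : ℝ) * A.ε →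
        A.position a = u (A.shift a) ∧ A.shift a ∈ Metric.ball x (R * A.ε) ∧
          ‖A.shift a - x‖ ≤ ((n + 1) + A.CY) * A.ε := by
      intro a ha hax
      rw [hn, mul_comm] at hax
      have h1 := A.dist_shift_le a
      have h2 := dist_triangle_left (A.shift a) x (node A.ε a)
      rw [dist_eq_norm (node A.ε a) x, dist_eq_norm (A.shift a) x] at h2
      have h3 : ‖A.shift a - x‖ ≤ ((n + 1) + A.CY) * A.ε := by linarith
      refine ⟨A.position_eq_of_ball (by linarith) hxP ha hax, ?_, h3⟩
      rw [Metric.mem_ball, dist_eq_norm]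
      refine h3.trans_lt (mul_lt_mul_of_pos_right (lt_of_le_of_lt ?_ hR) hε)
      have : 0 ≤ ((n : ℝ) + 1) * A.T + (n + 1) := by positivity
      linarith
    intro a ha hax
    obtain ⟨ha1, ha2, ha3⟩ := key a ha hax
    constructor
    · rw [ha1, hr _ ha2 _ hxm]
      refine (hnorm _).trans ((mul_le_mul_of_nonneg_left ha3 (norm_nonneg _)).trans ?_)
      rw [← mul_assoc]
      exact mul_le_mul_of_nonneg_right hD3 hε.le
    · intro b hb hbx
      obtain ⟨hb1, hb2, -⟩ := key b hb hbx
      rw [ha1, hb1, hr _ ha2 _ hb2, hd, ← map_sub]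
      have h1 := A.norm_shift_sub_le b a
      have h2 : ‖node A.ε a - node A.ε b‖ ≤ 2 * (n + 1) * A.ε := by
        have e : node A.ε a - node A.ε b = (node A.ε a - x) - (node A.ε b - x) := by abel
        rw [e]
        rw [hn] at hax hbx
        linarith [norm_sub_le (node A.ε a - x) (node A.ε b - x)]
      refine (hnorm _).trans ((mul_le_mul_of_nonneg_left (h1.trans
        (mul_le_mul_of_nonneg_left h2 (mul_nonneg A.Λ.2 hε.le))) (norm_nonneg _)).trans ?_)
      have e : ‖lin H‖ * (A.Λ * A.ε * (2 * (n + 1) * A.ε)) =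
        ‖lin H‖ * (A.Λ * (2 * (n + 1))) * A.ε * A.ε := by ring
      rw [e]
      gcongr

end Layout

/-! ### The choice of the parameters -/

section Existence

variable {n m : ℕ} {H : Matrix (Fin (n + 1)) (Fin (n + 1)) ℝ} {Ω : Set (Eu (n + 1))}
  {ν : Fin m → Eu (n + 1)} {c : Fin m → ℝ} {u : Eu (n + 1) → Eu (n + 1)} {C : ℝ≥0}

/-- About `ε⁻¹` bonds, in units of the surface scaling, each cost `ε ^ p`. The product tends to zero
because `p > 1`. -/
lemma tendsto_bulk_energy {p : ℝ} (hp : 1 < p) {b : ℝ} (hb : 0 ≤ b) (K : ℝ) :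
    Tendsto (fun ε : ℝ => (b * ε) ^ p * (ε⁻¹ * K)) (𝓝[>] 0) (𝓝 0) := by
  have h1 : Tendsto (fun ε : ℝ => b ^ p * K * ε ^ (p - 1)) (𝓝[>] 0) (𝓝 0) := by
    have : ContinuousAt (fun ε : ℝ => b ^ p * K * ε ^ (p - 1)) 0 :=
      continuousAt_const.mul (continuousAt_id.rpow_const (Or.inr (by linarith)))
    have h := this.tendsto
    simp only [Real.zero_rpow (by linarith : p - 1 ≠ 0), mul_zero] at h
    exact h.mono_left nhdsWithin_le_nhds
  refine h1.congr' ?_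
  filter_upwards [self_mem_nhdsWithin] with ε hε
  have hε : 0 < ε := hε
  rw [Real.mul_rpow hb hε.le, Real.rpow_sub_one hε.ne']
  ring

lemma exists_forall_le_shellBound (hn : 1 ≤ n) {a η : ℝ} (ha : 0 ≤ a) (hη : 0 < η) :
    ∃ T₁ : ℝ, ∀ T, T₁ ≤ T → a * Layout.shellBound n T ≤ η * T ^ n := by
  have hr := maxBond_nonneg (n + 1)
  obtain ⟨T₁, -, h⟩ := exists_mul_add_pow_le hn (C := a * (2 * (n + 1) * ((2 * (2 * maxBond (n + 1)) +
    2 * (n + 1)) * (3 * maxBond (n + 1) + 2 * (n + 1))))) (q := 4 * maxBond (n + 1) + 2 * (n + 1))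
    (by positivity) (by positivity) hη
  refine ⟨T₁, fun T hT => le_trans (le_of_eq ?_) (h T hT)⟩
  have e : 2 * (T / 2 + 2 * maxBond (n + 1)) + 2 * ((n : ℝ) + 1) =
    T + (4 * maxBond (n + 1) + 2 * (n + 1)) := by ring
  rw [Layout.shellBound, e]
  ring

/-- The existence of almost optimal deformations of the lattices. -/
lemma exists_recovery (hn : 1 ≤ n) {p : ℝ} (hp : 1 < p) (hH : 0 < H.det)
    (h : PiecewiseRigid H Ω ν c u C) (hbd : Bornology.IsBounded Ω) (hL : HasLipschitzBoundary Ω)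
    (hinj : Function.Injective fun j => hyperplane (ν j) (c j)) {M : ℝ} (hM0 : 0 ≤ M)
    (hM : ∀ x ∈ Ω, ‖u x‖ ≤ M) {g : Fin m → ℝ≥0}
    (hg : ∀ j (b : OrthonormalBasis (Fin (n + 1)) ℝ (Eu (n + 1))), b 0 = ν j →
      Tendsto (fun T : ℝ => cellInf H (twinReflection H (ν j) * H) p (ν j) b T /
        ENNReal.ofReal (T ^ n)) atTop (𝓝 (g j : ℝ≥0∞))) {η : ℝ} (hη : 0 < η) :
    ∃ D R : ℝ, ∀ᶠ ε in 𝓝[>] (0 : ℝ), ∃ w, IsRecovery H p Ω ν c u D R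
      (∑ j, ENNReal.ofReal (g j + 2 * η) * (μHE[n] : Measure (Eu (n + 1))) (crease H Ω ν c u j) +
        ENNReal.ofReal (2 * η)) ε w := by
  have hr := maxBond_nonneg (n + 1)
  obtain ⟨r, hrdef⟩ : ∃ r, r = maxBond (n + 1) := ⟨_, rfl⟩
  rw [← hrdef] at hr
  choose b hb0 using fun j => exists_basis_zero_eq (h.norm_normal j)
  choose T₁ hT₁ using fun j => exists_optimal_cells hn hp hH (h.norm_normal j) (hb0 j) (hg j (b j) (hb0 j)) hη
  set card : ℝ := (Fintype.card (bonds (n + 1)) : ℝ) with hcard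
  have hcc := Layout.creaseCost_nonneg H C p
  obtain ⟨T₂, hT₂⟩ := exists_forall_le_shellBound hn (a := card * Layout.creaseCost H C p)
    (by positivity) hη
  obtain ⟨T₀, hT₀⟩ := Finite.bddAbove_range T₁
  -- The size of the tiles is fixed first, by the quality of the cells and the cost of the lateral
  -- faces. The distance `δ`, the field, and finally `ε` follow.
  set T := max T₀ (max T₂ (6 * r + 1)) with hT
  have hTT₁ : ∀ j, T₁ j ≤ T := fun j => (hT₀ (mem_range_self j)).trans (le_max_left _ _)
  have hTT₂ : T₂ ≤ T := (le_max_left _ _).trans (le_max_right _ _)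
  have hTr : 6 * r + 1 ≤ T := (le_max_right _ _).trans (le_max_right _ _)
  have hTpos : 0 < T := by linarith
  choose CW₁ hCW₁ using fun j => hT₁ j T (hTT₁ j)
  choose W hW1 hW2 hW3 using fun j κ => hCW₁ j (gridPoint (b j) T κ)
    (by rw [← hb0 j, inner_gridPoint_zero])
  obtain ⟨CW, hCW0, hCW⟩ : ∃ CW, 0 ≤ CW ∧ ∀ j, CW₁ j ≤ CW :=
    ⟨∑ j, |CW₁ j|, Finset.sum_nonneg fun _ _ => abs_nonneg _, fun j => (le_abs_self _).trans
      (Finset.single_le_sum (f := fun j => |CW₁ j|) (fun _ _ => abs_nonneg _) (Finset.mem_univ j))⟩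
  choose K hK using fun j => exists_count_near_plane (b j) (c j) (2 * r)
  set κ₀ : ℝ := card * (Layout.creaseCost H C p * ∑ j, (K j : ℝ)) with hκ₀
  have hκ₀0 : 0 ≤ κ₀ := by positivity
  -- The admissible area of the bad parts of the hyperplanes: multiplied by the cost `κ₀` it stays
  -- below `η`.
  set θ : ℝ := η / (κ₀ + 1) with hθ
  have hθ0 : 0 < θ := by positivity
  have hκθ : κ₀ * θ ≤ η := by
    rw [hθ, ← mul_div_assoc, div_le_iff₀ (by positivity)]
    nlinarith
  obtain ⟨δ, hδθ, hδ⟩ : ∃ δ : ℝ, (∀ j, (μHE[n] : Measure (Eu (n + 1)))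
      ((Ω ∩ {y | creaseDist Ω ν c j y < 5 * δ}) ∩ hyperplane (ν j) (c j)) ≤ ENNReal.ofReal θ) ∧ 0 < δ := by
    -- The nodes in `near` belong to points with distance below `4 * δ`; balls of radius `ε ≤ δ`
    -- around these points are still within `5 * δ`.
    have : ∀ᶠ δ in 𝓝[>] (0 : ℝ), ∀ j, (μHE[n] : Measure (Eu (n + 1)))
        ((Ω ∩ {y | creaseDist Ω ν c j y < 5 * δ}) ∩ hyperplane (ν j) (c j)) ≤ ENNReal.ofReal θ := by
      refine eventually_all.2 fun j => ?_
      obtain ⟨δ, hδ, hlt⟩ := exists_creaseDist_small h hbd hinj j (ENNReal.ofReal_pos.2 hθ0)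
      filter_upwards [Ioo_mem_nhdsGT (by positivity : 0 < δ / 5)] with δ' hδ'
      refine le_trans (measure_mono ?_) hlt.le
      rintro y ⟨⟨hy1, hy2⟩, hy3⟩
      refine ⟨⟨hy1, ?_⟩, hy3⟩
      have h1 : creaseDist Ω ν c j y < 5 * δ' := hy2
      have h2 := hδ'.2
      change creaseDist Ω ν c j y < δ
      linarith
    exact (this.and self_mem_nhdsWithin).exists
  obtain ⟨Λ, CY, ε₁, hε₁, hCY, hfield⟩ := exists_shift_field h hbd hL hδ
    (R := 2 * (r + (n + 1)) + 1) (by positivity)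
  obtain ⟨KL, hKL⟩ := exists_count_hull_le hbd
  have hbulk : ∀ᶠ ε in 𝓝[>] (0 : ℝ), card * ((‖lin H‖ * Λ * r * ε) ^ p * (ε⁻¹ * KL)) ≤ η := by
    have h1 := (tendsto_bulk_energy hp (b := ‖lin H‖ * Λ * r) (by positivity) KL).const_mul card
    rw [mul_zero] at h1
    exact h1.eventually (ge_mem_nhds hη)
  set E : ℝ := (n + 1) * T + (n + 1) + 2 * r + CY + 1 with hE
  have hE0 : 0 < E := by positivity
  have hmin : 0 < min ε₁ (min 1 (min (δ / E) (1 / (2 * (Λ + 1))))) :=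
    lt_min hε₁ (lt_min one_pos (lt_min (by positivity) (by positivity)))
  refine ⟨max (max (M + CW) (2 * C * (n + 1) + 2 * CW)) (max (‖lin H‖ * ((n + 1) + CY))
    (‖lin H‖ * (Λ * (2 * (n + 1))))), (n + 1) * T + (n + 1) + (n + 1) + CY + 1, ?_⟩
  filter_upwards [Ioo_mem_nhdsGT hmin, hbulk] with ε hεI hbε
  have hε : 0 < ε := hεI.1
  have e1 := hεI.2.trans_le (min_le_left _ _)
  have e2 := hεI.2.trans_le ((min_le_right _ _).trans (min_le_left _ _))
  have e3 := hεI.2.trans_le ((min_le_right _ _).trans ((min_le_right _ _).trans (min_le_left _ _)))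
  have e4 := hεI.2.trans_le ((min_le_right _ _).trans ((min_le_right _ _).trans (min_le_right _ _)))
  rw [lt_div_iff₀ hE0] at e3
  rw [lt_div_iff₀ (by positivity)] at e4
  -- The offsets depend on `ε` through `c j / ε`. This is why the constants of the field had to be
  -- uniform in them.
  choose k s hs hks using fun j => exists_normal_offset (h.norm_normal j) (c j / ε)
  obtain ⟨Y, hY1, hY2, hY3, hY4⟩ := hfield s hs
  let A : Layout H Ω ν c u C :=
    { basis := b, ε := ε, δ := δ, T := T, CY := CY, CW := CW, Λ := Λ, k := k, s := s, Y := Y, W := W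
      rigid := h, det_pos := hH, bounded := hbd, basis_zero := hb0, ε_pos := hε, δ_pos := hδ
      le_T := by rw [← hrdef]; exact hTr
      CY_nonneg := hCY
      small := by rw [← hrdef, ← hE]; exact e3.le
      Λ_small := by nlinarith
      offset := hks
      abs_offset := fun j => by simpa using hs j
      lipschitz := hY1, norm_le := hY2
      ball_subset := by rw [← hrdef]; exact hY3 ε hε e1
      field_eq := hY4, cell_eq := hW1
      cell_near := fun j κ z => (hW2 j κ z).trans (hCW j) }
  have hnear : ∀ j, ENNReal.ofReal (A.ε ^ n) * Measure.count (A.near j) ≤ K j * ENNReal.ofReal θ := by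
    intro j
    have hopen : IsOpen (Ω ∩ {y | creaseDist Ω ν c j y < 5 * δ}) :=
      h.isOpen.inter (isOpen_lt (Metric.continuous_infDist_pt _) continuous_const)
    refine (hK j ε hε A.shift (fun z z' => A.norm_node_sub_le_two_mul z' z) _ _ hopen ?_).trans
      (mul_le_mul_right ?_ _)
    · rintro z ⟨y, hyP, hyz, hyd, hyb⟩
      refine ⟨y, by rw [hb0]; exact hyP, by rw [hrdef]; exact hyz, fun x hx => ⟨hyb hx, ?_⟩⟩
      have h1 := creaseDist_le (Ω := Ω) (ν := ν) (c := c) (j := j) x y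
      have h2 := A.small_two
      have h3 : dist x y < ε := hx
      have h4 : A.δ = δ := rfl
      have h5 : A.ε = ε := rfl
      have h6 : A.CY = CY := rfl
      rw [h4, h5, h6, ← hrdef] at h2
      rw [h4] at hyd
      change creaseDist Ω ν c j x < 5 * δ
      nlinarith
    · rw [hb0]; exact hδθ j
  refine ⟨A.position, A.isRecovery hCW0 hM0 hM e2.le (lt_add_one _)
    ((le_max_left _ _).trans (le_max_left _ _)) ((le_max_right _ _).trans (le_max_left _ _))
    ((le_max_left _ _).trans (le_max_right _ _)) ((le_max_right _ _).trans (le_max_right _ _)) ?_⟩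
  refine (A.pairEnergy_le (by linarith) hη.le hW3 (hT₂ T hTT₂) hnear).trans (add_le_add_right ?_ _)
  have hfar : ENNReal.ofReal (ε ^ n) * Measure.count {z : Fin (n + 1) → ℤ | node ε z ∈ cubeHull ε Ω} ≤
      ENNReal.ofReal (ε⁻¹ * KL) := by
    have h1 := hKL ε hε e2.le
    rw [ENNReal.ofReal_mul (by positivity), ENNReal.ofReal_coe_nnreal]
    refine le_trans (le_of_eq ?_) (mul_le_mul_right h1 _)
    rw [← mul_assoc, ← ENNReal.ofReal_mul (by positivity)]
    congr 2
    rw [pow_succ]; field_simp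
  have hc' : (Fintype.card (bonds (n + 1)) : ℝ≥0∞) = ENNReal.ofReal card := by
    rw [hcard, ENNReal.ofReal_natCast]
  have hsum : ∑ j, (K j : ℝ≥0∞) * ENNReal.ofReal θ = ENNReal.ofReal ((∑ j, (K j : ℝ)) * θ) := by
    rw [← Finset.sum_mul, ENNReal.ofReal_mul (by positivity), ← NNReal.coe_sum, ENNReal.ofReal_coe_nnreal,
      ENNReal.ofNNReal_finsetSum]
  rw [hc', hsum, ← hrdef]
  refine (mul_le_mul_right (add_le_add_right (mul_le_mul_right hfar _) _) _).trans ?_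
  change ENNReal.ofReal card * (_ + ENNReal.ofReal ((‖lin H‖ * Λ * r * ε) ^ p) * _) ≤ _
  rw [← ENNReal.ofReal_mul hcc, ← ENNReal.ofReal_mul (by positivity),
    ← ENNReal.ofReal_add (by positivity) (by positivity), ← ENNReal.ofReal_mul (by positivity)]
  refine ENNReal.ofReal_le_ofReal ?_
  have e : card * (Layout.creaseCost H C p * ((∑ j, (K j : ℝ)) * θ)) = κ₀ * θ := by rw [hκ₀]; ring
  rw [mul_add, e]
  linarith

end Existence

/-! ### Convergence of the interpolations -/

/-- Dominated convergence on a finite measure space. The domination is required only eventually, as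
the good bounds hold only for small `ε`. -/
lemma tendsto_eLpNorm_of_bounded {α E : Type*} [MeasurableSpace α] [NormedAddCommGroup E]
    {μ : Measure α} [IsFiniteMeasure μ] {f : ℝ → α → E} {K p : ℝ} (hp : 0 < p)
    (hmeas : ∀ᶠ ε in 𝓝[>] 0, AEStronglyMeasurable (f ε) μ)
    (hbound : ∀ᶠ ε in 𝓝[>] 0, ∀ᵐ x ∂μ, ‖f ε x‖ ≤ K)
    (hlim : ∀ᵐ x ∂μ, Tendsto (fun ε => f ε x) (𝓝[>] 0) (𝓝 0)) :
    Tendsto (fun ε => eLpNorm (f ε) (ENNReal.ofReal p) μ) (𝓝[>] 0) (𝓝 0) := by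
  have hp' : (ENNReal.ofReal p).toReal = p := ENNReal.toReal_ofReal hp.le
  have e : ∀ ε, eLpNorm (f ε) (ENNReal.ofReal p) μ = (∫⁻ x, ‖f ε x‖ₑ ^ p ∂μ) ^ (1 / p) := fun ε => by
    rw [eLpNorm_eq_lintegral_rpow_enorm_toReal (by simpa using hp) ENNReal.ofReal_ne_top, hp']
  simp only [e]
  have h : Tendsto (fun ε => ∫⁻ x, ‖f ε x‖ₑ ^ p ∂μ) (𝓝[>] 0) (𝓝 (∫⁻ _, 0 ∂μ)) := by
    refine tendsto_lintegral_filter_of_dominated_convergence' (fun _ => ENNReal.ofReal K ^ p) ?_ ?_ ?_ ?_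
    · filter_upwards [hmeas] with ε hε
      exact hε.enorm.pow_const p
    · filter_upwards [hbound] with ε hε
      filter_upwards [hε] with x hx
      refine ENNReal.rpow_le_rpow ?_ hp.le
      rw [← ofReal_norm]
      exact ENNReal.ofReal_le_ofReal hx
    · rw [lintegral_const]
      exact ENNReal.mul_ne_top (ENNReal.rpow_ne_top_of_nonneg hp.le ENNReal.ofReal_ne_top)
        (measure_ne_top _ _)
    · filter_upwards [hlim] with x hx
      have h1 := (continuous_enorm.tendsto (0 : E)).comp hx
      rw [enorm_zero] at h1
      have h2 := ((ENNReal.continuous_rpow_const (y := p)).tendsto 0).comp h1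
      rwa [ENNReal.zero_rpow_of_pos hp] at h2
  rw [lintegral_zero] at h
  have h2 := ((ENNReal.continuous_rpow_const (y := 1 / p)).tendsto 0).comp h
  rwa [ENNReal.zero_rpow_of_pos (by positivity)] at h2

section Interp

variable {N m : ℕ}

lemma norm_interp_sub_const_le {w : (Fin N → ℤ) → Eu N} {y e : Eu N} {K : ℝ}
    (h : ∀ s ∈ Ioo (0 : ℝ) 1, ‖w (roundUp y s) - e‖ ≤ K) : ‖interp w y - e‖ ≤ K := by
  have hi : Integrable (fun s => w (roundUp y s)) ((volume : Measure ℝ).restrict (Ioo 0 1)) :=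
    integrableOn_roundUp w y
  have e1 : interp w y - e = ∫ s in Ioo (0 : ℝ) 1, (w (roundUp y s) - e) := by
    rw [integral_sub hi (integrable_const e), setIntegral_const]
    simp [interp]
  rw [e1]
  have := norm_setIntegral_le_of_norm_le_const (μ := volume) (s := Ioo (0 : ℝ) 1) (by simp) h
  simpa using this

lemma corner_mem {Ω : Set (Eu N)} {ε : ℝ} (hε : 0 < ε) {x : Eu N} (hxΩ : x ∈ Ω) {c a : Fin N → ℤ}
    (hx : x ∈ latticeCube ε c) (ha : ∀ i, c i ≤ a i ∧ a i ≤ c i + 1) :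
    node ε a ∈ cubeHull ε Ω ∧ node ε a ∈ latticeCube ε c ∧ ‖node ε a - x‖ ≤ N * ε := by
  have h : node ε a ∈ latticeCube ε c := fun i => by
    have h1 : (c i : ℝ) ≤ a i := by exact_mod_cast (ha i).1
    have h2 : (a i : ℝ) ≤ c i + 1 := by exact_mod_cast (ha i).2
    rw [node_apply]
    exact ⟨mul_le_mul_of_nonneg_left h1 hε.le, mul_le_mul_of_nonneg_left h2 hε.le⟩
  exact ⟨mem_iUnion₂.2 ⟨c, ⟨x, hx, hxΩ⟩, h⟩, h, norm_sub_le_of_mem_latticeCube hε h hx⟩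

lemma smul_mem_latticeCube {ε : ℝ} (hε : 0 < ε) {x : Eu N} {c : Fin N → ℤ} (hx : x ∈ latticeCube ε c) :
    ε⁻¹ • x ∈ latticeCube 1 c := by
  intro i
  have := hx i
  rw [PiLp.smul_apply, smul_eq_mul, one_mul, one_mul, ← div_eq_inv_mul, le_div_iff₀ hε, div_le_iff₀ hε,
    mul_comm (c i : ℝ), mul_comm ((c i : ℝ) + 1)]
  exact this

/-- The faces of the lattice cubes lie in countably many hyperplanes. -/
lemma ae_mem_open_cube {ε : ℝ} (hε : 0 < ε) :
    ∀ᵐ x : Eu N, ∀ i, ε * ⌊x i / ε⌋ < x i ∧ x i < ε * (⌊x i / ε⌋ + 1) := by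
  have h : ∀ᵐ x : Eu N, ∀ i, ∀ k : ℤ, x i ≠ ε * k := by
    refine ae_all_iff.2 fun i => ae_all_iff.2 fun k => ?_
    have h0 : (unitVec i : Eu N) ≠ 0 := by
      intro h
      have := congrFun (congrArg WithLp.ofLp h) i
      simp [unitVec] at this
    refine measure_mono_null (fun x hx => ?_) (volume_level_eq_zero h0 (ε * k))
    rw [mem_compl_iff, mem_ofPred_eq, not_not] at hx
    rw [mem_ofPred_eq, ← hx]
    simp [unitVec, inner_eq_sum]
  filter_upwards [h] with x hx i
  have h1 := mem_latticeCube_floor hε x i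
  exact ⟨lt_of_le_of_ne h1.1 (hx i _).symm, lt_of_le_of_ne h1.2 (by
    have := hx i (⌊x i / ε⌋ + 1)
    push_cast at this
    exact this)⟩

variable {H : Matrix (Fin N) (Fin N) ℝ} {p : ℝ} {Ω : Set (Eu N)} {ν : Fin m → Eu N} {c : Fin m → ℝ}
  {u : Eu N → Eu N} {D R : ℝ} {B : ℝ≥0∞} {ε : ℝ} {w : (Fin N → ℤ) → Eu N}

lemma IsRecovery.energy_interp_le (h : IsRecovery H p Ω ν c u D R B ε w) (hε : 0 < ε) :
    energy H p Ω ε (fun x => interp w (ε⁻¹ • x)) ≤ B := by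
  have e : ∀ z, interp w (ε⁻¹ • node ε z) = w z := fun z => by
    rw [node_eq_smul, smul_smul, inv_mul_cancel₀ hε.ne', one_smul, interp_node]
  rw [energy, if_pos (admissible_interp h.norm_le hε Ω)]
  simp only [e]
  exact h.energy_le

lemma IsRecovery.norm_interp_le (h : IsRecovery H p Ω ν c u D R B ε w) (y : Eu N) :
    ‖interp w y‖ ≤ D := by
  have := norm_interp_sub_const_le (w := w) (y := y) (e := 0) (K := D) fun s _ => by
    rw [sub_zero]; exact h.norm_le _
  rwa [sub_zero] at this

lemma IsRecovery.norm_interp_sub_apply_le (h : IsRecovery H p Ω ν c u D R B ε w) (hε : 0 < ε)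
    {x : Eu N} (hx : x ∈ Ω) (hb : Metric.ball x (R * ε) ⊆ Ω)
    (hP : ∀ j, ∀ y ∈ Metric.ball x (R * ε), y ∉ hyperplane (ν j) (c j)) :
    ‖interp w (ε⁻¹ • x) - u x‖ ≤ D * ε := by
  refine norm_interp_sub_const_le fun s hs => ?_
  have hc := mem_latticeCube_floor hε x
  have ha := corner_mem hε hx hc (roundUp_mem_cube (smul_mem_latticeCube hε hc) hs)
  exact (h.near_flat x hb hP _ ha.1 ha.2.2).1

lemma IsRecovery.norm_fderiv_le (h : IsRecovery H p Ω ν c u D R B ε w) (hε : 0 < ε)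
    {x : Eu N} (hx : x ∈ Ω) (hc : ∀ i, ε * ⌊x i / ε⌋ < x i ∧ x i < ε * (⌊x i / ε⌋ + 1))
    (hd : DifferentiableAt ℝ (fun x => interp w (ε⁻¹ • x)) x) :
    ‖fderiv ℝ (fun x => interp w (ε⁻¹ • x)) x‖ ≤ N * D := by
  have := norm_fderiv_interp_sub_le (c := fun i => ⌊x i / ε⌋) hε hc hd 0 (D := D) fun a b ha hb => by
    have ha := corner_mem hε hx (mem_latticeCube_floor hε x) ha
    have hb := corner_mem hε hx (mem_latticeCube_floor hε x) hb
    rw [zero_apply, sub_zero]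
    exact h.norm_sub_le a b ha.1 hb.1 (norm_sub_le_of_mem_latticeCube hε ha.2.1 hb.2.1)
  rwa [sub_zero] at this

lemma IsRecovery.norm_fderiv_sub_le (h : IsRecovery H p Ω ν c u D R B ε w) (hε : 0 < ε)
    {x : Eu N} (hx : x ∈ Ω) (hb : Metric.ball x (R * ε) ⊆ Ω)
    (hP : ∀ j, ∀ y ∈ Metric.ball x (R * ε), y ∉ hyperplane (ν j) (c j))
    (hc : ∀ i, ε * ⌊x i / ε⌋ < x i ∧ x i < ε * (⌊x i / ε⌋ + 1))
    (hd : DifferentiableAt ℝ (fun x => interp w (ε⁻¹ • x)) x) :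
    ‖fderiv ℝ (fun x => interp w (ε⁻¹ • x)) x - fderiv ℝ u x‖ ≤ N * (D * ε) := by
  refine norm_fderiv_interp_sub_le (c := fun i => ⌊x i / ε⌋) hε hc hd _ fun a b ha hb' => ?_
  have ha := corner_mem hε hx (mem_latticeCube_floor hε x) ha
  have hb' := corner_mem hε hx (mem_latticeCube_floor hε x) hb'
  rw [node_sub]
  exact (h.near_flat x hb hP a ha.1 ha.2.2).2 b hb'.1 hb'.2.2

lemma eventually_ball_subset (hΩ : IsOpen Ω) (R : ℝ) {x : Eu N} (hx : x ∈ Ω)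
    (hP : ∀ j, x ∉ hyperplane (ν j) (c j)) :
    ∀ᶠ ε in 𝓝[>] (0 : ℝ), Metric.ball x (R * ε) ⊆ Ω ∧
      ∀ j, ∀ y ∈ Metric.ball x (R * ε), y ∉ hyperplane (ν j) (c j) := by
  have hopen : IsOpen (Ω ∩ ⋂ j, (hyperplane (ν j) (c j))ᶜ) :=
    hΩ.inter (isOpen_iInter_of_finite fun j => (isClosed_hyperplane _ _).isOpen_compl)
  obtain ⟨ρ, hρ, hsub⟩ := Metric.isOpen_iff.1 hopen x ⟨hx, mem_iInter.2 hP⟩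
  filter_upwards [Ioo_mem_nhdsGT (by positivity : 0 < ρ / (|R| + 1))] with ε hε
  have h1 := hε.2
  rw [lt_div_iff₀ (by positivity)] at h1
  have hle : R * ε ≤ ρ := by
    have := mul_le_mul_of_nonneg_right (le_abs_self R) hε.1.le
    nlinarith [hε.1]
  have h2 := (Metric.ball_subset_ball hle).trans hsub
  exact ⟨fun y hy => (h2 hy).1, fun j y hy => mem_iInter.1 (h2 hy).2 j⟩

/-- The interpolations converge, and bound the upper `Γ`-limit. -/
lemma gammaLimsup_le_of_recovery (hp : 1 < p) (hΩ : IsOpen Ω) (hbd : Bornology.IsBounded Ω)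
    (hν : ∀ j, ‖ν j‖ = 1) {u₀ : Eu N → Eu N} {G : Eu N → Eu N →L[ℝ] Eu N} (hS : IsSobolev ⊤ Ω u₀ G)
    (hu : ∀ᵐ x, x ∈ Ω → u₀ x = u x) (hG : ∀ᵐ x, x ∈ Ω → HasFDerivAt u (G x) x) {M M' : ℝ}
    (hM : ∀ x ∈ Ω, ‖u x‖ ≤ M) (hM' : ∀ᵐ x, x ∈ Ω → ‖G x‖ ≤ M')
    (h : ∀ᶠ ε in 𝓝[>] (0 : ℝ), ∃ w, IsRecovery H p Ω ν c u D R B ε w) : gammaLimsup H p Ω u₀ ≤ B := by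
  classical
  have hfin : IsFiniteMeasure (volume.restrict Ω) :=
    ⟨by rw [Measure.restrict_apply_univ]; exact (volume_ne_top_of_isBounded hbd).lt_top⟩
  -- For the mesh sizes without a recovery the zero map serves, so that every member of the family
  -- is a Sobolev map.
  set w : ℝ → (Fin N → ℤ) → Eu N := fun ε =>
    if h : ∃ w, IsRecovery H p Ω ν c u D R B ε w then h.choose else 0 with hw
  have hrec : ∀ᶠ ε in 𝓝[>] (0 : ℝ), IsRecovery H p Ω ν c u D R B ε (w ε) := by
    filter_upwards [h] with ε hε
    simp only [hw, dif_pos hε]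
    exact hε.choose_spec
  have hwb : ∀ ε, ∃ K, ∀ z, ‖w ε z‖ ≤ K := by
    intro ε
    by_cases hε : ∃ w, IsRecovery H p Ω ν c u D R B ε w
    · refine ⟨D, ?_⟩
      simp only [hw, dif_pos hε]
      exact hε.choose_spec.norm_le
    · refine ⟨0, fun z => ?_⟩
      simp only [hw, dif_neg hε]
      simp
  set v : ℝ → Eu N → Eu N := fun ε x => interp (w ε) (ε⁻¹ • x) with hv
  have hLip : ∀ ε, ∃ K, LipschitzWith K (v ε) := fun ε => by
    obtain ⟨K, hK⟩ := hwb ε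
    exact ⟨_, (lipschitzWith_interp hK).comp (lipschitzWith_smul ε⁻¹)⟩
  have hpl : ∀ᵐ x, ∀ j, x ∉ hyperplane (ν j) (c j) :=
    ae_all_iff.2 fun j => measure_eq_zero_iff_ae_notMem.1 (volume_hyperplane (hν j) (c j))
  have hD : Tendsto (fun ε : ℝ => D * ε) (𝓝[>] 0) (𝓝 0) := by
    have : Tendsto (fun ε : ℝ => D * ε) (𝓝 0) (𝓝 (D * 0)) := (continuous_const.mul continuous_id).tendsto 0
    rw [mul_zero] at this
    exact this.mono_left nhdsWithin_le_nhds
  have hconv : TendstoSobolev (ENNReal.ofReal p) Ω v u₀ := by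
    refine ⟨fun ε => fderiv ℝ (v ε), G, fun ε _ => ?_, ⟨hS.1.mono_exponent le_top,
      hS.2.1.mono_exponent le_top, hS.2.2⟩, ?_, ?_⟩
    · obtain ⟨K, hK⟩ := hLip ε
      exact isSobolev_of_lipschitz hK hbd _
    · refine tendsto_eLpNorm_of_bounded (K := D + M) (by linarith) (Eventually.of_forall fun ε => ?_) ?_ ?_
      · obtain ⟨K, hK⟩ := hLip ε
        exact hK.continuous.aestronglyMeasurable.sub hS.1.1
      · filter_upwards [hrec] with ε hε
        rw [ae_restrict_iff' hΩ.measurableSet]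
        filter_upwards [hu] with x hx hxΩ
        rw [hx hxΩ]
        exact (norm_sub_le _ _).trans (add_le_add (hε.norm_interp_le _) (hM x hxΩ))
      · rw [ae_restrict_iff' hΩ.measurableSet]
        filter_upwards [hu, hpl] with x hx hxP hxΩ
        refine squeeze_zero_norm' ?_ hD
        filter_upwards [hrec, eventually_ball_subset hΩ R hxΩ hxP, self_mem_nhdsWithin] with ε h1 h2 h3
        rw [hx hxΩ]
        exact h1.norm_interp_sub_apply_le h3 hxΩ h2.1 h2.2
    -- The exceptional null set depends on `ε`, and there are uncountably many of these. Replacing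
    -- the difference by zero at the exceptional points gives convergence for every `ε` at almost
    -- every fixed point, without changing the norms.
    · set good : ℝ → Eu N → Prop := fun ε x => DifferentiableAt ℝ (v ε) x ∧
        ∀ i, ε * ⌊x i / ε⌋ < x i ∧ x i < ε * (⌊x i / ε⌋ + 1) with hgood
      set f : ℝ → Eu N → Eu N →L[ℝ] Eu N := fun ε x => if good ε x then fderiv ℝ (v ε) x - G x else 0 with hf
      have hgae : ∀ ε, 0 < ε → ∀ᵐ x, good ε x := fun ε hε => by
        obtain ⟨K, hK⟩ := hLip ε
        filter_upwards [hK.ae_differentiableAt, ae_mem_open_cube hε] with x h1 h2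
        exact ⟨h1, h2⟩
      have hfae : ∀ ε, 0 < ε → f ε =ᵐ[volume.restrict Ω] fun x => fderiv ℝ (v ε) x - G x := fun ε hε => by
        refine ae_restrict_of_ae ?_
        filter_upwards [hgae ε hε] with x hx
        simp only [hf, if_pos hx]
      have hlim : Tendsto (fun ε => eLpNorm (f ε) (ENNReal.ofReal p) (volume.restrict Ω)) (𝓝[>] 0) (𝓝 0) := by
        refine tendsto_eLpNorm_of_bounded (K := N * D + M') (by linarith) ?_ ?_ ?_
        · filter_upwards [self_mem_nhdsWithin] with ε hε
          refine AEStronglyMeasurable.congr ?_ (hfae ε hε).symm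
          exact (measurable_fderiv ℝ (v ε)).aestronglyMeasurable.sub hS.2.1.1
        · filter_upwards [hrec, self_mem_nhdsWithin] with ε h1 hε
          rw [ae_restrict_iff' hΩ.measurableSet]
          filter_upwards [hM', hgae ε hε] with x hx hg hxΩ
          simp only [hf, if_pos hg]
          exact (norm_sub_le _ _).trans (add_le_add (h1.norm_fderiv_le hε hxΩ hg.2 hg.1) (hx hxΩ))
        · rw [ae_restrict_iff' hΩ.measurableSet]
          filter_upwards [hG, hpl] with x hx hxP hxΩ
          have hD' := hD.const_mul (N : ℝ)
          rw [mul_zero] at hD'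
          refine squeeze_zero_norm' ?_ hD'
          filter_upwards [hrec, eventually_ball_subset hΩ R hxΩ hxP, self_mem_nhdsWithin] with ε h1 h2 h3
          by_cases hg : good ε x
          · simp only [hf, if_pos hg]
            rw [← (hx hxΩ).fderiv]
            exact h1.norm_fderiv_sub_le h3 hxΩ h2.1 h2.2 hg.2 hg.1
          · simp only [hf, if_neg hg, norm_zero]
            have h0 : 0 ≤ D := (norm_nonneg _).trans (h1.norm_le 0)
            exact mul_nonneg (Nat.cast_nonneg _) (mul_nonneg h0 (le_of_lt h3))
      refine hlim.congr' ?_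
      filter_upwards [self_mem_nhdsWithin] with ε hε
      exact eLpNorm_congr_ae (hfae ε hε)
  refine iInf₂_le_of_le v hconv (limsup_le_of_le (by isBoundedDefault) ?_)
  filter_upwards [hrec, self_mem_nhdsWithin] with ε h1 hε
  exact h1.energy_interp_le hε

end Interp

/-! ### The upper bound -/

section CellInf

variable {N : ℕ} {H R : Matrix (Fin N) (Fin N) ℝ} {p : ℝ} {ν : Eu N}
  {b b' : OrthonormalBasis (Fin N) ℝ (Eu N)} {T : ℝ}

lemma cellInf_congr (h : orientedCube b T = orientedCube b' T) :
    cellInf H R p ν b T = cellInf H R p ν b' T := by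
  unfold cellInf; rw [h]

lemma orientedCube_reindex (e : Fin N ≃ Fin N) : orientedCube (b.reindex e) T = orientedCube b T := by
  ext x
  simp only [orientedCube, mem_ofPred_eq, OrthonormalBasis.reindex_apply]
  exact ⟨fun h l => by simpa using h (e l), fun h l => h _⟩

lemma orientedCube_neg : orientedCube (b.map (LinearIsometryEquiv.neg ℝ)) T = orientedCube b T := by
  ext x
  simp [orientedCube, inner_neg_right]

/-- Composing with the reflection carries competitors for `-ν` to competitors for `ν`, and preserves
their energy. -/
lemma cellInf_le_cellInf_neg (hH : 0 < H.det) (hν : ‖ν‖ = 1) :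
    cellInf H (twinReflection H ν * H) p ν b T ≤
      cellInf H (twinReflection H (-ν) * H) p (-ν) b T := by
  rw [cellInf_eq, cellInf_eq]
  refine le_iInf₂ fun w hw => ?_
  refine iInf₂_le_of_le (fun z => lin (twinReflection H ν) (w z)) (fun z h1 h2 => ?_) (le_of_eq ?_)
  · change lin (twinReflection H ν) (w z) = fold H ν (node 1 z)
    rw [hw z h1 h2]
    exact fold_neg hH hν _
  · have := latEnergy_move (H := H) (p := p) (L := nodesIn (orientedCube b T)) (twinReflection_mem hH hν) w 0 0
    simp only [sub_zero, add_zero] at this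
    exact this

lemma cellInf_neg (hH : 0 < H.det) (hν : ‖ν‖ = 1) :
    cellInf H (twinReflection H (-ν) * H) p (-ν) b T = cellInf H (twinReflection H ν * H) p ν b T := by
  refine le_antisymm ?_ (cellInf_le_cellInf_neg hH hν)
  have := cellInf_le_cellInf_neg (p := p) (b := b) (T := T) hH (ν := -ν) (by rwa [norm_neg])
  rwa [neg_neg] at this

end CellInf

/-- A continuous function that exceeds its essential bound at one point does so on a nonempty open
set, which has positive measure. -/
lemma exists_forall_norm_le {N : ℕ} {Ω : Set (Eu N)} (hΩ : IsOpen Ω) {u₀ u : Eu N → Eu N}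
    (h₀ : MemLp u₀ ⊤ (volume.restrict Ω)) (hu : ∀ᵐ x, x ∈ Ω → u₀ x = u x) (hc : ContinuousOn u Ω) :
    ∃ M, 0 ≤ M ∧ ∀ x ∈ Ω, ‖u x‖ ≤ M := by
  have h1 := ae_le_eLpNormEssSup (f := u₀) (μ := volume.restrict Ω)
  have h2 : eLpNormEssSup u₀ (volume.restrict Ω) ≠ ⊤ := by
    rw [← eLpNorm_exponent_top]; exact h₀.2.ne
  set M := (eLpNormEssSup u₀ (volume.restrict Ω)).toReal with hM
  rw [ae_restrict_iff' hΩ.measurableSet] at h1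
  refine ⟨M, ENNReal.toReal_nonneg, fun x hx => ?_⟩
  by_contra! hcon
  have hopen : IsOpen (Ω ∩ (fun y => ‖u y‖) ⁻¹' Ioi M) := hc.norm.isOpen_inter_preimage hΩ isOpen_Ioi
  have hpos := hopen.measure_pos volume ⟨x, hx, hcon⟩
  refine hpos.ne' (measure_mono_null (t := {x | ¬ ((x ∈ Ω → u₀ x = u x) ∧
    (x ∈ Ω → ‖u₀ x‖ₑ ≤ eLpNormEssSup u₀ (volume.restrict Ω)))}) ?_ (hu.and h1))
  rintro y ⟨hyΩ, hyM⟩ ⟨h3, h4⟩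
  have h5 := h4 hyΩ
  rw [h3 hyΩ] at h5
  have h6 : ‖u y‖ ≤ M := by
    rw [← toReal_enorm, hM]
    exact ENNReal.toReal_mono h2 h5
  exact absurd hyM (not_lt.2 h6)

/-- The upper bound, for the surface energy densities `g`. -/
theorem gammaLimsup_le_lintegral {n : ℕ} (hn : 1 ≤ n) {p : ℝ} (hp : 1 < p)
    {H : Matrix (Fin (n + 1)) (Fin (n + 1)) ℝ} (hH : 0 < H.det) {g : Eu (n + 1) → ℝ≥0}
    (hg : ∀ ν : Eu (n + 1), ‖ν‖ = 1 → ∀ b : OrthonormalBasis (Fin (n + 1)) ℝ (Eu (n + 1)), b 0 = ν →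
      Tendsto (fun T : ℝ => cellInf H (twinReflection H ν * H) p ν b T / ENNReal.ofReal (T ^ n))
        atTop (𝓝 (g ν : ℝ≥0∞)))
    {Ω : Set (Eu (n + 1))} (hΩ : IsOpen Ω) (hb : Bornology.IsBounded Ω) (hL : HasLipschitzBoundary Ω)
    {u : Eu (n + 1) → Eu (n + 1)} {G : Eu (n + 1) → Eu (n + 1) →L[ℝ] Eu (n + 1)}
    (h : IsPolyhedralDeformation H Ω u G) {ν : Eu (n + 1) → Eu (n + 1)}
    (hν : ∀ x ∈ jumpSet Ω G, ∃ F₁ F₂, IsJumpPoint G x (ν x) F₁ F₂) :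
    gammaLimsup H p Ω u ≤ ∫⁻ x in jumpSet Ω G, (g (ν x) : ℝ≥0∞) ∂(μHE[n] : Measure (Eu (n + 1))) := by
  obtain ⟨m, N, c, C, u', hr, hinj, hu, hG⟩ := h.exists_piecewiseRigid hH hΩ hb
  have hcont : ContinuousOn u' Ω := by
    intro x hx
    obtain ⟨ρ, hρ, hsub⟩ := Metric.isOpen_iff.1 hΩ x hx
    exact ((hr.lipschitz x ρ hsub).continuousOn.continuousAt (Metric.ball_mem_nhds x hρ)).continuousWithinAt
  obtain ⟨M, hM0, hM⟩ := exists_forall_norm_le hΩ h.1.1 hu hcont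
  have hM' : ∀ᵐ x, x ∈ Ω → ‖G x‖ ≤ ‖lin H‖ := by
    have := h.2.2.1
    rw [ae_restrict_iff' hΩ.measurableSet] at this
    filter_upwards [this] with x hx hxΩ
    obtain ⟨Q, hQ, e⟩ := hx hxΩ
    rw [e]
    refine ContinuousLinearMap.opNorm_le_bound _ (norm_nonneg _) fun v => ?_
    rw [lin_mul, norm_lin_orthogonal hQ]
    exact (lin H).le_opNorm v
  have hneg : ∀ x, ‖x‖ = 1 → g (-x) = g x := by
    intro x hx
    obtain ⟨b, hb⟩ := exists_basis_zero_eq hx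
    have h1 := hg x hx b hb
    have h2 := hg (-x) (by rwa [norm_neg]) (b.map (LinearIsometryEquiv.neg ℝ)) (by simp [hb])
    have e : ∀ T, cellInf H (twinReflection H (-x) * H) p (-x) (b.map (LinearIsometryEquiv.neg ℝ)) T =
        cellInf H (twinReflection H x * H) p x b T := fun T => by
      rw [cellInf_congr orientedCube_neg, cellInf_neg hH hx]
    simp only [e] at h2
    exact_mod_cast tendsto_nhds_unique h2 h1
  -- It suffices to bound the upper limit by the sum over the creases.
  refine le_trans ?_ (sum_crease_le_lintegral hr hH hG _ hneg hν)
  set μ : Fin m → ℝ≥0∞ := fun j => (μHE[n] : Measure (Eu (n + 1))) (crease H Ω N c u' j) with hμ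
  have hμt : ∀ j, μ j ≠ ⊤ := by
    intro j
    obtain ⟨b, hb0⟩ := exists_basis_zero_eq (hr.norm_normal j)
    have := euclideanHausdorff_inter_hyperplane_ne_top b (c j) hb
    rw [hb0] at this
    have hsub : crease H Ω N c u' j ⊆ Ω ∩ hyperplane (N j) (c j) := fun y hy => ⟨hy.1, hy.2.2.1⟩
    exact measure_ne_top_of_subset hsub this
  set S : ℝ≥0∞ := ∑ j, μ j + 1 with hS
  have hSt : S ≠ ⊤ := ENNReal.add_ne_top.2 ⟨ENNReal.sum_ne_top.2 fun j _ => hμt j, ENNReal.one_ne_top⟩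
  refine ENNReal.le_of_forall_pos_le_add fun δ hδ _ => ?_
  -- The creases have finite area because `Ω` is bounded, so the error `2 * η` per area, together
  -- with the additive `2 * η`, can be made smaller than `δ`.
  obtain ⟨η, hη, hηS⟩ : ∃ η : ℝ, 0 < η ∧ ENNReal.ofReal (2 * η) * S ≤ δ := by
    have hS0 : 0 ≤ S.toReal := ENNReal.toReal_nonneg
    refine ⟨δ / (2 * (S.toReal + 1)), by positivity, ?_⟩
    rw [← ENNReal.ofReal_toReal hSt, ← ENNReal.ofReal_mul (by positivity), ← ENNReal.ofReal_coe_nnreal]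
    refine ENNReal.ofReal_le_ofReal ?_
    rw [ENNReal.toReal_ofReal hS0]
    have e : 2 * ((δ : ℝ) / (2 * (S.toReal + 1))) * S.toReal = δ * (S.toReal / (S.toReal + 1)) := by
      field_simp
    rw [e]
    refine mul_le_of_le_one_right δ.2 ?_
    rw [div_le_one (by positivity)]
    linarith
  obtain ⟨D, R, hrec⟩ := exists_recovery hn hp hH hr hb hL hinj hM0 hM (g := fun j => g (N j))
    (fun j b hbj => hg (N j) (hr.norm_normal j) b hbj) hη
  refine (gammaLimsup_le_of_recovery hp hΩ hb hr.norm_normal h.1 hu hG hM hM' hrec).trans ?_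
  have e : ∀ j, ENNReal.ofReal (g (N j) + 2 * η) * μ j = g (N j) * μ j + ENNReal.ofReal (2 * η) * μ j := by
    intro j
    rw [ENNReal.ofReal_add (by positivity) (by positivity), ENNReal.ofReal_coe_nnreal, add_mul]
  calc ∑ j, ENNReal.ofReal (g (N j) + 2 * η) * μ j + ENNReal.ofReal (2 * η)
      = ∑ j, g (N j) * μ j + ENNReal.ofReal (2 * η) * S := by
        simp only [e]
        rw [Finset.sum_add_distrib, ← Finset.mul_sum, hS, mul_add, mul_one, add_assoc]
    _ ≤ _ := add_le_add_right hηS _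

end LatticeUpperBound

end

theorem proposition1p8 (N : ℕ) (hN : 2 ≤ N) (p : ℝ) (hp : 1 < p)
    (H : Matrix (Fin N) (Fin N) ℝ) (hH : 0 < H.det) :
    ∃ g₂ : Eu N → ℝ≥0,
      (∀ ν : Eu N, ‖ν‖ = 1 →
        (∃! R, IsTwin H ν R) ∧
        ∀ R, IsTwin H ν R →
          ∀ b : OrthonormalBasis (Fin N) ℝ (Eu N), (∃ i, b i = ν) →
            Tendsto (fun T : ℝ => cellInf H R p ν b T / ENNReal.ofReal (T ^ (N - 1)))
              atTop (𝓝 (g₂ ν : ℝ≥0∞))) ∧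
      ∀ Ω : Set (Eu N), IsOpen Ω → Bornology.IsBounded Ω → HasLipschitzBoundary Ω →
        ∀ (u : Eu N → Eu N) (G : Eu N → Eu N →L[ℝ] Eu N), IsPolyhedralDeformation H Ω u G →
          ∀ ν : Eu N → Eu N, (∀ x ∈ jumpSet Ω G, ∃ F₁ F₂, IsJumpPoint G x (ν x) F₁ F₂) →
            gammaLimsup H p Ω u ≤
              ∫⁻ x in jumpSet Ω G, (g₂ (ν x) : ℝ≥0∞) ∂(μHE[N - 1] : Measure (Eu N)) := by
  classical
  obtain ⟨n, rfl⟩ : ∃ n, N = n + 1 := ⟨N - 1, by omega⟩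
  have hn : 1 ≤ n := by omega
  simp only [Nat.add_sub_cancel]
  have hlim : ∀ ν : Eu (n + 1), ∃ g : ℝ≥0, ‖ν‖ = 1 →
      ∀ b : OrthonormalBasis (Fin (n + 1)) ℝ (Eu (n + 1)), b 0 = ν →
        Tendsto (fun T : ℝ => cellInf H (twinReflection H ν * H) p ν b T / ENNReal.ofReal (T ^ n))
          atTop (𝓝 (g : ℝ≥0∞)) := by
    intro ν
    by_cases hν : ‖ν‖ = 1
    · obtain ⟨g, hg⟩ := exists_cell_limit hn hp hH hν
      exact ⟨g, fun _ => hg⟩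
    · exact ⟨0, fun h => absurd h hν⟩
  choose g hg using hlim
  refine ⟨g, fun ν hν => ⟨⟨_, isTwin_twinReflection hH hν, fun R hR => (isTwin_iff hH hν).1 hR⟩, ?_⟩, ?_⟩
  · rintro R hR b ⟨i, hi⟩
    rw [(isTwin_iff hH hν).1 hR]
    -- The cube does not depend on the order of the basis, so `ν` may be moved to the index `0`.
    have h := hg ν hν (b.reindex (Equiv.swap i 0)) (by simp [hi])
    refine h.congr fun T => ?_
    rw [cellInf_congr (orientedCube_reindex _)]
  · intro Ω hΩ hb hL u G h ν hν
    exact gammaLimsup_le_lintegral hn hp hH hg hΩ hb hL h hν
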